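/- **Conventions.** For a topological space $X$ let $S_*X$ be the normalized singular chains (singular chains modulo degenerate simplices) and let $S^*X=\mathrm{Hom}(S_*X,\mathbb Z)$ be the normalized singular cochains, with coboundary $d(x)=-(-1)^{|x|}x\circ\partial$. The usual sign rule applies to tensor products; in particular $(x_1\otimes\cdots\otimes x_k)(c_1\otimes\cdots\otimes c_k)=(-1)^{\sum_{i<i'}|c_i||x_{i'}|}\prod_i x_i(c_i)$. Write $\bar m=\{1,\dots,m\}$ and $\|A\|=|A|-1$. For $k\ge 0$ and $n\in\mathbb Z$ let $\mathcal N(k)_n$ be the group of natural transformations $\nu:(S^*X)^{\otimes k}\to S^*X$ ($X$ ranging over all spaces) which lower the total degree by $n$. With the differential $\partial\nu=d\circ\nu-(-1)^{n}\nu\circ d$, the right action of $\Sigma_k$ by permuting the tensor factors with Koszul signs, the multivariable composition with Koszul signs, and the identity transformation in $\mathcal N(1)_0$ as unit, the $\mathcal N(k)$ form a chain operad $\mathcal N$, the endomorphism operad of the functor $S^*$. An overlapping partition $\mathcal A$ of $\{0,\dots,p\}$ with $m\ge1$ pieces consists of subsets $A_1,\dots,A_m$ which cover $\{0,\dots,p\}$,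 such that each element of $A_j$ is $\le$ each element of $A_{j'}$ for $j<j'$, and $A_j\cap A_{j+1}$ has exactly one element for $1\le j<m$. For $m=0$ there is one (the empty collection) if $p=0$ and none if $p>0$. For a surjection $f:\bar m\to\bar k$ let $\tau_f(j)=|\{j': f(j')<f(j)\text{, or } f(j')=f(j)\text{ and } j'\le j\}|$ and $$\epsilon(f,\mathcal A)=\sum_{j<j',\ f(j)>f(j')}\|A_j\|\,\|A_{j'}\|+\sum_{j=1}^m\|A_j\|\,(\tau_f(j)-f(j)).$$ For $\sigma:\Delta^p\to X$ and a finite multiset $B$ of elements of $\{0,\dots,p\}$ let $\sigma(B)$ be the composite of $\sigma$ with the affine map $\Delta^{\|B\|}\to\Delta^p$ which sends the vertices in order to the elements of $B$ listed in nondecreasing order with repetitions. Put $$\sigma[f]=\sum_{\mathcal A}(-1)^{\epsilon(f,\mathcal A)}\bigotimes_{i=1}^k\sigma\Bigl(\coprod_{f(j)=i}A_j\Bigr)\in (S_*X)^{\otimes k},\qquad \langle f\rangle(x_1\otimes\cdots\otimes x_k)(\sigma)=(-1)^{m-k}(x_1\otimes\cdots\otimes x_k)(\sigma[f]),$$ where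 $\mathcal A$ runs over the overlapping partitions of $\{0,\dots,p\}$ with $m$ pieces; this defines the sequence operation $\langle f\rangle\in\mathcal N(k)_{m-k}$. Call $f:\bar m\to\bar k$ nondegenerate if it is surjective and $f(j)\ne f(j+1)$ for $1\le j<m$ (the identity of $\bar 0=\emptyset$ is nondegenerate). Let $\mathcal S(k)_n$ be the span in $\mathcal N(k)_n$ of the $\langle f\rangle$ with $f:\bar m\to\bar k$ nondegenerate and $m-k=n$. **Theorem.** $\mathcal N$ is a chain operad, and for each $k\ge0$ the operations $\langle f\rangle$, with $f:\bar m\to\bar k$ nondegenerate and $m$ arbitrary, are linearly independent over $\mathbb Z$, so that $\mathcal S(k)$ is the free graded abelian group on the nondegenerate maps $\bar m\to\bar k$. Moreover: (a) $\mathcal S(k)$ is a subcomplex of $\mathcal N(k)$ for every $k\ge 0$. (b) $\mathcal S=\{\mathcal S(k)\}_{k\ge0}$ is a sub-chain-operad of $\mathcal N$: it contains the unit and is closed under the differential, the symmetric group actions and the multivariable compositions. (c) Each $\mathcal S(k)$ has the homology of a point: $H_0(\mathcal S(k))\cong\mathbb Z$ and $H_n(\mathcal S(k))=0$ for $n\neq0$.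 Consequently $\mathcal S$ is an $E_\infty$ chain operad (a chain operad for which each $\mathcal S(k)$ has the homology of a point and each $\mathcal S(k)_n$ is a free $\mathbb Z[\Sigma_k]$-module) which, being a suboperad of $\mathcal N$, acts naturally on $S^*X$; and it is of finite type: each $\mathcal S(k)_n$ is a finitely generated abelian group. -/

import Mathlib

open CategoryTheory Opposite Simplicial

universe u v

namespace SeqOp

noncomputable section

/-! ## Signs -/

/-- The sign `(-1)^e`. -/
def sgn (e : ℤ) : ℤ := (e.negOnePow : ℤ)

/-- The Koszul sign of rearranging graded objects `x_i` of degrees `n i` into the order in which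
`x_i` stands at the place `e i`: every pair which is interchanged contributes `n i * n i'`. -/
def koszul {k k' : ℕ} (e : Fin k ≃ Fin k') (n : Fin k → ℤ) : ℤ :=
  sgn (∑ i, ∑ i', if i < i' ∧ e i' < e i then n i * n i' else 0)

/-! ## Chain operads over the integers

The arity `k` part of an operad is a family of subgroups `G k n` (`n : ℤ` the degree) of an abelian
group `M k`; the structure maps are defined on `M`.  In this way an operad and its suboperads
share their structure maps. -/

/-- Structure maps of a symmetric operad in chain complexes.

* `d k n` is the differential on the elements of arity `k` and degree `n`.
* `act` is the right action of bijections; for `k = k'` it is the right action of the symmetric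
  group `Σ_k`.  (The two numbers always agree if there is a bijection; they are kept apart so that
  `act` also serves as transport along equalities of arities.)
* `comp j n f g` is the multivariable composite `f(g_1, …, g_k)`, where `g_i` has arity `j i` and
  degree `n i` (the degrees enter in the signs). -/
structure OperadData where
  M : ℕ → Type v
  [addCommGroup : ∀ k, AddCommGroup (M k)]
  d : ∀ k : ℕ, ℤ → (M k →ₗ[ℤ] M k)
  act : ∀ {k k' : ℕ}, (Fin k ≃ Fin k') → (M k' →ₗ[ℤ] M k)
  one : M 1
  comp : ∀ {k : ℕ} (j : Fin k → ℕ) (_ : Fin k → ℤ), M k → (∀ i, M (j i)) → M (∑ i, j i)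

attribute [instance] OperadData.addCommGroup

/-- The bijection between `{1, …, ∑ j i}`, divided into consecutive blocks of lengths `j i`, and
`{1, …, ∑ j' i'}`, divided likewise, induced by a bijection of pairs (block, place). -/
def blockEquiv {k k' : ℕ} {j : Fin k → ℕ} {j' : Fin k' → ℕ}
    (e : (Σ i, Fin (j i)) ≃ (Σ i, Fin (j' i))) : Fin (∑ i, j i) ≃ Fin (∑ i, j' i) :=
  finSigmaFinEquiv.symm.trans (e.trans finSigmaFinEquiv)

/-- The graded pieces `G k n`, with the structure maps of `D`, form a chain operad
(a symmetric operad with unit in the category of chain complexes of abelian groups). -/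
structure IsChainOperad (D : OperadData.{v}) (G : ∀ k : ℕ, ℤ → Submodule ℤ (D.M k)) : Prop where
  -- the structure maps preserve the graded pieces
  d_mem : ∀ {k n f}, f ∈ G k n → D.d k n f ∈ G k (n - 1)
  act_mem : ∀ {k k' n f} (e : Fin k ≃ Fin k'), f ∈ G k' n → D.act e f ∈ G k n
  one_mem : D.one ∈ G 1 0
  comp_mem : ∀ {k a} {j : Fin k → ℕ} {n : Fin k → ℤ} {f : D.M k} {g : ∀ i, D.M (j i)},
    f ∈ G k a → (∀ i, g i ∈ G (j i) (n i)) → D.comp j n f g ∈ G (∑ i, j i) (a + ∑ i, n i)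
  -- each arity is a chain complex
  d_d : ∀ {k n f}, f ∈ G k n → D.d k (n - 1) (D.d k n f) = 0
  -- right actions, by chain maps
  act_refl : ∀ {k n f}, f ∈ G k n → D.act (Equiv.refl (Fin k)) f = f
  act_trans : ∀ {k k' k'' n f} (e : Fin k ≃ Fin k') (e' : Fin k' ≃ Fin k''), f ∈ G k'' n →
    D.act (e.trans e') f = D.act e (D.act e' f)
  d_act : ∀ {k k' n f} (e : Fin k ≃ Fin k'), f ∈ G k' n →
    D.d k n (D.act e f) = D.act e (D.d k' n f)
  -- composition is multilinear
  comp_add_left : ∀ {k a} {j : Fin k → ℕ} {n : Fin k → ℤ} {f f' : D.M k} {g : ∀ i, D.M (j i)},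
    f ∈ G k a → f' ∈ G k a → (∀ i, g i ∈ G (j i) (n i)) →
    D.comp j n (f + f') g = D.comp j n f g + D.comp j n f' g
  comp_add_right : ∀ {k a} {j : Fin k → ℕ} {n : Fin k → ℤ} {f : D.M k} {g : ∀ i, D.M (j i)}
    (i : Fin k) {g' : D.M (j i)},
    f ∈ G k a → (∀ i, g i ∈ G (j i) (n i)) → g' ∈ G (j i) (n i) →
    D.comp j n f (Function.update g i (g i + g')) =
      D.comp j n f g + D.comp j n f (Function.update g i g')
  -- composition is a chain map
  d_comp : ∀ {k a} {j : Fin k → ℕ} {n : Fin k → ℤ} {f : D.M k} {g : ∀ i, D.M (j i)},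
    f ∈ G k a → (∀ i, g i ∈ G (j i) (n i)) →
    D.d _ (a + ∑ i, n i) (D.comp j n f g) =
      D.comp j n (D.d k a f) g +
      ∑ i, sgn (a + ∑ i', if i' < i then n i' else 0) •
        D.comp j (Function.update n i (n i - 1)) f
          (Function.update g i (D.d (j i) (n i) (g i)))
  d_one : D.d 1 0 D.one = 0
  -- unit
  one_comp : ∀ {k n} {g : D.M k}, g ∈ G k n →
    D.comp (fun _ : Fin 1 => k) (fun _ => n) D.one (fun _ => g) = D.act (finCongr (by simp)) g
  comp_one : ∀ {k n} {f : D.M k}, f ∈ G k n →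
    D.comp (fun _ : Fin k => 1) (fun _ => 0) f (fun _ => D.one) = D.act (finCongr (by simp)) f
  -- associativity; the arguments `h` are numbered consecutively, `h (finSigmaFinEquiv ⟨i, b⟩)`
  -- being the one which is plugged into the `b`-th place of `g i`
  assoc : ∀ {k a} {j : Fin k → ℕ} {n : Fin k → ℤ} {l : Fin (∑ i, j i) → ℕ}
    {r : Fin (∑ i, j i) → ℤ} {f : D.M k} {g : ∀ i, D.M (j i)} {h : ∀ c, D.M (l c)}
    (hl : ∑ c, l c = ∑ i, ∑ b : Fin (j i), l (finSigmaFinEquiv ⟨i, b⟩)),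
    f ∈ G k a → (∀ i, g i ∈ G (j i) (n i)) → (∀ c, h c ∈ G (l c) (r c)) →
    D.comp l r (D.comp j n f g) h =
      sgn (∑ i, ∑ i', if i < i' then n i' * ∑ b, r (finSigmaFinEquiv ⟨i, b⟩) else 0) •
        D.act (finCongr hl)
          (D.comp (fun i => ∑ b, l (finSigmaFinEquiv ⟨i, b⟩))
            (fun i => n i + ∑ b, r (finSigmaFinEquiv ⟨i, b⟩)) f
            (fun i => D.comp (fun b => l (finSigmaFinEquiv ⟨i, b⟩))
              (fun b => r (finSigmaFinEquiv ⟨i, b⟩)) (g i)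
              (fun b => h (finSigmaFinEquiv ⟨i, b⟩))))
  -- equivariance
  act_comp : ∀ {k k' a} {j : Fin k → ℕ} {n : Fin k → ℤ} {f : D.M k'} {g : ∀ i, D.M (j i)}
    (e : Fin k ≃ Fin k'), f ∈ G k' a → (∀ i, g i ∈ G (j i) (n i)) →
    D.comp j n (D.act e f) g =
      koszul e n • D.act (blockEquiv (Equiv.sigmaCongrLeft' e))
        (D.comp (fun i' => j (e.symm i')) (fun i' => n (e.symm i')) f (fun i' => g (e.symm i')))
  comp_act : ∀ {k a} {j j' : Fin k → ℕ} {n : Fin k → ℤ} {f : D.M k} {g : ∀ i, D.M (j' i)}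
    (e : ∀ i, Fin (j i) ≃ Fin (j' i)), f ∈ G k a → (∀ i, g i ∈ G (j' i) (n i)) →
    D.comp j n f (fun i => D.act (e i) (g i)) =
      D.act (blockEquiv (Equiv.sigmaCongrRight e)) (D.comp j' n f g)

/-- `G'` is a sub-chain-operad of the chain operad `G`: its pieces are contained in those of `G`,
it contains the unit and is closed under the differential, the symmetric group actions and the
multivariable compositions. -/
structure IsSubChainOperad (D : OperadData.{v}) (G' G : ∀ k : ℕ, ℤ → Submodule ℤ (D.M k)) :
    Prop where
  le : ∀ k n, G' k n ≤ G k n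
  d_mem : ∀ {k n f}, f ∈ G' k n → D.d k n f ∈ G' k (n - 1)
  act_mem : ∀ {k n f} (ρ : Equiv.Perm (Fin k)), f ∈ G' k n → D.act ρ f ∈ G' k n
  one_mem : D.one ∈ G' 1 0
  comp_mem : ∀ {k a} {j : Fin k → ℕ} {n : Fin k → ℤ} {f : D.M k} {g : ∀ i, D.M (j i)},
    f ∈ G' k a → (∀ i, g i ∈ G' (j i) (n i)) → D.comp j n f g ∈ G' (∑ i, j i) (a + ∑ i, n i)

/-- The cycles of degree `n` in arity `k`. -/
def cycles (D : OperadData.{v}) (G : ∀ k : ℕ, ℤ → Submodule ℤ (D.M k)) (k : ℕ) (n : ℤ) :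
    Submodule ℤ (D.M k) := G k n ⊓ LinearMap.ker (D.d k n)

/-- The boundaries of degree `n` in arity `k`. -/
def boundaries (D : OperadData.{v}) (G : ∀ k : ℕ, ℤ → Submodule ℤ (D.M k)) (k : ℕ) (n : ℤ) :
    Submodule ℤ (D.M k) := (G k (n + 1)).map (D.d k (n + 1))

/-- The homology of the complex in arity `k`. -/
abbrev Homology (D : OperadData.{v}) (G : ∀ k : ℕ, ℤ → Submodule ℤ (D.M k)) (k : ℕ) (n : ℤ) :
    Type v := cycles D G k n ⧸ (boundaries D G k n).submoduleOf (cycles D G k n)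

/-- The complex in arity `k` has the homology of a point. -/
def HasHomologyOfPoint (D : OperadData.{v}) (G : ∀ k : ℕ, ℤ → Submodule ℤ (D.M k)) (k : ℕ) :
    Prop :=
  Nonempty (Homology D G k 0 ≃ₗ[ℤ] ℤ) ∧ ∀ n : ℤ, n ≠ 0 → Subsingleton (Homology D G k n)

/-- The symmetric group `Σ_k` acts freely in arity `k`: in every degree there is a set `B` such that
the elements `b ρ` (`b ∈ B`, `ρ ∈ Σ_k`) form a basis over `ℤ`; in other words `B` is a basis over
the group ring `ℤ[Σ_k]`. -/
def IsSymmetricFree (D : OperadData.{v}) (G : ∀ k : ℕ, ℤ → Submodule ℤ (D.M k)) (k : ℕ) : Prop :=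
  ∀ n : ℤ, ∃ B : Set (D.M k), B ⊆ G k n ∧
    LinearIndependent ℤ (fun x : B × Equiv.Perm (Fin k) => D.act x.2 (x.1 : D.M k)) ∧
    Submodule.span ℤ (Set.range fun x : B × Equiv.Perm (Fin k) => D.act x.2 (x.1 : D.M k)) = G k n

/-- An `E_∞` chain operad: a chain operad such that, for every `k`, the complex in arity `k` has
the homology of a point and consists of free `ℤ[Σ_k]`-modules. -/
structure IsEInfinityOperad (D : OperadData.{v}) (G : ∀ k : ℕ, ℤ → Submodule ℤ (D.M k)) :
    Prop where
  isChainOperad : IsChainOperad D G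
  acyclic : ∀ k, HasHomologyOfPoint D G k
  free : ∀ k, IsSymmetricFree D G k

/-- Finite type: every graded piece is a finitely generated abelian group. -/
def IsOfFiniteType (D : OperadData.{v}) (G : ∀ k : ℕ, ℤ → Submodule ℤ (D.M k)) : Prop :=
  ∀ k n, (G k n).FG

/-! ## Normalized singular cochains -/

/-- Singular `n`-simplices of a space. -/
abbrev Sing (X : TopCat.{u}) (n : ℕ) : Type u := (TopCat.toSSet.obj X) _⦋n⦌

/-- The normalized singular cochains `S^* X = ⨁ S^n X`.  A normalized `n`-cochain, that is, a
homomorphism from the singular `n`-chains modulo degeneracies to `ℤ`, is given by a function on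
singular `n`-simplices which vanishes on the degenerate ones; an element of the direct sum has only
finitely many nonzero components. -/
def cochains (X : TopCat.{u}) : Submodule ℤ (∀ n : ℕ, Sing X n → ℤ) where
  carrier := {x | (∀ n, ∀ σ ∈ (TopCat.toSSet.obj X).degenerate n, x n σ = 0) ∧
    ∃ b : ℕ, ∀ n, b < n → x n = 0}
  zero_mem' := ⟨fun _ _ _ => rfl, 0, fun _ _ => rfl⟩
  add_mem' := by
    rintro x y ⟨hx, b, hb⟩ ⟨hy, c, hc⟩
    refine ⟨fun n σ hσ => by simp [hx n σ hσ, hy n σ hσ], max b c, fun n hn => ?_⟩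
    simp [hb n (lt_of_le_of_lt (le_max_left _ _) hn), hc n (lt_of_le_of_lt (le_max_right _ _) hn)]
  smul_mem' := by
    rintro a x ⟨hx, b, hb⟩
    exact ⟨fun n σ hσ => by simp [hx n σ hσ], b, fun n hn => by simp [hb n hn]⟩

/-- The cochain `x` is homogeneous of degree `p`. -/
def IsHomogeneous {X : TopCat.{u}} (p : ℕ) (x : cochains X) : Prop := ∀ q, q ≠ p → x.1 q = 0

/-- Evaluation on a simplex. -/
def ev {X : TopCat.{u}} {n : ℕ} (σ : Sing X n) : cochains X →ₗ[ℤ] ℤ where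
  toFun x := x.1 n σ
  map_add' _ _ := rfl
  map_smul' _ _ := rfl

/-- The homomorphism which multiplies the component of degree `n` by `c n`. -/
def scale (X : TopCat.{u}) (c : ℕ → ℤ) : cochains X →ₗ[ℤ] cochains X where
  toFun x := ⟨fun n => c n • x.1 n, fun n σ hσ => by simp [x.2.1 n σ hσ], by
    obtain ⟨b, hb⟩ := x.2.2
    exact ⟨b, fun n hn => by simp [hb n hn]⟩⟩
  map_add' x y := by ext n σ; simp [mul_add]
  map_smul' a x := by ext n σ; simp [mul_left_comm]

/-- The map `x ↦ (-1)^{e |x|} x`. -/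
def signMap (X : TopCat.{u}) (e : ℤ) : cochains X →ₗ[ℤ] cochains X := scale X fun n => sgn (e * n)

/-- The projection to the components of even (`c = 0`) or odd (`c = 1`) degrees. -/
def parityPart (X : TopCat.{u}) (c : ZMod 2) : cochains X →ₗ[ℤ] cochains X :=
  scale X fun n => if (n : ZMod 2) = c then 1 else 0

/-- The homomorphism `S^* Y → S^* X` induced by a map `X → Y`. -/
def pullback {X Y : TopCat.{u}} (φ : X ⟶ Y) : cochains Y →ₗ[ℤ] cochains X where
  toFun y := ⟨fun n σ => y.1 n ((TopCat.toSSet.map φ).app (op ⦋n⦌) σ),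
    fun n σ hσ => y.2.1 n _ (SSet.degenerate_app_apply hσ _), by
      obtain ⟨b, hb⟩ := y.2.2
      exact ⟨b, fun n hn => by ext σ; simp [hb n hn]⟩⟩
  map_add' _ _ := rfl
  map_smul' _ _ := rfl

/-- The values of the coboundary `d x = -(-1)^{|x|} x ∘ ∂`. -/
def coboundaryFun {X : TopCat.{u}} (x : ∀ n : ℕ, Sing X n → ℤ) (n : ℕ) : Sing X n → ℤ :=
  match n with
  | 0 => fun _ => 0
  | n + 1 => fun σ =>
    -sgn n * ∑ i : Fin (n + 2), sgn (i : ℕ) * x n ((TopCat.toSSet.obj X).δ i σ)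

theorem degenerate_of_not_injective {X : SSet.{u}} {n m : ℕ} (θ : ⦋n⦌ ⟶ ⦋m⦌) (y : X _⦋m⦌)
    (hθ : ¬ Function.Injective θ.toOrderHom) : X.map θ.op y ∈ X.degenerate n := by
  by_contra h
  exact hθ (SimplexCategory.mono_iff_injective.1
    (X.mono_of_nonDegenerate ⟨_, h⟩ θ y rfl))

theorem coboundaryFun_degenerate {X : TopCat.{u}} (x : cochains X) (n : ℕ) (σ : Sing X n)
    (hσ : σ ∈ (TopCat.toSSet.obj X).degenerate n) : coboundaryFun x.1 n σ = 0 := by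
  obtain _ | n := n
  · rfl
  rw [SSet.degenerate_eq_iUnion_range_σ] at hσ
  simp only [Set.mem_iUnion, Set.mem_range] at hσ
  obtain ⟨s, y, rfl⟩ := hσ
  have key : ∑ i : Fin (n + 2), sgn (i : ℕ) * x.1 n ((TopCat.toSSet.obj X).δ i
      ((TopCat.toSSet.obj X).σ s y)) = 0 := by
    rw [Finset.sum_eq_add s.castSucc s.succ (Fin.castSucc_lt_succ).ne]
    · have h1 : (TopCat.toSSet.obj X).δ s.castSucc ((TopCat.toSSet.obj X).σ s y) = y := by
        simp
      have h2 : (TopCat.toSSet.obj X).δ s.succ ((TopCat.toSSet.obj X).σ s y) = y := by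
        simp
      rw [h1, h2]
      simp [sgn, Int.negOnePow_succ]
    · rintro i - ⟨hi1, hi2⟩
      have : (TopCat.toSSet.obj X).δ i ((TopCat.toSSet.obj X).σ s y) =
          (TopCat.toSSet.obj X).map (SimplexCategory.δ i ≫ SimplexCategory.σ s).op y := by
        simp [SimplicialObject.δ, SimplicialObject.σ]
      rw [this, x.2.1, mul_zero]
      apply degenerate_of_not_injective
      intro hinj
      obtain ⟨a, ha⟩ := Fin.exists_succAbove_eq (Ne.symm hi1)
      obtain ⟨b, hb⟩ := Fin.exists_succAbove_eq (Ne.symm hi2)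
      have hab : a = b := by
        apply hinj
        change s.predAbove (i.succAbove a) = s.predAbove (i.succAbove b)
        rw [ha, hb]
        simp
      rw [← hab, ha] at hb
      exact (Fin.castSucc_lt_succ).ne hb
    · simp
    · simp
  simp only [coboundaryFun, key, mul_zero]

/-- The coboundary of `S^* X`. -/
def coboundary (X : TopCat.{u}) : cochains X →ₗ[ℤ] cochains X where
  toFun x := ⟨coboundaryFun x.1, coboundaryFun_degenerate x, by
    obtain ⟨b, hb⟩ := x.2.2
    refine ⟨b + 1, fun n hn => ?_⟩
    obtain _ | n := n
    · omega
    · ext σ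
      simp [coboundaryFun, hb n (by omega)]⟩
  map_add' x y := by
    ext n σ
    cases n <;> simp [coboundaryFun, mul_add, Finset.sum_add_distrib]
  map_smul' a x := by
    ext n σ
    cases n
    · simp [coboundaryFun]
    · simp only [coboundaryFun, Submodule.coe_smul, Pi.smul_apply, smul_eq_mul, RingHom.id_apply,
        Finset.mul_sum]
      exact Finset.sum_congr rfl fun _ _ => by ring

/-! ## The endomorphism operad of the functor of normalized cochains -/

/-- A family of homomorphisms `(S^* X)^{⊗ k} → S^* X`, one for each space `X`, written as a family
of multilinear maps. -/
abbrev Family (k : ℕ) : Type (u + 1) :=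
  ∀ X : TopCat.{u}, MultilinearMap ℤ (fun _ : Fin k => cochains X) (cochains X)

/-- The group `N(k)_n` of natural transformations `(S^* X)^{⊗ k} → S^* X` which lower the total
degree by `n`. -/
def N (k : ℕ) (n : ℤ) : Submodule ℤ (Family.{u} k) where
  carrier := {ν |
    (∀ (X Y : TopCat.{u}) (φ : X ⟶ Y) (y : Fin k → cochains Y),
      ν X (fun i => pullback φ (y i)) = pullback φ (ν Y y)) ∧
    (∀ (X : TopCat.{u}) (x : Fin k → cochains X) (p : Fin k → ℕ),
      (∀ i, IsHomogeneous (p i) (x i)) →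
      ∀ q : ℕ, (q : ℤ) ≠ (∑ i, (p i : ℤ)) - n → (ν X x).1 q = 0)}
  zero_mem' := ⟨fun X Y φ y => by simp, fun X x p hx q hq => by simp⟩
  add_mem' := by
    rintro ν μ ⟨h1, h2⟩ ⟨h1', h2'⟩
    refine ⟨fun X Y φ y => ?_, fun X x p hx q hq => ?_⟩
    · simp [h1 X Y φ y, h1' X Y φ y]
    · simp [h2 X x p hx q hq, h2' X x p hx q hq]
  smul_mem' := by
    rintro a ν ⟨h1, h2⟩
    refine ⟨fun X Y φ y => ?_, fun X x p hx q hq => ?_⟩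
    · simp [h1 X Y φ y]
    · simp [h2 X x p hx q hq]

/-- The differential `∂ ν = d ∘ ν - (-1)^n ν ∘ d` for `ν` of degree `n`, where
`d (x_1 ⊗ ⋯ ⊗ x_k) = ∑_i (-1)^{|x_1| + ⋯ + |x_{i-1}|} x_1 ⊗ ⋯ ⊗ d x_i ⊗ ⋯ ⊗ x_k`. -/
def diff (k : ℕ) (n : ℤ) : Family.{u} k →ₗ[ℤ] Family.{u} k where
  toFun ν X := (coboundary X).compMultilinearMap (ν X) -
    sgn n • ∑ i : Fin k, (ν X).compLinearMap fun i' =>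
      if i' < i then signMap X 1 else if i' = i then coboundary X else LinearMap.id
  map_add' ν μ := by
    funext X; ext1 x
    simp [Finset.sum_add_distrib, smul_add]
    abel
  map_smul' a ν := by
    funext X; ext1 x
    simp [← Finset.smul_sum, smul_sub, smul_comm a]

/-- The right action: `(ν e)(x_1 ⊗ ⋯ ⊗ x_k) = ± ν (x_{e⁻¹ 1} ⊗ ⋯ ⊗ x_{e⁻¹ k})`, where the sign is
the Koszul sign of the rearrangement, which depends on the parities of the degrees of the `x_i`
(see `act_apply`). -/
def act {k k' : ℕ} (e : Fin k ≃ Fin k') : Family.{u} k' →ₗ[ℤ] Family.{u} k where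
  toFun ν X := ∑ c : Fin k → ZMod 2, koszul e (fun i => ((c i).val : ℤ)) •
    ((ν X).domDomCongr e.symm).compLinearMap fun i => parityPart X (c i)
  map_add' ν μ := by
    funext X; ext1 x
    simp [Finset.sum_add_distrib]
  map_smul' a ν := by
    funext X; ext1 x
    simp [Finset.smul_sum, smul_comm a]

/-- The composite
`ν(μ_1, …, μ_k)(x_1 ⊗ ⋯ ) = ± ν(μ_1(x_1 ⊗ ⋯ ⊗ x_{j_1}) ⊗ ⋯ ⊗ μ_k( ⋯ ))`.  The sign comes from
moving `μ_i`, of degree `n i`, past the arguments of `μ_1, …, μ_{i-1}`; that is, each argument `x`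
of `μ_i` contributes `(-1)^{e |x|}`, where `e` is the sum of the degrees of `μ_{i+1}, …, μ_k`. -/
def comp {k : ℕ} (j : Fin k → ℕ) (n : Fin k → ℤ) (ν : Family.{u} k)
    (μ : ∀ i, Family.{u} (j i)) : Family.{u} (∑ i, j i) := fun X =>
  (((ν X).compMultilinearMap fun i => (μ i X).compLinearMap fun _ =>
    signMap X (∑ i', if i < i' then n i' else 0)).domDomCongr finSigmaFinEquiv)

/-- The identity transformation. -/
def one : Family.{u} 1 := fun X =>
  MultilinearMap.ofSubsingleton ℤ (cochains X) (cochains X) 0 LinearMap.id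

/-- The structure maps of the endomorphism operad of `S^*`. -/
def endData : OperadData.{u + 1} where
  M := Family.{u}
  d := diff
  act := act
  one := one
  comp := comp

/-- On homogeneous elements the action is given by the Koszul sign. -/
theorem act_apply {k k' : ℕ} (e : Fin k ≃ Fin k') (ν : Family.{u} k') (X : TopCat.{u})
    (x : Fin k → cochains X) (p : Fin k → ℕ) (hx : ∀ i, IsHomogeneous (p i) (x i)) :
    act e ν X x = koszul e (fun i => (p i : ℤ)) • ν X (fun i' => x (e.symm i')) := by
  have hp : ∀ i, parityPart X (p i : ZMod 2) (x i) = x i := by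
    intro i
    ext q σ
    by_cases h : q = p i
    · subst h; simp [parityPart, scale]
    · simp [parityPart, scale, hx i q h]
  have h0 : ∀ i (c : ZMod 2), (p i : ZMod 2) ≠ c → parityPart X c (x i) = 0 := by
    intro i c hc
    ext q σ
    by_cases h : q = p i
    · subst h; simp [parityPart, scale, hc]
    · simp [parityPart, scale, hx i q h]
  have hk : koszul e (fun i => (((p i : ZMod 2)).val : ℤ)) = koszul e (fun i => (p i : ℤ)) := by
    unfold koszul sgn
    congr 1
    rw [Int.negOnePow_eq_iff, ← Finset.sum_sub_distrib]
    refine Finset.even_sum _ fun i _ => ?_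
    rw [← Finset.sum_sub_distrib]
    refine Finset.even_sum _ fun i' _ => ?_
    split_ifs
    · rw [← ZMod.intCast_eq_zero_iff_even]
      push_cast
      rw [ZMod.natCast_zmod_val, ZMod.natCast_zmod_val, sub_self]
    · simp
  change (∑ c : Fin k → ZMod 2, koszul e (fun i => ((c i).val : ℤ)) •
    ((ν X).domDomCongr e.symm).compLinearMap fun i => parityPart X (c i)) x = _
  rw [sum_apply, Finset.sum_eq_single fun i => (p i : ZMod 2)]
  · rw [smul_apply, MultilinearMap.compLinearMap_apply, hk]
    simp only [hp]
    rfl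
  · intro c _ hc
    obtain ⟨i, hi⟩ := Function.ne_iff.1 hc
    rw [smul_apply, MultilinearMap.compLinearMap_apply,
      MultilinearMap.map_coord_zero _ i (h0 i _ (Ne.symm hi)), smul_zero]
  · simp

/-! ## Overlapping partitions -/

/-- Overlapping partitions of `{0, …, q}` with `m` pieces, given by their overlap points: a sequence
`0 = t_0 ≤ t_1 ≤ ⋯ ≤ t_m = q`, the pieces being the intervals from `t_{j-1}` to `t_j`.
For `m = 0` there is one if `q = 0`, and none otherwise. -/
def OverlapPartition (m q : ℕ) : Type :=
  {t : Fin (m + 1) → Fin (q + 1) // Monotone t ∧ t 0 = 0 ∧ t (Fin.last m) = Fin.last q}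

instance (m q : ℕ) : Fintype (OverlapPartition m q) := by
  classical exact inferInstanceAs (Fintype {t : Fin (m + 1) → Fin (q + 1) //
    Monotone t ∧ t 0 = 0 ∧ t (Fin.last m) = Fin.last q})

/-- The pieces of an overlapping partition. -/
def OverlapPartition.piece {m q : ℕ} (A : OverlapPartition m q) (j : Fin m) :
    Finset (Fin (q + 1)) := Finset.Icc (A.1 j.castSucc) (A.1 j.succ)

theorem OverlapPartition.piece_injective {m q : ℕ} :
    Function.Injective (OverlapPartition.piece : OverlapPartition m q → _) := by
  intro A B h
  apply Subtype.ext
  funext j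
  induction j using Fin.cases with
  | zero => rw [A.2.2.1, B.2.2.1]
  | succ j =>
    have h1 : ∀ s, s ∈ A.piece j ↔ s ∈ B.piece j := by simp [h]
    simp only [OverlapPartition.piece, Finset.mem_Icc] at h1
    have hA := A.2.1 (Fin.castSucc_lt_succ (i := j)).le
    have hB := B.2.1 (Fin.castSucc_lt_succ (i := j)).le
    exact le_antisymm ((h1 _).1 ⟨hA, le_rfl⟩).2 ((h1 _).2 ⟨hB, le_rfl⟩).2

/-- A collection of `m ≥ 1` subsets consists of the pieces of an overlapping partition if and only
if they cover `{0, …, q}`, each element of an earlier subset is `≤` each element of a later one,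
and consecutive subsets have exactly one element in common. -/
theorem OverlapPartition.exists_piece_eq_iff {m q : ℕ} (hm : m ≠ 0)
    (A : Fin m → Finset (Fin (q + 1))) :
    (∃ P : OverlapPartition m q, P.piece = A) ↔
      (∀ s, ∃ j, s ∈ A j) ∧ (∀ j j', j < j' → ∀ s ∈ A j, ∀ s' ∈ A j', s ≤ s') ∧
      (∀ j j' : Fin m, (j : ℕ) + 1 = j' → (A j ∩ A j').card = 1) := by
  obtain ⟨m, rfl⟩ := Nat.exists_eq_succ_of_ne_zero hm
  constructor
  · rintro ⟨P, rfl⟩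
    refine ⟨fun s => ?_, fun j j' hj s hs s' hs' => ?_, fun j j' hj => ?_⟩
    · have key : ∀ n : ℕ, ∀ hn : n < m + 1, s ≤ P.1 ⟨n + 1, by omega⟩ → ∃ j, s ∈ P.piece j := by
        intro n
        induction n with
        | zero =>
          intro hn h
          refine ⟨⟨0, hn⟩, Finset.mem_Icc.2 ⟨?_, h⟩⟩
          have : P.1 (Fin.castSucc ⟨0, hn⟩) = 0 := P.2.2.1
          rw [this]; exact Fin.zero_le _
        | succ n ih =>
          intro hn h
          by_cases h' : s ≤ P.1 ⟨n + 1, by omega⟩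
          · exact ih (by omega) h'
          · exact ⟨⟨n + 1, hn⟩, Finset.mem_Icc.2 ⟨(not_le.1 h').le, h⟩⟩
      exact key m (by omega) (by
        have : P.1 ⟨m + 1, by omega⟩ = Fin.last _ := P.2.2.2
        rw [this]; exact Fin.le_last _)
    · simp only [OverlapPartition.piece, Finset.mem_Icc] at hs hs'
      have : P.1 j.succ ≤ P.1 j'.castSucc := P.2.1 (by simpa [Fin.le_def] using hj)
      exact hs.2.trans (this.trans hs'.1)
    · have e : j.succ = j'.castSucc := by ext; simpa using hj
      have h1 : P.1 j.castSucc ≤ P.1 j.succ := P.2.1 (Fin.castSucc_lt_succ).le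
      have h2 : P.1 j'.castSucc ≤ P.1 j'.succ := P.2.1 (Fin.castSucc_lt_succ).le
      rw [Finset.card_eq_one]
      refine ⟨P.1 j.succ, ?_⟩
      ext s
      simp only [OverlapPartition.piece, Finset.mem_inter, Finset.mem_Icc, Finset.mem_singleton]
      rw [← e] at h2 ⊢
      constructor
      · rintro ⟨⟨_, ha⟩, hb, _⟩
        exact le_antisymm ha hb
      · rintro rfl
        exact ⟨⟨h1, le_rfl⟩, le_rfl, h2⟩
  · rintro ⟨hc, ho, hi⟩
    have hi' : ∀ j : Fin m, ∃ c, A j.castSucc ∩ A j.succ = {c} := fun j =>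
      Finset.card_eq_one.1 (hi j.castSucc j.succ (by simp))
    choose c hc' using hi'
    have hcl : ∀ j, c j ∈ A j.castSucc := fun j =>
      (Finset.mem_inter.1 (by rw [hc' j]; simp : c j ∈ A j.castSucc ∩ A j.succ)).1
    have hcr : ∀ j, c j ∈ A j.succ := fun j =>
      (Finset.mem_inter.1 (by rw [hc' j]; simp : c j ∈ A j.castSucc ∩ A j.succ)).2
    have h0 : (0 : Fin (q + 1)) ∈ A 0 := by
      obtain ⟨j, hj⟩ := hc 0
      induction j using Fin.cases with
      | zero => exact hj
      | succ j =>
        have := ho 0 j.succ (Fin.succ_pos j)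
        have hne : (A 0).Nonempty := by
          have hm' : 0 < m := j.pos
          exact ⟨_, hcl ⟨0, hm'⟩⟩
        obtain ⟨s, hs⟩ := hne
        have := Fin.le_zero_iff.1 (this s hs 0 hj)
        rwa [this] at hs
    have hl : Fin.last q ∈ A (Fin.last m) := by
      obtain ⟨j, hj⟩ := hc (Fin.last q)
      induction j using Fin.lastCases with
      | last => exact hj
      | cast j =>
        have := ho j.castSucc (Fin.last m) (Fin.castSucc_lt_last j)
        have hne : (A (Fin.last m)).Nonempty := by
          have hm' : 0 < m := j.pos
          refine ⟨c ⟨m - 1, by omega⟩, ?_⟩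
          have e : Fin.succ ⟨m - 1, by omega⟩ = Fin.last m := by ext; simp; omega
          have := hcr ⟨m - 1, by omega⟩
          rwa [e] at this
        obtain ⟨s, hs⟩ := hne
        have := Fin.last_le_iff.1 (this _ hj s hs)
        rwa [this] at hs
    -- the overlap points
    let t : Fin (m + 1 + 1) → Fin (q + 1) :=
      Fin.cases 0 (Fin.lastCases (Fin.last q) c)
    have t0 : t 0 = 0 := rfl
    have tl : t (Fin.last (m + 1)) = Fin.last q := by
      change (Fin.lastCases (Fin.last q) c (Fin.last m) : Fin (q + 1)) = _
      rw [Fin.lastCases_last]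
    have tc : ∀ j : Fin m, t j.castSucc.succ = c j := fun j => by simp [t]
    have hL : ∀ j : Fin (m + 1), t j.castSucc ∈ A j := by
      intro j
      induction j using Fin.cases with
      | zero => exact h0
      | succ j => rw [← Fin.succ_castSucc, tc]; exact hcr j
    have hR : ∀ j : Fin (m + 1), t j.succ ∈ A j := by
      intro j
      induction j using Fin.lastCases with
      | last => rw [Fin.succ_last, tl]; exact hl
      | cast j => rw [tc]; exact hcl j
    have hlow : ∀ j, ∀ s ∈ A j, t j.castSucc ≤ s := by
      intro j s hs
      induction j using Fin.cases with
      | zero => exact Fin.zero_le _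
      | succ j =>
        rw [← Fin.succ_castSucc, tc]
        exact ho _ _ (Fin.castSucc_lt_succ) _ (hcl j) _ hs
    have hupp : ∀ j, ∀ s ∈ A j, s ≤ t j.succ := by
      intro j s hs
      induction j using Fin.lastCases with
      | last => rw [Fin.succ_last, tl]; exact Fin.le_last _
      | cast j =>
        rw [tc]
        exact ho _ _ (Fin.castSucc_lt_succ) _ hs _ (hcr j)
    have tm : Monotone t := Fin.monotone_iff_le_succ.2 fun j => hlow j _ (hR j)
    refine ⟨⟨t, tm, t0, tl⟩, ?_⟩
    funext j
    ext s
    simp only [OverlapPartition.piece, Finset.mem_Icc]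
    refine ⟨fun ⟨h1, h2⟩ => ?_, fun hs => ⟨hlow j s hs, hupp j s hs⟩⟩
    obtain ⟨i, hs⟩ := hc s
    rcases lt_trichotomy i j with h | h | h
    · have : s ≤ t j.castSucc := (hupp i s hs).trans (tm (by simpa [Fin.le_def] using h))
      rw [le_antisymm this h1]; exact hL j
    · exact h ▸ hs
    · have : t j.succ ≤ s := le_trans (tm (by simpa [Fin.le_def] using h)) (hlow i s hs)
      rw [le_antisymm h2 this]; exact hR j

/-! ## Sequence operations -/

/-- A map `f : {1, …, m} → {1, …, k}` is nondegenerate if it is surjective and takes distinct values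
on adjacent elements. -/
def Nondegenerate {m k : ℕ} (f : Fin m → Fin k) : Prop :=
  Function.Surjective f ∧ ∀ j j' : Fin m, (j : ℕ) + 1 = j' → f j ≠ f j'

/-- `τ_f(j)` is the number of `j'` with `f j' < f j`, or `f j' = f j` and `j' ≤ j`. -/
def tau {m k : ℕ} (f : Fin m → Fin k) (j : Fin m) : ℕ :=
  (Finset.univ.filter fun j' => f j' < f j ∨ (f j' = f j ∧ j' ≤ j)).card

/-- The exponent `ε(f, A)`, the sum of the `‖A_j‖ ‖A_{j'}‖` over all `j < j'` with `f j > f j'`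
and of the `‖A_j‖ (τ_f(j) - f(j))` over all `j`, where `‖A_j‖ = |A_j| - 1`.  The value of `f` in
`{1, …, k}` is `(f j : ℕ) + 1`. -/
def epsilon {m k q : ℕ} (f : Fin m → Fin k) (A : OverlapPartition m q) : ℤ :=
  (∑ j, ∑ j', if j < j' ∧ f j' < f j then
    (((A.piece j).card : ℤ) - 1) * (((A.piece j').card : ℤ) - 1) else 0) +
  ∑ j, (((A.piece j).card : ℤ) - 1) * ((tau f j : ℤ) - ((f j : ℕ) + 1))

/-- The disjoint union `∐_{f(j) = i} A_j`, as a multiset. -/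
def block {m k q : ℕ} (f : Fin m → Fin k) (A : OverlapPartition m q) (i : Fin k) :
    Multiset (Fin (q + 1)) :=
  ∑ j ∈ Finset.univ.filter (fun j => f j = i), (A.piece j).val

/-- The map of simplices `Δ^p → Δ^q`, `p = |B| - 1`, which takes the vertices of `Δ^p` in order to
the elements of the nonempty multiset `B`, listed in nondecreasing order with repetitions. -/
def vertexMap {q : ℕ} (B : Multiset (Fin (q + 1))) : ⦋B.card - 1⦌ ⟶ ⦋q⦌ :=
  SimplexCategory.mkHom
    { toFun := fun a => (B.sort (· ≤ ·)).getD a 0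
      monotone' := by
        intro a b hab
        rcases Nat.eq_zero_or_pos B.card with h | h
        · simp [Multiset.card_eq_zero.1 h]
        · have ha : (a : ℕ) < (B.sort (· ≤ ·)).length := by
            have : (a : ℕ) < B.card - 1 + 1 := a.2
            rw [Multiset.length_sort]; omega
          have hb : (b : ℕ) < (B.sort (· ≤ ·)).length := by
            have : (b : ℕ) < B.card - 1 + 1 := b.2
            rw [Multiset.length_sort]; omega
          change (B.sort (· ≤ ·)).getD a 0 ≤ (B.sort (· ≤ ·)).getD b 0
          rw [List.getD_eq_getElem _ _ ha, List.getD_eq_getElem _ _ hb]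
          exact (B.pairwise_sort (· ≤ ·)).sortedLE.monotone_get (a := ⟨a, ha⟩) (b := ⟨b, hb⟩) hab }

/-- The simplex `σ(B)`. -/
def face {X : TopCat.{u}} {q : ℕ} (σ : Sing X q) (B : Multiset (Fin (q + 1))) :
    Sing X (B.card - 1) := (TopCat.toSSet.obj X).map (vertexMap B).op σ

/-- The values `⟨f⟩(x_1 ⊗ ⋯ ⊗ x_k)(σ) = (-1)^{m-k} (x_1 ⊗ ⋯ ⊗ x_k)(σ[f])`, where
`σ[f] = ∑_A (-1)^{ε(f, A)} ⨂_i σ(∐_{f(j) = i} A_j)`.  A cochain vanishes on simplices whose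
dimension is not its degree, and
`(x_1 ⊗ ⋯ ⊗ x_k)(c_1 ⊗ ⋯ ⊗ c_k) = (-1)^{∑_{i < i'} |c_i| |x_{i'}|} x_1(c_1) ⋯ x_k(c_k)`. -/
def seqValue {m k : ℕ} (f : Fin m → Fin k) (X : TopCat.{u}) (q : ℕ) (σ : Sing X q) :
    MultilinearMap ℤ (fun _ : Fin k => cochains X) ℤ :=
  sgn ((m : ℤ) - k) • ∑ A : OverlapPartition m q,
    (sgn (epsilon f A) *
      sgn (∑ i, ∑ i', if i < i' then
        (((block f A i).card : ℤ) - 1) * (((block f A i').card : ℤ) - 1) else 0)) •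
    (MultilinearMap.mkPiAlgebra ℤ (Fin k) ℤ).compLinearMap fun i => ev (face σ (block f A i))

/-- Consecutive numbers lie in a common piece of an overlapping partition. -/
theorem OverlapPartition.exists_mem_piece {m q : ℕ} (A : OverlapPartition m (q + 1))
    (s : Fin (q + 1)) : ∃ j, s.castSucc ∈ A.piece j ∧ s.succ ∈ A.piece j := by
  have key : ∀ n : ℕ, ∀ hn : n < m + 1, s.succ ≤ A.1 ⟨n, hn⟩ →
      ∃ j, s.castSucc ∈ A.piece j ∧ s.succ ∈ A.piece j := by
    intro n
    induction n with
    | zero =>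
      intro hn h
      have h0 : A.1 ⟨0, hn⟩ = 0 := A.2.2.1
      rw [h0] at h
      exact absurd h (by simp [Fin.le_def])
    | succ n ih =>
      intro hn h
      by_cases h' : s.succ ≤ A.1 ⟨n, by omega⟩
      · exact ih _ h'
      · refine ⟨⟨n, by omega⟩, ?_⟩
        have e1 : A.1 (Fin.castSucc ⟨n, by omega⟩) = A.1 ⟨n, by omega⟩ := rfl
        have e2 : A.1 (Fin.succ ⟨n, by omega⟩) = A.1 ⟨n + 1, hn⟩ := rfl
        simp only [OverlapPartition.piece, Finset.mem_Icc, e1, e2]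
        simp only [Fin.le_def, Fin.val_succ, Fin.val_castSucc] at h h' ⊢
        omega
  exact key m (by omega) (by
    have : A.1 ⟨m, by omega⟩ = Fin.last _ := A.2.2.2
    rw [this]; exact Fin.le_last _)

theorem seqValue_degenerate {m k : ℕ} (f : Fin m → Fin k) (X : TopCat.{u})
    (x : Fin k → cochains X) (q : ℕ) (σ : Sing X q)
    (hσ : σ ∈ (TopCat.toSSet.obj X).degenerate q) : seqValue f X q σ x = 0 := by
  obtain _ | q := q
  · simp at hσ
  rw [SSet.degenerate_eq_iUnion_range_σ] at hσ
  simp only [Set.mem_iUnion, Set.mem_range] at hσ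
  obtain ⟨s, y, rfl⟩ := hσ
  simp only [seqValue, smul_apply, sum_apply]
  rw [Finset.sum_eq_zero, smul_zero]
  intro A _
  obtain ⟨j, hj1, hj2⟩ := A.exists_mem_piece s
  rw [MultilinearMap.compLinearMap_apply, MultilinearMap.mkPiAlgebra_apply,
    Finset.prod_eq_zero (Finset.mem_univ (f j)), smul_zero]
  refine (x (f j)).2.1 _ _ ?_
  set B := block f A (f j) with hB
  have hmem : ∀ a, a ∈ A.piece j → a ∈ B.sort (· ≤ ·) := by
    intro a ha
    rw [Multiset.mem_sort, hB, block, Multiset.mem_sum]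
    exact ⟨j, by simp, ha⟩
  have hf : face ((TopCat.toSSet.obj X).σ s y) B =
      (TopCat.toSSet.obj X).map (vertexMap B ≫ SimplexCategory.σ s).op y := by
    simp [face, SimplicialObject.σ]
  rw [hf]
  apply degenerate_of_not_injective
  intro hinj
  obtain ⟨a, ha, ha'⟩ := List.getElem_of_mem (hmem _ hj1)
  obtain ⟨b, hb, hb'⟩ := List.getElem_of_mem (hmem _ hj2)
  have hlen : (B.sort (· ≤ ·)).length = B.card := by simp
  have hab := @hinj ⟨a, ha.trans_le (by rw [hlen]; exact Nat.le_add_of_sub_le le_rfl)⟩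
    ⟨b, hb.trans_le (by rw [hlen]; exact Nat.le_add_of_sub_le le_rfl)⟩ (by
      change s.predAbove ((B.sort (· ≤ ·)).getD a 0) = s.predAbove ((B.sort (· ≤ ·)).getD b 0)
      rw [List.getD_eq_getElem _ _ ha, List.getD_eq_getElem _ _ hb, ha', hb']
      simp)
  have hab' : a = b := by simpa using hab
  subst hab'
  rw [ha'] at hb'
  exact (Fin.castSucc_lt_succ).ne hb'

theorem seqValue_bounded {m k : ℕ} (f : Fin m → Fin k) (X : TopCat.{u})
    (x : Fin k → cochains X) :
    ∃ b : ℕ, ∀ q, b < q → ∀ σ : Sing X q, seqValue f X q σ x = 0 := by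
  choose b hb using fun i => (x i).2.2
  refine ⟨∑ i, (b i + 1), fun q hq σ => ?_⟩
  simp only [seqValue, smul_apply, sum_apply]
  rw [Finset.sum_eq_zero, smul_zero]
  intro A _
  rw [MultilinearMap.compLinearMap_apply, MultilinearMap.mkPiAlgebra_apply]
  have hex : ∃ i, b i < (block f A i).card - 1 := by
    by_contra! hcon
    have h1 : ∑ i, (block f A i).card = ∑ j, (A.piece j).card := by
      have h0 : ∀ i, (block f A i).card =
          ∑ j ∈ Finset.univ.filter (fun j => f j = i), (A.piece j).card := fun i => by
        rw [block, Multiset.card_sum]; rfl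
      simp only [h0]
      exact Finset.sum_fiberwise _ _ _
    have h2 : ∀ j, (A.1 j.succ : ℕ) - (A.1 j.castSucc : ℕ) ≤ (A.piece j).card := by
      intro j
      simp only [OverlapPartition.piece, Fin.card_Icc]
      omega
    have h3 : q ≤ ∑ j, (A.piece j).card := by
      have h4 : ∀ n : ℕ, ∀ hn : n < m + 1, (A.1 ⟨n, hn⟩ : ℕ) ≤
          ∑ j : Fin m, if (j : ℕ) < n then (A.piece j).card else 0 := by
        intro n
        induction n with
        | zero =>
          intro hn
          have : A.1 ⟨0, hn⟩ = 0 := A.2.2.1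
          rw [this]; simp
        | succ n ih =>
          intro hn
          have ih' := ih (by omega)
          have h5 := h2 ⟨n, by omega⟩
          simp only [Fin.succ_mk, Fin.castSucc_mk] at h5
          have h6 : ∑ j : Fin m, (if (j : ℕ) < n + 1 then (A.piece j).card else 0) =
              ∑ j : Fin m, ((if (j : ℕ) < n then (A.piece j).card else 0) +
                if j = ⟨n, by omega⟩ then (A.piece j).card else 0) := by
            refine Finset.sum_congr rfl fun j _ => ?_
            simp only [Fin.ext_iff]
            split_ifs <;> omega
          rw [h6, Finset.sum_add_distrib, Finset.sum_ite_eq' Finset.univ]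
          simp only [Finset.mem_univ, if_true]
          omega
      have h7 := h4 m (by omega)
      have h8 : A.1 ⟨m, by omega⟩ = Fin.last q := A.2.2.2
      rw [h8] at h7
      simpa using h7
    have h9 : ∑ i, (block f A i).card ≤ ∑ i, (b i + 1) :=
      Finset.sum_le_sum fun i _ => by have := hcon i; omega
    omega
  obtain ⟨i, hi⟩ := hex
  rw [Finset.prod_eq_zero (Finset.mem_univ i), smul_zero]
  change (x i).1 _ _ = 0
  rw [hb i _ hi]
  rfl

/-- The sequence operation `⟨f⟩` of a surjection `f : {1, …, m} → {1, …, k}`. -/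
def seqOp {m k : ℕ} (f : Fin m → Fin k) : Family.{u} k := fun X =>
  (MultilinearMap.pi fun q => MultilinearMap.pi fun σ => seqValue f X q σ).codRestrict
    (cochains X) fun x => ⟨fun q σ hσ => seqValue_degenerate f X x q σ hσ, by
      obtain ⟨b, hb⟩ := seqValue_bounded f X x
      exact ⟨b, fun q hq => funext fun σ => hb q hq σ⟩⟩

/-- `S(k)_n`: the span of the sequence operations `⟨f⟩`, `f : {1, …, m} → {1, …, k}` nondegenerate
with `m - k = n`. -/
def S (k : ℕ) (n : ℤ) : Submodule ℤ (Family.{u} k) :=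
  Submodule.span ℤ {ν | ∃ (m : ℕ) (f : Fin m → Fin k),
    Nondegenerate f ∧ (m : ℤ) - k = n ∧ ν = seqOp f}

end

end SeqOp

namespace SeqOp

noncomputable section

/-! ## Instances which abbreviate the search -/

/-! The proof rests on one change of description. An overlapping partition of `{0, …, q}` is
determined by the piece to which each gap between `s` and `s + 1` belongs, so partitions with `m`
pieces are monotone maps `J` from the `q` gaps to the `m` pieces (`ofGaps_bijective`). As `‖A_j‖` is
the number of gaps in `A_j`, the exponent `ε(f, A)` becomes modulo 2 a sum over inverted pairs of
gaps and over single gaps (`cast_epsilon`). Up to a sign depending only on degrees, `⟨f⟩` is the sum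
`core` over such maps (`seqOp_eq_core`), and its pieces may be indexed by any finite linear order.
Operations are compared on homogeneous cochains. A term whose blocks have the wrong dimensions
vanishes, so in every sign the number of gaps with a given label may be replaced by a degree.

Composition. The block of the pieces labelled `i` is a simplex; its gaps are the gaps of `σ`
labelled `i` and the junctions between consecutive pieces. Applying `⟨g_i⟩` to it means summing over
monotone maps `K_i` on these gaps. The restriction `T` of the `K_i` to the junctions does not depend
on `σ`, and what remains is a cut of `σ` along a new sequence, with elements `Letter T` and values
`label g`. The pairs `(J, K)` and `(T, J')` are equivalent data (`combine_bijective`), with the same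
pieces (`gpiece_toLetter`) and with signs that differ only by terms in `T` and the degrees
(`composite_sign`). So the composite is a signed sum of sequence operations over `T` (`comp_seqOp`).
Degenerate sequences do no harm: their operation is zero, because a block then has a repeated vertex
(`seqOp_eq_zero`). Permutations relabel `f` up to a sign (`act_seqOp`).

Differential. The coboundary of an argument omits a vertex from a piece. For a piece with gaps,
omitting its first vertex cancels against omitting the last vertex of the preceding piece once the
gap between has been moved there (`sum_shift`). The omissions without a partner are the partitions
of the faces of `σ` and give `d ∘ ⟨f⟩` (`sum_eraseVertex`). Omitting a piece without gaps deletes an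
element of the sequence. Hence `∂⟨f⟩` is the signed sum of the deletions of those elements whose
value occurs again (`diff_seqOp`).

The operad axioms for `N` are comparisons of Koszul signs on homogeneous elements, and `S` inherits
them once it is closed under the structure maps.

Linear independence. On the identity simplex of `Δ^m`, cut into its `m` edges, take as arguments the
cochains which detect the vertex sets of the blocks of `f`. Among all `⟨f'⟩` only `⟨f⟩` has a
nonzero value, which is `±1` (`eq_of_labelled_eq`). A permutation fixing a surjective map is
trivial, so the orbits of the nondegenerate maps give bases over the group ring.

Homology. Prepending the value `0` is a homotopy between the identity of `S(k + 1)` and the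
composite of `lowerOp` (remove a `0` that occurs once) with `raiseOp` (raise all values and prepend
`0`), and `lowerOp` is a left inverse of `raiseOp` (`homotopy_identity`, `lowerOp_raiseOp`). So `S(k
+ 1)` has the homology of `S(k)`, and `S(0)` is `ℤ` in degree `0`. -/

abbrev cochains.addCommMonoid (X : TopCat.{u}) : AddCommMonoid (cochains X) := Submodule.addCommMonoid _

abbrev cochains.addCommGroup (X : TopCat.{u}) : AddCommGroup (cochains X) := Submodule.addCommGroup _

abbrev cochains.module (X : TopCat.{u}) : Module ℤ (cochains X) := Submodule.module _

abbrev Family.addCommMonoid (k : ℕ) : AddCommMonoid (Family.{u} k) := Pi.addCommMonoid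

abbrev Family.addCommGroup (k : ℕ) : AddCommGroup (Family.{u} k) := Pi.addCommGroup

abbrev Family.module (k : ℕ) : Module ℤ (Family.{u} k) := Pi.module _ _ _

attribute [local instance] cochains.addCommMonoid cochains.addCommGroup cochains.module
  Family.addCommMonoid Family.addCommGroup Family.module

/-! ## Signs -/

/-- The sign `(-1)^c` for `c` modulo `2`. -/
def zs (c : ZMod 2) : ℤ := if c = 0 then 1 else -1

theorem zs_zero : zs 0 = 1 := rfl

theorem zs_one : zs 1 = -1 := rfl

theorem zs_add (a b : ZMod 2) : zs (a + b) = zs a * zs b := by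
  revert a b; decide

theorem zs_mul_self (a : ZMod 2) : zs a * zs a = 1 := by
  revert a; decide

theorem zs_ne_zero (a : ZMod 2) : zs a ≠ 0 := by
  revert a; decide

theorem zs_mul_zs_mul (a : ZMod 2) (b : ℤ) : zs a * (zs a * b) = b := by
  rw [← mul_assoc, zs_mul_self, one_mul]

theorem zs_sum {ι : Type*} (s : Finset ι) (c : ι → ZMod 2) :
    zs (∑ i ∈ s, c i) = ∏ i ∈ s, zs (c i) := by
  classical
  induction s using Finset.induction_on with
  | empty => simp [zs_zero]
  | insert a s ha ih => rw [Finset.sum_insert ha, Finset.prod_insert ha, zs_add, ih]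

theorem sgn_eq_zs (a : ℤ) : sgn a = zs (a : ZMod 2) := by
  unfold sgn zs
  rcases Int.even_or_odd a with h | h
  · rw [Int.negOnePow_even a h, if_pos ((ZMod.intCast_eq_zero_iff_even).2 h)]; rfl
  · rw [Int.negOnePow_odd a h, if_neg]; · rfl
    rw [ZMod.intCast_eq_zero_iff_even, Int.not_even_iff_odd]; exact h

theorem zmod_two_add_self (a : ZMod 2) : a + a = 0 := CharTwo.add_self_eq_zero a

/-- The degree part of the Koszul sign of evaluating a tensor product. -/
def revSign {k : ℕ} (p : Fin k → ZMod 2) : ZMod 2 := ∑ i, ∑ i', if i < i' then p i * p i' else 0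

/-! ## Homogeneous cochains, integer degrees -/

/-- Homogeneity with respect to an integer degree; there are no nonzero cochains of negative
degree. -/
def IsHom {X : TopCat.{u}} (p : ℤ) (x : cochains X) : Prop := ∀ q : ℕ, (q : ℤ) ≠ p → x.1 q = 0

theorem IsHomogeneous.isHom {X : TopCat.{u}} {p : ℕ} {x : cochains X} (h : IsHomogeneous p x) :
    IsHom p x := fun q hq => h q (by exact_mod_cast hq)

theorem IsHom.isHomogeneous {X : TopCat.{u}} {p : ℕ} {x : cochains X} (h : IsHom p x) :
    IsHomogeneous p x := fun q hq => h q (by exact_mod_cast hq)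

/-- The degree of a value of an operation is a sum of degrees minus the degree of the operation and
can be negative. Integer degrees let such values be fed into the next operation without a case
distinction. -/
theorem IsHom.eq_zero {X : TopCat.{u}} {p : ℤ} {x : cochains X} (h : IsHom p x) (hp : p < 0) :
    x = 0 := by
  ext q σ
  rw [h q (by omega)]
  rfl

theorem cochain_ext {X : TopCat.{u}} {x y : cochains X}
    (h : ∀ n (σ : Sing X n), x.1 n σ = y.1 n σ) : x = y :=
  Subtype.ext (funext fun n => funext fun σ => h n σ)

/-- The component of degree `n`. -/
def homPart {X : TopCat.{u}} (n : ℕ) (x : cochains X) : cochains X :=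
  scale X (fun q => if q = n then 1 else 0) x

theorem homPart_isHomogeneous {X : TopCat.{u}} (n : ℕ) (x : cochains X) :
    IsHomogeneous n (homPart n x) := by
  intro q hq
  change (if q = n then (1 : ℤ) else 0) • x.1 q = 0
  rw [if_neg hq, zero_smul]

theorem span_homogeneous (X : TopCat.{u}) :
    Submodule.span ℤ ({x | ∃ p, IsHomogeneous p x} : Set (cochains X)) = ⊤ := by
  rw [eq_top_iff]
  rintro x -
  obtain ⟨b, hb⟩ := x.2.2
  have : x = ∑ n ∈ Finset.range (b + 1), homPart n x := by
    apply Subtype.ext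
    funext q
    rw [AddSubmonoidClass.coe_finsetSum, Finset.sum_apply]
    have h : ∀ n, (homPart n x).1 q = if q = n then x.1 q else 0 := by
      intro n
      change (if q = n then (1 : ℤ) else 0) • x.1 q = _
      split_ifs <;> simp
    simp only [h]
    rw [Finset.sum_ite_eq]
    split_ifs with hq
    · rfl
    · exact hb q (by simpa using hq)
  rw [this]
  exact Submodule.sum_mem _ fun n _ => Submodule.subset_span ⟨n, homPart_isHomogeneous n x⟩

/-- Every identity between operations is checked on homogeneous arguments, where the Koszul signs
are plain numbers; homogeneous cochains span, so this is enough. -/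
theorem family_ext {k : ℕ} {ν μ : Family.{u} k}
    (h : ∀ (X : TopCat.{u}) (x : Fin k → cochains X) (p : Fin k → ℕ),
      (∀ i, IsHomogeneous (p i) (x i)) → ν X x = μ X x) : ν = μ := by
  funext X
  refine MultilinearMap.ext_of_span_eq_top
    (g := fun (_ : Fin k) (x : {x : cochains X // ∃ p, IsHomogeneous p x}) => (x : cochains X))
    (fun _ => by
      rw [Subtype.range_coe_subtype]; exact span_homogeneous X) ?_
  intro x
  choose p hp using fun i => (x i).2
  exact h X _ p hp

/-! ## Faces -/

theorem sort_map_of_monotone {n q : ℕ} (φ : Fin n → Fin q) (hφ : Monotone φ) :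
    (Multiset.map φ (Finset.univ : Finset (Fin n)).val).sort (· ≤ ·) = List.ofFn φ := by
  refine List.Perm.eq_of_pairwise' (r := (· ≤ ·)) (Multiset.pairwise_sort _ _) ?_ ?_
  · exact (List.sortedLE_ofFn_iff.2 hφ).pairwise
  · rw [← Multiset.coe_eq_coe, Multiset.sort_eq]
    simp [Fin.univ_def, List.ofFn_eq_map]

theorem vertexMap_apply_of_monotone {p q : ℕ} (B : Multiset (Fin (q + 1)))
    (hp : B.card - 1 = p) (φ : Fin (p + 1) → Fin (q + 1)) (hφ : Monotone φ)
    (hB : B = Multiset.map φ (Finset.univ : Finset (Fin (p + 1))).val) (c : Fin (p + 1)) :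
    (vertexMap B).toOrderHom (Fin.cast (by rw [hp]) c) = φ c := by
  change (B.sort (· ≤ ·)).getD c 0 = φ c
  rw [hB, sort_map_of_monotone φ hφ]
  rw [List.getD_eq_getElem _ _ (by rw [List.length_ofFn]; exact c.2), List.getElem_ofFn]

/-- The two simplices have dimensions `n` and `B.card - 1`, which are equal only by a proof. The
evaluation functionals live in a type that does not mention the dimension, so they can be compared
without transport. -/
theorem ev_map_eq_ev_face {X : TopCat.{u}} {n q : ℕ} (θ : ⦋n⦌ ⟶ ⦋q⦌) (σ : Sing X q)
    (B : Multiset (Fin (q + 1)))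
    (hB : B = Multiset.map θ.toOrderHom (Finset.univ : Finset (Fin (n + 1))).val) :
    ev (X := X) ((TopCat.toSSet.obj X).map θ.op σ : Sing X n) = ev (face σ B) := by
  have hc : B.card - 1 = n := by rw [hB]; simp
  -- The dimension is made a variable so that the equation can be substituted.
  have key : ∀ (n' : ℕ) (h : B.card - 1 = n') (θ' : ⦋n'⦌ ⟶ ⦋q⦌),
      (∀ c : Fin (n' + 1), (vertexMap B).toOrderHom (Fin.cast (by rw [h]) c) = θ'.toOrderHom c) →
      ev (X := X) ((TopCat.toSSet.obj X).map θ'.op σ : Sing X n') = ev (face σ B) := by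
    intro n' h θ' hθ
    subst h
    have : θ' = vertexMap B := by
      ext c
      exact congrArg _ (hθ c).symm
    rw [this]
    rfl
  exact key n hc θ fun c => vertexMap_apply_of_monotone B hc _ θ.toOrderHom.monotone hB c

/-- Nonemptiness matters: by truncated subtraction and the default value, the empty multiset yields
the vertex `0`. -/
theorem univ_map_vertexMap {q : ℕ} (B : Multiset (Fin (q + 1))) (hB : B ≠ 0) :
    Multiset.map (vertexMap B).toOrderHom Finset.univ.val = B := by
  have hc : 0 < B.card := Multiset.card_pos.2 hB
  have h1 : (B.sort (· ≤ ·)).length = B.card - 1 + 1 := by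
    rw [Multiset.length_sort]; omega
  conv_rhs => rw [← Multiset.sort_eq B (· ≤ ·)]
  have h2 : Multiset.map (vertexMap B).toOrderHom Finset.univ.val =
      ((List.ofFn fun c : Fin (B.card - 1 + 1) => (vertexMap B).toOrderHom c :
        List (Fin (q + 1))) : Multiset (Fin (q + 1))) := by
    rw [List.ofFn_eq_map, ← Multiset.map_coe]
    rfl
  rw [h2]
  congr 1
  apply List.ext_getElem
  · rw [List.length_ofFn, h1]
  · intro c h3 h4
    rw [List.getElem_ofFn]
    change (B.sort (· ≤ ·)).getD c 0 = _
    rw [List.getD_eq_getElem]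

theorem ev_face_face {X : TopCat.{u}} {q : ℕ} (σ : Sing X q) (B : Multiset (Fin (q + 1)))
    (B' : Multiset (Fin (B.card - 1 + 1))) (hB' : B' ≠ 0) :
    ev (face (face σ B) B') = ev (face σ (B'.map (vertexMap B).toOrderHom)) := by
  have : face (face σ B) B' = (TopCat.toSSet.obj X).map (vertexMap B' ≫ vertexMap B).op σ := by
    simp [face]
  rw [this]
  refine ev_map_eq_ev_face _ σ _ ?_
  conv_lhs => rw [← univ_map_vertexMap B' hB']
  rw [Multiset.map_map]
  rfl

theorem ev_of_isHom {X : TopCat.{u}} {n : ℕ} {p : ℤ} {x : cochains X} (hx : IsHom p x)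
    (σ : Sing X n) (h : (n : ℤ) ≠ p) : ev σ x = 0 := by
  change x.1 n σ = 0
  rw [hx n h]
  rfl

/-! ## Overlapping partitions in terms of gaps -/

instance {M L : Type*} [Fintype M] [Fintype L] [Preorder M] [Preorder L] : Fintype (M →o L) := by
  classical exact Fintype.ofInjective (fun J : M →o L => (J : M → L)) DFunLike.coe_injective

/-- A predicate that is inherited downwards holds on an initial segment, and the cardinality is the
place where the segment ends. This translates between cut points and monotone maps. -/
theorem lt_card_filter_iff {n : ℕ} (P : Fin n → Prop) [DecidablePred P]
    (hP : ∀ a b, a ≤ b → P b → P a) (j : Fin n) :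
    (j : ℕ) < (Finset.univ.filter P).card ↔ P j := by
  constructor
  · intro h
    by_contra hj
    have : Finset.univ.filter P ⊆ Finset.Iio j := by
      intro a ha
      rw [Finset.mem_Iio]
      by_contra h'
      exact hj (hP j a (not_lt.1 h') (Finset.mem_filter.1 ha).2)
    have := Finset.card_le_card this
    rw [Fin.card_Iio] at this
    omega
  · intro hj
    have : Finset.Iic j ⊆ Finset.univ.filter P := by
      intro a ha
      exact Finset.mem_filter.2 ⟨Finset.mem_univ _, hP a j (Finset.mem_Iic.1 ha) hj⟩
    have := Finset.card_le_card this
    rw [Fin.card_Iic] at this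
    omega

section Gap

variable {L : Type*} [LinearOrder L]

/-- The vertices of the piece `j`, if the gap between the vertices `s` and `s + 1` belongs to
the piece `J s`. -/
def gpiece {q : ℕ} (J : Fin q → L) (j : L) : Finset (Fin (q + 1)) :=
  Finset.univ.filter fun b => ∀ s : Fin q, (J s < j → (s : ℕ) < b) ∧ ((s : ℕ) < b → J s ≤ j)

theorem mem_gpiece {q : ℕ} {J : Fin q → L} {j : L} {b : Fin (q + 1)} :
    b ∈ gpiece J j ↔ ∀ s : Fin q, (J s < j → (s : ℕ) < b) ∧ ((s : ℕ) < b → J s ≤ j) := by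
  simp [gpiece]

theorem le_of_mem_gpiece {q : ℕ} {J : Fin q → L} {j j' : L} (h : j < j') {b b' : Fin (q + 1)}
    (hb : b ∈ gpiece J j) (hb' : b' ∈ gpiece J j') : b ≤ b' := by
  by_contra hlt
  rw [not_le, Fin.lt_def] at hlt
  have hq : (b' : ℕ) < q := by omega
  have h1 := (mem_gpiece.1 hb ⟨b', hq⟩).2 hlt
  have h2 := (mem_gpiece.1 hb' ⟨b', hq⟩).1 (lt_of_le_of_lt h1 h)
  exact lt_irrefl _ h2

/-- The first vertex of a piece is preceded exactly by the gaps of earlier pieces, the last vertex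
also by the gaps of the piece itself. -/
theorem gpiece_eq_Icc {q : ℕ} (J : Fin q →o L) (j : L) :
    gpiece J j = Finset.Icc
      ⟨(Finset.univ.filter fun s => J s < j).card,
        Nat.lt_succ_of_le ((Finset.card_le_univ _).trans_eq (Fintype.card_fin q))⟩
      ⟨(Finset.univ.filter fun s => J s ≤ j).card,
        Nat.lt_succ_of_le ((Finset.card_le_univ _).trans_eq (Fintype.card_fin q))⟩ := by
  have h1 := lt_card_filter_iff (fun s => J s < j) fun a b hab h => (J.monotone hab).trans_lt h
  have h2 := lt_card_filter_iff (fun s => J s ≤ j) fun a b hab h => (J.monotone hab).trans h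
  ext b
  rw [mem_gpiece, Finset.mem_Icc, Fin.le_def, Fin.le_def]
  constructor
  · intro h
    constructor
    · by_contra hlt
      change ¬ (_ ≤ (b : ℕ)) at hlt
      have hc : (Finset.univ.filter fun s => J s < j).card ≤ q :=
        (Finset.card_le_univ _).trans_eq (Fintype.card_fin q)
      have hq : (b : ℕ) < q := by omega
      have := (h ⟨b, hq⟩).1 ((h1 ⟨b, hq⟩).1 (not_le.1 hlt))
      exact lt_irrefl _ this
    · by_contra hlt
      simp only at hlt
      set c := (Finset.univ.filter fun s => J s ≤ j).card with hcd
      have hb := b.2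
      have hq : c < q := by omega
      have := (h2 ⟨c, hq⟩).2 ((h ⟨c, hq⟩).2 (not_le.1 hlt))
      exact lt_irrefl _ this
  · rintro ⟨h3, h4⟩ s
    change _ ≤ (b : ℕ) at h3
    change (b : ℕ) ≤ _ at h4
    exact ⟨fun h => ((h1 s).2 h).trans_le h3, fun h => (h2 s).1 (h.trans_le h4)⟩

/-- An interval has one vertex more than gaps. So `‖A_j‖` counts gaps, and products of such numbers
in the exponent become sums over pairs of gaps. -/
theorem card_gpiece {q : ℕ} (J : Fin q →o L) (j : L) :
    (gpiece J j).card = (Finset.univ.filter fun s => J s = j).card + 1 := by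
  rw [gpiece_eq_Icc, Fin.card_Icc]
  have : (Finset.univ.filter fun s => J s ≤ j).card =
      (Finset.univ.filter fun s => J s < j).card + (Finset.univ.filter fun s => J s = j).card := by
    rw [← Finset.card_union_of_disjoint]
    · congr 1
      ext s
      simp [le_iff_lt_or_eq]
    · rw [Finset.disjoint_filter]
      exact fun s _ h h' => h.ne h'
  change _ + 1 - _ = _
  simp only
  omega

end Gap

/-- The overlapping partition given by the pieces which contain the gaps. -/
def ofGaps {m q : ℕ} (J : Fin q →o Fin m) : OverlapPartition m q :=
  ⟨fun j => ⟨(Finset.univ.filter fun s => ((J s : Fin m) : ℕ) < j).card,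
      Nat.lt_succ_of_le ((Finset.card_le_univ _).trans_eq (Fintype.card_fin q))⟩,
    fun j j' h => Finset.card_le_card fun s hs => by
      rw [Finset.mem_filter] at hs ⊢
      exact ⟨hs.1, hs.2.trans_le h⟩,
    by simp,
    by
      apply Fin.ext
      simp⟩

theorem lt_ofGaps_iff {m q : ℕ} (J : Fin q →o Fin m) (j : Fin (m + 1)) (s : Fin q) :
    (s : ℕ) < ((ofGaps J).1 j : ℕ) ↔ ((J s : Fin m) : ℕ) < j :=
  lt_card_filter_iff (fun s : Fin q => ((J s : Fin m) : ℕ) < j)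
    (fun _ _ hab h => lt_of_le_of_lt (J.monotone hab) h) s

theorem piece_ofGaps {m q : ℕ} (J : Fin q →o Fin m) (j : Fin m) :
    (ofGaps J).piece j = gpiece J j := by
  rw [gpiece_eq_Icc, OverlapPartition.piece]
  congr 1
  apply Fin.ext
  change (Finset.univ.filter fun s => ((J s : Fin m) : ℕ) < j.succ).card =
    (Finset.univ.filter fun s => J s ≤ j).card
  refine congrArg Finset.card (Finset.filter_congr fun s _ => ?_)
  rw [Fin.val_succ, Nat.lt_succ_iff, Fin.le_def]

/-- For surjectivity, the gap after `s` is sent to the first piece that ends beyond `s`; its index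
is the number of pieces ending at or before `s`. -/
theorem ofGaps_bijective {m q : ℕ} :
    Function.Bijective (ofGaps : (Fin q →o Fin m) → OverlapPartition m q) := by
  constructor
  · intro J J' h
    have key : ∀ (j : ℕ) (s : Fin q), j ≤ m → (((J s : Fin m) : ℕ) < j ↔ ((J' s : Fin m) : ℕ) < j) := by
      intro j s hj
      have h1 := lt_ofGaps_iff J ⟨j, by omega⟩ s
      have h2 := lt_ofGaps_iff J' ⟨j, by omega⟩ s
      rw [h] at h1
      exact h1.symm.trans h2
    ext s
    have h1 := key ((J s : Fin m) : ℕ) s (J s).2.le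
    have h2 := key ((J' s : Fin m) : ℕ) s (J' s).2.le
    omega
  · intro A
    have hlow : ∀ s : Fin q, ∀ a b : Fin m, a ≤ b → ((A.1 b.succ : ℕ) ≤ s) → (A.1 a.succ : ℕ) ≤ s :=
      fun s a b hab h => le_trans (A.2.1 (Fin.succ_le_succ_iff.2 hab)) h
    have hc := fun s : Fin q => lt_card_filter_iff (fun a : Fin m => (A.1 a.succ : ℕ) ≤ s) (hlow s)
    have hm : ∀ s : Fin q, (Finset.univ.filter fun a : Fin m => (A.1 a.succ : ℕ) ≤ s).card < m := by
      intro s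
      -- Without pieces the two conditions on the overlap points force `q = 0`, so there is no gap.
      obtain _ | m := m
      · have h1 := A.2.2.1
        have h2 := A.2.2.2
        have h3 : A.1 0 = Fin.last q := h2
        rw [h1] at h3
        have h4 := congrArg Fin.val h3
        simp at h4
        have := s.2
        omega
      · by_contra hcon
        have h1 := (hc s (Fin.last m)).1 (by simp; omega)
        rw [Fin.succ_last, A.2.2.2] at h1
        have := s.2
        simp at h1
        omega
    have hmono : Monotone fun s : Fin q => (⟨_, hm s⟩ : Fin m) := by
      refine fun s s' h => Fin.mk_le_mk.2 (Finset.card_le_card fun a ha => ?_)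
      rw [Finset.mem_filter] at ha ⊢
      exact ⟨ha.1, ha.2.trans h⟩
    refine ⟨⟨_, hmono⟩, ?_⟩
    · apply Subtype.ext
      funext j
      apply Fin.ext
      have h1 : ∀ s : Fin q, (s : ℕ) < ((ofGaps ⟨_, hmono⟩).1 j : ℕ) ↔ (s : ℕ) < A.1 j := by
        intro s
        refine (lt_ofGaps_iff _ _ _).trans ?_
        change (Finset.univ.filter fun a : Fin m => (A.1 a.succ : ℕ) ≤ s).card < j ↔ _
        induction j using Fin.cases with
        | zero => simp [A.2.2.1]
        | succ j =>
          have := hc s j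
          rw [Fin.val_succ]
          omega
      generalize hw : ofGaps ⟨_, hmono⟩ = w at h1 ⊢
      by_contra hne
      have hw1 := (w.1 j).2
      have hA1 := (A.1 j).2
      rcases lt_or_gt_of_ne hne with hlt | hlt
      · have := h1 ⟨w.1 j, by omega⟩
        simp at this
        omega
      · have := h1 ⟨A.1 j, by omega⟩
        simp at this
        omega

/-! ### Signed sums over cuts of a simplex -/

section Core

variable {L : Type*} [LinearOrder L] [Fintype L] {k : ℕ}

/-- The parity of the number of elements which precede `j` if `L` is ordered by the values of `f`
first. -/
def nb (f : L → Fin k) (j : L) : ZMod 2 :=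
  ∑ j', if f j' < f j ∨ (f j' = f j ∧ j' < j) then 1 else 0

/-- The sign exponent of the monotone map `J` from gaps to pieces. -/
def geps {M : Type*} [LinearOrder M] [Fintype M] (f : L → Fin k) (J : M → L) : ZMod 2 :=
  (∑ s, ∑ s', if s < s' ∧ f (J s') < f (J s) then 1 else 0) +
    ∑ s, (nb f (J s) + ((f (J s) : ℕ) : ZMod 2))

/-- The disjoint union of the pieces which are labelled by `i`. -/
def labelled {q : ℕ} (f : L → Fin k) (P : L → Finset (Fin (q + 1))) (i : Fin k) :
    Multiset (Fin (q + 1)) :=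
  ∑ j ∈ Finset.univ.filter (fun j => f j = i), (P j).val

/-- The product of the values of the cochains `x i` on the faces spanned by the pieces labelled
by `i`. -/
def monom {X : TopCat.{u}} {q : ℕ} (f : L → Fin k) (x : Fin k → cochains X) (σ : Sing X q)
    (P : L → Finset (Fin (q + 1))) : ℤ := ∏ i, ev (face σ (labelled f P i)) (x i)

/-- The signed sum over overlapping partitions, indexed by `L`, which underlies the sequence
operation of `f`. -/
def core {X : TopCat.{u}} {q : ℕ} (f : L → Fin k) (x : Fin k → cochains X) (σ : Sing X q) : ℤ :=
  ∑ J : Fin q →o L, zs (geps f J) * monom f x σ (gpiece J)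

theorem card_labelled {q : ℕ} (f : L → Fin k) (J : Fin q →o L) (i : Fin k) :
    (labelled f (gpiece J) i).card =
      (Finset.univ.filter fun s => f (J s) = i).card +
        (Finset.univ.filter fun j => f j = i).card := by
  rw [labelled, Multiset.card_sum]
  simp only [Finset.card_val, card_gpiece, Finset.sum_add_distrib, Finset.sum_const, smul_eq_mul,
    mul_one]
  congr 1
  rw [← Finset.card_biUnion]
  · congr 1
    ext s
    simp
  · intro a _ b _ hab
    rw [Function.onFun, Finset.disjoint_filter]
    exact fun s _ h h' => hab (h.symm.trans h')

theorem labelled_ne_zero {q : ℕ} {f : L → Fin k} (hf : Function.Surjective f) (J : Fin q →o L)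
    (i : Fin k) : labelled f (gpiece J) i ≠ 0 := by
  obtain ⟨j, hj⟩ := hf i
  rw [← Multiset.card_pos, card_labelled]
  have : 0 < (Finset.univ.filter fun j => f j = i).card :=
    Finset.card_pos.2 ⟨j, by simp [hj]⟩
  omega

end Core

/-- This is what allows every sign computation to assume that the dimensions of the blocks are the
degrees of the arguments: the other terms are zero. -/
theorem monom_eq_zero {L : Type*} [Fintype L] {k : ℕ} {X : TopCat.{u}} {q : ℕ} {f : L → Fin k} {x : Fin k → cochains X}
    {σ : Sing X q} {P : L → Finset (Fin (q + 1))} {p : Fin k → ℤ} (hx : ∀ i, IsHom (p i) (x i))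
    {i : Fin k} (h : (((labelled f P i).card - 1 : ℕ) : ℤ) ≠ p i) : monom f x σ P = 0 :=
  Finset.prod_eq_zero (Finset.mem_univ i) (ev_of_isHom (hx i) _ h)

/-- Weighting each piece by its number of gaps is the same as summing over the gaps. -/
theorem sum_indicator_mul {q m : ℕ} (J : Fin q → Fin m) (F : Fin m → ZMod 2) :
    ∑ j, (∑ s, if J s = j then (1 : ZMod 2) else 0) * F j = ∑ s, F (J s) := by
  simp only [Finset.sum_mul]
  rw [Finset.sum_comm]
  refine Finset.sum_congr rfl fun s _ => ?_
  rw [Finset.sum_eq_single (J s)]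
  · simp
  · intro j _ hj
    simp [Ne.symm hj]
  · simp

theorem cast_card_piece {q m : ℕ} (J : Fin q →o Fin m) (j : Fin m) :
    (((((ofGaps J).piece j).card : ℤ) - 1 : ℤ) : ZMod 2) = ∑ s, if J s = j then 1 else 0 := by
  rw [piece_ofGaps, card_gpiece]
  push_cast
  rw [add_sub_cancel_right, Finset.card_filter]
  push_cast
  rfl

theorem cast_tau {m k : ℕ} (f : Fin m → Fin k) (j : Fin m) :
    (tau f j : ZMod 2) = nb f j + 1 := by
  rw [tau, nb, Finset.card_filter]
  push_cast
  have : (1 : ZMod 2) = ∑ j', if j' = j then 1 else 0 := by simp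
  conv_rhs => rw [this]
  rw [← Finset.sum_add_distrib]
  refine Finset.sum_congr rfl fun j' _ => ?_
  by_cases h : j' = j
  · subst h; simp
  · have : j' ≤ j ↔ j' < j := ⟨fun h' => lt_of_le_of_ne h' h, le_of_lt⟩
    simp [h, this]

theorem cast_epsilon {m k q : ℕ} (f : Fin m → Fin k) (J : Fin q →o Fin m) :
    (epsilon f (ofGaps J) : ZMod 2) = geps f J := by
  have hite : ∀ (c : Prop) [Decidable c] (a : ℤ), ((if c then a else 0 : ℤ) : ZMod 2) =
      if c then (a : ZMod 2) else 0 := by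
    intro c _ a; split_ifs <;> simp
  rw [epsilon, geps]
  rw [Int.cast_add, Int.cast_sum, Int.cast_sum]
  congr 1
  · simp only [Int.cast_sum, hite, Int.cast_mul, cast_card_piece]
    have h1 : ∀ j j' : Fin m, (if j < j' ∧ f j' < f j then
        (∑ s, if J s = j then (1 : ZMod 2) else 0) * (∑ s, if J s = j' then 1 else 0) else 0) =
        (∑ s, if J s = j then (1 : ZMod 2) else 0) * ((∑ s, if J s = j' then (1 : ZMod 2) else 0) *
          if j < j' ∧ f j' < f j then 1 else 0) := by
      intro j j'
      split_ifs <;> simp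
    simp only [h1, ← Finset.mul_sum]
    rw [sum_indicator_mul J fun j => ∑ j', (∑ s, if J s = j' then (1 : ZMod 2) else 0) *
          if j < j' ∧ f j' < f j then 1 else 0]
    refine Finset.sum_congr rfl fun s _ => ?_
    rw [sum_indicator_mul J fun j' => if J s < j' ∧ f j' < f (J s) then 1 else 0]
    refine Finset.sum_congr rfl fun s' _ => ?_
    congr 1
    -- Gaps with different labels lie in different pieces, so comparing the gaps and comparing their
    -- pieces is the same.
    apply propext
    constructor
    · rintro ⟨h, h'⟩
      exact ⟨lt_of_not_ge fun hle => (J.monotone hle).not_gt h, h'⟩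
    · rintro ⟨h, h'⟩
      refine ⟨lt_of_le_of_ne (J.monotone h.le) fun he => ?_, h'⟩
      rw [he] at h'
      exact lt_irrefl _ h'
  · simp only [Int.cast_mul, cast_card_piece]
    rw [sum_indicator_mul J fun j => (((tau f j : ℤ) - ((f j : ℕ) + 1) : ℤ) : ZMod 2)]
    refine Finset.sum_congr rfl fun s _ => ?_
    push_cast
    rw [cast_tau]
    have h2 := zmod_two_add_self ((f (J s) : ℕ) : ZMod 2)
    linear_combination -h2

/-- For homogeneous arguments the sign of evaluating a tensor product depends on the degrees alone
and leaves the sum. Surjectivity makes every block nonempty, so that `card - 1` in `ℕ` and in `ℤ`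
agree. -/
theorem seqOp_eq_core {X : TopCat.{u}} {m k q : ℕ} {f : Fin m → Fin k}
    (hf : Function.Surjective f) {x : Fin k → cochains X} {p : Fin k → ℤ}
    (hx : ∀ i, IsHom (p i) (x i)) (σ : Sing X q) :
    (seqOp f X x).1 q σ =
      sgn ((m : ℤ) - k) * (zs (revSign fun i => (p i : ZMod 2)) * core f x σ) := by
  change seqValue f X q σ x = _
  rw [seqValue, smul_apply, smul_eq_mul, sum_apply]
  refine congrArg (sgn ((m : ℤ) - k) * ·) ?_
  rw [core, Finset.mul_sum]
  refine (Fintype.sum_bijective ofGaps ofGaps_bijective _ _ fun J => ?_).symm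
  rw [smul_apply, MultilinearMap.compLinearMap_apply, MultilinearMap.mkPiAlgebra_apply]
  have hb : ∀ i, block f (ofGaps J) i = labelled f (gpiece J) i := by
    intro i
    rw [block, labelled]
    simp only [piece_ofGaps]
  change _ = (sgn (epsilon f (ofGaps J)) * _) * ∏ i, ev (face σ (block f (ofGaps J) i)) (x i)
  have hm : ∏ i, ev (face σ (block f (ofGaps J) i)) (x i) = monom f x σ (gpiece J) :=
    Finset.prod_congr rfl fun i _ => congrArg (fun B => ev (face σ B) (x i)) (hb i)
  rw [hm, sgn_eq_zs, cast_epsilon]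
  simp only [hb]
  by_cases h : ∀ i, (((labelled f (gpiece J) i).card - 1 : ℕ) : ℤ) = p i
  · have h' : ∀ i, ((labelled f (gpiece J) i).card : ℤ) - 1 = p i := by
      intro i
      rw [← h i]
      have := Multiset.card_pos.2 (labelled_ne_zero hf J i)
      omega
    simp only [h']
    have hs : sgn (∑ i, ∑ i', if i < i' then p i * p i' else 0) =
        zs (revSign fun i => (p i : ZMod 2)) := by
      rw [sgn_eq_zs, revSign]
      congr 1
      push_cast
      refine Finset.sum_congr rfl fun i _ => Finset.sum_congr rfl fun i' _ => ?_
      split_ifs <;> simp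
    rw [hs]
    ring
  · push Not at h
    obtain ⟨i, hi⟩ := h
    rw [monom_eq_zero hx hi]
    ring

/-! ## Relabelling -/

theorem nb_comp_orderIso {L L' : Type*} [LinearOrder L] [Fintype L] [LinearOrder L'] [Fintype L']
    {k : ℕ} (e : L' ≃o L) (f : L → Fin k) (j : L') : nb (f ∘ e) j = nb f (e j) := by
  rw [nb, nb, ← e.toEquiv.sum_comp]
  simp

/-- Allows composite sequences to be indexed by the type of their letters instead of an initial
segment of the natural numbers. -/
theorem core_comp_orderIso {X : TopCat.{u}} {q : ℕ} {L L' : Type*} [LinearOrder L] [Fintype L]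
    [LinearOrder L'] [Fintype L'] {k : ℕ} (e : L' ≃o L) (f : L → Fin k) (x : Fin k → cochains X)
    (σ : Sing X q) : core (f ∘ e) x σ = core f x σ := by
  have hp : ∀ (J : Fin q → L') (j : L'), gpiece (e ∘ J) (e j) = gpiece J j := by
    intro J j
    ext b
    simp [mem_gpiece]
  refine Fintype.sum_bijective
    (fun J : Fin q →o L' => (⟨e ∘ J, e.monotone.comp J.monotone⟩ : Fin q →o L)) ⟨?_, ?_⟩ _ _ ?_
  · intro J J' h
    ext s
    exact e.injective (DFunLike.congr_fun h s)
  · intro J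
    refine ⟨⟨e.symm ∘ J, e.symm.monotone.comp J.monotone⟩, ?_⟩
    ext s
    simp
  · intro J
    congr 1
    · congr 1
      simp only [geps, nb_comp_orderIso, Function.comp_apply, OrderHom.coe_mk]
    · refine Finset.prod_congr rfl fun i _ => ?_
      have : labelled (f ∘ e) (gpiece J) i = labelled f (gpiece (e ∘ J)) i := ?_
      · exact congrArg (fun B => ev (face σ B) (x i)) this
      rw [labelled, labelled]
      rw [Finset.sum_filter, Finset.sum_filter, ← e.toEquiv.sum_comp]
      refine Finset.sum_congr rfl fun j _ => ?_
      exact congrArg (fun P : Finset (Fin (q + 1)) => if f (e j) = i then P.val else 0)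
        (hp J j).symm

/-! ## The gaps and vertices of a block -/

theorem geps_comp_orderIso {L M M' : Type*} [LinearOrder L] [Fintype L] [LinearOrder M]
    [Fintype M] [LinearOrder M'] [Fintype M'] {k : ℕ} (e : M' ≃o M) (f : L → Fin k) (J : M → L) :
    geps f (J ∘ e) = geps f J := by
  rw [geps, geps, ← e.toEquiv.sum_comp, ← e.toEquiv.sum_comp]
  congr 1
  refine Finset.sum_congr rfl fun s _ => ?_
  rw [← e.toEquiv.sum_comp]
  simp

theorem map_val_eq_sum {α β : Type*} (F : α → β) (s : Finset α) :
    Multiset.map F s.val = ∑ a ∈ s, {F a} := by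
  rw [Finset.sum, ← Multiset.sum_map_singleton (Multiset.map F s.val), Multiset.map_map]
  rfl

theorem map_finset_sum {α β ι : Type*} (F : α → β) (s : Finset ι) (B : ι → Multiset α) :
    Multiset.map F (∑ i ∈ s, B i) = ∑ i ∈ s, Multiset.map F (B i) :=
  map_sum (Multiset.mapAddMonoidHom F) B s

section Block

variable {L : Type*} [LinearOrder L] [Fintype L] {k q : ℕ}

/-- The elements of the fibre of `i` which have a successor in the fibre. -/
abbrev Junction (f : L → Fin k) (i : Fin k) : Type _ := {j : L // f j = i ∧ ∃ j', j < j' ∧ f j' = i}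

/-- The gaps of the block labelled by `i`: gaps of the simplex, and junctions between consecutive
pieces of the block. -/
inductive Gap (f : L → Fin k) (J : Fin q → L) (i : Fin k) : Type _ where
  | gap (s : {s : Fin q // f (J s) = i})
  | junction (e : Junction f i)

/-- The gaps of a block as a disjoint union. -/
def Gap.equivSum (f : L → Fin k) (J : Fin q → L) (i : Fin k) :
    {s : Fin q // f (J s) = i} ⊕ Junction f i ≃ Gap f J i where
  toFun := Sum.elim Gap.gap Gap.junction
  invFun x := match x with
    | Gap.gap s => Sum.inl s
    | Gap.junction e => Sum.inr e
  left_inv := by rintro (s | e) <;> rfl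
  right_inv := by rintro (s | e) <;> rfl

instance (f : L → Fin k) (J : Fin q → L) (i : Fin k) : Fintype (Gap f J i) := by
  classical exact Fintype.ofEquiv _ (Gap.equivSum f J i)

theorem card_gap (f : L → Fin k) (J : Fin q → L) (i : Fin k) :
    Fintype.card (Gap f J i) =
      (Finset.univ.filter fun s => f (J s) = i).card + Fintype.card (Junction f i) := by
  classical
  rw [← Fintype.card_congr (Gap.equivSum f J i), Fintype.card_sum, Fintype.card_subtype]

theorem sum_gap {N : Type*} [AddCommMonoid N] (f : L → Fin k) (J : Fin q → L) (i : Fin k)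
    (F : Gap f J i → N) : ∑ x, F x =
      ∑ s : {s : Fin q // f (J s) = i}, F (Gap.gap s) + ∑ e : Junction f i, F (Gap.junction e) := by
  rw [← (Gap.equivSum f J i).sum_comp, Fintype.sum_sum_type]
  rfl

/-- The place of a gap in the block. -/
def Gap.key {f : L → Fin k} {J : Fin q → L} {i : Fin k} (x : Gap f J i) :
    L ×ₗ WithTop (Fin q) :=
  match x with
  | Gap.gap s => toLex (J s, ((s : Fin q) : WithTop (Fin q)))
  -- With `⊤` the junction comes after all the gaps of the piece that it ends.
  | Gap.junction e => toLex (e.1, ⊤)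

theorem Gap.key_injective {f : L → Fin k} {J : Fin q → L} {i : Fin k} :
    Function.Injective (Gap.key : Gap f J i → _) := by
  rintro (s | e) (s' | e') h
  · have := congrArg (fun v => (ofLex v).2) h
    simp only [Gap.key, ofLex_toLex, WithTop.coe_inj] at this
    rw [Subtype.ext this]
  · have := congrArg (fun v => (ofLex v).2) h
    simp [Gap.key] at this
  · have := congrArg (fun v => (ofLex v).2) h
    simp [Gap.key] at this
  · have := congrArg (fun v => (ofLex v).1) h
    simp only [Gap.key, ofLex_toLex] at this
    rw [Subtype.ext this]

instance (f : L → Fin k) (J : Fin q → L) (i : Fin k) : LinearOrder (Gap f J i) :=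
  LinearOrder.lift' Gap.key Gap.key_injective

/-- The gap lies to the left of the vertex `b` of the piece `j`. -/
def Gap.IsLeft {f : L → Fin k} {J : Fin q → L} {i : Fin k} (x : Gap f J i) (j : L)
    (b : Fin (q + 1)) : Prop :=
  match x with
  | Gap.gap s => ((s : Fin q) : ℕ) < b
  | Gap.junction e => e.1 < j

theorem Gap.isLeft_of_le {f : L → Fin k} {J : Fin q →o L} {i : Fin k} {x y : Gap f J i}
    (hxy : x ≤ y) {j : L} {b : Fin (q + 1)} (hb : b ∈ gpiece J j) (hy : y.IsLeft j b) :
    x.IsLeft j b := by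
  have hkey : Gap.key x ≤ Gap.key y := hxy
  rcases x with s | e <;> rcases y with s' | e'
  · simp only [Gap.key, Prod.Lex.toLex_le_toLex, WithTop.coe_le_coe] at hkey
    have : (s : Fin q) ≤ s' := by
      rcases hkey with h | h
      · exact (lt_of_not_ge fun hle => (J.monotone hle).not_gt h).le
      · exact h.2
    exact lt_of_le_of_lt this hy
  · simp only [Gap.key, Prod.Lex.toLex_le_toLex, le_top, and_true] at hkey
    have h1 : J s ≤ e'.1 := hkey.elim le_of_lt le_of_eq
    exact ((mem_gpiece.1 hb s).1 (lt_of_le_of_lt h1 hy))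
  · simp only [Gap.key, Prod.Lex.toLex_le_toLex, top_le_iff, WithTop.coe_ne_top, and_false,
      or_false] at hkey
    exact lt_of_lt_of_le hkey ((mem_gpiece.1 hb s').2 hy)
  · simp only [Gap.key, Prod.Lex.toLex_le_toLex, le_refl, and_true] at hkey
    have h1 : e.1 ≤ e'.1 := hkey.elim le_of_lt le_of_eq
    exact lt_of_le_of_lt h1 hy

/-- The vertices of the block labelled by `i`. -/
abbrev Vert (f : L → Fin k) (J : Fin q → L) (i : Fin k) : Type _ :=
  {v : L ×ₗ Fin (q + 1) // f (ofLex v).1 = i ∧ (ofLex v).2 ∈ gpiece J (ofLex v).1}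

instance (f : L → Fin k) (J : Fin q → L) (i : Fin k) : Fintype (Vert f J i) := by
  classical
  haveI : Fintype (L ×ₗ Fin (q + 1)) := inferInstanceAs (Fintype (L × Fin (q + 1)))
  exact Subtype.fintype _

theorem sum_vert {N : Type*} [AddCommMonoid N] (f : L → Fin k) (J : Fin q → L) (i : Fin k)
    (F : L → Fin (q + 1) → N) :
    ∑ v : Vert f J i, F (ofLex v.1).1 (ofLex v.1).2 =
      ∑ j ∈ Finset.univ.filter (fun j => f j = i), ∑ b ∈ gpiece J j, F j b := by
  rw [Finset.sum_sigma']
  refine Finset.sum_bij (fun v _ => ⟨(ofLex v.1).1, (ofLex v.1).2⟩) ?_ ?_ ?_ ?_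
  · rintro v -
    simpa using v.2
  · rintro v - v' - h
    simp only [Sigma.mk.injEq, heq_eq_eq] at h
    exact Subtype.ext (ofLex.injective (Prod.ext h.1 h.2))
  · rintro ⟨j, b⟩ h
    exact ⟨⟨toLex (j, b), by simpa using h⟩, Finset.mem_univ _, rfl⟩
  · rintro v -
    rfl

theorem labelled_eq_map_vert (f : L → Fin k) (J : Fin q → L) (i : Fin k) :
    labelled f (gpiece J) i =
      Multiset.map (fun v : Vert f J i => (ofLex v.1).2) Finset.univ.val := by
  rw [map_val_eq_sum, sum_vert f J i fun _ b => ({b} : Multiset (Fin (q + 1))), labelled]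
  simp only [Finset.sum_multiset_singleton]

theorem isLeft_of_lt {f : L → Fin k} {J : Fin q → L} {i : Fin k} {v v' : Vert f J i}
    (h : v < v') {x : Gap f J i} (hx : x.IsLeft (ofLex v.1).1 (ofLex v.1).2) :
    x.IsLeft (ofLex v'.1).1 (ofLex v'.1).2 := by
  have h' : v.1 < v'.1 := h
  rw [Prod.Lex.lt_iff] at h'
  rcases x with s | e
  · rcases h' with h' | h'
    · exact lt_of_lt_of_le hx (le_of_mem_gpiece h' v.2.2 v'.2.2)
    · exact lt_trans hx h'.2
  · rcases h' with h' | h'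
    · exact lt_trans hx h'
    · exact lt_of_lt_of_eq hx h'.1

/-- If the vertices lie in different pieces, the junction ending the first piece separates them; in
the same piece it is the gap just after the smaller vertex. -/
theorem exists_isLeft_of_lt {f : L → Fin k} {J : Fin q → L} {i : Fin k} {v v' : Vert f J i}
    (h : v < v') : ∃ x : Gap f J i, x.IsLeft (ofLex v'.1).1 (ofLex v'.1).2 ∧
      ¬ x.IsLeft (ofLex v.1).1 (ofLex v.1).2 := by
  have h' : v.1 < v'.1 := h
  rw [Prod.Lex.lt_iff] at h'
  rcases h' with h' | ⟨h1, h2⟩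
  · exact ⟨Gap.junction ⟨(ofLex v.1).1, v.2.1, (ofLex v'.1).1, h', v'.2.1⟩, h', lt_irrefl _⟩
  · have hq : ((ofLex v.1).2 : ℕ) < q := lt_of_lt_of_le h2 (Nat.le_of_lt_succ (ofLex v'.1).2.2)
    have h3 := (mem_gpiece.1 v.2.2 ⟨_, hq⟩).1
    have h4 := (mem_gpiece.1 v'.2.2 ⟨_, hq⟩).2 h2
    have h5 : J ⟨_, hq⟩ = (ofLex v.1).1 :=
      le_antisymm (h4.trans_eq h1.symm) (not_lt.1 fun hlt => lt_irrefl _ (h3 hlt))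
    exact ⟨Gap.gap ⟨⟨_, hq⟩, by rw [h5]; exact v.2.1⟩, h2, fun h => lt_irrefl _ h⟩

/-- All elements of a fibre except the last have a successor in it. -/
theorem card_fibre_eq {f : L → Fin k} {i : Fin k} (hi : ∃ j, f j = i) :
    (Finset.univ.filter fun j => f j = i).card = Fintype.card (Junction f i) + 1 := by
  classical
  have hne : (Finset.univ.filter fun j => f j = i).Nonempty := by
    obtain ⟨j, hj⟩ := hi
    exact ⟨j, by simp [hj]⟩
  set t := (Finset.univ.filter fun j => f j = i).max' hne with ht
  have htm := Finset.max'_mem _ hne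
  rw [← ht] at htm
  have : Fintype.card (Junction f i) = ((Finset.univ.filter fun j => f j = i).erase t).card := by
    rw [Fintype.card_subtype]
    congr 1
    ext j
    simp only [Finset.mem_filter, Finset.mem_univ, true_and, Finset.mem_erase]
    constructor
    · rintro ⟨h1, j', h2, h3⟩
      refine ⟨fun h => ?_, h1⟩
      have := Finset.le_max' (Finset.univ.filter fun j => f j = i) j' (by simp [h3])
      rw [← ht, ← h] at this
      exact this.not_gt h2
    · rintro ⟨h1, h2⟩
      have := Finset.le_max' (Finset.univ.filter fun j => f j = i) j (by simp [h2])
      rw [← ht] at this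
      exact ⟨h2, t, lt_of_le_of_ne this h1, by simpa using htm⟩
  rw [this, Finset.card_erase_add_one htm]

theorem card_labelled_eq {f : L → Fin k} {i : Fin k} (hi : ∃ j, f j = i) (J : Fin q →o L) :
    (labelled f (gpiece J) i).card = Fintype.card (Gap f J i) + 1 := by
  classical
  rw [card_labelled, card_fibre_eq hi, card_gap]
  omega

theorem card_vert {f : L → Fin k} {i : Fin k} (hi : ∃ j, f j = i) (J : Fin q →o L) :
    Fintype.card (Vert f J i) = Fintype.card (Gap f J i) + 1 := by
  rw [← card_labelled_eq hi J, labelled_eq_map_vert, Multiset.card_map]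
  rfl

theorem strictMono_fin_eq {n : ℕ} (g : Fin n → Fin n) (hg : StrictMono g) (c : Fin n) :
    g c = c := by
  have hs : Function.Surjective g := Finite.surjective_of_injective hg.injective
  have := Subsingleton.elim (StrictMono.orderIsoOfSurjective g hg hs) (OrderIso.refl _)
  exact DFunLike.congr_fun this c

/-- The number of gaps to the left of a vertex is its place in the block. -/
theorem lt_iff_isLeft {f : L → Fin k} {i : Fin k} {J : Fin q →o L} {p : ℕ}
    (ι : Fin p ≃o Gap f J i) (θ : Fin (p + 1) ≃o Vert f J i) (r : Fin p) (c : Fin (p + 1)) :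
    (r : ℕ) < c ↔ (ι r).IsLeft (ofLex (θ c).1).1 (ofLex (θ c).1).2 := by
  classical
  have h1 := fun c : Fin (p + 1) => lt_card_filter_iff
    (fun r => (ι r).IsLeft (ofLex (θ c).1).1 (ofLex (θ c).1).2)
    (fun a b hab h => Gap.isLeft_of_le (ι.monotone hab) (θ c).2.2 h)
  let g : Fin (p + 1) → Fin (p + 1) := fun c =>
    ⟨(Finset.univ.filter fun r => (ι r).IsLeft (ofLex (θ c).1).1 (ofLex (θ c).1).2).card,
      Nat.lt_succ_of_le ((Finset.card_le_univ _).trans_eq (Fintype.card_fin p))⟩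
  -- The number of gaps to the left grows strictly from vertex to vertex. As there is one vertex
  -- more than gaps, this counting map is a strictly monotone self-map of a finite chain, hence the
  -- identity.
  have hg : StrictMono g := by
    intro c c' h
    refine Fin.mk_lt_mk.2 (Finset.card_lt_card ?_)
    have hlt : θ c < θ c' := θ.strictMono h
    rw [Finset.ssubset_iff_of_subset]
    · obtain ⟨x, hx, hx'⟩ := exists_isLeft_of_lt hlt
      exact ⟨ι.symm x, by simpa using hx, by simpa using hx'⟩
    · intro r hr
      simp only [Finset.mem_filter, Finset.mem_univ, true_and] at hr ⊢
      exact isLeft_of_lt hlt hr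
  rw [← h1 c r]
  have := congrArg Fin.val (strictMono_fin_eq g hg c)
  exact Eq.subst (motive := fun n => (r : ℕ) < c ↔ (r : ℕ) < n) this.symm Iff.rfl

/-- The part of the piece `j` which lies in the piece `a` of the block, if the block is cut
according to `K`. -/
def subpiece {f : L → Fin k} {J : Fin q → L} {i : Fin k} {m : ℕ} (K : Gap f J i → Fin m)
    (a : Fin m) (j : L) : Finset (Fin (q + 1)) := by
  classical exact (gpiece J j).filter fun b =>
    ∀ x : Gap f J i, (K x < a → x.IsLeft j b) ∧ (x.IsLeft j b → K x ≤ a)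

theorem mem_subpiece {f : L → Fin k} {J : Fin q → L} {i : Fin k} {m : ℕ} {K : Gap f J i → Fin m}
    {a : Fin m} {j : L} {b : Fin (q + 1)} : b ∈ subpiece K a j ↔ b ∈ gpiece J j ∧
      ∀ x : Gap f J i, (K x < a → x.IsLeft j b) ∧ (x.IsLeft j b → K x ≤ a) := by
  simp [subpiece]

/-- The union of the pieces of a block which are labelled by `b`. -/
def sublabelled {f : L → Fin k} {J : Fin q → L} {i : Fin k} {m l : ℕ} (g : Fin m → Fin l)
    (K : Gap f J i → Fin m) (b : Fin l) : Multiset (Fin (q + 1)) :=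
  ∑ a ∈ Finset.univ.filter (fun a => g a = b), ∑ j ∈ Finset.univ.filter (fun j => f j = i),
    (subpiece K a j).val

/-- The face spanned by a block has the gaps `Gap f J i` and the vertices `Vert f J i`. Transport
along the order isomorphisms `ι` and `θ` turns cuts of this face into cuts of the block, whose
pieces can be described inside the large simplex. -/
theorem core_face_labelled {X : TopCat.{u}} {f : L → Fin k} {i : Fin k} (hi : ∃ j, f j = i)
    (J : Fin q →o L) {m l : ℕ} {g : Fin m → Fin l} (hg : Function.Surjective g)
    (y : Fin l → cochains X) (σ : Sing X q) :
    core g y (face σ (labelled f (gpiece J) i)) =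
      ∑ K : Gap f J i →o Fin m, zs (geps g K) * ∏ b, ev (face σ (sublabelled g K b)) (y b) := by
  classical
  have hB := labelled_eq_map_vert f J i
  have hcard := card_labelled_eq hi J
  set B := labelled f (gpiece J) i with hBdef
  have hp : Fintype.card (Gap f J i) = B.card - 1 := by omega
  have hv : Fintype.card (Vert f J i) = B.card - 1 + 1 := by rw [card_vert hi J, hp]
  let ι : Fin (B.card - 1) ≃o Gap f J i := Fintype.orderIsoFinOfCardEq _ hp
  let θ : Fin (B.card - 1 + 1) ≃o Vert f J i := Fintype.orderIsoFinOfCardEq _ hv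
  have hvm : ∀ c, (vertexMap B).toOrderHom c = (ofLex (θ c).1).2 := by
    intro c
    refine vertexMap_apply_of_monotone B rfl (fun c => (ofLex (θ c).1).2) ?_ ?_ c
    · intro c c' h
      rcases h.eq_or_lt with rfl | h
      · exact le_rfl
      · have h' : (θ c).1 < (θ c').1 := θ.strictMono h
        rw [Prod.Lex.lt_iff] at h'
        rcases h' with h' | h'
        · exact le_of_mem_gpiece h' (θ c).2.2 (θ c').2.2
        · exact h'.2.le
    · refine hB.trans ?_
      have : (Finset.univ : Finset (Vert f J i)) = Finset.univ.map θ.toEquiv.toEmbedding := by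
        simp
      rw [this, Finset.map_val, Multiset.map_map]
      rfl
  refine (Fintype.sum_bijective
    (fun K : Gap f J i →o Fin m => (⟨K ∘ ι, K.monotone.comp ι.monotone⟩ :
      Fin (B.card - 1) →o Fin m)) ⟨?_, ?_⟩ _ _ ?_).symm
  · intro K K' h
    ext x
    have := DFunLike.congr_fun h (ι.symm x)
    simp only [OrderHom.coe_mk, Function.comp_apply, OrderIso.apply_symm_apply] at this
    rw [this]
  · intro K
    refine ⟨⟨K ∘ ι.symm, K.monotone.comp ι.symm.monotone⟩, ?_⟩
    ext s
    simp
  · intro K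
    change _ = zs (geps g (K ∘ ι)) * ∏ b, _
    rw [geps_comp_orderIso]
    congr 1
    refine Finset.prod_congr rfl fun b _ => ?_
    rw [ev_face_face σ B _ (labelled_ne_zero hg (⟨K ∘ ι, K.monotone.comp ι.monotone⟩ :
      Fin (B.card - 1) →o Fin m) b)]
    refine congrArg (fun C => ev (face σ C) (y b)) ?_
    rw [labelled, sublabelled, map_finset_sum]
    refine Finset.sum_congr rfl fun a _ => ?_
    -- The conditions defining a piece only compare gaps with vertices, and `lt_iff_isLeft`
    -- transports these comparisons.
    have hmem : ∀ c, c ∈ gpiece (K ∘ ι) a ↔ (ofLex (θ c).1).2 ∈ subpiece K a (ofLex (θ c).1).1 := by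
      intro c
      rw [mem_subpiece, mem_gpiece]
      constructor
      · refine fun h => ⟨(θ c).2.2, fun x => ?_⟩
        have := h (ι.symm x)
        simpa [lt_iff_isLeft ι θ] using this
      · rintro ⟨-, h⟩ r
        have := h (ι r)
        rwa [← lt_iff_isLeft ι θ] at this
    have h1 : ∀ s : Finset (Fin (B.card - 1 + 1)), Multiset.map (vertexMap B).toOrderHom s.val =
        ∑ c, if c ∈ s then {(ofLex (θ c).1).2} else 0 := by
      intro s
      rw [← Finset.sum_filter, Finset.filter_mem_eq_inter, Finset.univ_inter, map_val_eq_sum]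
      simp only [hvm]
    change _ = Multiset.map _ (gpiece (K ∘ ι) a).val
    rw [h1]
    simp only [hmem]
    refine Eq.trans ?_ (θ.toEquiv.sum_comp (fun v : Vert f J i =>
      if (ofLex v.1).2 ∈ subpiece K a (ofLex v.1).1 then
        ({(ofLex v.1).2} : Multiset (Fin (q + 1))) else 0)).symm
    rw [sum_vert f J i (fun j b => if b ∈ subpiece K a j then ({b} : Multiset (Fin (q + 1))) else 0)]
    refine Finset.sum_congr rfl fun j _ => ?_
    rw [← Finset.sum_filter, ← Finset.sum_multiset_singleton]
    refine Finset.sum_congr ?_ fun _ _ => rfl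
    ext b
    simp only [Finset.mem_filter]
    exact ⟨fun h => ⟨(mem_subpiece.1 h).1, h⟩, fun h => h.2⟩

end Block

/-! ## Composition of sequences -/

section Composite

variable {L : Type*} [LinearOrder L] [Fintype L] {k q : ℕ} {m l : Fin k → ℕ}

/-- If the fibre of `i` is divided at its junctions into overlapping pieces, as prescribed by `T`,
then `j` belongs to the piece `a`. -/
def Fits {f : L → Fin k} (T : ∀ i, Junction f i →o Fin (m i)) (i : Fin k) (a : Fin (m i))
    (j : L) : Prop := ∀ e : Junction f i, (T i e < a → e.1 < j) ∧ (e.1 < j → T i e ≤ a)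

/-- The elements of a composite sequence. -/
structure Letter {f : L → Fin k} (T : ∀ i, Junction f i →o Fin (m i)) : Type _ where
  pos : L
  val : Fin (m (f pos))
  fits : Fits T (f pos) val pos

variable {f : L → Fin k} {T : ∀ i, Junction f i →o Fin (m i)}

theorem Letter.ext' {z z' : Letter T} (h1 : z.pos = z'.pos) (h2 : (z.val : ℕ) = z'.val) :
    z = z' := by
  obtain ⟨j, a, h⟩ := z
  obtain ⟨j', a', h'⟩ := z'
  obtain rfl : j = j' := h1
  obtain rfl : a = a' := Fin.ext h2
  rfl

/-- The order of the elements of a composite sequence is lexicographic. -/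
def Letter.key (z : Letter T) : L ×ₗ ℕ := toLex (z.pos, (z.val : ℕ))

instance : LinearOrder (Letter T) := LinearOrder.lift' Letter.key fun _ _ h =>
  Letter.ext' (congrArg (fun v => (ofLex v).1) h) (congrArg (fun v => (ofLex v).2) h)

instance : Fintype (Letter T) := by
  classical
  exact Fintype.ofInjective
    (fun z : Letter T => (⟨z.pos, z.val⟩ : Σ j : L, Fin (m (f j)))) fun z z' h => by
      obtain ⟨j, a, h⟩ := z
      obtain ⟨j', a', h'⟩ := z'
      simp only [Sigma.mk.injEq] at h
      obtain ⟨rfl, h⟩ := h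
      obtain rfl := eq_of_heq h
      rfl

theorem Letter.lt_iff {z z' : Letter T} :
    z < z' ↔ z.pos < z'.pos ∨ z.pos = z'.pos ∧ (z.val : ℕ) < z'.val := by
  change Letter.key z < Letter.key z' ↔ _
  rw [Letter.key, Letter.key, Prod.Lex.toLex_lt_toLex]

theorem Letter.le_iff {z z' : Letter T} :
    z ≤ z' ↔ z.pos < z'.pos ∨ z.pos = z'.pos ∧ (z.val : ℕ) ≤ z'.val := by
  change Letter.key z ≤ Letter.key z' ↔ _
  rw [Letter.key, Letter.key, Prod.Lex.toLex_le_toLex]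

/-- The labels of a composite sequence. -/
def label (g : ∀ i, Fin (m i) → Fin (l i)) (z : Letter T) : Fin (∑ i, l i) :=
  finSigmaFinEquiv ⟨f z.pos, g (f z.pos) z.val⟩

open Classical in
theorem sum_letter {N : Type*} [AddCommMonoid N] (G : ∀ i, Fin (m i) → L → N) :
    ∑ z : Letter T, G (f z.pos) z.val z.pos =
      ∑ i, ∑ a, ∑ j, if f j = i ∧ Fits T i a j then G i a j else 0 := by
  rw [Finset.sum_sigma', Finset.sum_sigma']
  rw [← Finset.sum_filter]
  refine Finset.sum_bij (fun z _ => ⟨⟨f z.pos, z.val⟩, z.pos⟩) ?_ ?_ ?_ ?_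
  · rintro z -
    simpa using z.fits
  · rintro ⟨j, a, h⟩ - ⟨j', a', h'⟩ - heq
    simp only [Sigma.mk.injEq] at heq
    obtain ⟨⟨-, h2⟩, h3⟩ := heq
    obtain rfl := eq_of_heq h3
    obtain rfl := eq_of_heq h2
    rfl
  · rintro ⟨⟨i, a⟩, j⟩ h
    simp only [Finset.mem_filter, Finset.mem_sigma, Finset.mem_univ, and_self, true_and] at h
    obtain ⟨rfl, h⟩ := h
    exact ⟨⟨j, a, h⟩, Finset.mem_univ _, rfl⟩
  · rintro z -
    rfl

theorem Gap.gap_le_junction_iff {J : Fin q → L} {i : Fin k} {s : {s : Fin q // f (J s) = i}}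
    {e : Junction f i} : (Gap.gap s : Gap f J i) ≤ Gap.junction e ↔ J s ≤ e.1 := by
  change Gap.key (Gap.gap s : Gap f J i) ≤ Gap.key (Gap.junction e) ↔ _
  rw [Gap.key, Gap.key, Prod.Lex.toLex_le_toLex]
  simp [le_iff_lt_or_eq]

theorem Gap.junction_le_gap_iff {J : Fin q → L} {i : Fin k} {s : {s : Fin q // f (J s) = i}}
    {e : Junction f i} : (Gap.junction e : Gap f J i) ≤ Gap.gap s ↔ e.1 < J s := by
  change Gap.key (Gap.junction e : Gap f J i) ≤ Gap.key (Gap.gap s) ↔ _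
  rw [Gap.key, Gap.key, Prod.Lex.toLex_le_toLex]
  simp

theorem Gap.junction_le_junction_iff {J : Fin q → L} {i : Fin k}
    {e e' : Junction f i} : (Gap.junction e : Gap f J i) ≤ Gap.junction e' ↔ e ≤ e' := by
  change Gap.key (Gap.junction e : Gap f J i) ≤ Gap.key (Gap.junction e') ↔ _
  rw [Gap.key, Gap.key, Prod.Lex.toLex_le_toLex, ← Subtype.coe_le_coe]
  simp [le_iff_lt_or_eq]

theorem Gap.gap_le_gap_iff {J : Fin q →o L} {i : Fin k} {s s' : {s : Fin q // f (J s) = i}} :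
    (Gap.gap s : Gap f J i) ≤ Gap.gap s' ↔ s ≤ s' := by
  change Gap.key (Gap.gap s : Gap f J i) ≤ Gap.key (Gap.gap s') ↔ _
  rw [Gap.key, Gap.key, Prod.Lex.toLex_le_toLex, ← Subtype.coe_le_coe]
  simp only [WithTop.coe_le_coe]
  constructor
  · rintro (h | h)
    · exact (lt_of_not_ge fun hle => (J.monotone hle).not_gt h).le
    · exact h.2
  · intro h
    rcases (J.monotone h).lt_or_eq with h' | h'
    · exact Or.inl h'
    · exact Or.inr ⟨h', h⟩

/-- The restriction to the junctions of cuts of the blocks. -/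
def cutJunctions {J : Fin q → L} (K : ∀ i, Gap f J i →o Fin (m i)) (i : Fin k) :
    Junction f i →o Fin (m i) :=
  ⟨fun e => K i (Gap.junction e), fun _ _ h => (K i).monotone (Gap.junction_le_junction_iff.2 h)⟩

theorem val_gap_eq {J : Fin q → L} (K : ∀ i, Gap f J i →o Fin (m i)) {i : Fin k} {s : Fin q}
    (hs : f (J s) = i) :
    ((K (f (J s)) (Gap.gap ⟨s, rfl⟩) : Fin _) : ℕ) = (K i (Gap.gap ⟨s, hs⟩) : Fin _) := by
  subst hs
  rfl

/-- The element of the composite sequence which contains a given gap. -/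
def toLetter {J : Fin q → L} (K : ∀ i, Gap f J i →o Fin (m i)) (s : Fin q) :
    Letter (cutJunctions K) where
  pos := J s
  val := K (f (J s)) (Gap.gap ⟨s, rfl⟩)
  fits e := by
    constructor
    · intro h
      by_contra hle
      exact ((K (f (J s))).monotone (Gap.gap_le_junction_iff.2 (not_lt.1 hle))).not_gt h
    · intro h
      exact (K (f (J s))).monotone (Gap.junction_le_gap_iff.2 h)

theorem toLetter_monotone {J : Fin q →o L} (K : ∀ i, Gap f J i →o Fin (m i)) :
    Monotone (toLetter K) := by
  intro s s' h
  rw [Letter.le_iff]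
  rcases (J.monotone h).lt_or_eq with h' | h'
  · exact Or.inl h'
  · refine Or.inr ⟨h', ?_⟩
    change ((K (f (J s)) (Gap.gap ⟨s, rfl⟩) : Fin _) : ℕ) ≤ (K (f (J s')) (Gap.gap ⟨s', rfl⟩) : Fin _)
    rw [val_gap_eq K (congrArg f h')]
    exact (K (f (J s'))).monotone (Gap.gap_le_gap_iff.2 h)

/-- Cuts of the simplex and of the blocks determine a cut of the simplex according to a composite
sequence. -/
def combine (x : Σ J : Fin q →o L, ∀ i, Gap f J i →o Fin (m i)) :
    Σ T : (∀ i, Junction f i →o Fin (m i)), Fin q →o Letter T :=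
  ⟨cutJunctions x.2, ⟨toLetter x.2, toLetter_monotone x.2⟩⟩

theorem Letter.val_le {z : Letter T} {i : Fin k} (hz : f z.pos = i) {j' : L} (h : z.pos < j')
    (hj' : f j' = i) : (z.val : ℕ) ≤ (T i ⟨z.pos, hz, j', h, hj'⟩ : Fin _) := by
  subst hz
  by_contra hlt
  exact lt_irrefl _ ((z.fits ⟨z.pos, rfl, j', h, hj'⟩).1 (not_le.1 hlt))

theorem Letter.le_val {z : Letter T} {i : Fin k} (hz : f z.pos = i) {e : Junction f i}
    (h : e.1 < z.pos) : ((T i e : Fin _) : ℕ) ≤ z.val := by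
  subst hz
  exact (z.fits e).2 h

theorem Letter.val_le_of_le {z : Letter T} {i : Fin k} (hz : f z.pos = i) {e : Junction f i}
    (h : z.pos ≤ e.1) : (z.val : ℕ) ≤ (T i e : Fin _) := by
  subst hz
  by_contra hlt
  exact ((z.fits e).1 (not_le.1 hlt)).not_ge h

/-- A cut of a block has values at junctions and at gaps of the simplex. The former are `T`; the
latter, together with `J`, form a map to letters. The condition `Fits` and the lexicographic order
of the letters express exactly that the two kinds of values fit together monotonically. -/
theorem combine_bijective : Function.Bijective (combine : (Σ J : Fin q →o L,
    ∀ i, Gap f J i →o Fin (m i)) → Σ T : (∀ i, Junction f i →o Fin (m i)), Fin q →o Letter T) := by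
  constructor
  · rintro ⟨J, K⟩ ⟨J', K'⟩ h
    obtain rfl : J = J' := by
      ext s
      exact congrArg (fun r : Σ T : (∀ i, Junction f i →o Fin (m i)), Fin q →o Letter T =>
        (r.2 s).pos) h
    congr 1
    funext i
    ext x
    rcases x with ⟨s, hs⟩ | e
    · have h2 := congrArg (fun r : Σ T : (∀ i, Junction f i →o Fin (m i)), Fin q →o Letter T =>
        ((r.2 s).val : ℕ)) h
      change ((K (f (J s)) (Gap.gap ⟨s, rfl⟩) : Fin _) : ℕ) =
        (K' (f (J s)) (Gap.gap ⟨s, rfl⟩) : Fin _) at h2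
      rwa [val_gap_eq K hs, val_gap_eq K' hs] at h2
    · exact congrArg (fun r : Σ T : (∀ i, Junction f i →o Fin (m i)), Fin q →o Letter T =>
        ((r.1 i e : Fin _) : ℕ)) h
  · rintro ⟨T, J'⟩
    have hJ : Monotone fun s => (J' s).pos := by
      intro s s' h
      rcases Letter.le_iff.1 (J'.monotone h) with h' | h'
      · exact h'.le
      · exact h'.1.le
    let J : Fin q →o L := ⟨fun s => (J' s).pos, hJ⟩
    let K0 : ∀ i, Gap f J i → Fin (m i) := fun i x => match x with
      | Gap.gap s => ⟨(J' s).val, (J' s).val.2.trans_eq (congrArg m s.2)⟩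
      | Gap.junction e => T i e
    have hK : ∀ i, Monotone (K0 i) := by
      rintro i (s | e) (s' | e') h
      · have h' := Gap.gap_le_gap_iff.1 h
        rcases Letter.le_iff.1 (J'.monotone h') with h2 | h2
        · have h3 : (J' s).pos < (J' s').pos := h2
          -- Two gaps in different pieces of a block are compared through the junction at the end of
          -- the first piece.
          exact (Letter.val_le s.2 h3 s'.2).trans (Letter.le_val (e := ⟨_, s.2, _, h3, s'.2⟩) s'.2 h3)
        · exact h2.2
      · exact Letter.val_le_of_le s.2 (Gap.gap_le_junction_iff.1 h)
      · exact Letter.le_val s'.2 (Gap.junction_le_gap_iff.1 h)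
      · exact (T i).monotone (Gap.junction_le_junction_iff.1 h)
    exact ⟨⟨J, fun i => ⟨K0 i, hK i⟩⟩, rfl⟩

/-- The cut by letters is the common refinement of the cut of the simplex and the cuts of the
blocks: both sides impose the same inequalities between the vertex and the gaps. -/
theorem gpiece_toLetter {J : Fin q →o L} (K : ∀ i, Gap f J i →o Fin (m i))
    (z : Letter (cutJunctions K)) :
    gpiece (toLetter K) z = subpiece (K (f z.pos)) z.val z.pos := by
  ext b
  rw [mem_gpiece, mem_subpiece, mem_gpiece]
  constructor
  · intro h
    refine ⟨fun s => ⟨fun h' => (h s).1 (Letter.lt_iff.2 (Or.inl h')), fun h' => ?_⟩, ?_⟩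
    · rcases Letter.le_iff.1 ((h s).2 h') with h2 | h2
      · exact h2.le
      · exact h2.1.le
    · rintro (⟨s, hs⟩ | e)
      · have hv : (((toLetter K s).val : Fin _) : ℕ) = (K (f z.pos) (Gap.gap ⟨s, hs⟩) : Fin _) :=
          val_gap_eq K hs
        constructor
        · intro h'
          refine (h s).1 (Letter.lt_iff.2 ?_)
          rcases lt_trichotomy (J s) z.pos with h2 | h2 | h2
          · exact Or.inl h2
          · exact Or.inr ⟨h2, hv.trans_lt h'⟩
          -- A gap in a later piece of the block lies beyond the junction at the end of `z.pos`, so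
          -- its value cannot be smaller than that of `z`.
          · have h3 := Letter.val_le (z := z) rfl h2 hs
            have h4 := Letter.le_val (z := toLetter K s) (e := ⟨z.pos, rfl, _, h2, hs⟩) hs h2
            exact absurd h' (not_lt.2 (h3.trans (h4.trans_eq hv)))
        · intro h'
          rcases Letter.le_iff.1 ((h s).2 h') with h2 | h2
          · have h3 := Letter.val_le (z := toLetter K s) hs h2 rfl
            have h4 := Letter.le_val (z := z) (e := ⟨_, hs, _, h2, rfl⟩) rfl h2
            exact hv.symm.trans_le (h3.trans h4)
          · exact hv.symm.trans_le h2.2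
      · exact z.fits e
  · rintro ⟨h1, h2⟩ s
    constructor
    · intro h
      rcases Letter.lt_iff.1 h with h | ⟨h, h'⟩
      · exact (h1 s).1 h
      · have hs : f (J s) = f z.pos := congrArg f h
        have hv : (((toLetter K s).val : Fin _) : ℕ) = (K (f z.pos) (Gap.gap ⟨s, hs⟩) : Fin _) :=
          val_gap_eq K hs
        exact (h2 (Gap.gap ⟨s, hs⟩)).1 (hv.symm.trans_lt h')
    · intro h
      rcases ((h1 s).2 h).lt_or_eq with h3 | h3
      · exact Letter.le_iff.2 (Or.inl h3)
      · have hs : f (J s) = f z.pos := congrArg f h3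
        have hv : (((toLetter K s).val : Fin _) : ℕ) = (K (f z.pos) (Gap.gap ⟨s, hs⟩) : Fin _) :=
          val_gap_eq K hs
        exact Letter.le_iff.2 (Or.inr ⟨h3, hv.trans_le ((h2 (Gap.gap ⟨s, hs⟩)).2 h)⟩)

theorem labelled_label {J : Fin q →o L} (g : ∀ i, Fin (m i) → Fin (l i))
    (K : ∀ i, Gap f J i →o Fin (m i)) (i : Fin k) (b : Fin (l i)) :
    labelled (label g) (gpiece (toLetter K)) (finSigmaFinEquiv ⟨i, b⟩) =
      sublabelled (g i) (K i) b := by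
  classical
  rw [labelled, Finset.sum_filter]
  simp only [gpiece_toLetter]
  have := sum_letter (T := cutJunctions K) (fun i' a j =>
    if finSigmaFinEquiv ⟨i', g i' a⟩ = finSigmaFinEquiv (⟨i, b⟩ : Σ i, Fin (l i)) then
      (subpiece (K i') a j).val else 0)
  refine this.trans ?_
  rw [Finset.sum_eq_single i, sublabelled, Finset.sum_filter]
  · refine Finset.sum_congr rfl fun a _ => ?_
    rw [Finset.sum_filter]
    simp only [EmbeddingLike.apply_eq_iff_eq, Sigma.mk.injEq, heq_eq_eq, true_and]
    by_cases ha : g i a = b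
    · simp only [ha, if_true]
      refine Finset.sum_congr rfl fun j _ => ?_
      by_cases hj : f j = i
      · simp only [hj, true_and, if_true]
        split_ifs with hfit
        · rfl
        -- Pairs that are not letters contribute nothing: the conditions `Fits` are among those that
        -- a vertex of the subpiece satisfies.
        · have : subpiece (K i) a j = ∅ := by
            rw [Finset.eq_empty_iff_forall_notMem]
            exact fun c hc => hfit fun e => (mem_subpiece.1 hc).2 (Gap.junction e)
          rw [this]; rfl
      · simp [hj]
    · simp [ha]
  · intro i' _ hi'
    refine Finset.sum_eq_zero fun a _ => Finset.sum_eq_zero fun j _ => ?_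
    have : ¬ (finSigmaFinEquiv ⟨i', g i' a⟩ = finSigmaFinEquiv (⟨i, b⟩ : Σ i, Fin (l i))) := by
      intro h
      exact hi' (congrArg Sigma.fst (finSigmaFinEquiv.injective h))
    rw [if_neg this]
    simp
  · simp

end Composite

/-! ## The position of blocks -/

theorem finSigma_val {k : ℕ} {n : Fin k → ℕ} (i : Fin k) (b : Fin (n i)) :
    (finSigmaFinEquiv (⟨i, b⟩ : Σ i, Fin (n i)) : ℕ) = (∑ i', if i' < i then n i' else 0) + b := by
  rw [finSigmaFinEquiv_apply, ← Finset.sum_filter]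
  congr 1
  refine Finset.sum_bij (fun c _ => Fin.castLE i.2.le c) ?_ ?_ ?_ ?_
  · intro c _
    rw [Finset.mem_filter]
    exact ⟨Finset.mem_univ _, c.2⟩
  · intro c _ c' _ h
    exact Fin.castLE_injective _ h
  · intro c hc
    exact ⟨⟨c, (Finset.mem_filter.1 hc).2⟩, Finset.mem_univ _, rfl⟩
  · intro c _
    rfl

theorem sum_ite_lt_add_le {k : ℕ} (n : Fin k → ℕ) {i i' : Fin k} (h : i < i') :
    (∑ c, if c < i then n c else 0) + n i ≤ ∑ c, if c < i' then n c else 0 := by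
  have h1 : n i = ∑ c, if c = i then n c else 0 := by simp
  rw [h1, ← Finset.sum_add_distrib]
  refine Finset.sum_le_sum fun c _ => ?_
  by_cases hc : c < i
  · have : c ≠ i := hc.ne
    simp [hc, this, hc.trans h]
  · by_cases hc' : c = i
    · subst hc'; simp [h]
    · simp [hc, hc']

theorem finSigma_lt {k : ℕ} {n : Fin k → ℕ} (x y : Σ i, Fin (n i)) :
    finSigmaFinEquiv x < finSigmaFinEquiv y ↔
      x.1 < y.1 ∨ (x.1 = y.1 ∧ (x.2 : ℕ) < y.2) := by
  obtain ⟨i, b⟩ := x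
  obtain ⟨i', b'⟩ := y
  rw [Fin.lt_def, finSigma_val, finSigma_val]
  have hb := b.2
  have hb' := b'.2
  simp only
  rcases lt_trichotomy i i' with h | h | h
  · have := sum_ite_lt_add_le n h
    simp only [h, true_or, iff_true]
    omega
  · subst h
    simp
  · have := sum_ite_lt_add_le n h
    simp only [h.not_gt, h.ne', false_and, or_self, iff_false]
    omega

theorem sum_fiber {ι κ N : Type*} [Fintype ι] [Fintype κ] [DecidableEq κ] [AddCommMonoid N]
    (φ : ι → κ) (F : ∀ i, {s // φ s = i} → N) :
    ∑ i, ∑ s, F i s = ∑ s, F (φ s) ⟨s, rfl⟩ := by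
  rw [Finset.sum_sigma']
  refine Fintype.sum_equiv (Equiv.sigmaFiberEquiv φ) _ _ ?_
  rintro ⟨i, s, rfl⟩
  rfl

/-! ### The signs of composite sequences -/

section Sign

variable {L : Type*} [LinearOrder L] [Fintype L] {k q : ℕ} {m l : Fin k → ℕ}
variable {f : L → Fin k} {T : ∀ i, Junction f i →o Fin (m i)}

open Classical in
theorem sum_junction {N : Type*} [AddCommMonoid N] (f : L → Fin k) (i : Fin k) (F : L → N) :
    ∑ e : Junction f i, F e.1 = ∑ j, if f j = i ∧ ∃ j', j < j' ∧ f j' = i then F j else 0 := by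
  rw [← Finset.sum_filter]
  exact (Finset.sum_subtype _ (by simp) F).symm

/-- The positions at which `a` fits are consecutive in the fibre, and the witness is the last of
them: the first position whose junction, if there is one, already belongs to a piece after `a`. Each
of the other positions ends in a junction that belongs to `a`. -/
theorem exists_fits (T : ∀ i, Junction f i →o Fin (m i)) {i : Fin k} (hi : ∃ j, f j = i)
    (a : Fin (m i)) : ∃ j, f j = i ∧ Fits T i a j ∧ (∀ e : Junction f i, e.1 = j → a < T i e) ∧
      ∀ j', f j' = i → j' ≠ j → Fits T i a j' → ∃ e : Junction f i, e.1 = j' ∧ T i e = a := by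
  classical
  let Q : Finset L := Finset.univ.filter fun j => f j = i ∧ ∀ e : Junction f i, e.1 = j → a < T i e
  have hQ : Q.Nonempty := by
    have hne : (Finset.univ.filter fun j => f j = i).Nonempty := by
      obtain ⟨j, hj⟩ := hi
      exact ⟨j, by simp [hj]⟩
    refine ⟨(Finset.univ.filter fun j => f j = i).max' hne, ?_⟩
    simp only [Q, Finset.mem_filter, Finset.mem_univ, true_and]
    refine ⟨by simpa using Finset.max'_mem _ hne, ?_⟩
    rintro ⟨e, he, j', hj', hj''⟩ rfl
    exact absurd (Finset.le_max' (Finset.univ.filter fun j => f j = i) j' (by simp [hj'']))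
      (not_le.2 hj')
  have hmem := Finset.min'_mem Q hQ
  have hmin : ∀ j ∈ Q, Q.min' hQ ≤ j := fun j hj => Finset.min'_le Q j hj
  generalize Q.min' hQ = j at hmem hmin
  simp only [Q, Finset.mem_filter, Finset.mem_univ, true_and] at hmem hmin
  refine ⟨j, hmem.1, ?_, hmem.2, ?_⟩
  · intro e
    constructor
    · intro h
      by_contra hle
      rcases (not_lt.1 hle).eq_or_lt with h' | h'
      · exact (hmem.2 e h'.symm).not_gt h
      · have h1 := hmem.2 ⟨j, hmem.1, e.1, h', e.2.1⟩ rfl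
        have h2 : T i ⟨j, hmem.1, e.1, h', e.2.1⟩ ≤ T i e := (T i).monotone h'.le
        exact (h1.trans_le h2).not_gt h
    · intro h
      by_contra hlt
      refine absurd (hmin e.1 ⟨e.2.1, ?_⟩) (not_le.2 h)
      rintro e' he'
      rw [Subtype.ext he']
      exact not_le.1 hlt
  · intro j' hj' hne hfit
    by_contra hcon
    push Not at hcon
    have hle : ∀ e : Junction f i, e.1 = j' → a < T i e := by
      intro e he
      refine lt_of_le_of_ne (not_lt.1 fun h => ?_) (hcon e he).symm
      exact absurd ((hfit e).1 h) (by rw [he]; exact lt_irrefl _)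
    have h1 := lt_of_le_of_ne (hmin j' ⟨hj', hle⟩) (Ne.symm hne)
    have h2 := (hfit ⟨j, hmem.1, j', h1, hj'⟩).2 h1
    exact (hmem.2 ⟨j, hmem.1, j', h1, hj'⟩ rfl).not_ge h2

theorem fits_of_eq {i : Fin k} (e : Junction f i) : Fits T i (T i e) e.1 := fun _ =>
  ⟨fun h => lt_of_not_ge fun hle => ((T i).monotone hle).not_gt h,
    fun h => (T i).monotone (le_of_lt h)⟩

-- A piece of a block that contains `c` junctions meets `c + 1` pieces of the simplex.
open Classical in
theorem count_fits {R : Type*} [CommSemiring R] (T : ∀ i, Junction f i →o Fin (m i)) {i : Fin k}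
    (hi : ∃ j, f j = i) (a : Fin (m i)) :
    (∑ j, if f j = i ∧ Fits T i a j then (1 : R) else 0) =
      1 + ∑ e, if T i e = a then 1 else 0 := by
  obtain ⟨j, hj, hfit, hlt, huniq⟩ := exists_fits T hi a
  rw [Finset.sum_boole, Finset.sum_boole]
  have : (Finset.univ.filter fun j => f j = i ∧ Fits T i a j) =
      insert j ((Finset.univ.filter fun e => T i e = a).image Subtype.val) := by
    ext j'
    simp only [Finset.mem_filter, Finset.mem_univ, true_and, Finset.mem_insert, Finset.mem_image]
    constructor
    · rintro ⟨h1, h2⟩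
      by_cases h : j' = j
      · exact Or.inl h
      · obtain ⟨e, he, he'⟩ := huniq j' h1 h h2
        exact Or.inr ⟨e, he', he⟩
    · rintro (rfl | ⟨e, rfl, rfl⟩)
      · exact ⟨hj, hfit⟩
      · exact ⟨e.2.1, fits_of_eq e⟩
  rw [this, Finset.card_insert_of_notMem, Finset.card_image_of_injective _ Subtype.val_injective]
  · push_cast; ring
  · simp only [Finset.mem_image, Finset.mem_filter, Finset.mem_univ, true_and, not_exists, not_and]
    intro e he he'
    exact absurd he (hlt e he').ne'

theorem label_surjective (hf : Function.Surjective f) {g : ∀ i, Fin (m i) → Fin (l i)}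
    (hg : ∀ i, Function.Surjective (g i)) (T : ∀ i, Junction f i →o Fin (m i)) :
    Function.Surjective (label g : Letter T → _) := by
  intro c
  obtain ⟨⟨i, b⟩, rfl⟩ := finSigmaFinEquiv.surjective c
  obtain ⟨a, rfl⟩ := hg i b
  obtain ⟨j, rfl, hfit, -⟩ := exists_fits T (hf i) a
  exact ⟨⟨j, a, hfit⟩, rfl⟩

/-- Each earlier fibre has one element more than junctions, and the elements of the own fibre before
`j` are all junctions. -/
theorem nb_eq_sum (hf : Function.Surjective f) {i : Fin k} {j : L} (hj : f j = i) :
    nb f j = (∑ i', if i' < i then ((Fintype.card (Junction f i') : ZMod 2) + 1) else 0) +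
      ∑ e : Junction f i, if e.1 < j then 1 else 0 := by
  classical
  have h1 : ∀ i', (Fintype.card (Junction f i') : ZMod 2) + 1 = ∑ j', if f j' = i' then 1 else 0 := by
    intro i'
    rw [Finset.sum_boole, card_fibre_eq (hf i')]
    push_cast
    rfl
  have h2 : ∀ i' : Fin k, (if i' < i then ((Fintype.card (Junction f i') : ZMod 2) + 1) else 0) =
      ∑ j', if f j' = i' then (if i' < i then 1 else 0) else 0 := by
    intro i'
    rw [h1]
    split_ifs <;> simp
  simp only [h2]
  rw [Finset.sum_comm, sum_junction f i fun j' => if j' < j then (1 : ZMod 2) else 0,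
    ← Finset.sum_add_distrib, nb]
  refine Finset.sum_congr rfl fun j' _ => ?_
  rw [Finset.sum_ite_eq, hj]
  simp only [Finset.mem_univ, if_true]
  by_cases h3 : f j' < i
  · simp [h3, h3.ne]
  · by_cases h4 : f j' = i
    · by_cases h5 : j' < j
      · simp only [h4, h5, and_self, or_true, if_true, true_and, if_false, zero_add, lt_irrefl]
        rw [if_pos ⟨j, h5, hj⟩]
      · simp [h4, h5]
    · simp [h3, h4]

-- This counts the letters with value `a` that precede `z` in the order by labels. For `a ≠ z.val`
-- either all fitting positions count or none, since a smaller `a` sits no later and a larger one no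
-- earlier than `z`. For `a = z.val` the earlier positions are the junctions with this value.
open Classical in
theorem sum_fits_le (g : ∀ i, Fin (m i) → Fin (l i)) (z : Letter T)
    (a : Fin (m (f z.pos))) :
    (∑ j, if f j = f z.pos ∧ Fits T (f z.pos) a j then
      (if g _ a < g _ z.val ∨ (g _ a = g _ z.val ∧
        (j < z.pos ∨ j = z.pos ∧ (a : ℕ) < z.val)) then (1 : ZMod 2) else 0) else 0) =
      (if g _ a < g _ z.val ∨ (g _ a = g _ z.val ∧ a < z.val) then 1 else 0) *
        (1 + ∑ e, if T (f z.pos) e = a then 1 else 0) +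
      if a = z.val then ∑ e : Junction f (f z.pos),
        if e.1 < z.pos ∧ T (f z.pos) e = z.val then 1 else 0 else 0 := by
  have hpos : ∀ j, f j = f z.pos → Fits T (f z.pos) a j → a < z.val → j ≤ z.pos := by
    intro j hj hfit ha
    by_contra hlt
    have h1 := Letter.val_le (z := z) rfl (not_le.1 hlt) hj
    have h2 := (hfit ⟨z.pos, rfl, j, not_le.1 hlt, hj⟩).2 (not_le.1 hlt)
    exact ha.not_ge (Fin.le_def.2 (h1.trans h2))
  rcases lt_trichotomy a z.val with ha | rfl | ha
  · rw [if_neg ha.ne, add_zero, ← count_fits T ⟨z.pos, rfl⟩ a, Finset.mul_sum]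
    refine Finset.sum_congr rfl fun j _ => ?_
    by_cases hj : f j = f z.pos ∧ Fits T (f z.pos) a j
    · have h1 := (hpos j hj.1 hj.2 ha).lt_or_eq
      have h2 : (a : ℕ) < z.val := ha
      have h3 : j < z.pos ∨ j = z.pos ∧ (a : ℕ) < z.val := h1.imp id fun h => ⟨h, h2⟩
      simp only [hj, and_self, if_true, h3, ha, and_true, mul_one]
    · simp [hj]
  · have hT : ∀ e : Junction f (f z.pos), e.1 < z.pos →
        (T (f z.pos) e = z.val ↔ Fits T (f z.pos) z.val e.1) := by
      intro e he
      refine ⟨fun h => h ▸ fits_of_eq e, fun h => le_antisymm (Letter.le_val (z := z) rfl he) ?_⟩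
      by_contra hlt
      exact lt_irrefl _ ((h e).1 (not_le.1 hlt))
    have h1 : ∀ e : Junction f (f z.pos), (if e.1 < z.pos ∧ T (f z.pos) e = z.val then
        (1 : ZMod 2) else 0) = if e.1 < z.pos ∧ Fits T (f z.pos) z.val e.1 then 1 else 0 := by
      intro e
      by_cases he : e.1 < z.pos
      · simp only [he, hT e he]
      · simp [he]
    simp only [h1, lt_irrefl, and_false, or_false, true_and, false_or, if_false, zero_mul, zero_add,
      if_true]
    rw [sum_junction f (f z.pos) fun j => if j < z.pos ∧ Fits T (f z.pos) z.val j then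
      (1 : ZMod 2) else 0]
    refine Finset.sum_congr rfl fun j _ => ?_
    by_cases hj : j < z.pos
    · by_cases hj' : f j = f z.pos
      · have : ∃ j', j < j' ∧ f j' = f z.pos := ⟨z.pos, hj, rfl⟩
        simp [hj, hj', this]
      · simp [hj']
    · simp [hj]
  · have h2 : ¬ (a : ℕ) < z.val := not_lt.2 (Fin.lt_def.1 ha).le
    rw [if_neg ha.ne', add_zero, ← count_fits T ⟨z.pos, rfl⟩ a, Finset.mul_sum]
    refine Finset.sum_congr rfl fun j _ => ?_
    by_cases hj : f j = f z.pos ∧ Fits T (f z.pos) a j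
    · have h1 : ¬ j < z.pos := by
        intro hlt
        have h3 : T (f z.pos) ⟨j, hj.1, z.pos, hlt, rfl⟩ ≤ z.val :=
          Letter.le_val (z := z) (e := ⟨j, hj.1, z.pos, hlt, rfl⟩) rfl hlt
        exact lt_irrefl _ ((hj.2 ⟨j, hj.1, z.pos, hlt, rfl⟩).1 (lt_of_le_of_lt h3 ha))
      simp only [hj, and_self, if_true, h1, h2, and_false, or_self, ha.not_gt, mul_one]
    · simp [hj]

theorem sum_ite_val_eq {i : Fin k} (c : Fin (m i) → Prop) [DecidablePred c]
    (t : Junction f i → Fin (m i)) :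
    ∑ a, (if c a then (1 : ZMod 2) else 0) * (1 + ∑ e, if t e = a then 1 else 0) =
      (∑ a, if c a then 1 else 0) + ∑ e, if c (t e) then 1 else 0 := by
  simp only [mul_add, mul_one, Finset.sum_add_distrib, Finset.mul_sum]
  rw [Finset.sum_comm]
  congr 1
  refine Finset.sum_congr rfl fun e _ => ?_
  simp

/-- The first sum collects the letters in blocks of smaller label, the rest those in the block of
`z`, counted with the junctions inside each piece by means of `count_fits`. -/
theorem nb_label_eq (hf : Function.Surjective f) (g : ∀ i, Fin (m i) → Fin (l i)) (z : Letter T) :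
    nb (label g) z =
      (∑ i', if i' < f z.pos then ((m i' : ZMod 2) + Fintype.card (Junction f i')) else 0) +
      (nb (g (f z.pos)) z.val + ∑ e : Junction f (f z.pos),
        if g _ (T _ e) < g _ z.val ∨ (g _ (T _ e) = g _ z.val ∧ T _ e < z.val) then 1 else 0) +
      ∑ e : Junction f (f z.pos), if e.1 < z.pos ∧ T (f z.pos) e = z.val then 1 else 0 := by
  classical
  have h0 : nb (label g) z = ∑ z' : Letter T,
      if finSigmaFinEquiv ⟨f z'.pos, g _ z'.val⟩ < label g z ∨
        (finSigmaFinEquiv ⟨f z'.pos, g _ z'.val⟩ = label g z ∧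
          (z'.pos < z.pos ∨ z'.pos = z.pos ∧ (z'.val : ℕ) < z.val)) then 1 else 0 := by
    rw [nb]
    refine Finset.sum_congr rfl fun z' _ => ?_
    refine if_congr ?_ rfl rfl
    rw [Letter.lt_iff]
    rfl
  rw [h0, sum_letter (T := T) (fun i' a j => if finSigmaFinEquiv ⟨i', g _ a⟩ < label g z ∨
        (finSigmaFinEquiv ⟨i', g _ a⟩ = label g z ∧
          (j < z.pos ∨ j = z.pos ∧ (a : ℕ) < z.val)) then (1 : ZMod 2) else 0)]
  have h1 : ∀ i', (∑ a, ∑ j, if f j = i' ∧ Fits T i' a j then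
      (if finSigmaFinEquiv ⟨i', g _ a⟩ < label g z ∨
        (finSigmaFinEquiv ⟨i', g _ a⟩ = label g z ∧
          (j < z.pos ∨ j = z.pos ∧ (a : ℕ) < z.val)) then (1 : ZMod 2) else 0) else 0) =
      (if i' < f z.pos then ((m i' : ZMod 2) + Fintype.card (Junction f i')) else 0) +
      if i' = f z.pos then ((nb (g (f z.pos)) z.val + ∑ e : Junction f (f z.pos),
        if g _ (T _ e) < g _ z.val ∨ (g _ (T _ e) = g _ z.val ∧ T _ e < z.val) then 1 else 0) +
      ∑ e : Junction f (f z.pos), if e.1 < z.pos ∧ T (f z.pos) e = z.val then 1 else 0) else 0 := by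
    intro i'
    rcases lt_trichotomy i' (f z.pos) with h | rfl | h
    · rw [if_pos h, if_neg h.ne, add_zero]
      have h2 : ∀ a, finSigmaFinEquiv ⟨i', g i' a⟩ < label g z := fun a =>
        (finSigma_lt _ _).2 (Or.inl h)
      simp only [h2, true_or, if_true, count_fits T (hf i')]
      have := sum_ite_val_eq (fun _ => True) (T i')
      simpa using this
    · rw [if_neg (lt_irrefl _), if_pos rfl, zero_add]
      have h2 : ∀ a, finSigmaFinEquiv ⟨f z.pos, g _ a⟩ < label g z ↔ g _ a < g _ z.val := by
        intro a
        refine (finSigma_lt _ _).trans ?_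
        simp
      have h3 : ∀ a, finSigmaFinEquiv ⟨f z.pos, g _ a⟩ = label g z ↔ g _ a = g _ z.val := by
        intro a
        rw [label, EmbeddingLike.apply_eq_iff_eq]
        simp
      simp only [h2, h3, sum_fits_le g z]
      rw [Finset.sum_add_distrib, sum_ite_val_eq (fun a => g _ a < g _ z.val ∨
        (g _ a = g _ z.val ∧ a < z.val)) (T (f z.pos))]
      simp only [nb, Finset.sum_ite_eq', Finset.mem_univ, if_true]
    · rw [if_neg h.not_gt, if_neg h.ne', add_zero]
      refine Finset.sum_eq_zero fun a _ => Finset.sum_eq_zero fun j _ => ?_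
      have h2 : label g z < finSigmaFinEquiv ⟨i', g i' a⟩ := (finSigma_lt _ _).2 (Or.inl h)
      simp [h2.not_gt, h2.ne']
  simp only [h1, Finset.sum_add_distrib, Finset.sum_ite_eq', Finset.mem_univ, if_true]
  ring

/-- The contribution of the junctions to the sign of the gaps in the element `z` of a composite
sequence. -/
def mixedSign (g : ∀ i, Fin (m i) → Fin (l i)) (z : Letter T) : ZMod 2 :=
  ∑ e : Junction f (f z.pos), ((if z.pos ≤ e.1 ∧ g _ (T _ e) < g _ z.val then 1 else 0) +
    if e.1 < z.pos ∧ g _ z.val < g _ (T _ e) then 1 else 0)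

/-- A single gap contributes the same sign to the composite as to `f` and `g` together, once its
inversions with the junctions of its block are included. The last summand on the left depends only
on the label, hence later only on degrees. -/
theorem letter_sign (hf : Function.Surjective f) (g : ∀ i, Fin (m i) → Fin (l i)) (z : Letter T) :
    (nb f z.pos + ((f z.pos : ℕ) : ZMod 2)) +
      (nb (g (f z.pos)) z.val + ((g (f z.pos) z.val : ℕ) : ZMod 2)) + mixedSign g z +
      (∑ i', if i' < f z.pos then ((m i' : ZMod 2) + l i') else 0) =
    nb (label g) z + ((label g z : ℕ) : ZMod 2) := by
  rw [nb_label_eq hf, nb_eq_sum hf rfl, label, finSigma_val, mixedSign]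
  have h1 : ((f z.pos : ℕ) : ZMod 2) = ∑ i', if i' < f z.pos then 1 else 0 := by
    rw [Finset.sum_boole]
    congr 1
    have : (Finset.univ.filter fun i' => i' < f z.pos) = Finset.Iio (f z.pos) := by ext; simp
    rw [this, Fin.card_Iio]
  rw [h1]
  push_cast
  -- The comparison holds for each junction separately.
  have h2 : ∀ e : Junction f (f z.pos), (if e.1 < z.pos then (1 : ZMod 2) else 0) +
      ((if z.pos ≤ e.1 ∧ g _ (T _ e) < g _ z.val then 1 else 0) +
        if e.1 < z.pos ∧ g _ z.val < g _ (T _ e) then 1 else 0) =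
      (if g _ (T _ e) < g _ z.val ∨ (g _ (T _ e) = g _ z.val ∧ T _ e < z.val) then 1 else 0) +
      if e.1 < z.pos ∧ T (f z.pos) e = z.val then 1 else 0 := by
    intro e
    by_cases he : e.1 < z.pos
    · have h3 : T _ e ≤ z.val := Letter.le_val (z := z) rfl he
      rcases h3.lt_or_eq with h4 | h4
      · rcases lt_trichotomy (g _ (T _ e)) (g _ z.val) with h5 | h5 | h5
        · simp [he, he.not_ge, h4, h4.ne, h5, h5.not_gt]
        · simp [he, he.not_ge, h4, h4.ne, h5]
        · simp [he, he.not_ge, h4.ne, h5, h5.not_gt, h5.ne', zmod_two_add_self]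
      · simp [he, he.not_ge, h4]
    · have h3 : z.val ≤ T _ e := Letter.val_le_of_le (z := z) rfl (not_lt.1 he)
      simp [he, not_lt.1 he, h3.not_gt]
  have h3 := Finset.sum_congr rfl fun e (_ : e ∈ (Finset.univ : Finset (Junction f (f z.pos)))) => h2 e
  simp only [Finset.sum_add_distrib] at h3
  have h4 : ∀ (A : Fin k → ZMod 2) (B : Fin k → ZMod 2),
      (∑ i', if i' < f z.pos then A i' else 0) + (∑ i', if i' < f z.pos then B i' else 0) =
      ∑ i', if i' < f z.pos then A i' + B i' else 0 := by
    intro A B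
    rw [← Finset.sum_add_distrib]
    refine Finset.sum_congr rfl fun i' _ => ?_
    split_ifs <;> simp
  have h5 : (∑ i', if i' < f z.pos then ((Fintype.card (Junction f i') : ZMod 2) + 1) else 0) +
      (∑ i', if i' < f z.pos then (1 : ZMod 2) else 0) +
      (∑ i', if i' < f z.pos then ((m i' : ZMod 2) + l i') else 0) =
      (∑ i', if i' < f z.pos then ((m i' : ZMod 2) + Fintype.card (Junction f i')) else 0) +
      (∑ i', if i' < f z.pos then (l i' : ZMod 2) else 0) := by
    rw [h4, h4, h4]
    refine Finset.sum_congr rfl fun i' _ => ?_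
    split_ifs
    · have := zmod_two_add_self 1
      linear_combination this
    · rfl
  simp only [Finset.sum_add_distrib]
  linear_combination h3 + h5

theorem label_toLetter {J : Fin q → L} (g : ∀ i, Fin (m i) → Fin (l i))
    (K : ∀ i, Gap f J i →o Fin (m i)) {i : Fin k} {s : Fin q} (hs : f (J s) = i) :
    label g (toLetter K s) = finSigmaFinEquiv ⟨i, g i (K i (Gap.gap ⟨s, hs⟩))⟩ := by
  subst hs
  rfl

/-- The contribution of pairs of junctions to the sign of a composite. -/
def junctionSign (g : ∀ i, Fin (m i) → Fin (l i)) (T : ∀ i, Junction f i →o Fin (m i)) : ZMod 2 :=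
  ∑ i, ((∑ e, ∑ e', if e < e' ∧ g i (T i e') < g i (T i e) then 1 else 0) +
    ∑ e, (nb (g i) (T i e) + ((g i (T i e) : ℕ) : ZMod 2)))

/-- A pair of gaps is inverted by the composite labels if it is inverted by `f`, or if the `f`
labels agree and it is inverted by `g`. The remaining terms of the signs of the blocks involve
junctions: pairs of a gap and a junction are absorbed by `letter_sign`, while pairs of junctions and
single junctions form a sign that depends only on the junction values. -/
theorem composite_sign (hf : Function.Surjective f) (J : Fin q →o L)
    (g : ∀ i, Fin (m i) → Fin (l i)) (K : ∀ i, Gap f J i →o Fin (m i)) :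
    geps f J + ∑ i, geps (g i) (K i) +
      (∑ s, ∑ i', if i' < f (J s) then ((m i' : ZMod 2) + l i') else 0) =
    geps (label g) (toLetter K) + junctionSign g (cutJunctions K) := by
  classical
  have hexp : ∀ i, geps (g i) (K i) =
      (∑ s : {s // f (J s) = i}, ∑ s' : {s // f (J s) = i}, if (s : Fin q) < s' ∧
        g i (K i (Gap.gap s')) < g i (K i (Gap.gap s)) then (1 : ZMod 2) else 0) +
      (∑ s : {s // f (J s) = i}, ∑ e : Junction f i,
        ((if J s ≤ e.1 ∧ g i (K i (Gap.junction e)) < g i (K i (Gap.gap s)) then 1 else 0) +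
         if e.1 < J s ∧ g i (K i (Gap.gap s)) < g i (K i (Gap.junction e)) then 1 else 0)) +
      (∑ s : {s // f (J s) = i}, (nb (g i) (K i (Gap.gap s)) +
        ((g i (K i (Gap.gap s)) : ℕ) : ZMod 2))) +
      ((∑ e, ∑ e', if e < e' ∧ g i (cutJunctions K i e') < g i (cutJunctions K i e) then 1 else 0) +
        ∑ e, (nb (g i) (cutJunctions K i e) + ((g i (cutJunctions K i e) : ℕ) : ZMod 2))) := by
    intro i
    rw [geps, sum_gap, sum_gap]
    simp only [sum_gap, Finset.sum_add_distrib]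
    have h1 : ∀ s s' : {s // f (J s) = i}, (Gap.gap s : Gap f J i) < Gap.gap s' ↔ (s : Fin q) < s' :=
      fun s s' => by rw [lt_iff_not_ge, Gap.gap_le_gap_iff, not_le, Subtype.coe_lt_coe]
    have h2 : ∀ (s : {s // f (J s) = i}) (e : Junction f i),
        (Gap.gap s : Gap f J i) < Gap.junction e ↔ J s ≤ e.1 :=
      fun s e => by rw [lt_iff_not_ge, Gap.junction_le_gap_iff, not_lt]
    have h3 : ∀ (s : {s // f (J s) = i}) (e : Junction f i),
        (Gap.junction e : Gap f J i) < Gap.gap s ↔ e.1 < J s :=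
      fun s e => by rw [lt_iff_not_ge, Gap.gap_le_junction_iff, not_le]
    have h4 : ∀ e e' : Junction f i, (Gap.junction e : Gap f J i) < Gap.junction e' ↔ e < e' :=
      fun e e' => by rw [lt_iff_not_ge, Gap.junction_le_junction_iff, not_le]
    simp only [h1, h2, h3, h4]
    rw [Finset.sum_comm (f := fun (e : Junction f i) (s : {s // f (J s) = i}) =>
      if e.1 < J s ∧ g i (K i (Gap.gap s)) < g i (K i (Gap.junction e)) then (1 : ZMod 2) else 0)]
    have h5 : ∀ e, cutJunctions K i e = K i (Gap.junction e) := fun _ => rfl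
    simp only [h5]
    ring
  have hgg : ∀ i, (∑ s : {s // f (J s) = i}, ∑ s' : {s // f (J s) = i}, if (s : Fin q) < s' ∧
        g i (K i (Gap.gap s')) < g i (K i (Gap.gap s)) then (1 : ZMod 2) else 0) =
      ∑ s : {s // f (J s) = i}, ∑ s', if f (J s') = i then (if (s : Fin q) < s' ∧
        label g (toLetter K s') < label g (toLetter K s) then 1 else 0) else 0 := by
    intro i
    refine Finset.sum_congr rfl fun s _ => ?_
    have hsub := Finset.sum_subtype (p := fun s' => f (J s') = i) (F := inferInstance)
      (Finset.univ.filter fun s' => f (J s') = i) (by simp)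
      fun s' => if (s : Fin q) < s' ∧ label g (toLetter K s') < label g (toLetter K s) then
        (1 : ZMod 2) else 0
    rw [Finset.sum_filter] at hsub
    rw [hsub]
    refine Finset.sum_congr rfl fun s' _ => ?_
    refine if_congr ?_ rfl rfl
    rw [label_toLetter g K s.2, label_toLetter g K s'.2, finSigma_lt]
    simp
  simp only [hexp, hgg]
  rw [Finset.sum_add_distrib, Finset.sum_add_distrib, Finset.sum_add_distrib,
    sum_fiber (fun s => f (J s)) (fun i s => ∑ s', if f (J s') = i then (if (s : Fin q) < s' ∧
        label g (toLetter K s') < label g (toLetter K s) then (1 : ZMod 2) else 0) else 0),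
    sum_fiber (fun s => f (J s)) (fun i s => ∑ e : Junction f i,
        ((if J s ≤ e.1 ∧ g i (K i (Gap.junction e)) < g i (K i (Gap.gap s)) then (1 : ZMod 2)
          else 0) +
         if e.1 < J s ∧ g i (K i (Gap.gap s)) < g i (K i (Gap.junction e)) then 1 else 0)),
    sum_fiber (fun s => f (J s)) (fun i s => nb (g i) (K i (Gap.gap s)) +
        ((g i (K i (Gap.gap s)) : ℕ) : ZMod 2))]
  have hls : (∑ s, (nb f (J s) + ((f (J s) : ℕ) : ZMod 2))) +
      (∑ s, (nb (g _) (K _ (Gap.gap ⟨s, rfl⟩)) +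
        ((g _ (K (f (J s)) (Gap.gap ⟨s, rfl⟩)) : ℕ) : ZMod 2))) +
      (∑ s, ∑ e : Junction f (f (J s)),
        ((if J s ≤ e.1 ∧ g _ (K _ (Gap.junction e)) < g _ (K _ (Gap.gap ⟨s, rfl⟩)) then
          (1 : ZMod 2) else 0) +
         if e.1 < J s ∧ g _ (K _ (Gap.gap ⟨s, rfl⟩)) < g _ (K _ (Gap.junction e)) then 1 else 0)) +
      (∑ s, ∑ i', if i' < f (J s) then ((m i' : ZMod 2) + l i') else 0) =
      ∑ s, (nb (label g) (toLetter K s) + ((label g (toLetter K s) : ℕ) : ZMod 2)) := by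
    rw [← Finset.sum_add_distrib, ← Finset.sum_add_distrib, ← Finset.sum_add_distrib]
    exact Finset.sum_congr rfl fun s _ => letter_sign hf g (toLetter K s)
  have hpair : (∑ s, ∑ s', if s < s' ∧ f (J s') < f (J s) then (1 : ZMod 2) else 0) +
      (∑ s, ∑ s', if f (J s') = f (J s) then (if s < s' ∧
        label g (toLetter K s') < label g (toLetter K s) then (1 : ZMod 2) else 0) else 0) =
      ∑ s, ∑ s', if s < s' ∧ label g (toLetter K s') < label g (toLetter K s) then 1 else 0 := by
    rw [← Finset.sum_add_distrib]
    refine Finset.sum_congr rfl fun s _ => ?_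
    rw [← Finset.sum_add_distrib]
    refine Finset.sum_congr rfl fun s' _ => ?_
    have h1 : label g (toLetter K s') < label g (toLetter K s) ↔ f (J s') < f (J s) ∨
        (f (J s') = f (J s) ∧ ((g _ (toLetter K s').val : Fin _) : ℕ) <
          (g _ (toLetter K s).val : Fin _)) := finSigma_lt _ _
    rcases lt_trichotomy (f (J s')) (f (J s)) with h | h | h
    · simp [h1, h, h.ne]
    · simp [h]
    · simp [h1, h.not_gt, h.ne']
  rw [geps, geps, junctionSign]
  linear_combination hpair + hls

end Sign

/-! ## Composites of sequence operations -/

section Composite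

variable {L : Type*} [LinearOrder L] [Fintype L] {k q : ℕ} {m l : Fin k → ℕ} {f : L → Fin k}

/-- The number of junctions. -/
def junctions (f : L → Fin k) (i : Fin k) : ℕ := Fintype.card (Junction f i)

theorem card_letter (hf : Function.Surjective f) (T : ∀ i, Junction f i →o Fin (m i)) :
    Fintype.card (Letter T) = ∑ i, (m i + junctions f i) := by
  simp only [junctions]
  classical
  rw [← Finset.card_univ, Finset.card_eq_sum_ones,
    sum_letter (T := T) (fun _ _ _ => (1 : ℕ))]
  refine Finset.sum_congr rfl fun i _ => ?_
  have h : ∀ a, (∑ j, if f j = i ∧ Fits T i a j then 1 else 0) =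
      1 + ∑ e, if T i e = a then 1 else 0 := count_fits (R := ℕ) T (hf i)
  rw [Finset.sum_congr rfl fun a _ => h a, Finset.sum_add_distrib, Finset.sum_comm]
  simp

theorem card_eq_sum_junction (hf : Function.Surjective f) :
    Fintype.card L = ∑ i, (junctions f i + 1) := by
  simp only [junctions]
  classical
  rw [← Finset.card_univ, Finset.card_eq_sum_card_fiberwise (f := f) (t := Finset.univ) (by simp)]
  exact Finset.sum_congr rfl fun i _ => card_fibre_eq (hf i)

theorem monom_label {X : TopCat.{u}} (J : Fin q →o L) (g : ∀ i, Fin (m i) → Fin (l i))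
    (K : ∀ i, Gap f J i →o Fin (m i)) (x : Fin (∑ i, l i) → cochains X) (σ : Sing X q) :
    monom (label g) x σ (gpiece (toLetter K)) =
      ∏ i, ∏ b, ev (face σ (sublabelled (g i) (K i) b)) (x (finSigmaFinEquiv ⟨i, b⟩)) := by
  rw [monom, ← finSigmaFinEquiv.prod_comp, Fintype.prod_sigma]
  refine Finset.prod_congr rfl fun i _ => Finset.prod_congr rfl fun b _ => ?_
  exact congrArg (fun B => ev (face σ B) (x (finSigmaFinEquiv ⟨i, b⟩))) (labelled_label g K i b)

/-- The product over the blocks of the sums over their cuts is a sum over families `K`;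
`combine_bijective` reorganizes the double sum over `J` and `K` into one over `T` and cuts along the
composite sequence. -/
theorem core_composite {X : TopCat.{u}} (hf : Function.Surjective f)
    {g : ∀ i, Fin (m i) → Fin (l i)} (hg : ∀ i, Function.Surjective (g i))
    (x : Fin (∑ i, l i) → cochains X) (w : Fin k → cochains X) (e : Fin k → ℤ)
    (hw : ∀ i, IsHom (e i) (w i)) (c : Fin k → ℤ) (hc0 : ∀ i, c i ≠ 0)
    (hc : ∀ i (n : ℕ) (τ : Sing X n),
      ev τ (w i) = c i * core (g i) (fun b => x (finSigmaFinEquiv ⟨i, b⟩)) τ)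
    (σ : Sing X q) :
    core f w σ = (∏ i, c i) *
      (zs (∑ i, ∑ i', if i' < i then
        ((e i : ZMod 2) + junctions f i) * ((m i' : ZMod 2) + l i') else 0) *
      ∑ T : ∀ i, Junction f i →o Fin (m i), zs (junctionSign g T) * core (label g : Letter T → _) x σ) := by
  classical
  simp only [junctions]
  set E := ∑ i, ∑ i', if i' < i then
        ((e i : ZMod 2) + Fintype.card (Junction f i)) * ((m i' : ZMod 2) + l i') else 0 with hE
  have hJ : ∀ J : Fin q →o L, zs (geps f J) * monom f w σ (gpiece J) = (∏ i, c i) * (zs E *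
      ∑ K : ∀ i, Gap f J i →o Fin (m i), zs (junctionSign g (cutJunctions K)) *
        (zs (geps (label g) (toLetter K)) * monom (label g) x σ (gpiece (toLetter K)))) := by
    intro J
    have hexp : monom f w σ (gpiece J) = (∏ i, c i) * ∑ K : ∀ i, Gap f J i →o Fin (m i),
        zs (∑ i, geps (g i) (K i)) * monom (label g) x σ (gpiece (toLetter K)) := by
      rw [monom]
      simp only [hc]
      rw [Finset.prod_mul_distrib]
      congr 1
      rw [Finset.prod_congr rfl fun i _ => core_face_labelled (hf i) J (hg i) _ σ,
        Finset.prod_univ_sum, Fintype.piFinset_univ]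
      refine Finset.sum_congr rfl fun K _ => ?_
      rw [Finset.prod_mul_distrib, zs_sum, monom_label]
    have hS : zs (geps f J) * monom f w σ (gpiece J) = (∏ i, c i) *
        (zs (∑ s, ∑ i', if i' < f (J s) then ((m i' : ZMod 2) + l i') else 0) *
      ∑ K : ∀ i, Gap f J i →o Fin (m i), zs (junctionSign g (cutJunctions K)) *
        (zs (geps (label g) (toLetter K)) * monom (label g) x σ (gpiece (toLetter K)))) := by
      rw [hexp, Finset.mul_sum, Finset.mul_sum, Finset.mul_sum, Finset.mul_sum]
      refine Finset.sum_congr rfl fun K _ => ?_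
      have h2 := composite_sign hf J g K
      set E' := ∑ s, ∑ i', if i' < f (J s) then ((m i' : ZMod 2) + l i') else 0
      have h3 : geps f J + ∑ i, geps (g i) (K i) =
          E' + (junctionSign g (cutJunctions K) + geps (label g) (toLetter K)) := by
        have := zmod_two_add_self E'
        linear_combination h2 - this
      have h4 := congrArg zs h3
      simp only [zs_add] at h4
      linear_combination (∏ i, c i) * monom (label g) x σ (gpiece (toLetter K)) * h4
    -- In the right degrees, the number of gaps labelled `i` is `e i` minus the number of junctions,
    -- so the remaining sign does not depend on `J`.
    by_cases hdeg : ∀ i, (((labelled f (gpiece J) i).card - 1 : ℕ) : ℤ) = e i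
    · have hE' : (∑ s, ∑ i', if i' < f (J s) then ((m i' : ZMod 2) + l i') else 0) = E := by
        have h1 := sum_fiber (fun s => f (J s)) (fun i (_ : {s // f (J s) = i}) =>
          ∑ i', if i' < i then ((m i' : ZMod 2) + l i') else 0)
        rw [← h1, hE]
        refine Finset.sum_congr rfl fun i _ => ?_
        rw [Finset.sum_const, Finset.card_univ, nsmul_eq_mul, Finset.mul_sum]
        refine Finset.sum_congr rfl fun i' _ => ?_
        split_ifs
        · congr 1
          rw [← hdeg i, card_labelled_eq (hf i), card_gap, Fintype.card_subtype]
          push_cast [Nat.add_sub_cancel]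
          have := zmod_two_add_self (Fintype.card (Junction f i) : ZMod 2)
          linear_combination -this
        · simp
      rw [hS, hE']
    · push Not at hdeg
      obtain ⟨i, hi⟩ := hdeg
      have h0 : monom f w σ (gpiece J) = 0 := monom_eq_zero hw hi
      -- In the wrong degrees the sign is out of control, but then `hS` shows that the sum over cuts
      -- is itself zero, because its coefficient is not.
      rw [h0, mul_zero] at hS ⊢
      have h1 : ∏ i, c i ≠ 0 := Finset.prod_ne_zero_iff.2 fun i _ => hc0 i
      have h2 := (mul_eq_zero.1 ((mul_eq_zero.1 hS.symm).resolve_left h1)).resolve_left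
        (zs_ne_zero _)
      rw [h2, mul_zero, mul_zero]
  rw [core, Finset.sum_congr rfl fun J _ => hJ J, ← Finset.mul_sum, ← Finset.mul_sum]
  congr 2
  rw [Finset.sum_sigma']
  have hs : ∀ T : ∀ i, Junction f i →o Fin (m i),
      zs (junctionSign g T) * core (label g : Letter T → _) x σ = ∑ J' : Fin q →o Letter T,
        zs (junctionSign g T) * (zs (geps (label g) J') * monom (label g) x σ (gpiece J')) := by
    intro T
    rw [core, Finset.mul_sum]
  simp only [hs]
  rw [Finset.sum_sigma']
  exact Fintype.sum_bijective combine combine_bijective _ _ fun _ => rfl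

end Composite

/-! ## Sequence operations of maps on finite linear orders -/

/-- The sequence operation of a map which is defined on a finite linear order. -/
def seqOpOn {L : Type*} [LinearOrder L] [Fintype L] {k : ℕ} (f : L → Fin k) : Family.{u} k :=
  seqOp (f ∘ Fintype.orderIsoFinOfCardEq L rfl)

theorem seqOpOn_apply {L : Type*} [LinearOrder L] [Fintype L] {k q : ℕ} {X : TopCat.{u}}
    {f : L → Fin k} (hf : Function.Surjective f) {x : Fin k → cochains X} {p : Fin k → ℤ}
    (hx : ∀ i, IsHom (p i) (x i)) (σ : Sing X q) :
    (seqOpOn f X x).1 q σ = zs ((Fintype.card L : ZMod 2) + k) *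
      (zs (revSign fun i => (p i : ZMod 2)) * core f x σ) := by
  refine (seqOp_eq_core (hf.comp (Fintype.orderIsoFinOfCardEq L rfl).surjective) hx σ).trans ?_
  rw [core_comp_orderIso, sgn_eq_zs]
  congr 2
  push_cast
  rw [sub_eq_add_neg, CharTwo.neg_eq]

theorem ev_face_eq_zero {X : TopCat.{u}} {q : ℕ} (σ : Sing X q) {B : Multiset (Fin (q + 1))}
    (hB : ¬ B.Nodup) : ev (face σ B) = 0 := by
  ext x
  refine x.2.1 _ _ (degenerate_of_not_injective _ _ fun hinj => hB ?_)
  have hB0 : B ≠ 0 := by rintro rfl; exact hB Multiset.nodup_zero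
  rw [← univ_map_vertexMap B hB0]
  exact Multiset.Nodup.map hinj Finset.univ.nodup

/-- Adjacent pieces with the same label share a vertex, which then occurs twice in their block, so
the corresponding face is degenerate. Hence the sequences produced by composition or deletion need
only be surjective. -/
theorem seqOp_eq_zero {m k : ℕ} {f : Fin m → Fin k} {j j' : Fin m} (hj : (j : ℕ) + 1 = j')
    (hf : f j = f j') : seqOp.{u} f = 0 := by
  funext X
  ext1 x
  refine cochain_ext fun q σ => ?_
  change seqValue f X q σ x = 0
  rw [seqValue, smul_apply, sum_apply, Finset.sum_eq_zero, smul_zero]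
  intro A _
  rw [smul_apply, MultilinearMap.compLinearMap_apply, MultilinearMap.mkPiAlgebra_apply,
    Finset.prod_eq_zero (Finset.mem_univ (f j)), smul_zero]
  rw [ev_face_eq_zero]
  · rfl
  rw [Multiset.nodup_iff_count_le_one]
  push Not
  -- The repeated vertex is the overlap point of the two pieces.
  refine ⟨A.1 j.succ, ?_⟩
  have hjj : j.succ = j'.castSucc := by ext; simpa using hj
  have h1 : A.1 j.castSucc ≤ A.1 j.succ := A.2.1 (Fin.castSucc_lt_succ).le
  have h2 : A.1 j'.castSucc ≤ A.1 j'.succ := A.2.1 (Fin.castSucc_lt_succ).le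
  have hne : j ≠ j' := by rintro rfl; omega
  have hsub : ({j, j'} : Finset (Fin m)) ⊆ Finset.univ.filter fun i => f i = f j := by
    intro i
    simp only [Finset.mem_insert, Finset.mem_singleton, Finset.mem_filter, Finset.mem_univ, true_and]
    rintro (rfl | rfl)
    · rfl
    · exact hf.symm
  have h3 : ∀ i ∈ ({j, j'} : Finset (Fin m)), 1 ≤ (A.piece i).val.count (A.1 j.succ) := by
    intro i
    simp only [Finset.mem_insert, Finset.mem_singleton]
    rintro (rfl | rfl)
    · exact Multiset.one_le_count_iff_mem.2 (Finset.mem_Icc.2 ⟨h1, le_rfl⟩)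
    · exact Multiset.one_le_count_iff_mem.2 (Finset.mem_Icc.2
        ⟨(congrArg A.1 hjj).ge, (congrArg A.1 hjj).le.trans h2⟩)
  calc 1 < ∑ i ∈ ({j, j'} : Finset (Fin m)), 1 := by rw [Finset.sum_pair hne]; norm_num
    _ ≤ ∑ i ∈ ({j, j'} : Finset (Fin m)), (A.piece i).val.count (A.1 j.succ) :=
      Finset.sum_le_sum h3
    _ ≤ _ := by
      rw [block, Multiset.count_sum']
      exact Finset.sum_le_sum_of_subset hsub

theorem seqOp_mem_S {m k : ℕ} {f : Fin m → Fin k} (hf : Function.Surjective f) :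
    seqOp.{u} f ∈ S k ((m : ℤ) - k) := by
  by_cases h : Nondegenerate f
  · exact Submodule.subset_span ⟨m, f, h, rfl, rfl⟩
  · have : ∃ j j' : Fin m, (j : ℕ) + 1 = j' ∧ f j = f j' := by
      by_contra! h'
      exact h ⟨hf, h'⟩
    obtain ⟨j, j', h1, h2⟩ := this
    rw [seqOp_eq_zero h1 h2]
    exact zero_mem _

theorem seqOpOn_mem_S {L : Type*} [LinearOrder L] [Fintype L] {k : ℕ} {f : L → Fin k}
    (hf : Function.Surjective f) : seqOpOn.{u} f ∈ S k ((Fintype.card L : ℤ) - k) :=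
  seqOp_mem_S (hf.comp (Equiv.surjective _))

/-! ## Degrees -/

/-- The blocks together have as many vertices as there are gaps and pieces, so the dimensions of the
blocks add up to `q + |L| - k`. -/
theorem core_eq_zero {L : Type*} [LinearOrder L] [Fintype L] {k q : ℕ} {X : TopCat.{u}}
    {f : L → Fin k} (hf : Function.Surjective f) {x : Fin k → cochains X} {p : Fin k → ℤ}
    (hx : ∀ i, IsHom (p i) (x i)) (σ : Sing X q)
    (hq : (q : ℤ) ≠ ∑ i, p i - ((Fintype.card L : ℤ) - k)) : core f x σ = 0 := by
  classical
  refine Finset.sum_eq_zero fun J _ => ?_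
  have : ∃ i, (((labelled f (gpiece J) i).card - 1 : ℕ) : ℤ) ≠ p i := by
    by_contra! h
    apply hq
    have h1 : ∑ i, p i = ∑ i, (((labelled f (gpiece J) i).card : ℤ) - 1) := by
      refine Finset.sum_congr rfl fun i _ => ?_
      rw [← h i]
      have := Multiset.card_pos.2 (labelled_ne_zero hf J i)
      omega
    have h2 : ∑ i, ((labelled f (gpiece J) i).card : ℤ) = q + Fintype.card L := by
      simp only [card_labelled]
      push_cast
      rw [Finset.sum_add_distrib]
      have e1 := Finset.card_eq_sum_card_fiberwise (f := fun s => f (J s)) (s := Finset.univ)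
        (t := Finset.univ) (by simp)
      have e2 := Finset.card_eq_sum_card_fiberwise (f := f) (s := Finset.univ)
        (t := Finset.univ) (by simp)
      rw [Finset.card_univ, Fintype.card_fin] at e1
      rw [Finset.card_univ] at e2
      have e3 := congrArg (Nat.cast : ℕ → ℤ) e1
      have e4 := congrArg (Nat.cast : ℕ → ℤ) e2
      push_cast at e3 e4
      rw [e3, e4]
    rw [h1, Finset.sum_sub_distrib, h2]
    simp
  obtain ⟨i, hi⟩ := this
  rw [monom_eq_zero hx hi, mul_zero]

theorem isHom_seqOp {m k : ℕ} {X : TopCat.{u}} {f : Fin m → Fin k}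
    (hf : Function.Surjective f) {x : Fin k → cochains X} {p : Fin k → ℤ}
    (hx : ∀ i, IsHom (p i) (x i)) : IsHom (∑ i, p i - ((m : ℤ) - k)) (seqOp f X x) := by
  intro q hq
  funext σ
  rw [seqOp_eq_core hf hx, core_eq_zero hf hx σ (by rwa [Fintype.card_fin]), mul_zero, mul_zero]
  rfl

theorem ev_pullback {X Y : TopCat.{u}} (φ : X ⟶ Y) {q : ℕ} (σ : Sing X q) (y : cochains Y) :
    ev σ (pullback φ y) = ev (X := Y) ((TopCat.toSSet.map φ).app (op ⦋q⦌) σ : Sing Y q) y := rfl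

theorem seqOp_natural {m k : ℕ} (f : Fin m → Fin k) {X Y : TopCat.{u}} (φ : X ⟶ Y)
    (y : Fin k → cochains Y) :
    seqOp f X (fun i => pullback φ (y i)) = pullback φ (seqOp f Y y) := by
  refine cochain_ext fun q σ => ?_
  change seqValue f X q σ _ = seqValue f Y q _ y
  rw [seqValue, seqValue, smul_apply, smul_apply, sum_apply, sum_apply]
  congr 1

theorem S_le_N (k : ℕ) (n : ℤ) : S.{u} k n ≤ N k n := by
  refine Submodule.span_le.2 ?_
  rintro _ ⟨m, f, hf, rfl, rfl⟩
  refine ⟨fun X Y φ y => seqOp_natural f φ y, fun X x p hx q hq => ?_⟩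
  exact isHom_seqOp hf.1 (fun i => (hx i).isHom) q hq

/-! ## Composites -/

theorem comp_apply {k : ℕ} (j : Fin k → ℕ) (n : Fin k → ℤ) (ν : Family.{u} k)
    (μ : ∀ i, Family.{u} (j i)) (X : TopCat.{u}) (x : Fin (∑ i, j i) → cochains X) :
    comp j n ν μ X x = ν X fun i => μ i X fun b =>
      signMap X (∑ i', if i < i' then n i' else 0) (x (finSigmaFinEquiv ⟨i, b⟩)) := rfl

theorem signMap_apply {X : TopCat.{u}} {p : ℤ} {x : cochains X} (hx : IsHom p x) (e : ℤ) :
    signMap X e x = zs ((e : ZMod 2) * p) • x := by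
  refine cochain_ext fun q σ => ?_
  change sgn (e * q) * x.1 q σ = _ * x.1 q σ
  by_cases h : (q : ℤ) = p
  · rw [sgn_eq_zs, ← h]
    push_cast
    rfl
  · rw [hx q h]
    simp

theorem IsHom.smul {X : TopCat.{u}} {p : ℤ} {x : cochains X} (hx : IsHom p x) (a : ℤ) :
    IsHom p (a • x) := fun q hq => by
  change a • x.1 q = 0
  rw [hx q hq, smul_zero]

/-- Pairs of arguments are separated into those inside one block and those in two blocks. -/
theorem revSign_flatten {k : ℕ} {l : Fin k → ℕ} (p : Fin (∑ i, l i) → ZMod 2) :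
    revSign p = ∑ i, revSign (fun b => p (finSigmaFinEquiv ⟨i, b⟩)) +
      ∑ i, ∑ i', if i < i' then (∑ b, p (finSigmaFinEquiv ⟨i, b⟩)) *
        ∑ b, p (finSigmaFinEquiv ⟨i', b⟩) else 0 := by
  have h : revSign p = ∑ i, ∑ b : Fin (l i), ∑ i', ∑ b' : Fin (l i'),
      if finSigmaFinEquiv ⟨i, b⟩ < finSigmaFinEquiv (⟨i', b'⟩ : Σ i, Fin (l i)) then
        p (finSigmaFinEquiv ⟨i, b⟩) * p (finSigmaFinEquiv ⟨i', b'⟩) else 0 := by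
    rw [revSign, ← finSigmaFinEquiv.sum_comp, Fintype.sum_sigma]
    refine Finset.sum_congr rfl fun i _ => Finset.sum_congr rfl fun b _ => ?_
    rw [← finSigmaFinEquiv.sum_comp, Fintype.sum_sigma]
  rw [h, ← Finset.sum_add_distrib]
  refine Finset.sum_congr rfl fun i _ => ?_
  rw [Finset.sum_comm]
  have h2 : ∀ i', (∑ b, ∑ b' : Fin (l i'),
      if finSigmaFinEquiv ⟨i, b⟩ < finSigmaFinEquiv (⟨i', b'⟩ : Σ i, Fin (l i)) then
        p (finSigmaFinEquiv ⟨i, b⟩) * p (finSigmaFinEquiv ⟨i', b'⟩) else 0) =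
      (if i' = i then revSign (fun b => p (finSigmaFinEquiv ⟨i, b⟩)) else 0) +
      if i < i' then (∑ b, p (finSigmaFinEquiv ⟨i, b⟩)) *
        ∑ b, p (finSigmaFinEquiv ⟨i', b⟩) else 0 := by
    intro i'
    simp only [finSigma_lt]
    rcases lt_trichotomy i i' with h | rfl | h
    · simp [h, h.ne', Finset.sum_mul_sum]
    · simp only [lt_irrefl, true_and, false_or, if_true, if_false, add_zero, revSign, Fin.val_fin_lt]
    · simp [h.not_gt, h.ne, h.ne']
  rw [Finset.sum_congr rfl fun i' _ => h2 i', Finset.sum_add_distrib]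
  simp

/-- Evaluation of operations on given arguments and a given simplex. -/
def evalAt {k q : ℕ} (X : TopCat.{u}) (x : Fin k → cochains X) (σ : Sing X q) :
    Family.{u} k →ₗ[ℤ] ℤ where
  toFun ν := ev σ (ν X x)
  map_add' _ _ := rfl
  map_smul' _ _ := rfl

/-- On the left: the evaluation sign of the outer operation, the sign of moving the inner operations
past earlier arguments, and the sign from `core_composite`. On the right: the sign that stays in the
composite, and the part of the evaluation sign of all arguments that mixes blocks. -/
theorem koszul_identity {k : ℕ} (P n r : Fin k → ZMod 2) :
    revSign (fun i => P i + n i) + ∑ i, (∑ i', if i < i' then n i' else 0) * P i +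
      (∑ i, ∑ i', if i' < i then (P i + n i + r i) * n i' else 0) =
    (∑ i, ∑ i', if i < i' then n i * r i' else 0) + ∑ i, ∑ i', if i < i' then P i * P i' else 0 := by
  rw [Finset.sum_comm (f := fun i i' => if i' < i then (P i + n i + r i) * n i' else 0), revSign]
  simp only [Finset.sum_mul]
  simp only [← Finset.sum_add_distrib]
  refine Finset.sum_congr rfl fun i _ => Finset.sum_congr rfl fun i' _ => ?_
  split_ifs
  · linear_combination zmod_two_add_self (P i * n i') + zmod_two_add_self (n i * n i') +
      zmod_two_add_self (n i * P i')
  · simp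

/-- Only parities enter: `P i` is the total degree of the arguments of `g i`, `n i` the degree of `g
i`, `r i` the number of junctions labelled `i`, and `R i` the evaluation sign of the arguments of `g
i`. -/
theorem comp_seqOp_eq {k M q : ℕ} {m l : Fin k → ℕ} {f : Fin M → Fin k}
    (hf : Function.Surjective f) {g : ∀ i, Fin (m i) → Fin (l i)}
    (hg : ∀ i, Function.Surjective (g i)) {X : TopCat.{u}} {x : Fin (∑ i, l i) → cochains X}
    {p : Fin (∑ i, l i) → ℤ} (hx : ∀ c, IsHom (p c) (x c)) (σ : Sing X q) (N : Fin k → ℤ)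
    (P n r R : Fin k → ZMod 2) (hP : ∀ i, P i = ∑ b, (p (finSigmaFinEquiv ⟨i, b⟩) : ZMod 2))
    (hn : ∀ i, n i = (m i : ZMod 2) + l i) (hr : ∀ i, r i = junctions f i)
    (hR : ∀ i, R i = revSign fun b => (p (finSigmaFinEquiv ⟨i, b⟩) : ZMod 2)) :
    (seqOp f X fun i => seqOp (g i) X fun b => signMap X (N i) (x (finSigmaFinEquiv ⟨i, b⟩))).1 q σ =
      zs ((M : ZMod 2) + k) * (zs (revSign fun i => P i + n i) *
        (zs (∑ i, ((N i : ZMod 2) * P i + n i + R i)) *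
          (zs (∑ i, ∑ i', if i' < i then (P i + n i + r i) * n i' else 0) *
            ∑ T : ∀ i, Junction f i →o Fin (m i),
              zs (junctionSign g T) * core (label g : Letter T → _) x σ))) := by
  have hw0 : ∀ i, (seqOp (g i) X fun b => signMap X (N i) (x (finSigmaFinEquiv ⟨i, b⟩))) =
      zs ((N i : ZMod 2) * P i) • seqOp (g i) X fun b => x (finSigmaFinEquiv ⟨i, b⟩) := by
    intro i
    simp only [fun b => signMap_apply (hx (finSigmaFinEquiv ⟨i, b⟩)) (N i)]
    rw [MultilinearMap.map_smul_univ, ← zs_sum, ← Finset.mul_sum, hP]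
  have hwe : ∀ i, IsHom (∑ b, p (finSigmaFinEquiv ⟨i, b⟩) - ((m i : ℤ) - l i))
      (seqOp (g i) X fun b => signMap X (N i) (x (finSigmaFinEquiv ⟨i, b⟩))) := by
    intro i
    rw [hw0]
    exact (isHom_seqOp (hg i) fun b => hx (finSigmaFinEquiv ⟨i, b⟩)).smul _
  have hec : ∀ i, ((∑ b, p (finSigmaFinEquiv ⟨i, b⟩) - ((m i : ℤ) - l i) : ℤ) : ZMod 2) =
      P i + n i := by
    intro i
    rw [hP, hn]
    push_cast
    rw [sub_eq_add_neg, CharTwo.neg_eq, sub_eq_add_neg, CharTwo.neg_eq]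
  have hc : ∀ i (n' : ℕ) (τ : Sing X n'), ev τ
      (seqOp (g i) X fun b => signMap X (N i) (x (finSigmaFinEquiv ⟨i, b⟩))) =
      zs ((N i : ZMod 2) * P i + n i + R i) *
        core (g i) (fun b => x (finSigmaFinEquiv ⟨i, b⟩)) τ := by
    intro i n' τ
    rw [hw0]
    change zs _ * (seqOp (g i) X _).1 n' τ = _
    rw [seqOp_eq_core (hg i) fun b => hx (finSigmaFinEquiv ⟨i, b⟩), zs_add, zs_add, sgn_eq_zs, hn, hR]
    push_cast
    rw [sub_eq_add_neg, CharTwo.neg_eq]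
    ring
  rw [seqOp_eq_core hf hwe σ, core_composite hf hg x _ _ hwe _ (fun i => zs_ne_zero _) hc σ,
    sgn_eq_zs, ← zs_sum]
  simp only [hec, ← hr, ← hn]
  push_cast
  rw [sub_eq_add_neg, CharTwo.neg_eq]
  congr!

/-- The composite of sequence operations is a signed sum of the sequence operations of the
composite sequences. -/
theorem comp_seqOp {k M : ℕ} {m l : Fin k → ℕ} {f : Fin M → Fin k} (hf : Function.Surjective f)
    {g : ∀ i, Fin (m i) → Fin (l i)} (hg : ∀ i, Function.Surjective (g i)) :
    comp l (fun i => (m i : ℤ) - l i) (seqOp.{u} f) (fun i => seqOp (g i)) =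
      ∑ T : ∀ i, Junction f i →o Fin (m i),
        zs ((∑ i, ∑ i', if i < i' then ((m i : ZMod 2) + l i) * junctions f i' else 0) +
          junctionSign g T) • seqOpOn (label g : Letter T → _) := by
  refine family_ext fun X x p hx => cochain_ext fun q σ => ?_
  have hx' := fun i => (hx i).isHom
  rw [comp_apply]
  refine (comp_seqOp_eq hf hg hx' σ _ _ _ _ _ (fun _ => rfl) (fun _ => rfl) (fun _ => rfl)
    (fun _ => rfl)).trans ?_
  change _ = evalAt X x σ _
  rw [map_sum, Finset.mul_sum, Finset.mul_sum, Finset.mul_sum, Finset.mul_sum]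
  refine Finset.sum_congr rfl fun T _ => ?_
  rw [map_smul, smul_eq_mul]
  change _ = _ * (seqOpOn (label g) X x).1 q σ
  rw [seqOpOn_apply (label_surjective hf hg T) hx']
  simp only [← mul_assoc, ← zs_add]
  congr 2
  -- The degree of `⟨f⟩` is the total number of junctions of `f`.
  have hM : (M : ZMod 2) + k = ∑ i, (junctions f i : ZMod 2) := by
    have := card_eq_sum_junction hf
    rw [Fintype.card_fin] at this
    have h := congrArg (Nat.cast : ℕ → ZMod 2) this
    push_cast at h
    rw [h, Finset.sum_add_distrib]
    simp only [Finset.sum_const, Finset.card_univ, Fintype.card_fin, nsmul_eq_mul, mul_one]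
    linear_combination zmod_two_add_self (k : ZMod 2)
  have hT : (Fintype.card (Letter T) : ZMod 2) + ((∑ i, l i : ℕ) : ZMod 2) =
      ∑ i, ((m i : ZMod 2) + l i) + ∑ i, (junctions f i : ZMod 2) := by
    rw [card_letter hf]
    push_cast
    simp only [Finset.sum_add_distrib]
    ring
  have hN' : ∀ i, ((∑ i', if i < i' then (m i' : ℤ) - l i' else 0 : ℤ) : ZMod 2) =
      ∑ i', if i < i' then (m i' : ZMod 2) + l i' else 0 := by
    intro i
    rw [Int.cast_sum]
    refine Finset.sum_congr rfl fun i' _ => ?_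
    split_ifs
    · push_cast
      rw [sub_eq_add_neg, CharTwo.neg_eq]
    · rfl
  have key := koszul_identity (fun i => ∑ b, ((p (finSigmaFinEquiv ⟨i, b⟩) : ℤ) : ZMod 2))
    (fun i => (m i : ZMod 2) + l i) (fun i => (junctions f i : ZMod 2))
  simp only [hN']
  rw [hM, hT, revSign_flatten, Finset.sum_add_distrib, Finset.sum_add_distrib]
  linear_combination key

/-! ## Closure under composition -/

theorem comp_update {k : ℕ} [DecidableEq (Fin k)] (j : Fin k → ℕ) (n : Fin k → ℤ) (ν : Family.{u} k)
    (μ : ∀ i, Family.{u} (j i)) (i : Fin k) (μ' : Family.{u} (j i)) (X : TopCat.{u})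
    (x : Fin (∑ i, j i) → cochains X) :
    comp j n ν (Function.update μ i μ') X x = ν X (Function.update (fun i => μ i X fun b =>
      signMap X (∑ i', if i < i' then n i' else 0) (x (finSigmaFinEquiv ⟨i, b⟩))) i
      (μ' X fun b => signMap X (∑ i', if i < i' then n i' else 0) (x (finSigmaFinEquiv ⟨i, b⟩)))) := by
  rw [comp_apply]
  congr 1
  funext i'
  by_cases h : i' = i
  · subst h; simp
  · simp [h]

/-- Composition as a multilinear map of the inner operations. -/
def compMultilinear {k : ℕ} (j : Fin k → ℕ) (n : Fin k → ℤ) (ν : Family.{u} k) :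
    MultilinearMap ℤ (fun i => Family.{u} (j i)) (Family.{u} (∑ i, j i)) where
  toFun := comp j n ν
  map_update_add' μ i a b := by
    funext X
    ext1 x
    simp only [comp_update, Pi.add_apply, add_apply, MultilinearMap.map_update_add]
  map_update_smul' μ i c a := by
    funext X
    ext1 x
    simp only [comp_update, Pi.smul_apply, smul_apply, MultilinearMap.map_update_smul]

/-- Composition as a linear map of the outer operation. -/
def compLeft {k : ℕ} (j : Fin k → ℕ) (n : Fin k → ℤ) (μ : ∀ i, Family.{u} (j i)) :
    Family.{u} k →ₗ[ℤ] Family.{u} (∑ i, j i) where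
  toFun ν := comp j n ν μ
  map_add' _ _ := rfl
  map_smul' _ _ := rfl

/-- Induction on the set of arguments that are allowed to be arbitrary elements of the spans. -/
theorem multilinear_mem_of_span {ι : Type*} [Fintype ι] {V : ι → Type*} {W : Type*}
    [∀ i, AddCommMonoid (V i)] [AddCommMonoid W] [∀ i, Module ℤ (V i)] [Module ℤ W] (φ : MultilinearMap ℤ V W) (A : ∀ i, Set (V i))
    (P : Submodule ℤ W) (h : ∀ v, (∀ i, v i ∈ A i) → φ v ∈ P) (v : ∀ i, V i)
    (hv : ∀ i, v i ∈ Submodule.span ℤ (A i)) : φ v ∈ P := by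
  classical
  have key : ∀ s : Finset ι, ∀ v : ∀ i, V i, (∀ i ∈ s, v i ∈ Submodule.span ℤ (A i)) →
      (∀ i ∉ s, v i ∈ A i) → φ v ∈ P := by
    intro s
    induction s using Finset.induction_on with
    | empty => exact fun v _ hv => h v fun i => hv i (Finset.notMem_empty i)
    | insert a s ha ih =>
      intro v hv hv'
      have h1 : ∀ y ∈ Submodule.span ℤ (A a), φ (Function.update v a y) ∈ P := by
        intro y hy
        induction hy using Submodule.span_induction with
        | mem y hy =>
          refine ih _ (fun i hi => ?_) (fun i hi => ?_)
          · have : i ≠ a := by rintro rfl; exact ha hi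
            rw [Function.update_of_ne this]
            exact hv i (Finset.mem_insert_of_mem hi)
          · by_cases h : i = a
            · subst h; simpa using hy
            · rw [Function.update_of_ne h]
              exact hv' i (by simp [h, hi])
        | zero => rw [MultilinearMap.map_update_zero]; exact zero_mem _
        | add y z _ _ hy hz => rw [MultilinearMap.map_update_add]; exact add_mem hy hz
        | smul c y _ hy => rw [MultilinearMap.map_update_smul]; exact Submodule.smul_mem _ _ hy
      have := h1 (v a) (hv a (Finset.mem_insert_self _ _))
      rwa [Function.update_eq_self] at this
  exact key Finset.univ v (fun i _ => hv i) (fun i hi => absurd (Finset.mem_univ i) hi)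

theorem comp_mem_S {k : ℕ} {a : ℤ} {j : Fin k → ℕ} {n : Fin k → ℤ} {ν : Family.{u} k}
    {μ : ∀ i, Family.{u} (j i)} (hν : ν ∈ S k a) (hμ : ∀ i, μ i ∈ S (j i) (n i)) :
    comp j n ν μ ∈ S (∑ i, j i) (a + ∑ i, n i) := by
  refine multilinear_mem_of_span (compMultilinear j n ν) _ _ (fun μ hμ => ?_) μ hμ
  change compLeft j n μ ν ∈ _
  refine (Submodule.span_le (p := (S (∑ i, j i) (a + ∑ i, n i)).comap (compLeft j n μ))).2 ?_ hν
  rintro _ ⟨M, f, hf, rfl, rfl⟩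
  choose m g hg hn hμ' using hμ
  obtain rfl : (fun i => (m i : ℤ) - j i) = n := funext hn
  obtain rfl : μ = fun i => seqOp (g i) := funext hμ'
  change comp j _ (seqOp f) _ ∈ S _ _
  rw [comp_seqOp hf.1 fun i => (hg i).1]
  refine Submodule.sum_mem _ fun T _ => Submodule.smul_mem _ _ ?_
  have := seqOpOn_mem_S.{u} (label_surjective hf.1 (fun i => (hg i).1) T)
  convert this using 1
  have hM := card_eq_sum_junction hf.1
  rw [Fintype.card_fin] at hM
  rw [card_letter hf.1]
  have hM' := congrArg (Nat.cast : ℕ → ℤ) hM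
  push_cast at hM' ⊢
  rw [hM']
  simp only [Finset.sum_add_distrib, Finset.sum_sub_distrib, Finset.sum_const, Finset.card_univ,
    Fintype.card_fin, nsmul_eq_mul, mul_one]
  ring_nf

/-! ## The symmetric group actions on sequence operations -/

/-- The indicator of the pairs which are interchanged by `e`. -/
def inv {k k' : ℕ} (e : Fin k ≃ Fin k') (i i' : Fin k) : ZMod 2 :=
  (if i' < i then 1 else 0) + if e i' < e i then 1 else 0

theorem inv_self {k k' : ℕ} (e : Fin k ≃ Fin k') (i : Fin k) : inv e i i = 0 := by simp [inv]

theorem inv_comm {k k' : ℕ} (e : Fin k ≃ Fin k') (i i' : Fin k) : inv e i i' = inv e i' i := by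
  rcases eq_or_ne i i' with rfl | h
  · rfl
  · have h2 : e i ≠ e i' := fun h' => h (e.injective h')
    rcases h.lt_or_gt with h1 | h1 <;> rcases h2.lt_or_gt with h3 | h3 <;>
      simp [inv, h1, h3, h1.not_gt, h3.not_gt, zmod_two_add_self]

/-- For a symmetric function vanishing on the diagonal, a sum over unordered pairs of gaps may be
ordered by position or by label. -/
theorem sum_pairs_inv {k q : ℕ} (χ : Fin k → Fin k → ZMod 2) (h0 : ∀ i, χ i i = 0)
    (hs : ∀ i i', χ i i' = χ i' i) (a : Fin q → Fin k) :
    (∑ s, ∑ s', if s < s' then χ (a s) (a s') else 0) =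
      ∑ s, ∑ s', if a s < a s' then χ (a s) (a s') else 0 := by
  have h1 : ∀ s s', (if s < s' then χ (a s) (a s') else 0) =
      (if s < s' ∧ a s < a s' then χ (a s) (a s') else 0) +
        if s < s' ∧ a s' < a s then χ (a s) (a s') else 0 := by
    intro s s'
    rcases lt_trichotomy (a s) (a s') with h | h | h
    · simp [h, h.not_gt]
    · simp [h, h0]
    · simp [h, h.not_gt]
  simp only [h1, Finset.sum_add_distrib]
  rw [Finset.sum_comm (f := fun s s' => if s < s' ∧ a s' < a s then χ (a s) (a s') else 0)]
  simp only [← Finset.sum_add_distrib]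
  refine Finset.sum_congr rfl fun s _ => Finset.sum_congr rfl fun s' _ => ?_
  by_cases h : a s < a s'
  · have hne : s ≠ s' := by rintro rfl; exact lt_irrefl _ h
    rcases hne.lt_or_gt with h2 | h2
    · simp [h, h2, h2.not_gt]
    · simp [h, h2, h2.not_gt, hs (a s') (a s)]
  · simp [h]

theorem sum_indicator {k q : ℕ} (a : Fin q → Fin k) (F : Fin k → ZMod 2) :
    ∑ s, F (a s) = ∑ i, (∑ s, if a s = i then (1 : ZMod 2) else 0) * F i :=
  (sum_indicator_mul a F).symm

section Act

variable {m k k' q : ℕ}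

/-- Let `G` count gaps and `r` junctions. Interchanging the labels `i` and `i'` changes the sign by
`G i * G i'` through pairs of gaps and by `G i * r i' + G i' * r i` through single gaps. With `p = G
+ r` this is `p i * p i' + r i * r i'`: the first summand is the Koszul sign of the arguments, the
second does not depend on the simplex. -/
theorem geps_act (e : Fin k ≃ Fin k') {f : Fin m → Fin k} (hf : Function.Surjective f)
    (J : Fin q → Fin m) (G p : Fin k → ZMod 2)
    (hG : ∀ i, G i = ∑ s, if f (J s) = i then 1 else 0) (hp : ∀ i, p i = G i + junctions f i) :
    geps (e ∘ f) J = geps f J +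
      (∑ i, ∑ i', if i < i' ∧ e i' < e i then p i * p i' else 0) +
      ∑ i, ∑ i', if i < i' ∧ e i' < e i then (junctions f i : ZMod 2) * junctions f i' else 0 := by
  set r : Fin k → ZMod 2 := fun i => junctions f i with hr
  have hnb : ∀ j, nb (e ∘ f) j + ((e (f j) : ℕ) : ZMod 2) = nb f j + ((f j : ℕ) : ZMod 2) +
      ∑ i', inv e (f j) i' * r i' := by
    intro j
    have hcard : ∀ (n : ℕ) (i : Fin n), ((i : ℕ) : ZMod 2) = ∑ i', if i' < i then 1 else 0 := by
      intro n i
      rw [Finset.sum_boole]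
      congr 1
      have : (Finset.univ.filter fun i' => i' < i) = Finset.Iio i := by ext; simp
      rw [this, Fin.card_Iio]
    have h1 : ∀ (n : ℕ) (f' : Fin m → Fin n), nb f' j + ((f' j : ℕ) : ZMod 2) =
        (∑ j', if f' j' < f' j then 1 else 0) + (∑ i', if i' < f' j then 1 else 0) +
          ∑ j', if f' j' = f' j ∧ j' < j then 1 else 0 := by
      intro n f'
      rw [hcard, nb, add_right_comm _ _ (∑ j', if f' j' = f' j ∧ j' < j then (1 : ZMod 2) else 0)]
      congr 1
      rw [← Finset.sum_add_distrib]
      refine Finset.sum_congr rfl fun j' _ => ?_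
      by_cases h : f' j' < f' j
      · simp [h, h.ne]
      · simp [h]
    have h2 := h1 _ (e ∘ f)
    simp only [Function.comp_apply, EmbeddingLike.apply_eq_iff_eq] at h2
    rw [h1, h2]
    have h3 : ∀ i', r i' + 1 = ∑ j', if f j' = i' then 1 else 0 := by
      intro i'
      rw [Finset.sum_boole, card_fibre_eq (hf i'), hr]
      simp only [junctions]
      push_cast
      congr!
    have h4 : ∀ P : Fin k → Prop, ∀ [DecidablePred P], (∑ j', if P (f j') then (1 : ZMod 2) else 0) =
        ∑ i', if P i' then r i' + 1 else 0 := by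
      intro P _
      have := sum_indicator f fun i' => if P i' then (1 : ZMod 2) else 0
      rw [this]
      refine Finset.sum_congr rfl fun i' _ => ?_
      rw [← h3]
      split_ifs <;> simp
    rw [h4 (fun i' => e i' < e (f j)), h4 (fun i' => i' < f j),
      ← e.sum_comp (fun i' => if i' < e (f j) then (1 : ZMod 2) else 0)]
    have h5 : (∑ i', if e i' < e (f j) then r i' + 1 else 0) + (∑ i', if e i' < e (f j) then 1 else 0) =
        (∑ i', if i' < f j then r i' + 1 else 0) + (∑ i', if i' < f j then 1 else 0) +
          ∑ i', inv e (f j) i' * r i' := by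
      simp only [← Finset.sum_add_distrib]
      refine Finset.sum_congr rfl fun i' _ => ?_
      have := zmod_two_add_self (1 : ZMod 2)
      have hrr := zmod_two_add_self (r i')
      rw [inv]
      split_ifs
      · linear_combination -hrr
      · linear_combination this
      · linear_combination -this - hrr
      · ring
    linear_combination h5
  have hpair : (∑ s, ∑ s', if s < s' ∧ e (f (J s')) < e (f (J s)) then (1 : ZMod 2) else 0) =
      (∑ s, ∑ s', if s < s' ∧ f (J s') < f (J s) then 1 else 0) +
        ∑ s, ∑ s', if s < s' then inv e (f (J s)) (f (J s')) else 0 := by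
    simp only [← Finset.sum_add_distrib]
    refine Finset.sum_congr rfl fun s _ => Finset.sum_congr rfl fun s' _ => ?_
    have := zmod_two_add_self (1 : ZMod 2)
    rw [inv]
    split_ifs <;> simp_all
  have hpair2 : (∑ s, ∑ s', if s < s' then inv e (f (J s)) (f (J s')) else 0) =
      ∑ i, ∑ i', if i < i' then inv e i i' * (G i * G i') else 0 := by
    rw [sum_pairs_inv _ (inv_self e) (inv_comm e)]
    have h1 := fun s => sum_indicator (fun s' => f (J s'))
      fun i' => if f (J s) < i' then inv e (f (J s)) i' else 0
    simp only [h1]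
    rw [sum_indicator (fun s => f (J s)) fun i => ∑ i',
      (∑ s, if f (J s) = i' then (1 : ZMod 2) else 0) * if i < i' then inv e i i' else 0]
    simp only [← hG, Finset.mul_sum]
    refine Finset.sum_congr rfl fun i _ => Finset.sum_congr rfl fun i' _ => ?_
    split_ifs <;> ring
  have hsingle : (∑ s, ∑ i', inv e (f (J s)) i' * r i') =
      ∑ i, ∑ i', if i < i' then inv e i i' * (G i * r i' + G i' * r i) else 0 := by
    rw [sum_indicator (fun s => f (J s)) fun i => ∑ i', inv e i i' * r i']
    simp only [← hG, Finset.mul_sum]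
    have h1 : ∀ i i', G i * (inv e i i' * r i') = (if i < i' then inv e i i' * (G i * r i') else 0) +
        if i' < i then inv e i' i * (G i * r i') else 0 := by
      intro i i'
      rcases lt_trichotomy i i' with h | rfl | h
      · simp [h, h.not_gt]; ring
      · simp [inv_self]
      · simp [h, h.not_gt, inv_comm e i' i]; ring
    simp only [h1, Finset.sum_add_distrib]
    rw [Finset.sum_comm (f := fun i i' => if i' < i then inv e i' i * (G i * r i') else 0)]
    simp only [← Finset.sum_add_distrib]
    refine Finset.sum_congr rfl fun i _ => Finset.sum_congr rfl fun i' _ => ?_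
    split_ifs <;> ring
  have hfin : (∑ i, ∑ i', if i < i' then inv e i i' * (G i * G i') else 0) +
      (∑ i, ∑ i', if i < i' then inv e i i' * (G i * r i' + G i' * r i) else 0) =
      (∑ i, ∑ i', if i < i' ∧ e i' < e i then p i * p i' else 0) +
      ∑ i, ∑ i', if i < i' ∧ e i' < e i then r i * r i' else 0 := by
    simp only [← Finset.sum_add_distrib]
    refine Finset.sum_congr rfl fun i _ => Finset.sum_congr rfl fun i' _ => ?_
    have hrr := zmod_two_add_self (r i * r i')
    by_cases h : i < i'
    · by_cases h2 : e i' < e i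
      · simp only [h, h2, and_self, if_true, inv, h.not_gt, if_false, hp]
        linear_combination -hrr
      · simp [h, h2, inv, h.not_gt]
    · simp [h]
  rw [geps, geps]
  simp only [Function.comp_apply, hnb, Finset.sum_add_distrib]
  linear_combination hpair + hpair2 + hsingle + hfin

/-- Each unordered pair of places contributes the product of its degrees, in whatever order the
places are taken. -/
theorem revSign_comp_equiv (e : Fin k ≃ Fin k') (p : Fin k' → ZMod 2) :
    revSign (fun i => p (e i)) = revSign p := by
  rw [revSign, revSign, ← e.sum_comp]
  conv_rhs => enter [2, i]; rw [← e.sum_comp]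
  have h1 : ∀ i i', (if e i < e i' then p (e i) * p (e i') else 0) =
      (if i < i' ∧ e i < e i' then p (e i) * p (e i') else 0) +
        if i' < i ∧ e i < e i' then p (e i) * p (e i') else 0 := by
    intro i i'
    rcases lt_trichotomy i i' with h | rfl | h
    · simp [h, h.not_gt]
    · simp
    · simp [h, h.not_gt]
  simp only [h1, Finset.sum_add_distrib]
  rw [Finset.sum_comm (f := fun i i' => if i' < i ∧ e i < e i' then p (e i) * p (e i') else 0)]
  simp only [← Finset.sum_add_distrib]
  refine Finset.sum_congr rfl fun i _ => Finset.sum_congr rfl fun i' _ => ?_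
  by_cases h : i < i'
  · have h2 : e i ≠ e i' := fun h' => h.ne (e.injective h')
    rcases h2.lt_or_gt with h3 | h3
    · simp [h, h3, h3.not_gt]
    · simp [h, h3, h3.not_gt, mul_comm]
  · simp [h]

theorem monom_act (e : Fin k ≃ Fin k') {X : TopCat.{u}} (f : Fin m → Fin k)
    (x : Fin k' → cochains X) (σ : Sing X q) (P : Fin m → Finset (Fin (q + 1))) :
    monom (e ∘ f) x σ P = monom f (fun i => x (e i)) σ P := by
  rw [monom, monom, ← e.prod_comp]
  refine Finset.prod_congr rfl fun i _ => ?_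
  have : labelled (e ∘ f) P (e i) = labelled f P i := by
    simp [labelled]
  exact congrArg (fun B => ev (face σ B) (x (e i))) this

theorem koszul_eq_zs (e : Fin k ≃ Fin k') (p : Fin k → ℤ) :
    koszul e p = zs (∑ i, ∑ i', if i < i' ∧ e i' < e i then (p i : ZMod 2) * p i' else 0) := by
  rw [koszul, sgn_eq_zs]
  congr 1
  push_cast
  refine Finset.sum_congr rfl fun i _ => Finset.sum_congr rfl fun i' _ => ?_
  split_ifs <;> simp

/-- The symmetric group acts on sequence operations by relabelling, up to sign. -/
theorem act_seqOp (e : Fin k ≃ Fin k') {f : Fin m → Fin k} (hf : Function.Surjective f) :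
    act e (seqOp.{u} (e ∘ f)) =
      zs (∑ i, ∑ i', if i < i' ∧ e i' < e i then (junctions f i : ZMod 2) * junctions f i' else 0) •
        seqOp f := by
  have hk : k = k' := by simpa using Fintype.card_congr e
  refine family_ext fun X x p hx => cochain_ext fun q σ => ?_
  have hx' := fun i => (hx i).isHom
  rw [act_apply e _ X x p hx, koszul_eq_zs]
  change _ * (seqOp (e ∘ f) X fun i' => x (e.symm i')).1 q σ = _ * (seqOp f X x).1 q σ
  rw [seqOp_eq_core (e.surjective.comp hf) (fun i => hx' (e.symm i)), seqOp_eq_core hf hx']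
  have hrev : (revSign fun i => ((p (e.symm i) : ℤ) : ZMod 2)) = revSign fun i => ((p i : ℤ) : ZMod 2) :=
    revSign_comp_equiv e.symm fun i => ((p i : ℤ) : ZMod 2)
  rw [hrev]
  set A := ∑ i, ∑ i', if i < i' ∧ e i' < e i then ((p i : ℤ) : ZMod 2) * ((p i' : ℤ) : ZMod 2) else 0
  set B := ∑ i, ∑ i', if i < i' ∧ e i' < e i then (junctions f i : ZMod 2) * junctions f i' else 0
  have hcore : core (e ∘ f) (fun i => x (e.symm i)) σ = zs (A + B) * core f x σ := by
    rw [core, core, Finset.mul_sum]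
    refine Finset.sum_congr rfl fun J _ => ?_
    rw [monom_act]
    simp only [Equiv.symm_apply_apply]
    by_cases h : ∀ i, (((labelled f (gpiece J) i).card - 1 : ℕ) : ℤ) = (p i : ℤ)
    · have hG := geps_act e hf J (fun i => ∑ s, if f (J s) = i then 1 else 0)
        (fun i => ((p i : ℤ) : ZMod 2)) (fun _ => rfl) (fun i => by
          rw [← h i, card_labelled, card_fibre_eq (hf i), ← add_assoc, Nat.add_sub_cancel,
            Finset.sum_boole, junctions]
          push_cast
          congr!)
      rw [hG, add_assoc, zs_add]
      ring
    · push Not at h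
      obtain ⟨i, hi⟩ := h
      rw [monom_eq_zero hx' hi]
      ring
  have hs : sgn ((m : ℤ) - k') = sgn ((m : ℤ) - k) := by rw [hk]
  rw [hcore, hs, zs_add]
  have := zs_mul_self A
  linear_combination (zs B * (sgn ((m : ℤ) - k) * (zs (revSign fun i => ((p i : ℤ) : ZMod 2)) * core f x σ))) * this

theorem act_mem_S (e : Fin k ≃ Fin k') {n : ℤ} {ν : Family.{u} k'} (hν : ν ∈ S k' n) :
    act e ν ∈ S k n := by
  refine (Submodule.span_le (p := (S k n).comap (act e))).2 ?_ hν
  rintro _ ⟨M, f, hf, rfl, rfl⟩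
  have hk : k = k' := by simpa using Fintype.card_congr e
  have h1 : f = e ∘ (e.symm ∘ f) := by ext; simp
  have h2 : Function.Surjective (e.symm ∘ f) := e.symm.surjective.comp hf.1
  have h3 : (M : ℤ) - k' = M - k := by rw [hk]
  change act e (seqOp f) ∈ S k ((M : ℤ) - k')
  rw [h1, act_seqOp e h2, h3]
  exact Submodule.smul_mem _ _ (seqOp_mem_S h2)

end Act

/-! ## The coboundary of an argument of a sequence operation -/

theorem ev_coboundary_zero {X : TopCat.{u}} {n : ℕ} (hn : n = 0) (τ : Sing X n) (y : cochains X) :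
    ev τ (coboundary X y) = 0 := by
  subst hn
  rfl

theorem ev_coboundary_succ {X : TopCat.{u}} {n : ℕ} (τ : Sing X (n + 1)) (y : cochains X) :
    ev τ (coboundary X y) = -sgn n * ∑ i : Fin (n + 2), sgn (i : ℕ) *
      ev (X := X) ((TopCat.toSSet.obj X).δ i τ : Sing X n) y := rfl

theorem ev_face_coboundary {X : TopCat.{u}} {n q : ℕ} (σ : Sing X q) (B : Multiset (Fin (q + 1)))
    (φ : Fin (n + 2) → Fin (q + 1)) (hφ : Monotone φ)
    (hB : B = Multiset.map φ (Finset.univ : Finset (Fin (n + 2))).val) (y : cochains X) :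
    ev (face σ B) (coboundary X y) =
      -sgn n * ∑ c, sgn ((c : Fin (n + 2)) : ℕ) * ev (face σ (B.erase (φ c))) y := by
  let θ : ⦋n + 1⦌ ⟶ ⦋q⦌ := SimplexCategory.mkHom ⟨φ, hφ⟩
  rw [← ev_map_eq_ev_face θ σ B hB, ev_coboundary_succ]
  congr 1
  refine Finset.sum_congr rfl fun c _ => ?_
  congr 1
  have h1 : ((TopCat.toSSet.obj X).δ c ((TopCat.toSSet.obj X).map θ.op σ) : Sing X n) =
      (TopCat.toSSet.obj X).map (SimplexCategory.δ c ≫ θ).op σ := by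
    simp [SimplicialObject.δ]
  rw [h1]
  refine DFunLike.congr_fun (ev_map_eq_ev_face _ σ _ ?_) y
  change B.erase (φ c) = Multiset.map (φ ∘ c.succAbove) Finset.univ.val
  rw [hB, Fin.univ_succAbove _ c, Finset.cons_val, Multiset.map_cons, Multiset.erase_cons_head,
    Finset.map_val, Multiset.map_map]
  rfl

section Block

variable {L : Type*} [LinearOrder L] [Fintype L] {k q : ℕ}

/-- The parity of the place of the vertex `b` of the piece `j` in its block. -/
def place (f : L → Fin k) (J : Fin q → L) (j : L) (b : Fin (q + 1)) : ZMod 2 :=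
  (∑ s : Fin q, if f (J s) = f j ∧ (s : ℕ) < b then 1 else 0) +
    ∑ e, if f e = f j ∧ e < j then 1 else 0

/-- The vertices of the block are omitted with alternating signs, and the place of a vertex in the
block is the number of gaps and junctions to its left. A block with a single vertex has no faces and
is excluded. -/
theorem ev_block_coboundary {X : TopCat.{u}} {f : L → Fin k} {i : Fin k} (hi : ∃ j, f j = i)
    (J : Fin q →o L) (hc : (labelled f (gpiece J) i).card ≠ 1) (y : cochains X) (σ : Sing X q) :
    ev (face σ (labelled f (gpiece J) i)) (coboundary X y) =
      ∑ j ∈ Finset.univ.filter (fun j => f j = i), ∑ b ∈ gpiece J j,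
        zs ((labelled f (gpiece J) i).card + 1 + place f J j b) *
          ev (face σ ((labelled f (gpiece J) i).erase b)) y := by
  classical
  have hB := labelled_eq_map_vert f J i
  have hcard := card_labelled_eq hi J
  set B := labelled f (gpiece J) i with hBdef
  obtain ⟨n, hn⟩ : ∃ n, Fintype.card (Gap f J i) = n + 1 :=
    Nat.exists_eq_succ_of_ne_zero fun h => hc (by rw [hcard, h])
  have hv : Fintype.card (Vert f J i) = n + 1 + 1 := by rw [card_vert hi J, hn]
  let ι : Fin (n + 1) ≃o Gap f J i := Fintype.orderIsoFinOfCardEq _ hn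
  let θ : Fin (n + 1 + 1) ≃o Vert f J i := Fintype.orderIsoFinOfCardEq _ hv
  rw [ev_face_coboundary (n := n) σ B (fun c => (ofLex (θ c).1).2) ?_ ?_ y]
  · rw [← sum_vert f J i (fun j b => zs (B.card + 1 + place f J j b) * ev (face σ (B.erase b)) y),
      ← θ.toEquiv.sum_comp, Finset.mul_sum]
    refine Finset.sum_congr rfl fun c _ => ?_
    rw [← mul_assoc]
    congr 1
    -- The index `c` is counted through the gaps before it, which `lt_iff_isLeft` identifies with
    -- those to the left of the vertex.
    have hpos : ((c : ℕ) : ZMod 2) = place f J (ofLex (θ c).1).1 (ofLex (θ c).1).2 := by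
      have h1 : ((c : ℕ) : ZMod 2) = ∑ r : Fin (n + 1), if (r : ℕ) < c then 1 else 0 := by
        rw [Finset.sum_boole, Fin.card_filter_val_lt, min_eq_right (Nat.le_of_lt_succ c.2)]
      have h2 : ∀ x : Gap f J i, Decidable (x.IsLeft (ofLex (θ c).1).1 (ofLex (θ c).1).2) :=
        fun _ => Classical.dec _
      rw [h1]
      simp only [lt_iff_isLeft ι θ]
      have h3 := ι.toEquiv.sum_comp
        fun x => if x.IsLeft (ofLex (θ c).1).1 (ofLex (θ c).1).2 then (1 : ZMod 2) else 0
      refine Eq.trans ?_ (h3.trans ?_)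
      · exact Finset.sum_congr rfl fun _ _ => if_congr Iff.rfl rfl rfl
      rw [sum_gap, place]
      have hfi := (θ c).2.1
      congr 1
      · rw [hfi]
        refine Eq.trans ?_ (Eq.trans (Finset.sum_subtype (p := fun s => f (J s) = i)
          (F := inferInstance) (Finset.univ.filter fun s => f (J s) = i) (by simp)
          fun s : Fin q => if (s : ℕ) < (ofLex (θ c).1).2 then (1 : ZMod 2) else 0).symm ?_)
        · exact Finset.sum_congr rfl fun _ _ => by congr
        · rw [Finset.sum_filter]
          refine Finset.sum_congr rfl fun s _ => ?_
          split_ifs <;> simp_all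
      · refine Eq.trans (Finset.sum_congr rfl fun e _ => ?_)
          ((sum_junction f i fun e => if e < (ofLex (θ c).1).1 then (1 : ZMod 2) else 0).trans ?_)
        · congr
        · rw [hfi]
          refine Finset.sum_congr rfl fun e _ => ?_
          by_cases h4 : f e = i ∧ e < (ofLex (θ c).1).1
          · rw [if_pos ⟨h4.1, _, h4.2, hfi⟩, if_pos h4.2, if_pos h4]
          · rw [if_neg h4]
            split_ifs with h5 h6
            · exact absurd ⟨h5.1, h6⟩ h4
            · rfl
            · rfl
    change _ = zs (B.card + 1 + place f J (ofLex (θ c).1).1 (ofLex (θ c).1).2)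
    rw [← hpos, hcard, hn, sgn_eq_zs, sgn_eq_zs]
    push_cast
    have h5 : (n : ZMod 2) + 1 + 1 + 1 + (c : ℕ) = 1 + n + (c : ℕ) := by
      linear_combination zmod_two_add_self (1 : ZMod 2)
    rw [h5, zs_add, zs_add, zs_one]
    ring
  · intro c c' h
    rcases h.eq_or_lt with rfl | h
    · exact le_rfl
    · have h' : (θ c).1 < (θ c').1 := θ.strictMono h
      rw [Prod.Lex.lt_iff] at h'
      rcases h' with h' | h'
      · exact le_of_mem_gpiece h' (θ c).2.2 (θ c').2.2
      · exact h'.2.le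
  · refine hB.trans ?_
    have : (Finset.univ : Finset (Vert f J i)) = Finset.univ.map θ.toEquiv.toEmbedding := by
      simp
    rw [this, Finset.map_val, Multiset.map_map]
    rfl

/-- The pieces of `P`, with the vertex `b` removed from the piece `j`. -/
def eraseVertex {q : ℕ} (P : L → Finset (Fin (q + 1))) (j : L) (b : Fin (q + 1)) :
    L → Finset (Fin (q + 1)) := Function.update P j ((P j).erase b)

theorem mem_eraseVertex {P : L → Finset (Fin (q + 1))} {j j' : L} {b b' : Fin (q + 1)} :
    b' ∈ eraseVertex P j b j' ↔ b' ∈ P j' ∧ ¬ (j' = j ∧ b' = b) := by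
  rw [eraseVertex]
  by_cases h : j' = j
  · subst h; simp [and_comm]
  · simp [h]

theorem labelled_eraseVertex {f : L → Fin k} {P : L → Finset (Fin (q + 1))} {j : L}
    {b : Fin (q + 1)} (hb : b ∈ P j) (i : Fin k) :
    labelled f (eraseVertex P j b) i =
      if f j = i then (labelled f P i).erase b else labelled f P i := by
  have hne : ∀ j' ∈ (Finset.univ.filter fun j' => f j' = i).erase j,
      (eraseVertex P j b j').val = (P j').val := by
    intro j' hj'
    rw [eraseVertex, Function.update_of_ne (Finset.ne_of_mem_erase hj')]
  split_ifs with h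
  · have hmem : j ∈ Finset.univ.filter fun j' => f j' = i := by simp [h]
    rw [labelled, labelled, ← Finset.add_sum_erase _ _ hmem, ← Finset.add_sum_erase _ _ hmem,
      Finset.sum_congr rfl hne, Multiset.erase_add_left_pos _ hb]
    simp [eraseVertex]
  · rw [labelled, labelled]
    refine Finset.sum_congr rfl fun j' hj' => ?_
    rw [eraseVertex, Function.update_of_ne]
    rintro rfl
    exact h (by simpa using hj')

end Block

/-! ## Signs of the terms of the differential -/

section Signs

variable {m k q : ℕ} {f : Fin m → Fin k}

theorem nb_add_val (hf : Function.Surjective f) (j : Fin m) :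
    nb f j + ((f j : ℕ) : ZMod 2) = (∑ i', if i' < f j then (junctions f i' : ZMod 2) else 0) +
      ∑ e, if f e = f j ∧ e < j then 1 else 0 := by
  have h3 : ∀ i', (junctions f i' : ZMod 2) + 1 = ∑ j', if f j' = i' then 1 else 0 := by
    intro i'
    rw [Finset.sum_boole, card_fibre_eq (hf i')]
    simp only [junctions]
    push_cast
    congr!
  have h4 : (∑ j', if f j' < f j then (1 : ZMod 2) else 0) =
      ∑ i', if i' < f j then (junctions f i' : ZMod 2) + 1 else 0 := by
    have := sum_indicator f fun i' => if i' < f j then (1 : ZMod 2) else 0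
    rw [this]
    refine Finset.sum_congr rfl fun i' _ => ?_
    rw [← h3]
    split_ifs <;> simp
  have h5 : ((f j : ℕ) : ZMod 2) = ∑ i', if i' < f j then 1 else 0 := by
    rw [Finset.sum_boole]
    congr 1
    have : (Finset.univ.filter fun i' => i' < f j) = Finset.Iio (f j) := by ext; simp
    rw [this, Fin.card_Iio]
  have h6 : nb f j = (∑ j', if f j' < f j then (1 : ZMod 2) else 0) +
      ∑ e, if f e = f j ∧ e < j then 1 else 0 := by
    rw [nb, ← Finset.sum_add_distrib]
    refine Finset.sum_congr rfl fun j' _ => ?_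
    by_cases h : f j' < f j
    · simp [h, h.ne]
    · simp [h]
  have h7 : (∑ i', if i' < f j then (junctions f i' : ZMod 2) + 1 else 0) +
      (∑ i', if i' < f j then (1 : ZMod 2) else 0) =
      ∑ i', if i' < f j then (junctions f i' : ZMod 2) else 0 := by
    rw [← Finset.sum_add_distrib]
    refine Finset.sum_congr rfl fun i' _ => ?_
    split_ifs
    · linear_combination zmod_two_add_self (1 : ZMod 2)
    · simp
  rw [h6, h4, h5]
  linear_combination h7

theorem degree_sum (J : Fin q → Fin m) (i : Fin k) (p : Fin k → ZMod 2)
    (hp : ∀ i', i < i' → p i' = (∑ s, if f (J s) = i' then 1 else 0) + junctions f i') :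
    (∑ i', if i < i' then p i' else 0) + (∑ i', if i' < i then (junctions f i' : ZMod 2) else 0) +
      junctions f i = (∑ s, if i < f (J s) then 1 else 0) + ∑ i', (junctions f i' : ZMod 2) := by
  have h1 : (∑ s, if i < f (J s) then (1 : ZMod 2) else 0) =
      ∑ i', if i < i' then (∑ s, if f (J s) = i' then 1 else 0) else 0 := by
    rw [sum_indicator (fun s => f (J s)) fun i' => if i < i' then (1 : ZMod 2) else 0]
    refine Finset.sum_congr rfl fun i' _ => ?_
    split_ifs <;> simp
  have h2 : (junctions f i : ZMod 2) = ∑ i', if i' = i then (junctions f i' : ZMod 2) else 0 := by simp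
  rw [h1, h2]
  simp only [← Finset.sum_add_distrib]
  refine Finset.sum_congr rfl fun i' _ => ?_
  rcases lt_trichotomy i i' with h | rfl | h
  · simp [h, h.not_gt, h.ne', hp i' h]
  · simp
  · simp [h, h.not_gt, h.ne]

/-- The sign of the vertex `b` of the piece `j` in the composite with the coboundary; `n` is the
number of vertices of the block. -/
def eraseSign (f : Fin m → Fin k) (J : Fin q → Fin m) (p : Fin k → ZMod 2) (j : Fin m)
    (b : Fin (q + 1)) (n : ZMod 2) : ZMod 2 :=
  geps f J + place f J j b + (n + 1) + ∑ i', if f j < i' then p i' else 0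

/-- The result depends on `J` only away from `g`, and on the vertex only through its parity. So
moving the gap `g` to an adjacent piece while passing from one end of `g` to the other reverses the
sign, which is the reason for the cancellation. -/
theorem eraseSign_gap (hf : Function.Surjective f) (J : Fin q → Fin m) (p : Fin k → ZMod 2)
    (g : Fin q) (b : Fin (q + 1)) (hb : (b : ℕ) = g ∨ (b : ℕ) = g + 1) (n : ZMod 2)
    (hp : ∀ i', f (J g) < i' → p i' = (∑ s, if f (J s) = i' then 1 else 0) + junctions f i')
    (hn : n = (∑ s, if f (J s) = f (J g) then 1 else 0) + junctions f (f (J g)) + 1) :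
    eraseSign f J p (J g) b n =
      geps f (fun s : {s // s ≠ g} => J s) + (b : ℕ) + q + ∑ i, (junctions f i : ZMod 2) := by
  have hd := degree_sum J (f (J g)) p hp
  have hnb := nb_add_val hf (J g)
  set i := f (J g)
  have hgeps : geps f J = geps f (fun s : {s // s ≠ g} => J s) +
      ((∑ s : {s // s ≠ g}, if g < s.1 ∧ f (J s) < i then 1 else 0) +
        ∑ s : {s // s ≠ g}, if s.1 < g ∧ i < f (J s) then 1 else 0) + (nb f (J g) + ((i : ℕ) : ZMod 2)) := by
    rw [geps, geps, Fintype.sum_eq_add_sum_subtype_ne _ g]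
    simp only [fun F : Fin q → ZMod 2 => Fintype.sum_eq_add_sum_subtype_ne F g]
    simp only [Finset.sum_add_distrib, lt_irrefl, false_and, if_false, zero_add, Subtype.coe_lt_coe]
    ring
  have hplace : place f J (J g) b = (if (g : ℕ) < b then 1 else 0) +
      (∑ s : {s // s ≠ g}, if f (J s) = i ∧ s.1 < g then 1 else 0) +
      ∑ e, if f e = i ∧ e < J g then 1 else 0 := by
    rw [place, Fintype.sum_eq_add_sum_subtype_ne _ g]
    congr 2
    · simp
    · refine Finset.sum_congr rfl fun s _ => if_congr (and_congr Iff.rfl ?_) rfl rfl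
      have : (s : ℕ) ≠ g := fun h => s.2 (Fin.ext h)
      rw [Fin.lt_def]
      omega
  have h1 : (∑ s, if i < f (J s) then (1 : ZMod 2) else 0) =
      ∑ s : {s // s ≠ g}, if i < f (J s) then 1 else 0 := by
    rw [Fintype.sum_eq_add_sum_subtype_ne _ g]
    simp [i]
  have h2 : (∑ s, if f (J s) = i then (1 : ZMod 2) else 0) =
      1 + ∑ s : {s // s ≠ g}, if f (J s) = i then 1 else 0 := by
    rw [Fintype.sum_eq_add_sum_subtype_ne _ g]
    simp [i]
  have h3 : (∑ s : {s // s ≠ g}, if g < s.1 then (1 : ZMod 2) else 0) = q + 1 + (g : ℕ) := by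
    have h4 := Fintype.sum_eq_add_sum_subtype_ne (fun s => if g < s then (1 : ZMod 2) else 0) g
    simp only [lt_irrefl, if_false, zero_add] at h4
    rw [← h4, Finset.sum_boole]
    have : (Finset.univ.filter fun s => g < s) = Finset.Ioi g := by ext; simp
    rw [this, Fin.card_Ioi, Nat.cast_sub (by omega), Nat.cast_sub (by omega)]
    push_cast
    rw [sub_eq_add_neg, CharTwo.neg_eq, sub_eq_add_neg, CharTwo.neg_eq]
  -- Whatever its label, another gap contributes `1` in total if it comes after `g` and `0`
  -- otherwise. So just the number of later gaps remains.
  have h4 : (∑ s : {s // s ≠ g}, if g < s.1 ∧ f (J s) < i then (1 : ZMod 2) else 0) +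
        (∑ s : {s // s ≠ g}, if s.1 < g ∧ i < f (J s) then 1 else 0) +
      (∑ s : {s // s ≠ g}, if f (J s) = i ∧ s.1 < g then 1 else 0) +
      (∑ s : {s // s ≠ g}, if i < f (J s) then 1 else 0) +
      (∑ s : {s // s ≠ g}, if f (J s) = i then 1 else 0) =
      ∑ s : {s // s ≠ g}, if g < s.1 then (1 : ZMod 2) else 0 := by
    simp only [← Finset.sum_add_distrib]
    refine Finset.sum_congr rfl fun s _ => ?_
    rcases lt_or_gt_of_ne s.2 with h | h <;>
      rcases lt_trichotomy (f (J s)) i with h' | h' | h'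
    · simp [h, h.not_gt, h'.not_gt, h'.ne]
    · simp [h, h.not_gt, h', zmod_two_add_self]
    · simp [h, h.not_gt, h', h'.ne', zmod_two_add_self]
    · simp [h, h.not_gt, h', h'.not_gt, h'.ne]
    · simp [h, h.not_gt, h']
    · simp [h, h.not_gt, h', h'.not_gt, h'.ne']
  have h5 : ((b : ℕ) : ZMod 2) = (g : ℕ) + if (g : ℕ) < b then 1 else 0 := by
    rcases hb with hb | hb <;> simp [hb]
  rw [h1] at hd
  rw [h2] at hn
  rw [eraseSign, hgeps, hplace, hn, h5]
  linear_combination hnb + hd + h4 + h3 + zmod_two_add_self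
    (∑ e, if f e = i ∧ e < J g then (1 : ZMod 2) else 0) + 2 * zmod_two_add_self (1 : ZMod 2)

theorem geps_succAbove {f : Fin (m + 1) → Fin k} (j : Fin (m + 1)) (K : Fin q → Fin m) :
    geps f (fun s => j.succAbove (K s)) = geps (f ∘ j.succAbove) K +
      ∑ s, if f j < f (j.succAbove (K s)) ∨
        (f j = f (j.succAbove (K s)) ∧ j < j.succAbove (K s)) then 1 else 0 := by
  have hnb : ∀ a, nb f (j.succAbove a) = nb (f ∘ j.succAbove) a +
      if f j < f (j.succAbove a) ∨ (f j = f (j.succAbove a) ∧ j < j.succAbove a) then 1 else 0 := by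
    intro a
    rw [nb, nb, Fin.sum_univ_succAbove _ j, add_comm]
    simp
  rw [geps, geps]
  simp only [hnb, Finset.sum_add_distrib, Function.comp_apply]
  ring

/-- A gap enters four of the counts, and these contributions cancel in all cases. What is left is
the sign of deleting `j` from the sequence, together with the parity of the degree. -/
theorem eraseSign_isolated {f : Fin (m + 1) → Fin k} (hf : Function.Surjective f)
    (j : Fin (m + 1)) (K : Fin q → Fin m) (p : Fin k → ZMod 2) (b : Fin (q + 1))
    (hb : ∀ s : Fin q, (s : ℕ) < b ↔ j.succAbove (K s) < j) (n : ZMod 2)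
    (hp : ∀ i', f j < i' →
      p i' = (∑ s, if f (j.succAbove (K s)) = i' then 1 else 0) + junctions f i')
    (hn : n = (∑ s, if f (j.succAbove (K s)) = f j then 1 else 0) + junctions f (f j) + 1) :
    eraseSign f (fun s => j.succAbove (K s)) p j b n =
      geps (f ∘ j.succAbove) K + (∑ i, (junctions f i : ZMod 2)) + (nb f j + ((f j : ℕ) : ZMod 2)) := by
  have hd := degree_sum (fun s => j.succAbove (K s)) (f j) p hp
  have hnb := nb_add_val hf j
  have h1 : (∑ s, if f j < f (j.succAbove (K s)) ∨
        (f j = f (j.succAbove (K s)) ∧ j < j.succAbove (K s)) then (1 : ZMod 2) else 0) +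
      (∑ s : Fin q, if f (j.succAbove (K s)) = f j ∧ (s : ℕ) < b then 1 else 0) +
      (∑ s, if f (j.succAbove (K s)) = f j then 1 else 0) +
      (∑ s, if f j < f (j.succAbove (K s)) then 1 else 0) = 0 := by
    simp only [← Finset.sum_add_distrib]
    refine Finset.sum_eq_zero fun s _ => ?_
    simp only [hb]
    rcases (Fin.succAbove_ne j (K s)).lt_or_gt with h | h <;>
      rcases lt_trichotomy (f j) (f (j.succAbove (K s))) with h' | h' | h'
    · simp [h', h'.ne', zmod_two_add_self]
    · simp [h, h.not_gt, ← h', zmod_two_add_self]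
    · simp [h'.not_gt, h'.ne, h'.ne']
    · simp [h', h'.ne', zmod_two_add_self]
    · simp [h, h.not_gt, ← h', zmod_two_add_self]
    · simp [h'.not_gt, h'.ne, h'.ne']
  rw [eraseSign, geps_succAbove, place, hn, hnb]
  linear_combination h1 + hd + zmod_two_add_self (1 : ZMod 2) -
    zmod_two_add_self (∑ i', if i' < f j then (junctions f i' : ZMod 2) else 0)

end Signs

/-! ## The composite with the coboundary -/

section Compose

variable {m k q : ℕ} {f : Fin m → Fin k}

theorem IsHom.coboundary {X : TopCat.{u}} {p : ℤ} {x : cochains X} (hx : IsHom p x) :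
    IsHom (p + 1) (coboundary X x) := by
  intro n hn
  funext σ
  change ev σ (SeqOp.coboundary X x) = 0
  cases n with
  | zero => rfl
  | succ n =>
    rw [ev_coboundary_succ, Finset.sum_eq_zero, mul_zero]
    intro i _
    rw [ev_of_isHom hx, mul_zero]
    intro h
    apply hn
    push_cast
    rw [h]

theorem revSign_add_single {k : ℕ} (p : Fin k → ZMod 2) (i : Fin k) :
    revSign (fun i' => p i' + if i' = i then 1 else 0) =
      revSign p + (∑ i', if i' < i then p i' else 0) + ∑ i', if i < i' then p i' else 0 := by
  have h1 : (∑ i', if i' < i then p i' else 0) =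
      ∑ a, ∑ a', if a < a' ∧ a' = i then p a else 0 := by
    refine Finset.sum_congr rfl fun a _ => ?_
    rw [Finset.sum_eq_single i]
    · simp
    · intro b _ hb; simp [hb]
    · simp
  have h2 : (∑ i', if i < i' then p i' else 0) =
      ∑ a, ∑ a', if a < a' ∧ a = i then p a' else 0 := by
    rw [Finset.sum_comm]
    refine Finset.sum_congr rfl fun a _ => ?_
    rw [Finset.sum_eq_single i]
    · simp
    · intro b _ hb; simp [hb]
    · simp
  rw [h1, h2, revSign, revSign]
  simp only [← Finset.sum_add_distrib]
  refine Finset.sum_congr rfl fun a _ => Finset.sum_congr rfl fun a' _ => ?_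
  by_cases h : a < a'
  · by_cases h3 : a = i
    · subst h3
      simp [h, h.ne']
      ring
    · by_cases h4 : a' = i
      · subst h4; simp [h, h3]; ring
      · simp [h, h3, h4]
  · simp [h]

/-- The coboundary of the `i`-th argument expands into the omissions of single vertices from the
pieces labelled `i`. -/
theorem seqOp_coboundary_arg (hf : Function.Surjective f) {X : TopCat.{u}}
    {x : Fin k → cochains X} {p : Fin k → ℤ} (hx : ∀ i, IsHom (p i) (x i)) (σ : Sing X q)
    (i : Fin k) :
    (seqOp f X fun i' => (if i' < i then signMap X 1 else if i' = i then coboundary X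
      else LinearMap.id) (x i')).1 q σ =
    sgn ((m : ℤ) - k) * (zs (revSign fun i => (p i : ZMod 2)) * ∑ J : Fin q →o Fin m,
      ∑ j, if f j = i ∧ (labelled f (gpiece J) i).card ≠ 1 then
        ∑ b ∈ gpiece J j, zs (eraseSign f J (fun i => (p i : ZMod 2)) j b
          ((labelled f (gpiece J) i).card)) * monom f x σ (eraseVertex (gpiece J) j b) else 0) := by
  classical
  set y : Fin k → cochains X := fun i' => (if i' < i then signMap X 1 else if i' = i then
    coboundary X else LinearMap.id) (x i') with hy
  have hyh : ∀ i', IsHom (p i' + if i' = i then 1 else 0) (y i') := by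
    intro i'
    rcases lt_trichotomy i' i with h | rfl | h
    · simp only [hy, h, if_true, h.ne, if_false, add_zero]
      rw [signMap_apply (hx i')]
      exact (hx i').smul _
    · simp only [hy, lt_irrefl, if_false, if_true]
      exact (hx i').coboundary
    · simp only [hy, h.not_gt, h.ne', if_false, add_zero]
      exact hx i'
  rw [seqOp_eq_core hf hyh]
  congr 1
  -- Raising the degree of one argument changes the evaluation sign by the degrees before and after
  -- it. The earlier degrees cancel against the signs put on the earlier arguments; the later ones
  -- enter `eraseSign`.
  have hrev : (revSign fun i' => ((p i' + if i' = i then 1 else 0 : ℤ) : ZMod 2)) =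
      revSign (fun i' => (p i' : ZMod 2)) + (∑ i', if i' < i then (p i' : ZMod 2) else 0) +
        ∑ i', if i < i' then (p i' : ZMod 2) else 0 := by
    rw [← revSign_add_single]
    congr 1
    funext i'
    push_cast
    rfl
  rw [hrev, zs_add, zs_add, mul_assoc, mul_assoc, core, Finset.mul_sum, Finset.mul_sum]
  congr 1
  refine Finset.sum_congr rfl fun J _ => ?_
  have hmon : monom f y σ (gpiece J) = zs (∑ i', if i' < i then (p i' : ZMod 2) else 0) *
      (ev (face σ (labelled f (gpiece J) i)) (coboundary X (x i)) *
        ∏ i' ∈ Finset.univ.erase i, ev (face σ (labelled f (gpiece J) i')) (x i')) := by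
    have h1 : ∀ i', ev (face σ (labelled f (gpiece J) i')) (y i') =
        zs (if i' < i then (p i' : ZMod 2) else 0) *
          if i' = i then ev (face σ (labelled f (gpiece J) i)) (coboundary X (x i)) else
            ev (face σ (labelled f (gpiece J) i')) (x i') := by
      intro i'
      rcases lt_trichotomy i' i with h | rfl | h
      · simp only [hy, h, if_true, h.ne, if_false]
        rw [signMap_apply (hx i'), map_smul]
        simp
      · simp [hy, zs_zero]
      · simp [hy, h.not_gt, h.ne', zs_zero]
    rw [monom, Finset.prod_congr rfl fun i' _ => h1 i', Finset.prod_mul_distrib, ← zs_sum]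
    congr 1
    rw [← Finset.mul_prod_erase _ _ (Finset.mem_univ i), if_pos rfl]
    congr 1
    exact Finset.prod_congr rfl fun i' hi' => by rw [if_neg (Finset.ne_of_mem_erase hi')]
  rw [hmon]
  by_cases hc : (labelled f (gpiece J) i).card = 1
  · rw [ev_coboundary_zero (by rw [hc])]
    simp only [zero_mul, mul_zero]
    exact (Finset.sum_eq_zero fun j _ => if_neg fun h => h.2 hc).symm
  · have hm : ∀ j, f j = i → ∀ b ∈ gpiece J j, monom f x σ (eraseVertex (gpiece J) j b) =
        ev (face σ ((labelled f (gpiece J) i).erase b)) (x i) *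
          ∏ i' ∈ Finset.univ.erase i, ev (face σ (labelled f (gpiece J) i')) (x i') := by
      intro j hj b hb
      rw [monom, ← Finset.mul_prod_erase _ _ (Finset.mem_univ i)]
      congr 1
      · refine congrArg (fun B => ev (face σ B) (x i)) ?_
        rw [labelled_eraseVertex hb, if_pos hj]
      · refine Finset.prod_congr rfl fun i' hi' => ?_
        refine congrArg (fun B => ev (face σ B) (x i')) ?_
        rw [labelled_eraseVertex hb, if_neg]
        rintro rfl
        exact Finset.ne_of_mem_erase hi' hj
    rw [ev_block_coboundary (hf i) J hc]
    simp only [ne_eq, hc, not_false_eq_true, and_true]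
    refine Eq.trans ?_ (Finset.sum_filter _ _)
    rw [Finset.sum_mul, Finset.mul_sum, Finset.mul_sum, Finset.mul_sum, Finset.mul_sum]
    refine Finset.sum_congr rfl fun j hj => ?_
    have hji : f j = i := by simpa using hj
    rw [Finset.sum_mul, Finset.mul_sum, Finset.mul_sum, Finset.mul_sum, Finset.mul_sum]
    refine Finset.sum_congr rfl fun b hb => ?_
    rw [hm j hji b hb, eraseSign, hji]
    simp only [zs_add]
    have := zs_mul_self (∑ i', if i' < i then (p i' : ZMod 2) else 0)
    set A := zs (∑ i', if i' < i then (p i' : ZMod 2) else 0)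
    linear_combination (zs (∑ i', if i < i' then (p i' : ZMod 2) else 0) * (zs (geps f J) *
      (zs ((labelled f (gpiece J) i).card : ZMod 2) * zs 1 * zs (place f J j b) *
      ev (face σ ((labelled f (gpiece J) i).erase b)) (x i) *
        ∏ i' ∈ Finset.univ.erase i, ev (face σ (labelled f (gpiece J) i')) (x i')))) * this

end Compose

/-! ## Cancellation of the terms of the differential -/

section Cancel

variable {m k q : ℕ}

/-- The next gap lies in the same piece. -/
def Next (J : Fin q → Fin m) (g : Fin q) : Prop := ∃ s : Fin q, (s : ℕ) = g + 1 ∧ J s = J g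

/-- The gap `g` is the first one, and in the first piece, or the preceding gap lies in the same
piece. -/
def AtBottom (J : Fin q → Fin m) (g : Fin q) : Prop :=
  ((g : ℕ) = 0 ∧ (J g : ℕ) = 0) ∨ ∃ s : Fin q, (s : ℕ) + 1 = g ∧ J s = J g

/-- The gap `g` is the last one, and in the last piece. -/
def AtTop (J : Fin q → Fin m) (g : Fin q) : Prop := (g : ℕ) + 1 = q ∧ (J g : ℕ) + 1 = m

-- In a piece with gaps, each vertex is the lower end of exactly one gap of the piece, except the
-- last vertex, which is the upper end of the last gap.
open Classical in
theorem sum_gpiece {J : Fin q →o Fin m} {j : Fin m} (hj : ∃ s, J s = j) (F : Fin (q + 1) → ℤ) :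
    ∑ b ∈ gpiece J j, F b = (∑ g, if J g = j then F g.castSucc else 0) +
      ∑ g, if J g = j ∧ ¬ Next J g then F g.succ else 0 := by
  obtain ⟨s0, hs0⟩ := hj
  rw [← Finset.sum_filter, ← Finset.sum_filter]
  rw [← Finset.sum_image (f := F) (g := Fin.castSucc) (s := Finset.univ.filter fun g => J g = j)
    fun _ _ _ _ h => Fin.castSucc_injective _ h]
  rw [← Finset.sum_image (f := F) (g := Fin.succ)
    (s := Finset.univ.filter fun g => J g = j ∧ ¬ Next J g) fun _ _ _ _ h => Fin.succ_injective _ h]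
  rw [← Finset.sum_union]
  · refine Finset.sum_congr ?_ fun _ _ => rfl
    ext b
    simp only [Finset.mem_union, Finset.mem_image, Finset.mem_filter, Finset.mem_univ, true_and,
      mem_gpiece]
    constructor
    · intro h
      by_cases hb : ∃ hq : (b : ℕ) < q, J ⟨b, hq⟩ = j
      · obtain ⟨hq, hb⟩ := hb
        exact Or.inl ⟨⟨b, hq⟩, hb, rfl⟩
      · right
        have hs : (s0 : ℕ) < b := by
          by_contra hle
          have hq : (b : ℕ) < q := by omega
          have h1 : J ⟨b, hq⟩ ≤ J s0 := J.monotone (by simpa [Fin.le_def] using hle)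
          refine hb ⟨hq, le_antisymm (h1.trans_eq hs0) (not_lt.1 fun h2 => ?_)⟩
          exact lt_irrefl _ ((h ⟨b, hq⟩).1 h2)
        have hq' : (b : ℕ) - 1 < q := by omega
        have h1 : J ⟨b - 1, hq'⟩ = j := by
          refine le_antisymm ((h _).2 (show (b : ℕ) - 1 < b by omega)) ?_
          rw [← hs0]
          have hle : s0 ≤ ⟨b - 1, hq'⟩ := Fin.le_def.2 (show (s0 : ℕ) ≤ b - 1 by omega)
          exact J.monotone hle
        refine ⟨⟨b - 1, hq'⟩, ⟨h1, ?_⟩, by ext; simp; omega⟩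
        rintro ⟨s, hs, hs'⟩
        refine hb ⟨by have := s.2; simp at hs; omega, ?_⟩
        rw [← h1, ← hs']
        congr 1
        ext
        simp at hs ⊢
        omega
    · rintro (⟨g, hg, rfl⟩ | ⟨g, ⟨hg, -⟩, rfl⟩) s
      · refine ⟨fun h => ?_, fun h => ?_⟩
        · by_contra hle
          have hle' : g ≤ s := Fin.le_def.2 (not_lt.1 hle)
          exact (J.monotone hle').not_gt (h.trans_eq hg.symm)
        · rw [← hg]
          have hle : s ≤ g := Fin.le_def.2 (Nat.le_of_lt h)
          exact J.monotone hle
      · refine ⟨fun h => ?_, fun h => ?_⟩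
        · by_contra hle
          rw [Fin.val_succ] at hle
          have hle' : g ≤ s := Fin.le_def.2 (by omega)
          exact (J.monotone hle').not_gt (h.trans_eq hg.symm)
        · rw [← hg]
          rw [Fin.val_succ] at h
          have hle : s ≤ g := Fin.le_def.2 (by omega)
          exact J.monotone hle
  · rw [Finset.disjoint_left]
    simp only [Finset.mem_image, Finset.mem_filter, Finset.mem_univ, true_and, not_exists, not_and]
    rintro _ ⟨g, hg, rfl⟩ g' ⟨hg', hn⟩ he
    refine hn ⟨g, ?_, hg.trans hg'.symm⟩
    have := congrArg Fin.val he
    simpa using this.symm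

open Classical in
theorem sum_vertices (J : Fin q →o Fin m) (F : Fin m → Fin (q + 1) → ℤ) :
    (∑ j, if ∃ s, J s = j then ∑ b ∈ gpiece J j, F j b else 0) =
      (∑ g, F (J g) g.castSucc) + ∑ g, if ¬ Next J g then F (J g) g.succ else 0 := by
  have h1 : ∀ j, (if ∃ s, J s = j then ∑ b ∈ gpiece J j, F j b else 0) =
      (∑ g, if J g = j then F j g.castSucc else 0) +
        ∑ g, if J g = j then (if ¬ Next J g then F j g.succ else 0) else 0 := by
    intro j
    split_ifs with h
    · rw [sum_gpiece h]
      congr 1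
      exact Finset.sum_congr rfl fun g _ => by rw [ite_and]
    · push Not at h
      simp [h]
  simp only [h1, Finset.sum_add_distrib]
  rw [Finset.sum_comm, Finset.sum_comm (s := Finset.univ) (t := Finset.univ)
    (f := fun j g => if J g = j then (if ¬ Next J g then F j g.succ else 0) else 0)]
  simp

/-- Here `g` is the first gap of its piece under `J` and the last one of the preceding piece under
`J'`. Both constructions break off the gap: one piece stops at its lower end, the next begins at its
upper end. -/
theorem eraseVertex_shift {J J' : Fin q →o Fin m} {g : Fin q} (hg : (J' g : ℕ) + 1 = J g)
    (h : ∀ s, s ≠ g → J s = J' s) :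
    eraseVertex (gpiece J) (J g) g.castSucc = eraseVertex (gpiece J') (J' g) g.succ := by
  funext j
  ext b
  simp only [mem_eraseVertex, mem_gpiece]
  have hlt : J' g < J g := Fin.lt_def.2 (by omega)
  have hle : ∀ a, J' g < a ↔ J g ≤ a := fun a => by rw [Fin.lt_def, Fin.le_def]; omega
  constructor
  · rintro ⟨h1, h2⟩
    refine ⟨fun s => ?_, ?_⟩
    · by_cases hs : s = g
      · subst hs
        refine ⟨fun h3 => ?_, fun h3 => hlt.le.trans ((h1 s).2 h3)⟩
        rcases ((hle j).1 h3).lt_or_eq with h4 | h4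
        · exact (h1 s).1 h4
        · by_contra hb
          have hb' : (b : ℕ) ≠ s := fun hb' => h2 ⟨h4.symm, Fin.ext hb'⟩
          have hq : (b : ℕ) < q := by have := s.2; omega
          have hne : (⟨b, hq⟩ : Fin q) ≠ s := fun he => hb' (congrArg Fin.val he)
          have h5 : J ⟨b, hq⟩ ≤ J' s := by
            rw [h _ hne]
            exact J'.monotone (by simp [Fin.le_def]; omega)
          exact lt_irrefl _ ((h1 ⟨b, hq⟩).1 (h5.trans_lt h3))
      · rw [← h s hs]
        exact h1 s
    · rintro ⟨rfl, rfl⟩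
      exact hlt.not_ge ((h1 g).2 (by simp))
  · rintro ⟨h1, h2⟩
    refine ⟨fun s => ?_, ?_⟩
    · by_cases hs : s = g
      · subst hs
        refine ⟨fun h3 => (h1 s).1 (hlt.trans h3), fun h3 => ?_⟩
        by_contra h4
        have h5 : j = J' s := le_antisymm (not_lt.1 fun h6 => h4 ((hle j).1 h6)) ((h1 s).2 h3)
        have hb : (b : ℕ) ≠ s + 1 := fun hb' => h2 ⟨h5, Fin.ext (by simpa using hb')⟩
        have hq : (s : ℕ) + 1 < q := by have := b.2; omega
        have hne : (⟨s + 1, hq⟩ : Fin q) ≠ s := fun he => by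
          have := congrArg Fin.val he; simp at this
        have h6 := (h1 ⟨s + 1, hq⟩).2 (by simp; omega)
        rw [← h _ hne] at h6
        exact h4 (le_trans (J.monotone (by simp [Fin.le_def])) h6)
      · rw [h s hs]
        exact h1 s
    · rintro ⟨rfl, rfl⟩
      exact lt_irrefl _ ((h1 g).1 hlt)

/-- The monotone map which is changed at `g`. -/
def setGap (J : Fin q →o Fin m) (g : Fin q) (t : Fin m) (h1 : ∀ s < g, J s ≤ t)
    (h2 : ∀ s, g < s → t ≤ J s) : Fin q →o Fin m :=
  ⟨Function.update J g t, by
    intro s s' hs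
    rcases hs.eq_or_lt with rfl | hs
    · exact le_rfl
    · by_cases hg : s = g
      · subst hg
        rw [Function.update_self, Function.update_of_ne hs.ne']
        exact h2 _ hs
      · rw [Function.update_of_ne hg]
        by_cases hg' : s' = g
        · subst hg'
          rw [Function.update_self]
          exact h1 _ hs
        · rw [Function.update_of_ne hg']
          exact J.monotone hs.le⟩

theorem setGap_self {J : Fin q →o Fin m} {g : Fin q} {t : Fin m} {h1 : ∀ s < g, J s ≤ t}
    {h2 : ∀ s, g < s → t ≤ J s} : setGap J g t h1 h2 g = t := Function.update_self _ _ _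

theorem setGap_of_ne {J : Fin q →o Fin m} {g s : Fin q} {t : Fin m} {h1 : ∀ s < g, J s ≤ t}
    {h2 : ∀ s, g < s → t ≤ J s} (hs : s ≠ g) : setGap J g t h1 h2 s = J s :=
  Function.update_of_ne hs _ _

theorem lt_of_not_atBottom {J : Fin q →o Fin m} {g : Fin q} (h : ¬ AtBottom J g) :
    (J g : ℕ) ≠ 0 ∧ ∀ s < g, J s < J g := by
  rw [AtBottom, not_or] at h
  have h2 : ∀ s < g, J s < J g := by
    intro s hs
    have hs' : (s : ℕ) < g := hs
    have hq : (g : ℕ) - 1 < q := by omega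
    have h3 : J s ≤ J ⟨g - 1, hq⟩ := J.monotone (by simp [Fin.le_def]; omega)
    have h4 : J ⟨g - 1, hq⟩ ≤ J g := J.monotone (by simp [Fin.le_def])
    refine h3.trans_lt (lt_of_le_of_ne h4 fun h5 => h.2 ⟨_, ?_, h5⟩)
    simp; omega
  refine ⟨fun h0 => ?_, h2⟩
  by_cases hg : (g : ℕ) = 0
  · exact h.1 ⟨hg, h0⟩
  · have := h2 ⟨0, g.pos⟩ (by simp [Fin.lt_def]; omega)
    rw [Fin.lt_def, h0] at this
    omega

theorem lt_of_not_next {J : Fin q →o Fin m} {g : Fin q} (h : ¬ Next J g) (h' : ¬ AtTop J g) :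
    (J g : ℕ) + 1 < m ∧ ∀ s, g < s → J g < J s := by
  have h2 : ∀ s, g < s → J g < J s := by
    intro s hs
    have hs' : (g : ℕ) < s := hs
    have hq : (g : ℕ) + 1 < q := by omega
    have h3 : J ⟨g + 1, hq⟩ ≤ J s := J.monotone (by simp [Fin.le_def]; omega)
    have h4 : J g ≤ J ⟨g + 1, hq⟩ := J.monotone (by simp [Fin.le_def])
    exact lt_of_lt_of_le (lt_of_le_of_ne h4 fun h5 => h ⟨_, rfl, h5.symm⟩) h3
  refine ⟨?_, h2⟩
  by_cases hg : (g : ℕ) + 1 = q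
  · by_contra hm
    exact h' ⟨hg, by have := (J g).2; omega⟩
  · have := h2 ⟨g + 1, by omega⟩ (by simp [Fin.lt_def])
    rw [Fin.lt_def] at this
    omega

-- Moving `g` down by one piece is a bijection between the two index sets. The signs agree because
-- `g` does not enter them, the remaining pieces by `eraseVertex_shift`.
open Classical in
theorem sum_shift {X : TopCat.{u}} (f : Fin m → Fin k) (x : Fin k → cochains X) (σ : Sing X q)
    (g : Fin q) :
    (∑ J : Fin q →o Fin m, if ¬ AtBottom J g then zs (geps f fun s : {s // s ≠ g} => J s) *
        monom f x σ (eraseVertex (gpiece J) (J g) g.castSucc) else 0) =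
      ∑ J : Fin q →o Fin m, if ¬ Next J g ∧ ¬ AtTop J g then
        zs (geps f fun s : {s // s ≠ g} => J s) *
          monom f x σ (eraseVertex (gpiece J) (J g) g.succ) else 0 := by
  rw [← Finset.sum_filter, ← Finset.sum_filter]
  have hdown : ∀ J ∈ Finset.univ.filter fun J : Fin q →o Fin m => ¬ AtBottom J g,
      (∀ s < g, J s ≤ ⟨J g - 1, by omega⟩) ∧ ∀ s, g < s → ⟨J g - 1, by omega⟩ ≤ J s := by
    intro J hJ
    obtain ⟨h0, h1⟩ := lt_of_not_atBottom (Finset.mem_filter.1 hJ).2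
    refine ⟨fun s hs => ?_, fun s hs => ?_⟩
    · have := Fin.lt_def.1 (h1 s hs)
      simp only [Fin.le_def]; omega
    · have := Fin.le_def.1 (J.monotone hs.le)
      simp only [Fin.le_def]; omega
  refine Finset.sum_bij (fun J hJ => setGap J g ⟨J g - 1, by omega⟩ (hdown J hJ).1 (hdown J hJ).2)
    ?_ ?_ ?_ ?_
  · intro J hJ
    obtain ⟨h0, h1⟩ := lt_of_not_atBottom (Finset.mem_filter.1 hJ).2
    rw [Finset.mem_filter]
    refine ⟨Finset.mem_univ _, ?_, ?_⟩
    · rintro ⟨s, hs, hs'⟩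
      have hne : s ≠ g := by rintro rfl; omega
      rw [setGap_self, setGap_of_ne hne] at hs'
      have hle : g ≤ s := Fin.le_def.2 (by omega)
      have h2 := Fin.le_def.1 (J.monotone hle)
      have := congrArg Fin.val hs'
      simp only at this
      omega
    · rintro ⟨-, h2⟩
      rw [setGap_self] at h2
      have := (J g).2
      simp only at h2
      omega
  · intro J hJ J' hJ' h
    obtain ⟨h0, -⟩ := lt_of_not_atBottom (Finset.mem_filter.1 hJ).2
    obtain ⟨h0', -⟩ := lt_of_not_atBottom (Finset.mem_filter.1 hJ').2
    ext s
    have := DFunLike.congr_fun h s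
    by_cases hs : s = g
    · subst hs
      rw [setGap_self, setGap_self, Fin.mk.injEq] at this
      omega
    · rw [setGap_of_ne hs, setGap_of_ne hs] at this
      rw [this]
  · intro J hJ
    obtain ⟨hm, h1⟩ := lt_of_not_next (Finset.mem_filter.1 hJ).2.1 (Finset.mem_filter.1 hJ).2.2
    have hup1 : ∀ s < g, J s ≤ ⟨J g + 1, hm⟩ := fun s hs => by
      have := Fin.le_def.1 (J.monotone hs.le)
      simp only [Fin.le_def]; omega
    have hup2 : ∀ s, g < s → ⟨J g + 1, hm⟩ ≤ J s := fun s hs => by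
      have := Fin.lt_def.1 (h1 s hs)
      simp only [Fin.le_def]; omega
    refine ⟨setGap J g ⟨J g + 1, hm⟩ hup1 hup2, ?_, ?_⟩
    · rw [Finset.mem_filter]
      refine ⟨Finset.mem_univ _, ?_⟩
      rintro (⟨-, h2⟩ | ⟨s, hs, hs'⟩)
      · rw [setGap_self] at h2
        simp at h2
      · have hne : s ≠ g := by rintro rfl; omega
        rw [setGap_self, setGap_of_ne hne] at hs'
        have hle : s ≤ g := Fin.le_def.2 (by omega)
        have h2 := Fin.le_def.1 (J.monotone hle)
        have := congrArg Fin.val hs'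
        simp only at this
        omega
    · ext s
      by_cases hs : s = g
      · subst hs
        rw [setGap_self]
        simp [setGap_self]
      · rw [setGap_of_ne hs, setGap_of_ne hs]
  · intro J hJ
    obtain ⟨h0, -⟩ := lt_of_not_atBottom (Finset.mem_filter.1 hJ).2
    congr 1
    · congr 2
      funext s
      rw [setGap_of_ne s.2]
    · rw [eraseVertex_shift]
      · rw [setGap_self]
        simp only
        omega
      · intro s hs
        rw [setGap_of_ne hs]

end Cancel

/-! ## Faces of a simplex -/

section Delta

variable {m k q : ℕ}

theorem succ_lt_iff_of_castSucc (g t : ℕ) (b : ℕ) :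
    (t < b ↔ (if t < g then t else t + 1) < if b < g then b else b + 1) := by
  split_ifs <;> omega

theorem val_succAbove {n : ℕ} (v : Fin (n + 1)) (b : Fin n) :
    (v.succAbove b : ℕ) = if (b : ℕ) < v then (b : ℕ) else b + 1 := by
  rw [Fin.succAbove]
  simp only [Fin.lt_def, Fin.val_castSucc]
  split_ifs <;> simp

/-- The erased vertex is interior to its piece or an end of the whole simplex. So it lies in no
other piece, and erasing it leaves an overlapping partition of the opposite face. -/
theorem eraseVertex_delta {J : Fin (q + 1) →o Fin m} {g : Fin (q + 1)} {v : Fin (q + 2)}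
    (h : (v = g.castSucc ∧ AtBottom J g) ∨ (v = g.succ ∧ AtTop J g)) (j : Fin m) :
    eraseVertex (gpiece J) (J g) v j =
      (gpiece (fun s => J (g.succAbove s)) j).map v.succAboveEmb := by
  have hbot : ∀ j, g.castSucc = v → AtBottom J g → (J g ≤ j ∨ ∃ s : Fin (q + 1), (s : ℕ) + 1 = g ∧ J s = J g) := by
    rintro j - (⟨-, h⟩ | h)
    · exact Or.inl (Fin.le_def.2 (by omega))
    · exact Or.inr h
  have hv : v ∈ gpiece J j → j = J g := by
    intro hv
    rw [mem_gpiece] at hv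
    rcases h with ⟨rfl, hg⟩ | ⟨rfl, hg⟩
    · have h1 : j ≤ J g := not_lt.1 fun h1 => lt_irrefl _ ((hv g).1 h1)
      refine le_antisymm h1 ?_
      rcases hbot j rfl hg with h2 | ⟨s, hs, hs'⟩
      · exact h2
      · rw [← hs']
        exact (hv s).2 (by rw [Fin.val_castSucc]; omega)
    · have h1 : J g ≤ j := (hv g).2 (by simp)
      refine le_antisymm (Fin.le_def.2 ?_) h1
      have := hg.2
      have := j.2
      omega
  have hlt : ∀ (t : Fin q) (b : Fin (q + 1)),
      (t : ℕ) < b ↔ ((g.succAbove t : Fin (q + 1)) : ℕ) < (v.succAbove b : Fin (q + 2)) := by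
    intro t b
    rw [val_succAbove, val_succAbove]
    rcases h with ⟨rfl, -⟩ | ⟨rfl, hg⟩
    · exact succ_lt_iff_of_castSucc g t b
    · have := t.2; have := b.2; have := hg.1
      rw [Fin.val_succ]
      split_ifs <;> omega
  ext b
  rw [mem_eraseVertex, Finset.mem_map]
  constructor
  · rintro ⟨hb, hne⟩
    have hbv : b ≠ v := by
      rintro rfl
      exact hne ⟨hv hb, rfl⟩
    obtain ⟨b', rfl⟩ := Fin.exists_succAbove_eq hbv
    refine ⟨b', mem_gpiece.2 fun t => ?_, rfl⟩
    rw [hlt]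
    exact mem_gpiece.1 hb _
  · rintro ⟨b', hb', rfl⟩
    refine ⟨?_, fun h' => Fin.succAbove_ne v b' h'.2⟩
    rw [mem_gpiece] at hb' ⊢
    have hb2 : ∀ t, (J (g.succAbove t) < j →
        ((g.succAbove t : Fin (q + 1)) : ℕ) < (v.succAbove b' : Fin (q + 2))) ∧
        (((g.succAbove t : Fin (q + 1)) : ℕ) < (v.succAbove b' : Fin (q + 2)) →
          J (g.succAbove t) ≤ j) := fun t => by
      rw [← hlt]; exact hb' t
    intro s
    change (J s < j → (s : ℕ) < (v.succAbove b' : Fin (q + 2))) ∧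
      ((s : ℕ) < (v.succAbove b' : Fin (q + 2)) → J s ≤ j)
    by_cases hs : s = g
    · subst hs
      have hne : ((v.succAbove b' : Fin (q + 2)) : ℕ) ≠ v := fun h' =>
        Fin.succAbove_ne v b' (Fin.ext h')
      rcases h with ⟨rfl, hg⟩ | ⟨rfl, hg⟩
      · rw [Fin.val_castSucc] at hne
        rcases hg with ⟨h0, h1⟩ | ⟨r, hr, hr'⟩
        · exact ⟨fun _ => by omega, fun _ => Fin.le_def.2 (by omega)⟩
        · obtain ⟨t, rfl⟩ := Fin.exists_succAbove_eq (x := r) (y := s) (by rintro rfl; omega)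
          have := hb2 t
          rw [hr'] at this
          exact ⟨fun h1 => by have := this.1 h1; omega, fun h1 => this.2 (by omega)⟩
      · rw [Fin.val_succ] at hne
        have h1 := hg.1
        have h2 := hg.2
        refine ⟨fun h3 => ?_, fun h3 => ?_⟩
        · have := Fin.lt_def.1 h3
          have := j.2
          omega
        · have := (s.succ.succAbove b').2
          omega
    · obtain ⟨t, rfl⟩ := Fin.exists_succAbove_eq hs
      exact hb2 t

theorem labelled_map {f : Fin m → Fin k} {P : Fin m → Finset (Fin (q + 1))} (v : Fin (q + 2))
    (i : Fin k) : labelled f (fun j => (P j).map v.succAboveEmb) i =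
      (labelled f P i).map v.succAbove := by
  rw [labelled, labelled, map_finset_sum]
  exact Finset.sum_congr rfl fun j _ => Finset.map_val _ _

theorem ev_face_delta {X : TopCat.{u}} (σ : Sing X (q + 1)) (v : Fin (q + 2))
    (B : Multiset (Fin (q + 1))) (hB : B ≠ 0) :
    ev (face ((TopCat.toSSet.obj X).δ v σ : Sing X q) B) = ev (face σ (B.map v.succAbove)) := by
  have h1 : face ((TopCat.toSSet.obj X).δ v σ : Sing X q) B =
      (TopCat.toSSet.obj X).map (vertexMap B ≫ SimplexCategory.δ v).op σ := by
    simp [face, SimplicialObject.δ]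
  rw [h1, ev_map_eq_ev_face (vertexMap B ≫ SimplexCategory.δ v) σ (B.map v.succAbove)]
  · conv_lhs => rw [← univ_map_vertexMap B hB]
    rw [Multiset.map_map]
    rfl

theorem monom_delta {X : TopCat.{u}} {f : Fin m → Fin k} (hf : Function.Surjective f)
    (x : Fin k → cochains X) (σ : Sing X (q + 1)) (v : Fin (q + 2)) (J : Fin q →o Fin m) :
    monom f x ((TopCat.toSSet.obj X).δ v σ : Sing X q) (gpiece J) =
      monom f x σ fun j => (gpiece J j).map v.succAboveEmb := by
  refine Finset.prod_congr rfl fun i _ => ?_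
  rw [ev_face_delta _ _ _ (labelled_ne_zero hf J i)]
  exact congrArg (fun B => ev (face σ B) (x i)) (labelled_map v i).symm

theorem geps_restrict (f : Fin m → Fin k) (J : Fin (q + 1) → Fin m) (g : Fin (q + 1)) :
    geps f (fun s : {s // s ≠ g} => J s) = geps f fun s => J (g.succAbove s) :=
  (geps_comp_orderIso (finSuccAboveOrderIso g) f fun s : {s // s ≠ g} => J s).symm

/-- Omit the gap `g`. -/
def omitGap (J : Fin (q + 1) →o Fin m) (g : Fin (q + 1)) : Fin q →o Fin m :=
  ⟨fun s => J (g.succAbove s), J.monotone.comp (Fin.strictMono_succAbove g).monotone⟩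

/-- Insert a gap. -/
def insertGap (J : Fin q →o Fin m) (g : Fin (q + 1)) (t : Fin m)
    (h1 : ∀ s, g.succAbove s < g → J s ≤ t) (h2 : ∀ s, g < g.succAbove s → t ≤ J s) :
    Fin (q + 1) →o Fin m :=
  ⟨g.insertNth t J, by
    intro a b hab
    induction a using g.succAboveCases with
    | x =>
      induction b using g.succAboveCases with
      | x => exact le_rfl
      | p b =>
        rw [Fin.insertNth_apply_same, Fin.insertNth_apply_succAbove]
        exact h2 b (lt_of_le_of_ne hab (Fin.succAbove_ne g b).symm)
    | p a =>
      induction b using g.succAboveCases with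
      | x =>
        rw [Fin.insertNth_apply_same, Fin.insertNth_apply_succAbove]
        exact h1 a (lt_of_le_of_ne hab (Fin.succAbove_ne g a))
      | p b =>
        rw [Fin.insertNth_apply_succAbove, Fin.insertNth_apply_succAbove]
        exact J.monotone ((Fin.strictMono_succAbove g).le_iff_le.1 hab)⟩

theorem insertGap_self {J : Fin q →o Fin m} {g : Fin (q + 1)} {t : Fin m}
    {h1 : ∀ s, g.succAbove s < g → J s ≤ t} {h2 : ∀ s, g < g.succAbove s → t ≤ J s} :
    insertGap J g t h1 h2 g = t := Fin.insertNth_apply_same (α := fun _ => Fin m) _ _ _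

theorem insertGap_succAbove {J : Fin q →o Fin m} {g : Fin (q + 1)} {t : Fin m}
    {h1 : ∀ s, g.succAbove s < g → J s ≤ t} {h2 : ∀ s, g < g.succAbove s → t ≤ J s} (s : Fin q) :
    insertGap J g t h1 h2 (g.succAbove s) = J s :=
  Fin.insertNth_apply_succAbove (α := fun _ => Fin m) _ _ _ _

theorem omitGap_insertGap {J : Fin q →o Fin m} {g : Fin (q + 1)} {t : Fin m}
    {h1 : ∀ s, g.succAbove s < g → J s ≤ t} {h2 : ∀ s, g < g.succAbove s → t ≤ J s} :
    omitGap (insertGap J g t h1 h2) g = J := by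
  ext s
  exact congrArg Fin.val (insertGap_succAbove (h1 := h1) (h2 := h2) s)

theorem ext_omitGap {J J' : Fin (q + 1) →o Fin m} {g : Fin (q + 1)} (h : J g = J' g)
    (h' : omitGap J g = omitGap J' g) : J = J' := by
  ext a
  induction a using g.succAboveCases with
  | x => rw [h]
  | p a => exact congrArg Fin.val (DFunLike.congr_fun h' a)

-- A partition of the face comes from exactly one partition of the simplex: the missing gap is
-- inserted into the piece of the gap before it, or into the first piece if there is none before it.
open Classical in
theorem core_delta_castSucc {X : TopCat.{u}} {f : Fin (m + 1) → Fin k}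
    (hf : Function.Surjective f) (x : Fin k → cochains X) (σ : Sing X (q + 1)) (g : Fin (q + 1)) :
    core f x ((TopCat.toSSet.obj X).δ g.castSucc σ : Sing X q) =
      ∑ J : Fin (q + 1) →o Fin (m + 1), if AtBottom J g then
        zs (geps f fun s : {s // s ≠ g} => J s) *
          monom f x σ (eraseVertex (gpiece J) (J g) g.castSucc) else 0 := by
  rw [← Finset.sum_filter]
  symm
  refine Finset.sum_bij (fun J _ => omitGap J g) (fun _ _ => Finset.mem_univ _) ?_ ?_ ?_
  · intro J hJ J' hJ' h
    refine ext_omitGap ?_ h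
    rcases (Finset.mem_filter.1 hJ).2 with ⟨h1, h2⟩ | ⟨s, hs, h2⟩
    · rcases (Finset.mem_filter.1 hJ').2 with ⟨h1', h2'⟩ | ⟨s', hs', h2'⟩
      · exact Fin.ext (h2.trans h2'.symm)
      · omega
    · rcases (Finset.mem_filter.1 hJ').2 with ⟨h1', h2'⟩ | ⟨s', hs', h2'⟩
      · omega
      · obtain rfl : s = s' := Fin.ext (by omega)
        obtain ⟨t, rfl⟩ := Fin.exists_succAbove_eq (x := s) (y := g) (by rintro rfl; omega)
        rw [← h2, ← h2']
        exact DFunLike.congr_fun h t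
  · intro K _
    by_cases hg : (g : ℕ) = 0
    · refine ⟨insertGap K g 0 (fun s hs => ?_) (fun _ _ => Fin.zero_le _), ?_, ?_⟩
      · rw [Fin.lt_def] at hs; omega
      · rw [Finset.mem_filter]
        exact ⟨Finset.mem_univ _, Or.inl ⟨hg, by rw [insertGap_self]; rfl⟩⟩
      · exact omitGap_insertGap
    · have hs0 : (g : ℕ) - 1 < q := by omega
      have hv : ((g.succAbove ⟨g - 1, hs0⟩ : Fin (q + 1)) : ℕ) = g - 1 := by
        rw [val_succAbove, if_pos (show (g : ℕ) - 1 < g by omega)]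
      refine ⟨insertGap K g (K ⟨g - 1, hs0⟩) (fun s hs => ?_) (fun s hs => ?_), ?_, ?_⟩
      · rw [Fin.lt_def, val_succAbove] at hs
        have hle : s ≤ ⟨g - 1, hs0⟩ := Fin.le_def.2 (show (s : ℕ) ≤ g - 1 by split_ifs at hs <;> omega)
        exact K.monotone hle
      · rw [Fin.lt_def, val_succAbove] at hs
        have hle : ⟨g - 1, hs0⟩ ≤ s := Fin.le_def.2 (show (g : ℕ) - 1 ≤ s by split_ifs at hs <;> omega)
        exact K.monotone hle
      · rw [Finset.mem_filter]
        refine ⟨Finset.mem_univ _, Or.inr ⟨g.succAbove ⟨g - 1, hs0⟩, by omega, ?_⟩⟩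
        rw [insertGap_self, insertGap_succAbove]
      · exact omitGap_insertGap
  · intro J hJ
    rw [geps_restrict, monom_delta hf]
    congr 2
    funext j
    exact eraseVertex_delta (Or.inl ⟨rfl, (Finset.mem_filter.1 hJ).2⟩) j

-- The last vertex is not the lower end of a gap, so this face needs its own argument: the last gap
-- is inserted into the last piece.
open Classical in
theorem core_delta_last {X : TopCat.{u}} {f : Fin (m + 1) → Fin k}
    (hf : Function.Surjective f) (x : Fin k → cochains X) (σ : Sing X (q + 1)) :
    core f x ((TopCat.toSSet.obj X).δ (Fin.last (q + 1)) σ : Sing X q) =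
      ∑ J : Fin (q + 1) →o Fin (m + 1), if AtTop J (Fin.last q) then
        zs (geps f fun s : {s // s ≠ Fin.last q} => J s) *
          monom f x σ (eraseVertex (gpiece J) (J (Fin.last q)) (Fin.last q).succ) else 0 := by
  rw [← Finset.sum_filter]
  symm
  refine Finset.sum_bij (fun J _ => omitGap J (Fin.last q)) (fun _ _ => Finset.mem_univ _) ?_ ?_ ?_
  · intro J hJ J' hJ' h
    refine ext_omitGap (Fin.ext ?_) h
    have h1 := (Finset.mem_filter.1 hJ).2.2
    have h2 := (Finset.mem_filter.1 hJ').2.2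
    omega
  · intro K _
    refine ⟨insertGap K (Fin.last q) (Fin.last m) (fun s _ => Fin.le_last _) (fun s hs => ?_), ?_, ?_⟩
    · exact absurd (Fin.le_last _) hs.not_ge
    · rw [Finset.mem_filter]
      exact ⟨Finset.mem_univ _, rfl, by rw [insertGap_self]; rfl⟩
    · exact omitGap_insertGap
  · intro J hJ
    rw [geps_restrict, monom_delta hf]
    congr 2
    funext j
    exact eraseVertex_delta (Or.inr ⟨rfl, (Finset.mem_filter.1 hJ).2⟩) j

end Delta

/-! ## The differential of a sequence operation -/

section Differential

variable {m k q : ℕ}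

theorem card_labelled_cast {f : Fin m → Fin k} (hf : Function.Surjective f) (J : Fin q →o Fin m)
    (i : Fin k) : ((labelled f (gpiece J) i).card : ZMod 2) =
      (∑ s, if f (J s) = i then 1 else 0) + junctions f i + 1 := by
  rw [card_labelled, card_fibre_eq (hf i), Finset.sum_boole, junctions]
  push_cast
  ring

/-- A nonzero value forces the dimensions of the blocks to be the given degrees. The block of `j`
has lost a vertex, but only later blocks are needed in `eraseSign`. -/
theorem eraseSign_eq_of_monom_ne {f : Fin m → Fin k} (hf : Function.Surjective f)
    {X : TopCat.{u}} {x : Fin k → cochains X} {p : Fin k → ℤ} (hx : ∀ i, IsHom (p i) (x i))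
    (σ : Sing X q) (J : Fin q →o Fin m) (j : Fin m) {b : Fin (q + 1)} (hb : b ∈ gpiece J j)
    (h : monom f x σ (eraseVertex (gpiece J) j b) ≠ 0) (i' : Fin k) (hi : f j < i') :
    (p i' : ZMod 2) = (∑ s, if f (J s) = i' then 1 else 0) + junctions f i' := by
  have h1 : (((labelled f (eraseVertex (gpiece J) j b) i').card - 1 : ℕ) : ℤ) = p i' := by
    by_contra hne
    exact h (monom_eq_zero hx hne)
  rw [labelled_eraseVertex hb, if_neg hi.ne] at h1
  have h2 := card_labelled_cast hf J i'
  have h3 := Multiset.card_pos.2 (labelled_ne_zero hf J i')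
  obtain ⟨c, hc⟩ : ∃ c, (labelled f (gpiece J) i').card = c + 1 := ⟨_, (Nat.sub_add_cancel h3).symm⟩
  rw [hc] at h1 h2
  rw [← h1]
  push_cast at h2 ⊢
  simpa using h2

theorem castSucc_mem_gpiece (J : Fin q →o Fin m) (g : Fin q) : g.castSucc ∈ gpiece J (J g) := by
  rw [mem_gpiece]
  intro s
  refine ⟨fun h => ?_, fun h => ?_⟩
  · by_contra hle
    have hle' : g ≤ s := Fin.le_def.2 (not_lt.1 hle)
    exact (J.monotone hle').not_gt h
  · have hle : s ≤ g := Fin.le_def.2 (Nat.le_of_lt h)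
    exact J.monotone hle

theorem succ_mem_gpiece (J : Fin q →o Fin m) (g : Fin q) : g.succ ∈ gpiece J (J g) := by
  rw [mem_gpiece]
  intro s
  refine ⟨fun h => ?_, fun h => ?_⟩
  · by_contra hle
    rw [Fin.val_succ] at hle
    have hle' : g ≤ s := Fin.le_def.2 (by omega)
    exact (J.monotone hle').not_gt h
  · rw [Fin.val_succ] at h
    have hle : s ≤ g := Fin.le_def.2 (by omega)
    exact J.monotone hle

/-- If the value is zero the sign is irrelevant; otherwise the degrees are those of the blocks and
`eraseSign_gap` applies. -/
theorem eraseSign_mul_monom {f : Fin m → Fin k} (hf : Function.Surjective f)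
    {X : TopCat.{u}} {x : Fin k → cochains X} {p : Fin k → ℤ} (hx : ∀ i, IsHom (p i) (x i))
    (σ : Sing X q) (J : Fin q →o Fin m) (g : Fin q) (b : Fin (q + 1))
    (hb : b = g.castSucc ∨ b = g.succ) :
    zs (eraseSign f J (fun i => (p i : ZMod 2)) (J g) b ((labelled f (gpiece J) (f (J g))).card)) *
        monom f x σ (eraseVertex (gpiece J) (J g) b) =
      zs ((b : ℕ) + q + ∑ i, (junctions f i : ZMod 2)) *
        (zs (geps f fun s : {s // s ≠ g} => J s) *
          monom f x σ (eraseVertex (gpiece J) (J g) b)) := by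
  by_cases h : monom f x σ (eraseVertex (gpiece J) (J g) b) = 0
  · simp [h]
  · have hmem : b ∈ gpiece J (J g) := by
      rcases hb with rfl | rfl
      · exact castSucc_mem_gpiece J g
      · exact succ_mem_gpiece J g
    rw [eraseSign_gap hf J _ g b (by rcases hb with rfl | rfl <;> simp) _
      (fun i' hi => eraseSign_eq_of_monom_ne hf hx σ J _ hmem h i' hi)
      (card_labelled_cast hf J _), ← mul_assoc, ← zs_add]
    congr 2
    ring

open Classical in
theorem sum_atTop {f : Fin (m + 1) → Fin k} (hf : Function.Surjective f) {X : TopCat.{u}}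
    (x : Fin k → cochains X) (σ : Sing X (q + 1)) (g : Fin (q + 1)) :
    (∑ J : Fin (q + 1) →o Fin (m + 1), if ¬ Next J g then
        zs (geps f fun s : {s // s ≠ g} => J s) *
          monom f x σ (eraseVertex (gpiece J) (J g) g.succ) else 0) =
      (∑ J : Fin (q + 1) →o Fin (m + 1), if ¬ Next J g ∧ ¬ AtTop J g then
        zs (geps f fun s : {s // s ≠ g} => J s) *
          monom f x σ (eraseVertex (gpiece J) (J g) g.succ) else 0) +
      if g = Fin.last q then
        core f x ((TopCat.toSSet.obj X).δ (Fin.last (q + 1)) σ : Sing X q) else 0 := by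
  have h1 : (if g = Fin.last q then
        core f x ((TopCat.toSSet.obj X).δ (Fin.last (q + 1)) σ : Sing X q) else 0) =
      ∑ J : Fin (q + 1) →o Fin (m + 1), if AtTop J g then
        zs (geps f fun s : {s // s ≠ g} => J s) *
          monom f x σ (eraseVertex (gpiece J) (J g) g.succ) else 0 := by
    split_ifs with hg
    · subst hg
      exact core_delta_last hf x σ
    · refine (Finset.sum_eq_zero fun J _ => if_neg fun h => hg ?_).symm
      exact Fin.ext (by have := h.1; rw [Fin.val_last]; omega)
  rw [h1, ← Finset.sum_add_distrib]
  refine Finset.sum_congr rfl fun J _ => ?_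
  by_cases h : AtTop J g
  · have hn : ¬ Next J g := by
      rintro ⟨s, hs, -⟩
      have := h.1
      have := s.2
      omega
    simp [h, hn]
  · simp [h]

open Classical in
/-- The terms in which a vertex of a nontrivial piece is omitted give the composite with the
coboundary. -/
theorem sum_eraseVertex {f : Fin (m + 1) → Fin k} (hf : Function.Surjective f)
    {X : TopCat.{u}} {x : Fin k → cochains X} {p : Fin k → ℤ} (hx : ∀ i, IsHom (p i) (x i))
    (σ : Sing X (q + 1)) :
    (∑ J : Fin (q + 1) →o Fin (m + 1), ∑ j, if ∃ s, J s = j then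
      ∑ b ∈ gpiece J j, zs (eraseSign f J (fun i => (p i : ZMod 2)) j b
        ((labelled f (gpiece J) (f j)).card)) * monom f x σ (eraseVertex (gpiece J) j b) else 0) =
      zs (q + 1 + ∑ i, (junctions f i : ZMod 2)) * ∑ v : Fin (q + 2), zs ((v : ℕ) : ZMod 2) *
        core f x ((TopCat.toSSet.obj X).δ v σ : Sing X q) := by
  have h1 : ∀ J : Fin (q + 1) →o Fin (m + 1), (∑ j, if ∃ s, J s = j then
      ∑ b ∈ gpiece J j, zs (eraseSign f J (fun i => (p i : ZMod 2)) j b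
        ((labelled f (gpiece J) (f j)).card)) * monom f x σ (eraseVertex (gpiece J) j b) else 0) =
      zs (q + 1 + ∑ i, (junctions f i : ZMod 2)) * ∑ g : Fin (q + 1), zs ((g : ℕ) : ZMod 2) *
        ((zs (geps f fun s : {s // s ≠ g} => J s) *
          monom f x σ (eraseVertex (gpiece J) (J g) g.castSucc)) -
        if ¬ Next J g then (zs (geps f fun s : {s // s ≠ g} => J s) *
          monom f x σ (eraseVertex (gpiece J) (J g) g.succ)) else 0) := by
    intro J
    rw [sum_vertices J fun j b => zs (eraseSign f J (fun i => (p i : ZMod 2)) j b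
        ((labelled f (gpiece J) (f j)).card)) * monom f x σ (eraseVertex (gpiece J) j b),
      ← Finset.sum_add_distrib, Finset.mul_sum]
    refine Finset.sum_congr rfl fun g _ => ?_
    rw [eraseSign_mul_monom hf hx σ J g _ (Or.inl rfl),
      eraseSign_mul_monom hf hx σ J g _ (Or.inr rfl)]
    simp only [Fin.val_castSucc, Fin.val_succ, Nat.cast_add, Nat.cast_one, zs_add, zs_one]
    split_ifs <;> ring
  rw [Finset.sum_congr rfl fun J _ => h1 J, ← Finset.mul_sum]
  congr 1
  -- Omitting the lower end of `g` gives the face opposite to it, plus terms to be cancelled by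
  -- omissions of the upper end.
  have h2 : ∀ g : Fin (q + 1), (∑ J : Fin (q + 1) →o Fin (m + 1),
      zs (geps f fun s : {s // s ≠ g} => J s) *
          monom f x σ (eraseVertex (gpiece J) (J g) g.castSucc)) =
      core f x ((TopCat.toSSet.obj X).δ g.castSucc σ : Sing X q) +
      ∑ J : Fin (q + 1) →o Fin (m + 1), if ¬ Next J g ∧ ¬ AtTop J g then
        zs (geps f fun s : {s // s ≠ g} => J s) *
          monom f x σ (eraseVertex (gpiece J) (J g) g.succ) else 0 := by
    intro g
    rw [← sum_shift, core_delta_castSucc hf, ← Finset.sum_add_distrib]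
    refine Finset.sum_congr rfl fun J _ => ?_
    by_cases h : AtBottom J g <;> simp [h]
  -- After the cancellation every gap leaves one face, and the last gap also leaves the face
  -- opposite to the last vertex.
  have h3 : ∀ g : Fin (q + 1), (∑ J : Fin (q + 1) →o Fin (m + 1), zs ((g : ℕ) : ZMod 2) *
        ((zs (geps f fun s : {s // s ≠ g} => J s) *
          monom f x σ (eraseVertex (gpiece J) (J g) g.castSucc)) -
        if ¬ Next J g then (zs (geps f fun s : {s // s ≠ g} => J s) *
          monom f x σ (eraseVertex (gpiece J) (J g) g.succ)) else 0)) =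
      zs ((g : ℕ) : ZMod 2) * core f x ((TopCat.toSSet.obj X).δ g.castSucc σ : Sing X q) -
        if g = Fin.last q then zs (q : ZMod 2) *
          core f x ((TopCat.toSSet.obj X).δ (Fin.last (q + 1)) σ : Sing X q) else 0 := by
    intro g
    rw [← Finset.mul_sum, Finset.sum_sub_distrib, h2 g, sum_atTop hf x σ g]
    split_ifs with hg
    · subst hg
      rw [Fin.val_last]
      ring
    · ring
  rw [Finset.sum_comm, Finset.sum_congr rfl fun g _ => h3 g, Finset.sum_sub_distrib,
    Finset.sum_ite_eq' Finset.univ, if_pos (Finset.mem_univ _), Fin.sum_univ_castSucc (n := q + 1)]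
  simp only [Fin.val_castSucc, Fin.val_last, Nat.cast_add, Nat.cast_one, zs_add, zs_one]
  ring

/-- The terms in which a piece without gaps is omitted. -/
theorem sum_isolated {f : Fin (m + 1) → Fin k} (hf : Function.Surjective f)
    {X : TopCat.{u}} {x : Fin k → cochains X} {p : Fin k → ℤ} (hx : ∀ i, IsHom (p i) (x i))
    (σ : Sing X q) (j : Fin (m + 1)) [DecidablePred fun J : Fin q →o Fin (m + 1) => ∃ s, J s = j] :
    (∑ J : Fin q →o Fin (m + 1), if ∃ s, J s = j then 0 else
      ∑ b ∈ gpiece J j, zs (eraseSign f J (fun i => (p i : ZMod 2)) j b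
        ((labelled f (gpiece J) (f j)).card)) * monom f x σ (eraseVertex (gpiece J) j b)) =
      zs ((∑ i, (junctions f i : ZMod 2)) + (nb f j + ((f j : ℕ) : ZMod 2))) *
        core (f ∘ j.succAbove) x σ := by
  simp only [← ite_not (∃ s, _ = j)]
  rw [← Finset.sum_filter, core, Finset.mul_sum]
  symm
  refine Finset.sum_bij (fun K _ => (⟨fun s => j.succAbove (K s),
    (Fin.strictMono_succAbove j).monotone.comp K.monotone⟩ : Fin q →o Fin (m + 1))) ?_ ?_ ?_ ?_
  · intro K _
    rw [Finset.mem_filter]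
    refine ⟨Finset.mem_univ _, ?_⟩
    rintro ⟨s, hs⟩
    exact Fin.succAbove_ne _ _ hs
  · intro K _ K' _ h
    ext s
    have := DFunLike.congr_fun h s
    exact congrArg Fin.val (Fin.succAbove_right_injective this)
  · intro J hJ
    have h1 : ∀ s, ∃ a, j.succAbove a = J s := fun s =>
      Fin.exists_succAbove_eq fun h => (Finset.mem_filter.1 hJ).2 ⟨s, h⟩
    choose K hK using h1
    refine ⟨⟨K, fun s s' h => ?_⟩, Finset.mem_univ _, ?_⟩
    · rw [← (Fin.strictMono_succAbove j).le_iff_le, hK, hK]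
      exact J.monotone h
    · ext s
      exact congrArg Fin.val (hK s)
  · intro K _
    set J : Fin q →o Fin (m + 1) := ⟨fun s => j.succAbove (K s),
      (Fin.strictMono_succAbove j).monotone.comp K.monotone⟩ with hJ
    have hJs : ∀ s, J s = j.succAbove (K s) := fun s => rfl
    -- Without gaps the piece is a single vertex, so erasing this vertex removes `j` from the
    -- sequence altogether.
    have hc : (gpiece J j).card = 1 := by
      rw [card_gpiece, Finset.card_eq_zero.2 (Finset.filter_eq_empty_iff.2
        fun s _ (h : J s = j) => Fin.succAbove_ne _ _ h)]
    obtain ⟨b, hb⟩ := Finset.card_eq_one.1 hc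
    have hbm : b ∈ gpiece J j := by rw [hb]; simp
    rw [hb, Finset.sum_singleton]
    have hmon : monom f x σ (eraseVertex (gpiece J) j b) =
        monom (f ∘ j.succAbove) x σ (gpiece K) := by
      refine Finset.prod_congr rfl fun i _ => congrArg (fun B => ev (face σ B) (x i)) ?_
      rw [labelled, labelled, Finset.sum_filter, Finset.sum_filter, Fin.sum_univ_succAbove _ j]
      have h0 : eraseVertex (gpiece J) j b j = ∅ := by
        rw [eraseVertex, Function.update_self, hb]; simp
      rw [h0]
      simp only [Finset.empty_val, ite_self, zero_add, Function.comp_apply]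
      refine Finset.sum_congr rfl fun a _ => ?_
      have h1 : eraseVertex (gpiece J) j b (j.succAbove a) = gpiece K a := by
        rw [eraseVertex, Function.update_of_ne (Fin.succAbove_ne j a)]
        ext b'
        simp only [mem_gpiece, hJs, (Fin.strictMono_succAbove j).le_iff_le,
          (Fin.strictMono_succAbove j).lt_iff_lt]
      rw [h1]
    by_cases h : monom f x σ (eraseVertex (gpiece J) j b) = 0
    · rw [h, ← hmon, h]; simp
    · have hs := eraseSign_isolated hf j K (fun i => (p i : ZMod 2)) b (fun s => ?_)
        ((labelled f (gpiece J) (f j)).card)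
        (fun i' hi => eraseSign_eq_of_monom_ne hf hx σ J _ hbm h i' hi)
        (card_labelled_cast hf J _)
      · rw [← hmon]
        change _ = zs (eraseSign f (fun s => j.succAbove (K s)) _ j b _) * _
        rw [hs, ← mul_assoc, ← zs_add]
        congr 2
        ring
      · have := mem_gpiece.1 hbm s
        rw [hJs] at this
        exact ⟨fun h1 => lt_of_le_of_ne (this.2 h1) (Fin.succAbove_ne _ _), this.1⟩

theorem sum_junctions_cast {f : Fin m → Fin k} (hf : Function.Surjective f) :
    ∑ i, (junctions f i : ZMod 2) = (((m : ℤ) - k : ℤ) : ZMod 2) := by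
  have h := card_eq_sum_junction hf
  rw [Fintype.card_fin] at h
  have h' := congrArg (Nat.cast (R := ZMod 2)) h
  push_cast [Finset.sum_add_distrib] at h'
  push_cast
  rw [h']
  simp

/-- The number of vertices of a block is its number of gaps plus its number of pieces. Consequently
a piece with gaps may always lose a vertex, while an isolated vertex may be omitted only if its
label occurs elsewhere, which keeps the shortened sequence surjective. -/
theorem card_labelled_ne_one_iff {f : Fin (m + 1) → Fin k} (J : Fin q →o Fin (m + 1))
    (j : Fin (m + 1)) : (labelled f (gpiece J) (f j)).card ≠ 1 ↔
      (∃ s, J s = j) ∨ ∃ a, f (j.succAbove a) = f j := by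
  have hj : j ∈ Finset.univ.filter fun j' => f j' = f j := by simp
  have hpos := Finset.card_pos.2 ⟨j, hj⟩
  rw [card_labelled]
  constructor
  · intro h
    by_contra! hcon
    refine h ?_
    have h1 : (Finset.univ.filter fun j' => f j' = f j) = {j} := by
      ext j'
      rw [Finset.mem_filter, Finset.mem_singleton]
      refine ⟨fun h' => ?_, fun h' => by simp [h']⟩
      by_contra hne
      obtain ⟨a, rfl⟩ := Fin.exists_succAbove_eq hne
      exact hcon.2 a h'.2
    rw [h1, Finset.filter_false_of_mem, Finset.card_singleton, Finset.card_empty]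
    intro s _ hs
    refine hcon.1 s ?_
    by_contra hne
    obtain ⟨a, ha⟩ := Fin.exists_succAbove_eq hne
    rw [← ha] at hs
    exact hcon.2 a hs
  · rintro (⟨s, hs⟩ | ⟨a, ha⟩)
    · have : 0 < (Finset.univ.filter fun s => f (J s) = f j).card :=
        Finset.card_pos.2 ⟨s, by simp [hs]⟩
      omega
    · have : 1 < (Finset.univ.filter fun j' => f j' = f j).card :=
        Finset.one_lt_card.2 ⟨j, hj, j.succAbove a, by simp [ha], (Fin.succAbove_ne j a).symm⟩
      omega

theorem ev_diff {n : ℤ} (ν : Family.{u} k) {X : TopCat.{u}} (x : Fin k → cochains X)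
    (σ : Sing X q) : (diff k n ν X x).1 q σ = ev σ (coboundary X (ν X x)) - sgn n *
      ∑ i, (ν X fun i' => (if i' < i then signMap X 1 else if i' = i then coboundary X
        else LinearMap.id) (x i')).1 q σ := by
  have h : diff k n ν X x = coboundary X (ν X x) - sgn n • ∑ i, (ν X fun i' =>
      (if i' < i then signMap X 1 else if i' = i then coboundary X else LinearMap.id) (x i')) := by
    change ((coboundary X).compMultilinearMap (ν X) - sgn n • ∑ i : Fin k,
      (ν X).compLinearMap fun i' => if i' < i then signMap X 1 else if i' = i then coboundary X
        else LinearMap.id) x = _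
    rw [sub_apply, smul_apply, sum_apply]
    rfl
  change ev σ (diff k n ν X x) = _
  rw [h, map_sub, map_smul, map_sum, smul_eq_mul]
  rfl

theorem surjective_comp_succAbove {f : Fin (m + 1) → Fin k} (hf : Function.Surjective f)
    {j : Fin (m + 1)} (h : ∃ a, f (j.succAbove a) = f j) :
    Function.Surjective (f ∘ j.succAbove) := by
  intro i
  obtain ⟨j', rfl⟩ := hf i
  by_cases hj : j' = j
  · subst hj
    exact h
  · obtain ⟨a, rfl⟩ := Fin.exists_succAbove_eq hj
    exact ⟨a, rfl⟩

theorem ev_coboundary_seqOp {f : Fin (m + 1) → Fin k} (hf : Function.Surjective f)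
    {X : TopCat.{u}} {x : Fin k → cochains X} {p : Fin k → ℤ} (hx : ∀ i, IsHom (p i) (x i))
    (σ : Sing X q) [∀ (J : Fin q →o Fin (m + 1)) j, Decidable (∃ s, J s = j)] :
    ev σ (coboundary X (seqOp f X x)) = zs (revSign fun i => (p i : ZMod 2)) *
      ∑ J : Fin q →o Fin (m + 1), ∑ j, if ∃ s, J s = j then
      ∑ b ∈ gpiece J j, zs (eraseSign f J (fun i => (p i : ZMod 2)) j b
        ((labelled f (gpiece J) (f j)).card)) * monom f x σ (eraseVertex (gpiece J) j b) else 0 := by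
  cases q with
  | zero =>
    rw [ev_coboundary_zero rfl, Finset.sum_eq_zero, mul_zero]
    exact fun J _ => Finset.sum_eq_zero fun j _ => if_neg fun ⟨s, _⟩ => s.elim0
  | succ q =>
    have h := sum_eraseVertex hf hx σ
    rw [ev_coboundary_succ]
    refine Eq.trans ?_ (congrArg (zs (revSign fun i => (p i : ZMod 2)) * ·) (Eq.trans h.symm ?_))
    · have h1 : ∀ v : Fin (q + 2), ev (X := X) ((TopCat.toSSet.obj X).δ v σ : Sing X q)
          (seqOp f X x) = sgn (((m + 1 : ℕ) : ℤ) - k) * (zs (revSign fun i => (p i : ZMod 2)) *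
            core f x ((TopCat.toSSet.obj X).δ v σ : Sing X q)) := fun v => seqOp_eq_core hf hx _
      simp only [h1, sum_junctions_cast hf, sgn_eq_zs, zs_add, zs_one, Finset.mul_sum]
      refine Finset.sum_congr rfl fun v _ => ?_
      push_cast
      ring
    · congr!

-- The composite of `⟨f⟩` with the coboundary omits vertices. The omissions from pieces with gaps
-- make up the coboundary of the value and cancel against `d ∘ ⟨f⟩`; the omissions of isolated
-- pieces remain as deletions.
open Classical in
theorem diff_seqOp {f : Fin (m + 1) → Fin k} (hf : Function.Surjective f) :
    diff.{u} k (((m + 1 : ℕ) : ℤ) - k) (seqOp f) =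
      ∑ j, if ∃ a, f (j.succAbove a) = f j then
        zs (nb f j + ((f j : ℕ) : ZMod 2)) • seqOp (f ∘ j.succAbove) else 0 := by
  refine family_ext fun X x p hx' => cochain_ext fun q σ => ?_
  have hx : ∀ i, IsHom (p i : ℤ) (x i) := fun i => (hx' i).isHom
  change _ = evalAt X x σ _
  rw [ev_diff, ev_coboundary_seqOp hf hx, map_sum]
  simp only [seqOp_coboundary_arg hf hx]
  have h1 : ∀ j, evalAt X x σ (if ∃ a, f (j.succAbove a) = f j then
      zs (nb f j + ((f j : ℕ) : ZMod 2)) • seqOp (f ∘ j.succAbove) else 0) =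
      if ∃ a, f (j.succAbove a) = f j then zs (nb f j + ((f j : ℕ) : ZMod 2)) *
        (sgn ((m : ℤ) - k) * (zs (revSign fun i => ((p i : ℤ) : ZMod 2)) *
          core (f ∘ j.succAbove) x σ)) else 0 := by
    intro j
    split_ifs with hj
    · rw [map_smul, smul_eq_mul, ← seqOp_eq_core (surjective_comp_succAbove hf hj) hx]
      rfl
    · rw [map_zero]
  simp only [h1]
  rw [← Finset.mul_sum, ← Finset.mul_sum]
  -- Separate the pieces with gaps from those without.
  have h2 : ∀ J : Fin q →o Fin (m + 1), (∑ i, ∑ j,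
      if f j = i ∧ (labelled f (gpiece J) i).card ≠ 1 then
        ∑ b ∈ gpiece J j, zs (eraseSign f J (fun i => ((p i : ℤ) : ZMod 2)) j b
          ((labelled f (gpiece J) i).card)) * monom f x σ (eraseVertex (gpiece J) j b) else 0) =
      (∑ j, if ∃ s, J s = j then
        ∑ b ∈ gpiece J j, zs (eraseSign f J (fun i => ((p i : ℤ) : ZMod 2)) j b
          ((labelled f (gpiece J) (f j)).card)) * monom f x σ (eraseVertex (gpiece J) j b) else 0) +
      ∑ j, if ∃ a, f (j.succAbove a) = f j then (if ∃ s, J s = j then 0 else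
        ∑ b ∈ gpiece J j, zs (eraseSign f J (fun i => ((p i : ℤ) : ZMod 2)) j b
          ((labelled f (gpiece J) (f j)).card)) * monom f x σ (eraseVertex (gpiece J) j b))
        else 0 := by
    intro J
    rw [Finset.sum_comm, ← Finset.sum_add_distrib]
    refine Finset.sum_congr rfl fun j _ => ?_
    rw [Finset.sum_eq_single (f j) (fun i _ hi => if_neg fun h => hi h.1.symm) (by simp)]
    have := card_labelled_ne_one_iff (f := f) J j
    by_cases hs : ∃ s, J s = j
    · rw [if_pos ⟨rfl, this.2 (Or.inl hs)⟩, if_pos hs, if_pos hs, ite_self, add_zero]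
    · rw [if_neg hs, if_neg hs, zero_add]
      exact if_congr (by rw [this]; tauto) rfl rfl
  rw [Finset.sum_comm (s := Finset.univ) (t := Finset.univ) (γ := Fin k),
    Finset.sum_congr rfl fun J _ => h2 J, Finset.sum_add_distrib, Finset.sum_comm (s := Finset.univ) (t := Finset.univ)
    (f := fun (J : Fin q →o Fin (m + 1)) j => if ∃ a, f (j.succAbove a) = f j then
      (if ∃ s, J s = j then 0 else
        ∑ b ∈ gpiece J j, zs (eraseSign f J (fun i => ((p i : ℤ) : ZMod 2)) j b
          ((labelled f (gpiece J) (f j)).card)) * monom f x σ (eraseVertex (gpiece J) j b))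
        else 0)]
  have h3 : ∀ j, (∑ J : Fin q →o Fin (m + 1), if ∃ a, f (j.succAbove a) = f j then
      (if ∃ s, J s = j then 0 else
        ∑ b ∈ gpiece J j, zs (eraseSign f J (fun i => ((p i : ℤ) : ZMod 2)) j b
          ((labelled f (gpiece J) (f j)).card)) * monom f x σ (eraseVertex (gpiece J) j b))
        else 0) = zs (((m + 1 : ℕ) : ℤ) - k : ℤ) * if ∃ a, f (j.succAbove a) = f j then
          zs (nb f j + ((f j : ℕ) : ZMod 2)) * core (f ∘ j.succAbove) x σ else 0 := by
    intro j
    split_ifs with hj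
    · rw [sum_isolated hf hx, sum_junctions_cast hf, zs_add, mul_assoc]
    · simp
  rw [Finset.sum_congr rfl fun j _ => h3 j, ← Finset.mul_sum, sgn_eq_zs]
  -- A deletion lowers the degree by one; the minus sign obtained in this way is the one in front of
  -- the second term of the differential.
  have h4 : ((((m : ℤ) - k : ℤ)) : ZMod 2) = ((((m + 1 : ℕ) : ℤ) - k : ℤ) : ZMod 2) + 1 := by
    push_cast
    linear_combination -zmod_two_add_self (1 : ZMod 2)
  have h5 : (∑ j, if ∃ a, f (j.succAbove a) = f j then zs (nb f j + ((f j : ℕ) : ZMod 2)) *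
        (sgn ((m : ℤ) - k) * (zs (revSign fun i => ((p i : ℤ) : ZMod 2)) *
          core (f ∘ j.succAbove) x σ)) else 0) =
      -zs ((((m + 1 : ℕ) : ℤ) - k : ℤ) : ZMod 2) * zs (revSign fun i => ((p i : ℤ) : ZMod 2)) *
        ∑ j, if ∃ a, f (j.succAbove a) = f j then
          zs (nb f j + ((f j : ℕ) : ZMod 2)) * core (f ∘ j.succAbove) x σ else 0 := by
    rw [Finset.mul_sum]
    refine Finset.sum_congr rfl fun j _ => ?_
    rw [sgn_eq_zs, h4, zs_add _ 1, zs_one]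
    split_ifs <;> ring
  rw [h5]
  rw [zs_mul_zs_mul]
  ring

end Differential

/-! ## Closure under the differential; the unit -/

/-- The operation of the empty sequence is the constant cochain `1`, which is closed since an edge
has two ends. In higher dimensions the value vanishes for degree reasons. -/
theorem diff_seqOp_empty (f : Fin 0 → Fin 0) (n : ℤ) : diff.{u} 0 n (seqOp f) = 0 := by
  refine family_ext fun X x p hx' => cochain_ext fun q σ => ?_
  have hx : ∀ i, IsHom (p i : ℤ) (x i) := fun i => (hx' i).isHom
  have hf : Function.Surjective f := fun i => i.elim0
  rw [ev_diff, Finset.univ_eq_empty, Finset.sum_empty, mul_zero, sub_zero]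
  change _ = 0
  rcases q with _ | q
  · rfl
  rw [ev_coboundary_succ]
  rcases q with _ | q
  · have h : ∀ τ : Sing X 0, ev τ (seqOp f X x) = 1 := by
      intro τ
      refine (seqOp_eq_core hf hx τ).trans ?_
      rw [core, Fintype.sum_subsingleton _ ⟨fun s => s.elim0, fun s => s.elim0⟩]
      simp [sgn, revSign, geps, monom, zs_zero]
    rw [Fin.sum_univ_two, h, h]
    simp [sgn]
  · rw [Finset.sum_eq_zero, mul_zero]
    intro v _
    rw [ev_of_isHom (isHom_seqOp hf hx) _ (by simp; omega), mul_zero]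

theorem diff_mem_S {k : ℕ} {n : ℤ} {ν : Family.{u} k} (hν : ν ∈ S k n) :
    diff k n ν ∈ S k (n - 1) := by
  classical
  induction hν using Submodule.span_induction with
  | mem ν h =>
    obtain ⟨m, f, hf, rfl, rfl⟩ := h
    cases m with
    | zero =>
      obtain rfl : k = 0 := by
        by_contra hk
        obtain ⟨j, -⟩ := hf.1 ⟨0, Nat.pos_of_ne_zero hk⟩
        exact j.elim0
      rw [diff_seqOp_empty]
      exact Submodule.zero_mem _
    | succ m =>
      rw [diff_seqOp hf.1]
      refine Submodule.sum_mem _ fun j _ => ?_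
      split_ifs with h
      · refine Submodule.smul_mem _ _ ?_
        have := seqOp_mem_S.{u} (surjective_comp_succAbove hf.1 h)
        rwa [show (m : ℤ) - k = ((m + 1 : ℕ) : ℤ) - k - 1 by push_cast; ring] at this
      · exact Submodule.zero_mem _
  | zero => rw [map_zero]; exact Submodule.zero_mem _
  | add ν μ _ _ h1 h2 => rw [map_add]; exact Submodule.add_mem _ h1 h2
  | smul a ν _ h => rw [map_smul]; exact Submodule.smul_mem _ _ h

theorem nondegenerate_id : Nondegenerate (id : Fin 1 → Fin 1) :=
  ⟨Function.surjective_id, fun j j' h => by omega⟩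

/-- With one piece there is one partition, its block is the whole simplex, and all signs are
trivial. -/
theorem one_eq_seqOp : one.{u} = seqOp (id : Fin 1 → Fin 1) := by
  refine family_ext fun X x p hx' => cochain_ext fun q σ => ?_
  have hx : ∀ i, IsHom (p i : ℤ) (x i) := fun i => (hx' i).isHom
  rw [seqOp_eq_core nondegenerate_id.1 hx]
  have hJ : ∀ J : Fin q →o Fin 1, J = ⟨fun _ => 0, fun _ _ _ => le_rfl⟩ := fun J => by
    ext s; omega
  rw [core, Fintype.sum_eq_single _ fun J h => absurd (hJ J) h]
  have h1 : labelled (id : Fin 1 → Fin 1) (gpiece (fun _ : Fin q => 0)) 0 =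
      (Finset.univ : Finset (Fin (q + 1))).val := by
    have : gpiece (fun _ : Fin q => (0 : Fin 1)) 0 = Finset.univ := by
      ext b
      simp [mem_gpiece]
    rw [labelled, Finset.filter_true_of_mem fun j _ => Subsingleton.elim _ _, Finset.univ_unique,
      Finset.sum_singleton]
    exact congrArg Finset.val this
  have h2 : ev σ = ev (face σ (Finset.univ : Finset (Fin (q + 1))).val) := by
    rw [← ev_map_eq_ev_face (𝟙 _) σ]
    · simp
    · exact (Multiset.map_id _).symm
  have h3 : geps (id : Fin 1 → Fin 1) (fun _ : Fin q => (0 : Fin 1)) = 0 := by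
    simp [geps, nb]
  have h4 : revSign (fun i => ((p i : ℤ) : ZMod 2)) = 0 := by simp [revSign]
  change ev σ (x 0) = sgn 0 * (zs (revSign fun i => ((p i : ℤ) : ZMod 2)) *
    (zs (geps (id : Fin 1 → Fin 1) (fun _ : Fin q => (0 : Fin 1))) * _))
  rw [h2, h3, h4, monom, Fin.prod_univ_one]
  refine Eq.trans ?_ (congrArg (fun B => sgn 0 * (zs 0 * (zs 0 * ev (face σ B) (x 0)))) h1.symm)
  simp [sgn, zs_zero]

theorem one_mem_S : one.{u} ∈ S 1 0 :=
  Submodule.subset_span ⟨1, id, nondegenerate_id, by simp, one_eq_seqOp⟩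

/-! ## Structure maps on homogeneous elements -/

section Homogeneous

variable {k k' : ℕ} {n : ℤ}

theorem family_ext_isHom {ν μ : Family.{u} k}
    (h : ∀ (X : TopCat.{u}) (x : Fin k → cochains X) (p : Fin k → ℤ),
      (∀ i, IsHom (p i) (x i)) → ν X x = μ X x) : ν = μ :=
  family_ext fun X x p hx => h X x (fun i => p i) fun i => (hx i).isHom

theorem isHom_zero {X : TopCat.{u}} (p : ℤ) : IsHom p (0 : cochains X) := fun _ _ => rfl

theorem isHom_of_mem_N {ν : Family.{u} k} (hν : ν ∈ N k n) {X : TopCat.{u}}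
    {x : Fin k → cochains X} {p : Fin k → ℤ} (hx : ∀ i, IsHom (p i) (x i)) :
    IsHom (∑ i, p i - n) (ν X x) := by
  by_cases hp : ∀ i, 0 ≤ p i
  · intro q hq
    refine hν.2 X x (fun i => (p i).toNat) (fun i => IsHom.isHomogeneous ?_) q ?_
    · rw [Int.toNat_of_nonneg (hp i)]
      exact hx i
    · rwa [Finset.sum_congr rfl fun i _ => Int.toNat_of_nonneg (hp i)]
  · push Not at hp
    obtain ⟨i, hi⟩ := hp
    rw [MultilinearMap.map_coord_zero _ i ((hx i).eq_zero hi)]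
    exact isHom_zero _

theorem mem_N {ν : Family.{u} k}
    (h1 : ∀ (X Y : TopCat.{u}) (φ : X ⟶ Y) (y : Fin k → cochains Y),
      ν X (fun i => pullback φ (y i)) = pullback φ (ν Y y))
    (h2 : ∀ (X : TopCat.{u}) (x : Fin k → cochains X) (p : Fin k → ℤ),
      (∀ i, IsHom (p i) (x i)) → IsHom (∑ i, p i - n) (ν X x)) : ν ∈ N k n :=
  ⟨h1, fun X x p hx q hq => h2 X x (fun i => p i) (fun i => (hx i).isHom) q hq⟩

theorem IsHom.congr {X : TopCat.{u}} {p p' : ℤ} {x : cochains X} (hx : IsHom p x) (h : p = p') :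
    IsHom p' x := h ▸ hx

theorem IsHom.add {X : TopCat.{u}} {p : ℤ} {x y : cochains X} (hx : IsHom p x) (hy : IsHom p y) :
    IsHom p (x + y) := fun q hq => by
  change x.1 q + y.1 q = 0
  rw [hx q hq, hy q hq, add_zero]

theorem IsHom.sub {X : TopCat.{u}} {p : ℤ} {x y : cochains X} (hx : IsHom p x) (hy : IsHom p y) :
    IsHom p (x - y) := fun q hq => by
  change x.1 q - y.1 q = 0
  rw [hx q hq, hy q hq, sub_zero]

theorem IsHom.sum {X : TopCat.{u}} {p : ℤ} {ι : Type*} {s : Finset ι} {x : ι → cochains X}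
    (hx : ∀ i ∈ s, IsHom p (x i)) : IsHom p (∑ i ∈ s, x i) := by
  classical
  induction s using Finset.induction_on with
  | empty => exact isHom_zero _
  | insert a s ha ih =>
    rw [Finset.sum_insert ha]
    exact (hx a (Finset.mem_insert_self _ _)).add
      (ih fun i hi => hx i (Finset.mem_insert_of_mem hi))

/-- The exponent of the Koszul sign. -/
def koszulExp (e : Fin k ≃ Fin k') (p : Fin k → ZMod 2) : ZMod 2 :=
  ∑ i, ∑ i', if i < i' ∧ e i' < e i then p i * p i' else 0

theorem act_apply_of_isHom (e : Fin k ≃ Fin k') (ν : Family.{u} k') {X : TopCat.{u}}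
    {x : Fin k → cochains X} {p : Fin k → ℤ} (hx : ∀ i, IsHom (p i) (x i)) :
    act e ν X x = zs (koszulExp e fun i => p i) • ν X (fun i' => x (e.symm i')) := by
  by_cases hp : ∀ i, 0 ≤ p i
  · have h1 : ∀ i, ((p i).toNat : ℤ) = p i := fun i => Int.toNat_of_nonneg (hp i)
    rw [act_apply e ν X x (fun i => (p i).toNat) fun i => IsHom.isHomogeneous (by
      rw [h1]; exact hx i), koszul_eq_zs]
    simp only [h1]
    rfl
  · push Not at hp
    obtain ⟨i, hi⟩ := hp
    have h0 := (hx i).eq_zero hi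
    rw [MultilinearMap.map_coord_zero _ i h0, MultilinearMap.map_coord_zero _ (e i) (by simpa using h0),
      smul_zero]

/-- The arguments in which the coboundary of one has been taken. -/
def coboundaryAt {X : TopCat.{u}} (x : Fin k → cochains X) (i : Fin k) : Fin k → cochains X :=
  Function.update x i (coboundary X (x i))

theorem isHom_coboundaryAt {X : TopCat.{u}} {x : Fin k → cochains X} {p : Fin k → ℤ}
    (hx : ∀ i, IsHom (p i) (x i)) (i i' : Fin k) :
    IsHom (p i' + if i' = i then 1 else 0) (coboundaryAt x i i') := by
  rw [coboundaryAt]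
  by_cases h : i' = i
  · subst h
    rw [Function.update_self, if_pos rfl]
    exact (hx i').coboundary
  · rw [Function.update_of_ne h, if_neg h, add_zero]
    exact hx i'

theorem diff_apply (ν : Family.{u} k) {X : TopCat.{u}} (x : Fin k → cochains X) :
    diff k n ν X x = coboundary X (ν X x) - sgn n • ∑ i, (ν X fun i' =>
      (if i' < i then signMap X 1 else if i' = i then coboundary X else LinearMap.id) (x i')) := by
  change ((coboundary X).compMultilinearMap (ν X) - sgn n • ∑ i : Fin k,
    (ν X).compLinearMap fun i' => if i' < i then signMap X 1 else if i' = i then coboundary X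
      else LinearMap.id) x = _
  rw [sub_apply, smul_apply, sum_apply]
  rfl

theorem diff_apply_of_isHom (ν : Family.{u} k) {X : TopCat.{u}} {x : Fin k → cochains X}
    {p : Fin k → ℤ} (hx : ∀ i, IsHom (p i) (x i)) :
    diff k n ν X x = coboundary X (ν X x) - zs n • ∑ i,
      zs (∑ i', if i' < i then (p i' : ZMod 2) else 0) • ν X (coboundaryAt x i) := by
  rw [diff_apply, sgn_eq_zs]
  congr 2
  refine Finset.sum_congr rfl fun i _ => ?_
  have h1 : (fun i' => (if i' < i then signMap X 1 else if i' = i then coboundary X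
      else LinearMap.id) (x i')) =
      fun i' => zs (if i' < i then (p i' : ZMod 2) else 0) • coboundaryAt x i i' := by
    funext i'
    rw [coboundaryAt]
    rcases lt_trichotomy i' i with h | rfl | h
    · simp only [h, if_true, Function.update_of_ne h.ne]
      rw [signMap_apply (hx i')]
      simp
    · simp [zs_zero]
    · simp [h.not_gt, h.ne', zs_zero]
  rw [h1, MultilinearMap.map_smul_univ, zs_sum]

/-- Omitting two vertices in either order gives the same face with opposite signs. -/
theorem coboundary_coboundary {X : TopCat.{u}} (x : cochains X) :
    coboundary X (coboundary X x) = 0 := by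
  refine cochain_ext fun q σ => ?_
  change ev σ (coboundary X (coboundary X x)) = 0
  rcases q with _ | _ | q
  · rfl
  · rw [ev_coboundary_succ]
    simp only [ev_coboundary_zero rfl]
    simp
  have hσ : ev σ = ev (face σ (Finset.univ : Finset (Fin (q + 3))).val) := by
    rw [← ev_map_eq_ev_face (𝟙 _) σ]
    · simp
    · exact (Multiset.map_id _).symm
  let U : Multiset (Fin (q + 3)) := (Finset.univ : Finset (Fin (q + 3))).val
  have h1 := ev_face_coboundary σ U id monotone_id (Multiset.map_id _).symm (coboundary X x)
  have h2 : ∀ a : Fin (q + 3), ev (face σ (U.erase a)) (coboundary X x) =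
      -sgn q * ∑ c, sgn ((c : Fin (q + 2)) : ℕ) * ev (face σ ((U.erase a).erase (a.succAbove c))) x :=
    fun a => ev_face_coboundary σ _ a.succAbove (Fin.strictMono_succAbove a).monotone (by
      change Multiset.erase (Finset.univ : Finset (Fin (q + 3))).val a = _
      rw [Fin.univ_succAbove _ a, Finset.cons_val, Multiset.erase_cons_head, Finset.map_val]
      rfl) x
  let H : Fin (q + 3) → Fin (q + 3) → ℤ := fun a b => if a = b then 0 else
    zs ((a : ℕ) + (b : ℕ) + if a < b then 1 else 0) * ev (face σ ((U.erase a).erase b)) x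
  have h3 : ∀ a : Fin (q + 3), sgn ((a : ℕ) : ℤ) *
      (∑ c, sgn (((c : Fin (q + 2)) : ℕ) : ℤ) * ev (face σ ((U.erase a).erase (a.succAbove c))) x) =
      ∑ b, H a b := by
    intro a
    rw [Fin.sum_univ_succAbove _ a, Finset.mul_sum]
    simp only [H, if_true, zero_add]
    refine Finset.sum_congr rfl fun c _ => ?_
    rw [if_neg (Fin.succAbove_ne a c).symm, sgn_eq_zs, sgn_eq_zs, ← mul_assoc, ← zs_add]
    congr 2
    simp only [Fin.lt_def, val_succAbove]
    by_cases h : (c : ℕ) < a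
    · simp [h, h.le, not_lt.2]
    · simp only [h, if_false]
      rw [if_pos (by omega)]
      push_cast
      linear_combination -zmod_two_add_self (1 : ZMod 2)
  have h4 : ∀ a b, H a b = -H b a := by
    intro a b
    rcases lt_trichotomy a b with h | rfl | h
    · simp only [H, h.ne, h.ne', if_false, h, if_true, h.not_gt, add_zero]
      rw [Multiset.erase_comm, zs_add, zs_one, add_comm ((b : ℕ) : ZMod 2)]
      ring
    · simp [H]
    · simp only [H, h.ne, h.ne', if_false, h, if_true, h.not_gt, add_zero]
      rw [Multiset.erase_comm, zs_add _ 1, zs_one, add_comm ((b : ℕ) : ZMod 2)]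
      ring
  have h5 : ∑ a, ∑ b, H a b = 0 := by
    have h6 : ∑ a, ∑ b, H a b = -∑ a, ∑ b, H a b := by
      conv_lhs => rw [Finset.sum_comm]
      rw [← Finset.sum_neg_distrib]
      refine Finset.sum_congr rfl fun a _ => ?_
      rw [← Finset.sum_neg_distrib]
      exact Finset.sum_congr rfl fun b _ => h4 b a
    omega
  have h7 : ∑ a : Fin (q + 3), sgn ((a : ℕ) : ℤ) * ev (face σ (U.erase (id a))) (coboundary X x) =
      -sgn q * ∑ a, ∑ b, H a b := by
    rw [Finset.mul_sum]
    refine Finset.sum_congr rfl fun a _ => ?_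
    rw [← h3, id, h2]
    ring
  rw [hσ]
  refine h1.trans ?_
  rw [h7, h5, mul_zero, mul_zero]

/-- Coboundaries in two different arguments anticommute and in the same argument vanish, while the
terms with one coboundary inside and one outside occur with the signs of `n` and `n - 1`, which are
opposite. -/
theorem diff_diff (ν : Family.{u} k) : diff k (n - 1) (diff k n ν) = 0 := by
  refine family_ext_isHom fun X x p hx => ?_
  have hxd : ∀ j i, IsHom (p i + if i = j then 1 else 0) (coboundaryAt x j i) := fun j i =>
    isHom_coboundaryAt hx j i
  refine cochain_ext fun q σ => ?_
  change ev σ (diff k (n - 1) (diff k n ν) X x) = 0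
  let H : Fin k → Fin k → ℤ := fun j i => zs (∑ i', if i' < j then (p i' : ZMod 2) else 0) *
    (zs (∑ i', if i' < i then ((p i' + if i' = j then 1 else 0 : ℤ) : ZMod 2) else 0) *
      ev σ (ν X (coboundaryAt (coboundaryAt x j) i)))
  have h4 : ∀ j i, H j i = -H i j := by
    intro j i
    rcases eq_or_ne j i with rfl | h
    · have : coboundaryAt (coboundaryAt x j) j j = 0 := by
        simp [coboundaryAt, coboundary_coboundary]
      simp only [H]
      rw [MultilinearMap.map_coord_zero _ j this]
      simp
    · have h1 : coboundaryAt (coboundaryAt x j) i = coboundaryAt (coboundaryAt x i) j := by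
        simp only [coboundaryAt, Function.update_of_ne h, Function.update_of_ne h.symm]
        exact Function.update_comm h _ _ _
      have h2 : ∀ j i : Fin k, (∑ i', if i' < i then ((p i' + if i' = j then 1 else 0 : ℤ) : ZMod 2) else 0) =
          (∑ i', if i' < i then (p i' : ZMod 2) else 0) + if j < i then 1 else 0 := by
        intro j i
        have : (if j < i then (1 : ZMod 2) else 0) = ∑ i', if i' = j then (if i' < i then 1 else 0) else 0 := by
          rw [Finset.sum_ite_eq' Finset.univ, if_pos (Finset.mem_univ _)]
        rw [this, ← Finset.sum_add_distrib]
        refine Finset.sum_congr rfl fun i' _ => ?_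
        split_ifs <;> simp
      simp only [H]
      rw [h1, h2, h2, zs_add, zs_add]
      rcases h.lt_or_gt with h3 | h3
      · simp only [h3, h3.not_gt, if_true, if_false, zs_one, zs_zero]; ring
      · simp only [h3, h3.not_gt, if_true, if_false, zs_one, zs_zero]; ring
  have h5 : ∑ a, ∑ b, H a b = 0 := by
    have h6 : ∑ a, ∑ b, H a b = -∑ a, ∑ b, H a b := by
      conv_lhs => rw [Finset.sum_comm]
      rw [← Finset.sum_neg_distrib]
      refine Finset.sum_congr rfl fun a _ => ?_
      rw [← Finset.sum_neg_distrib]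
      exact Finset.sum_congr rfl fun b _ => h4 b a
    omega
  rw [diff_apply_of_isHom _ hx, diff_apply_of_isHom _ hx]
  simp only [fun j => diff_apply_of_isHom (n := n) ν (hxd j)]
  simp only [map_sub, map_smul, map_sum, coboundary_coboundary, smul_eq_mul, zero_sub,
    mul_sub, Finset.sum_sub_distrib, Finset.mul_sum] at h5 ⊢
  have hz : zs ((n - 1 : ℤ) : ZMod 2) = -zs (n : ZMod 2) := by
    push_cast
    rw [CharTwo.sub_eq_add, zs_add, zs_one]
    ring
  have h8 : ∑ j, ∑ i, zs ((n - 1 : ℤ) : ZMod 2) * (zs (∑ i', if i' < j then (p i' : ZMod 2) else 0) *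
      (zs (n : ZMod 2) *
        (zs (∑ i', if i' < i then ((p i' + if i' = j then 1 else 0 : ℤ) : ZMod 2) else 0) *
      ev σ (ν X (coboundaryAt (coboundaryAt x j) i))))) =
      zs ((n - 1 : ℤ) : ZMod 2) * zs (n : ZMod 2) * ∑ j, ∑ i, H j i := by
    simp only [Finset.mul_sum]
    exact Finset.sum_congr rfl fun j _ => Finset.sum_congr rfl fun i _ => by simp only [H]; ring
  rw [h8, h5, hz]
  simp [Finset.mul_sum]

end Homogeneous

/-! ## Naturality and degrees -/

section Natural

variable {X Y : TopCat.{u}} (φ : X ⟶ Y)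

theorem pullback_coboundary (y : cochains Y) :
    pullback φ (coboundary Y y) = coboundary X (pullback φ y) := by
  refine cochain_ext fun q σ => ?_
  change ev σ (pullback φ (coboundary Y y)) = ev σ (coboundary X (pullback φ y))
  rw [ev_pullback]
  rcases q with _ | q
  · rfl
  · rw [ev_coboundary_succ, ev_coboundary_succ]
    congr 1

end Natural

section Members

variable {k k' : ℕ} {n : ℤ}

theorem diff_mem_N {ν : Family.{u} k} (hν : ν ∈ N k n) : diff k n ν ∈ N k (n - 1) := by
  refine mem_N (fun X Y φ y => ?_) fun X x p hx => ?_
  · rw [diff_apply, diff_apply, map_sub, map_smul, map_sum, pullback_coboundary, hν.1]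
    congr 2
    refine Finset.sum_congr rfl fun i _ => ?_
    rw [← hν.1]
    congr 1
    funext i'
    rcases lt_trichotomy i' i with h | h | h
    · simp only [h, if_true]; rfl
    · simp only [h, lt_irrefl, if_false, if_true]
      exact (pullback_coboundary φ _).symm
    · simp only [h.not_gt, h.ne', if_false]; rfl
  · rw [diff_apply_of_isHom ν hx]
    refine IsHom.sub ((isHom_of_mem_N hν hx).coboundary.congr (by ring)) ?_
    refine (IsHom.sum fun i _ => ?_).smul _
    refine ((isHom_of_mem_N hν (isHom_coboundaryAt hx i)).congr ?_).smul _
    rw [Finset.sum_add_distrib, Finset.sum_ite_eq' Finset.univ, if_pos (Finset.mem_univ _)]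
    ring

theorem act_mem_N (e : Fin k ≃ Fin k') {ν : Family.{u} k'} (hν : ν ∈ N k' n) :
    act e ν ∈ N k n := by
  refine mem_N (fun X Y φ y => ?_) fun X x p hx => ?_
  · change (∑ c : Fin k → ZMod 2, koszul e (fun i => ((c i).val : ℤ)) •
      ((ν X).domDomCongr e.symm).compLinearMap fun i => parityPart X (c i)) _ = pullback φ
      ((∑ c : Fin k → ZMod 2, koszul e (fun i => ((c i).val : ℤ)) •
      ((ν Y).domDomCongr e.symm).compLinearMap fun i => parityPart Y (c i)) y)
    rw [sum_apply, sum_apply, map_sum]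
    refine Finset.sum_congr rfl fun c _ => ?_
    rw [smul_apply, smul_apply, map_smul]
    congr 1
    exact hν.1 X Y φ fun i' => parityPart Y (c (e.symm i')) (y (e.symm i'))
  · rw [act_apply_of_isHom e ν hx]
    refine ((isHom_of_mem_N hν fun i' => hx (e.symm i')).congr ?_).smul _
    rw [e.symm.sum_comp]

theorem sum_finSigma {A : Type*} [AddCommMonoid A] {j : Fin k → ℕ} (F : Fin (∑ i, j i) → A) :
    ∑ c, F c = ∑ i, ∑ b, F (finSigmaFinEquiv ⟨i, b⟩) := by
  rw [← finSigmaFinEquiv.sum_comp, Fintype.sum_sigma]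

/-- The exponent of the sign in a composite. -/
def compExp (n P : Fin k → ZMod 2) : ZMod 2 := ∑ i, ∑ i', if i < i' then n i' * P i else 0

theorem comp_apply_of_isHom {j : Fin k → ℕ} (n : Fin k → ℤ) (ν : Family.{u} k)
    (μ : ∀ i, Family.{u} (j i)) {X : TopCat.{u}} {x : Fin (∑ i, j i) → cochains X}
    {p : Fin (∑ i, j i) → ℤ} (hx : ∀ c, IsHom (p c) (x c)) :
    comp j n ν μ X x = zs (compExp (fun i => n i) fun i => ∑ b, (p (finSigmaFinEquiv ⟨i, b⟩) : ZMod 2)) •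
      ν X fun i => μ i X fun b => x (finSigmaFinEquiv ⟨i, b⟩) := by
  rw [comp_apply]
  have h1 : (fun i => μ i X fun b => signMap X (∑ i', if i < i' then n i' else 0)
      (x (finSigmaFinEquiv ⟨i, b⟩))) = fun i =>
      zs (∑ i', if i < i' then (n i' : ZMod 2) * ∑ b, (p (finSigmaFinEquiv ⟨i, b⟩) : ZMod 2) else 0) •
        μ i X fun b => x (finSigmaFinEquiv ⟨i, b⟩) := by
    funext i
    have h2 : (fun b => signMap X (∑ i', if i < i' then n i' else 0) (x (finSigmaFinEquiv ⟨i, b⟩))) =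
        fun b => zs ((∑ i', if i < i' then (n i' : ZMod 2) else 0) * p (finSigmaFinEquiv ⟨i, b⟩)) •
          x (finSigmaFinEquiv ⟨i, b⟩) := by
      funext b
      rw [signMap_apply (hx _)]
      congr 3
      push_cast
      rfl
    rw [h2, MultilinearMap.map_smul_univ, ← zs_sum, ← Finset.mul_sum, Finset.sum_mul]
    simp only [ite_mul, zero_mul]
  rw [h1, MultilinearMap.map_smul_univ, ← zs_sum]
  rfl

theorem comp_mem_N {a : ℤ} {j : Fin k → ℕ} {n : Fin k → ℤ} {ν : Family.{u} k}
    {μ : ∀ i, Family.{u} (j i)} (hν : ν ∈ N k a) (hμ : ∀ i, μ i ∈ N (j i) (n i)) :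
    comp j n ν μ ∈ N (∑ i, j i) (a + ∑ i, n i) := by
  refine mem_N (fun X Y φ y => ?_) fun X x p hx => ?_
  · rw [comp_apply, comp_apply, ← hν.1]
    congr 1
    funext i
    rw [← (hμ i).1]
    rfl
  · rw [comp_apply_of_isHom n ν μ hx]
    refine ((isHom_of_mem_N hν fun i => isHom_of_mem_N (hμ i) fun b => hx _).congr ?_).smul _
    rw [Finset.sum_sub_distrib, sum_finSigma p]
    ring

end Members

/-! ## Actions -/

section Actions

variable {k k' k'' : ℕ} {n : ℤ}

theorem act_refl (ν : Family.{u} k) : act (Equiv.refl (Fin k)) ν = ν := by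
  refine family_ext_isHom fun X x p hx => ?_
  rw [act_apply_of_isHom _ _ hx]
  have : koszulExp (Equiv.refl (Fin k)) (fun i => (p i : ZMod 2)) = 0 := by
    refine Finset.sum_eq_zero fun i _ => Finset.sum_eq_zero fun i' _ => if_neg ?_
    rintro ⟨h, h'⟩
    exact lt_asymm h h'
  rw [this, zs_zero, one_smul]
  rfl

/-- Sign identities are reduced to a single pair of indices: the sum over ordered pairs is grouped
into unordered ones. -/
theorem sum_lt_eq_zero_iff_pair (F : Fin k → Fin k → ZMod 2) (h : ∀ i i', i < i' → F i i' + F i' i = 0)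
    (h0 : ∀ i, F i i = 0) : ∑ i, ∑ i', F i i' = 0 := by
  have h1 : ∀ i i', F i i' = (if i < i' then F i i' else 0) + if i' < i then F i i' else 0 := by
    intro i i'
    rcases lt_trichotomy i i' with h | rfl | h
    · simp [h, h.not_gt]
    · simp [h0]
    · simp [h, h.not_gt]
  rw [Finset.sum_congr rfl fun i _ => Finset.sum_congr rfl fun i' _ => h1 i i']
  simp only [Finset.sum_add_distrib]
  rw [Finset.sum_comm (f := fun i i' => if i' < i then F i i' else 0)]
  simp only [← Finset.sum_add_distrib]
  refine Finset.sum_eq_zero fun i _ => Finset.sum_eq_zero fun i' _ => ?_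
  by_cases hi : i < i'
  · rw [if_pos hi, if_pos hi, h i i' hi]
  · rw [if_neg hi, if_neg hi, add_zero]

/-- A pair is interchanged by a composite exactly when it is interchanged by one but not both of the
factors. -/
theorem koszulExp_trans (e : Fin k ≃ Fin k') (e' : Fin k' ≃ Fin k'') (p : Fin k → ZMod 2) :
    koszulExp (e.trans e') p = koszulExp e p + koszulExp e' fun i' => p (e.symm i') := by
  have h : koszulExp e' (fun i' => p (e.symm i')) =
      ∑ i, ∑ i', if e i < e i' ∧ e' (e i') < e' (e i) then p i * p i' else 0 := by
    rw [koszulExp, ← e.sum_comp]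
    refine Finset.sum_congr rfl fun i _ => ?_
    rw [← e.sum_comp]
    simp
  rw [← CharTwo.add_eq_zero, h, koszulExp, koszulExp, ← Finset.sum_add_distrib,
    ← Finset.sum_add_distrib]
  simp only [← Finset.sum_add_distrib]
  refine sum_lt_eq_zero_iff_pair _ (fun i i' hi => ?_) (fun i => by simp)
  have h2 : e i ≠ e i' := fun h => hi.ne (e.injective h)
  have h3 : e' (e i) ≠ e' (e i') := fun h => h2 (e'.injective h)
  rcases h2.lt_or_gt with h4 | h4 <;> rcases h3.lt_or_gt with h5 | h5 <;>
    simp [hi, hi.not_gt, h4, h4.not_gt, h5, h5.not_gt, zmod_two_add_self, mul_comm (p i')]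

theorem act_trans (e : Fin k ≃ Fin k') (e' : Fin k' ≃ Fin k'') (ν : Family.{u} k'') :
    act (e.trans e') ν = act e (act e' ν) := by
  refine family_ext_isHom fun X x p hx => ?_
  rw [act_apply_of_isHom _ _ hx, act_apply_of_isHom _ _ hx,
    act_apply_of_isHom e' ν fun i' => hx (e.symm i'), smul_smul, ← zs_add, koszulExp_trans]
  rfl

/-- The change is the sum over the arguments that are interchanged with the `i`-th, that is, which
precede it on exactly one side. For `diff_act` these two sums are the signs of moving `d` to its
place before and after the rearrangement. -/
theorem koszulExp_add_single (e : Fin k ≃ Fin k') (p : Fin k → ZMod 2) (i : Fin k) :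
    koszulExp e (fun i' => p i' + if i' = i then 1 else 0) = koszulExp e p +
      (∑ i', if i' < i then p i' else 0) + ∑ i', if e i' < e i then p i' else 0 := by
  have h1 : koszulExp e (fun i' => p i' + if i' = i then 1 else 0) = koszulExp e p +
      ((∑ i', if i' < i ∧ e i < e i' then p i' else 0) +
        ∑ i', if i < i' ∧ e i' < e i then p i' else 0) := by
    have h2 : (∑ i', if i' < i ∧ e i < e i' then p i' else 0) =
        ∑ a, ∑ a', if a' = i then (if a < a' ∧ e a' < e a then p a else 0) else 0 := by
      simp
    have h3 : (∑ i', if i < i' ∧ e i' < e i then p i' else 0) =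
        ∑ a, ∑ a', if a = i then (if a < a' ∧ e a' < e a then p a' else 0) else 0 := by
      rw [Finset.sum_comm]
      simp
    rw [h2, h3, koszulExp, koszulExp]
    simp only [← Finset.sum_add_distrib]
    refine Finset.sum_congr rfl fun a _ => Finset.sum_congr rfl fun a' _ => ?_
    by_cases h : a < a' ∧ e a' < e a
    · simp only [if_pos h]
      have : ¬ (a = i ∧ a' = i) := fun h' => by rw [h'.1, h'.2] at h; exact lt_irrefl _ h.1
      split_ifs with h4 h5
      · exact absurd ⟨h4, h5⟩ this
      all_goals simp
      all_goals ring
    · simp [h]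
  rw [h1, add_assoc]
  congr 1
  rw [← Finset.sum_add_distrib, ← Finset.sum_add_distrib]
  refine Finset.sum_congr rfl fun i' _ => ?_
  rcases lt_trichotomy i' i with h | rfl | h
  · have h2 : e i' ≠ e i := fun h' => h.ne (e.injective h')
    rcases h2.lt_or_gt with h3 | h3 <;> simp [h, h.not_gt, h3, h3.not_gt, zmod_two_add_self]
  · simp
  · have h2 : e i' ≠ e i := fun h' => h.ne' (e.injective h')
    rcases h2.lt_or_gt with h3 | h3 <;> simp [h, h.not_gt, h3, h3.not_gt]

theorem diff_act (e : Fin k ≃ Fin k') (ν : Family.{u} k') :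
    diff k n (act e ν) = act e (diff k' n ν) := by
  refine family_ext_isHom fun X x p hx => ?_
  have hx' : ∀ i', IsHom (p (e.symm i')) (x (e.symm i')) := fun i' => hx (e.symm i')
  rw [diff_apply_of_isHom _ hx, act_apply_of_isHom _ _ hx, act_apply_of_isHom _ _ hx,
    diff_apply_of_isHom _ hx', map_smul, smul_sub, smul_comm (zs (koszulExp e _)) (zs (n : ZMod 2))]
  congr 2
  rw [Finset.smul_sum, ← e.sum_comp]
  refine Finset.sum_congr rfl fun i _ => ?_
  rw [act_apply_of_isHom _ _ (isHom_coboundaryAt hx i), smul_smul, smul_smul, ← zs_add, ← zs_add]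
  have h1 : (fun i' => coboundaryAt x i (e.symm i')) = coboundaryAt (fun i' => x (e.symm i')) (e i) := by
    funext i'
    by_cases h : i' = e i
    · subst h
      simp [coboundaryAt]
    · rw [coboundaryAt, coboundaryAt, Function.update_of_ne h, Function.update_of_ne]
      rintro rfl
      exact h (by simp)
  rw [h1]
  congr 2
  have h2 := koszulExp_add_single e (fun i => (p i : ZMod 2)) i
  have h3 : (∑ i', if i' < e i then (p (e.symm i') : ZMod 2) else 0) =
      ∑ i', if e i' < e i then (p i' : ZMod 2) else 0 := by
    rw [← e.sum_comp]
    simp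
  have h4 : (fun i' => ((p i' + if i' = i then 1 else 0 : ℤ) : ZMod 2)) =
      fun i' => (p i' : ZMod 2) + if i' = i then 1 else 0 := by
    funext i'
    push_cast
    rfl
  rw [h4, h2, h3]
  linear_combination zmod_two_add_self (∑ i', if i' < i then (p i' : ZMod 2) else 0)

end Actions

/-! ## The operad axioms -/

section Operad

variable {k k' : ℕ}

theorem compExp_add_right (n P P' : Fin k → ZMod 2) :
    compExp n (fun i => P i + P' i) = compExp n P + compExp n P' := by
  simp only [compExp, ← Finset.sum_add_distrib]
  refine Finset.sum_congr rfl fun i _ => Finset.sum_congr rfl fun i' _ => ?_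
  split_ifs
  · ring
  · simp

theorem compExp_add_left (n n' P : Fin k → ZMod 2) :
    compExp (fun i => n i + n' i) P = compExp n P + compExp n' P := by
  simp only [compExp, ← Finset.sum_add_distrib]
  refine Finset.sum_congr rfl fun i _ => Finset.sum_congr rfl fun i' _ => ?_
  split_ifs
  · ring
  · simp

theorem compExp_single_right (n : Fin k → ZMod 2) (i : Fin k) :
    compExp n (fun i' => if i' = i then 1 else 0) = ∑ i', if i < i' then n i' else 0 := by
  rw [compExp, Finset.sum_eq_single i]
  · simp
  · intro a _ ha
    simp [ha]
  · simp

theorem compExp_single_left (P : Fin k → ZMod 2) (i : Fin k) :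
    compExp (fun i' => if i' = i then 1 else 0) P = ∑ i', if i' < i then P i' else 0 := by
  rw [compExp]
  refine Finset.sum_congr rfl fun a _ => ?_
  rw [Finset.sum_eq_single i]
  · simp
  · intro b _ hb
    simp [hb]
  · simp

theorem sum_lt_finSigma {A : Type*} [AddCommMonoid A] {j : Fin k → ℕ} (F : Fin (∑ i, j i) → A) (i : Fin k) (b : Fin (j i)) :
    (∑ c, if c < finSigmaFinEquiv ⟨i, b⟩ then F c else 0) =
      (∑ i', if i' < i then ∑ b', F (finSigmaFinEquiv ⟨i', b'⟩) else 0) +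
        ∑ b', if b' < b then F (finSigmaFinEquiv ⟨i, b'⟩) else 0 := by
  rw [sum_finSigma fun c => if c < finSigmaFinEquiv ⟨i, b⟩ then F c else 0]
  have h : ∀ i', (∑ b' : Fin (j i'), if finSigmaFinEquiv ⟨i', b'⟩ < finSigmaFinEquiv ⟨i, b⟩ then
      F (finSigmaFinEquiv ⟨i', b'⟩) else 0) = (if i' < i then ∑ b', F (finSigmaFinEquiv ⟨i', b'⟩) else 0)
        + if i' = i then ∑ b', (if b' < b then F (finSigmaFinEquiv ⟨i, b'⟩) else 0) else 0 := by
    intro i'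
    simp only [finSigma_lt]
    rcases lt_trichotomy i' i with h | rfl | h
    · simp [h, h.ne]
    · simp
    · simp [h.not_gt, h.ne']
  rw [Finset.sum_congr rfl fun i' _ => h i', Finset.sum_add_distrib, Finset.sum_ite_eq' Finset.univ,
    if_pos (Finset.mem_univ _)]

theorem coboundaryAt_finSigma {X : TopCat.{u}} {j : Fin k → ℕ} (μ : ∀ i, Family.{u} (j i))
    (x : Fin (∑ i, j i) → cochains X) (i : Fin k) (b : Fin (j i)) :
    (fun i' => μ i' X fun b' => coboundaryAt x (finSigmaFinEquiv ⟨i, b⟩) (finSigmaFinEquiv ⟨i', b'⟩)) =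
      Function.update (fun i' => μ i' X fun b' => x (finSigmaFinEquiv ⟨i', b'⟩)) i
        (μ i X (coboundaryAt (fun b' => x (finSigmaFinEquiv ⟨i, b'⟩)) b)) := by
  funext i'
  by_cases h : i' = i
  · subst h
    rw [Function.update_self]
    congr 1
    funext b'
    by_cases hb : b' = b
    · subst hb
      simp [coboundaryAt]
    · rw [coboundaryAt, coboundaryAt, Function.update_of_ne hb, Function.update_of_ne]
      intro h
      exact hb (by simpa using h)
  · rw [Function.update_of_ne h]
    congr 1
    funext b'
    rw [coboundaryAt, Function.update_of_ne]
    intro h'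
    have := finSigmaFinEquiv.injective h'
    rw [Sigma.mk.inj_iff] at this
    exact h this.1

theorem update_eval {X : TopCat.{u}} {j : Fin k → ℕ} (μ : ∀ i, Family.{u} (j i)) (i : Fin k)
    (μ' : Family.{u} (j i)) (x : ∀ i, Fin (j i) → cochains X) :
    (fun i' => Function.update μ i μ' i' X (x i')) =
      Function.update (fun i' => μ i' X (x i')) i (μ' X (x i)) := by
  funext i'
  by_cases h : i' = i
  · subst h; simp
  · simp [h]

/-- All terms have `d` outside, on the value of some `μ i`, or on one argument. The middle kind
comes from differentiating `ν` and from differentiating `μ i`, and cancels; the other two kinds make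
up the left-hand side. -/
theorem diff_comp {a : ℤ} {j : Fin k → ℕ} {n : Fin k → ℤ} (ν : Family.{u} k)
    {μ : ∀ i, Family.{u} (j i)} (hμ : ∀ i, μ i ∈ N (j i) (n i)) :
    diff _ (a + ∑ i, n i) (comp j n ν μ) = comp j n (diff k a ν) μ +
      ∑ i, sgn (a + ∑ i', if i' < i then n i' else 0) •
        comp j (Function.update n i (n i - 1)) ν (Function.update μ i (diff (j i) (n i) (μ i))) := by
  refine family_ext_isHom fun X x p hx => cochain_ext fun q σ => ?_
  let P : Fin k → ZMod 2 := fun i => ∑ b, (p (finSigmaFinEquiv ⟨i, b⟩) : ZMod 2)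
  let y : Fin k → cochains X := fun i => μ i X fun b => x (finSigmaFinEquiv ⟨i, b⟩)
  have hy : ∀ i, IsHom (∑ b, p (finSigmaFinEquiv ⟨i, b⟩) - n i) (y i) := fun i =>
    isHom_of_mem_N (hμ i) fun b => hx _
  have hyP : ∀ i, ((∑ b, p (finSigmaFinEquiv ⟨i, b⟩) - n i : ℤ) : ZMod 2) = P i + n i := by
    intro i
    push_cast
    rw [CharTwo.sub_eq_add]
  have hsum : ((a + ∑ i, n i : ℤ) : ZMod 2) = a + ∑ i, (n i : ZMod 2) := by push_cast; rfl
  have hn : ∀ i i', ((Function.update n i (n i - 1) i' : ℤ) : ZMod 2) =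
      n i' + if i' = i then 1 else 0 := by
    intro i i'
    by_cases h : i' = i
    · subst h
      rw [Function.update_self, if_pos rfl]
      push_cast
      rw [CharTwo.sub_eq_add]
    · rw [Function.update_of_ne h, if_neg h, add_zero]
  -- the left hand side
  have hL : ev σ (diff _ (a + ∑ i, n i) (comp j n ν μ) X x) =
      zs (compExp (fun i => n i) P) * ev σ (coboundary X (ν X y)) -
      ∑ i, ∑ b, zs (a + ∑ i, (n i : ZMod 2)) *
        (zs ((∑ i', if i' < i then P i' else 0) +
          ∑ b', if b' < b then (p (finSigmaFinEquiv ⟨i, b'⟩) : ZMod 2) else 0) *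
        (zs (compExp (fun i => n i) P + ∑ i', if i < i' then (n i' : ZMod 2) else 0) *
          ev σ (ν X (Function.update y i
            (μ i X (coboundaryAt (fun b' => x (finSigmaFinEquiv ⟨i, b'⟩)) b)))))) := by
    rw [diff_apply_of_isHom _ hx, comp_apply_of_isHom n ν μ hx, map_sub, map_smul, map_smul, map_smul,
      map_sum, hsum, smul_eq_mul, smul_eq_mul, sum_finSigma fun c => _, Finset.mul_sum]
    congr 1
    refine Finset.sum_congr rfl fun i _ => ?_
    rw [Finset.mul_sum]
    refine Finset.sum_congr rfl fun b _ => ?_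
    rw [map_smul, comp_apply_of_isHom n ν μ (isHom_coboundaryAt hx _), map_smul,
      coboundaryAt_finSigma, sum_lt_finSigma fun c => (p c : ZMod 2), smul_eq_mul, smul_eq_mul]
    congr 4
    rw [← compExp_single_right, ← compExp_add_right]
    congr 1
    funext i'
    push_cast
    rw [Finset.sum_add_distrib]
    congr 1
    by_cases h : i' = i
    · subst h
      simp
    · rw [if_neg h, Finset.sum_eq_zero]
      intro b' _
      rw [if_neg]
      intro h'
      have := finSigmaFinEquiv.injective h'
      rw [Sigma.mk.inj_iff] at this
      exact h this.1
  have hR1 : ev σ (comp j n (diff k a ν) μ X x) = zs (compExp (fun i => n i) P) *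
      (ev σ (coboundary X (ν X y)) - ∑ i, zs a * (zs (∑ i', if i' < i then P i' + n i' else 0) *
        ev σ (ν X (Function.update y i (coboundary X (y i)))))) := by
    rw [comp_apply_of_isHom n _ μ hx, map_smul, smul_eq_mul, diff_apply_of_isHom ν hy, map_sub, map_smul,
      map_sum, smul_eq_mul, Finset.mul_sum]
    simp only [hyP, map_smul, smul_eq_mul]
    rfl
  have hR2 : ∀ i, ev σ (comp j (Function.update n i (n i - 1)) ν
      (Function.update μ i (diff (j i) (n i) (μ i))) X x) =
      zs (compExp (fun i => n i) P + ∑ i', if i' < i then P i' else 0) *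
        (ev σ (ν X (Function.update y i (coboundary X (y i)))) - ∑ b, zs (n i) *
          (zs (∑ b', if b' < b then (p (finSigmaFinEquiv ⟨i, b'⟩) : ZMod 2) else 0) *
          ev σ (ν X (Function.update y i
            (μ i X (coboundaryAt (fun b' => x (finSigmaFinEquiv ⟨i, b'⟩)) b)))))) := by
    intro i
    rw [comp_apply_of_isHom _ ν _ hx, map_smul, smul_eq_mul,
      update_eval μ i _ fun i b => x (finSigmaFinEquiv ⟨i, b⟩),
      diff_apply_of_isHom (μ i) fun b => hx (finSigmaFinEquiv ⟨i, b⟩),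
      MultilinearMap.map_update_sub, MultilinearMap.map_update_smul,
      MultilinearMap.map_update_sum, map_sub, map_smul, map_sum, smul_eq_mul, Finset.mul_sum]
    simp only [MultilinearMap.map_update_smul, map_smul, smul_eq_mul, hn]
    rw [compExp_add_left, compExp_single_left]
  change ev σ (diff _ (a + ∑ i, n i) (comp j n ν μ) X x) = evalAt X x σ (comp j n (diff k a ν) μ +
      ∑ i, sgn (a + ∑ i', if i' < i then n i' else 0) •
        comp j (Function.update n i (n i - 1)) ν (Function.update μ i (diff (j i) (n i) (μ i))))
  rw [map_add, map_sum]
  change _ = ev σ (comp j n (diff k a ν) μ X x) + _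
  simp only [map_smul, smul_eq_mul]
  have hR3 : ∀ i, evalAt X x σ (comp j (Function.update n i (n i - 1)) ν
      (Function.update μ i (diff (j i) (n i) (μ i)))) = _ := fun i => hR2 i
  simp only [hR3]
  rw [hL, hR1, mul_sub, sub_add, Finset.mul_sum, ← Finset.sum_sub_distrib]
  congr 1
  refine Finset.sum_congr rfl fun i _ => ?_
  rw [sgn_eq_zs]
  have h1 : ((a + ∑ i', if i' < i then n i' else 0 : ℤ) : ZMod 2) =
      a + ∑ i', if i' < i then (n i' : ZMod 2) else 0 := by
    push_cast
    rfl
  have h2 : (∑ i', if i' < i then P i' + n i' else 0) = (∑ i', if i' < i then P i' else 0) +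
      ∑ i', if i' < i then (n i' : ZMod 2) else 0 := by
    rw [← Finset.sum_add_distrib]
    refine Finset.sum_congr rfl fun i' _ => ?_
    split_ifs <;> simp
  have h3 : (∑ i', (n i' : ZMod 2)) = (∑ i', if i' < i then (n i' : ZMod 2) else 0) + n i +
      ∑ i', if i < i' then (n i' : ZMod 2) else 0 := by
    have : (n i : ZMod 2) = ∑ i', if i' = i then (n i' : ZMod 2) else 0 := by simp
    rw [this, ← Finset.sum_add_distrib, ← Finset.sum_add_distrib]
    refine Finset.sum_congr rfl fun i' _ => ?_
    rcases lt_trichotomy i' i with h | h | h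
    · simp [h, h.ne, h.not_gt]
    · simp [h]
    · simp [h, h.ne', h.not_gt]
  rw [h1, h2, h3, mul_sub, mul_sub, Finset.mul_sum, Finset.mul_sum]
  simp only [zs_add]
  -- Here `v` and `w` are the two cancelling terms with `d` on the value of `μ i`; `u` and `z` are
  -- the terms with `d` on a single argument.
  have key : ∀ u v w z : ℤ, v = w → u = z → u = v - (w - z) := fun u v w z h h' => by
    rw [h, h']; ring
  refine key _ _ _ _ (by ring) ?_
  refine Finset.sum_congr rfl fun b _ => ?_
  linear_combination (zs a * zs (∑ i', if i' < i then (n i' : ZMod 2) else 0) * zs (n i) *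
    zs (∑ i', if i' < i then P i' else 0) *
    zs (∑ b', if b' < b then (p (finSigmaFinEquiv ⟨i, b'⟩) : ZMod 2) else 0) *
    zs (compExp (fun i => n i) P) * ev σ (ν X (Function.update y i
      (μ i X (coboundaryAt (fun b' => x (finSigmaFinEquiv ⟨i, b'⟩)) b))))) *
    zs_mul_self (∑ i', if i < i' then (n i' : ZMod 2) else 0)

end Operad

section Operad

variable {k k' : ℕ}

theorem koszulExp_of_strictMono {e : Fin k ≃ Fin k'} (he : StrictMono e) (p : Fin k → ZMod 2) :
    koszulExp e p = 0 :=
  Finset.sum_eq_zero fun _ _ => Finset.sum_eq_zero fun _ _ =>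
    if_neg fun ⟨h, h'⟩ => lt_asymm h (he.lt_iff_lt.1 h')

theorem act_finCongr_apply (h : k = k') (ν : Family.{u} k') {X : TopCat.{u}}
    {x : Fin k → cochains X} {p : Fin k → ℤ} (hx : ∀ i, IsHom (p i) (x i)) :
    act (finCongr h) ν X x = ν X (fun i' => x (Fin.cast h.symm i')) := by
  rw [act_apply_of_isHom _ _ hx, koszulExp_of_strictMono fun _ _ h => h, zs_zero, one_smul]
  rfl

theorem one_comp {n : ℤ} (μ : Family.{u} k) :
    comp (fun _ : Fin 1 => k) (fun _ => n) one (fun _ => μ) = act (finCongr (by simp)) μ := by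
  refine family_ext_isHom fun X x p hx => ?_
  rw [comp_apply_of_isHom _ _ _ hx, act_finCongr_apply _ _ hx]
  have h : ∀ P : Fin 1 → ZMod 2, compExp (fun _ : Fin 1 => (n : ZMod 2)) P = 0 := fun P =>
    Finset.sum_eq_zero fun i _ => Finset.sum_eq_zero fun i' _ => if_neg (by omega)
  rw [h, zs_zero, one_smul]
  change μ X _ = _
  congr 1
  funext b
  congr 1
  ext
  rw [finSigma_val]
  simp

theorem comp_one (ν : Family.{u} k) :
    comp (fun _ : Fin k => 1) (fun _ => 0) ν (fun _ => one) = act (finCongr (by simp)) ν := by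
  refine family_ext_isHom fun X x p hx => ?_
  rw [comp_apply_of_isHom _ _ _ hx, act_finCongr_apply _ _ hx]
  have h : ∀ P : Fin k → ZMod 2, compExp (fun _ : Fin k => ((0 : ℤ) : ZMod 2)) P = 0 := fun P =>
    Finset.sum_eq_zero fun i _ => Finset.sum_eq_zero fun i' _ => by simp
  rw [h, zs_zero, one_smul]
  congr 1
  funext i
  change x _ = x _
  congr 1
  ext
  rw [finSigma_val]
  have h1 : (∑ i' : Fin k, if i' < i then 1 else 0) = (i : ℕ) := by
    rw [← Finset.card_filter]
    have : (Finset.univ.filter fun i' => i' < i) = Finset.Iio i := by ext; simp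
    rw [this, Fin.card_Iio]
  rw [h1]
  simp

/-- An operation passes arguments of its own block or arguments of an earlier block. The same
division describes iterated composition, so the sign of associativity is what is left: inner
operations passing middle ones. -/
theorem compExp_flatten {j : Fin k → ℕ} (n P : Fin (∑ i, j i) → ZMod 2) :
    compExp n P = (∑ i, compExp (fun b => n (finSigmaFinEquiv ⟨i, b⟩))
        fun b => P (finSigmaFinEquiv ⟨i, b⟩)) +
      compExp (fun i => ∑ b, n (finSigmaFinEquiv ⟨i, b⟩)) fun i => ∑ b, P (finSigmaFinEquiv ⟨i, b⟩) := by
  rw [compExp, sum_finSigma]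
  simp only [fun i b => sum_finSigma fun c => if finSigmaFinEquiv (⟨i, b⟩ : Σ i, Fin (j i)) < c then
    n c * P (finSigmaFinEquiv ⟨i, b⟩) else 0]
  rw [compExp, ← Finset.sum_add_distrib]
  refine Finset.sum_congr rfl fun i _ => ?_
  have h : ∀ (b : Fin (j i)) i', (∑ b' : Fin (j i'), if finSigmaFinEquiv (⟨i, b⟩ : Σ i, Fin (j i)) <
      finSigmaFinEquiv ⟨i', b'⟩ then n (finSigmaFinEquiv ⟨i', b'⟩) * P (finSigmaFinEquiv ⟨i, b⟩) else 0) =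
      (if i' = i then ∑ b', (if b < b' then
        n (finSigmaFinEquiv ⟨i, b'⟩) * P (finSigmaFinEquiv ⟨i, b⟩) else 0) else 0) +
      if i < i' then (∑ b', n (finSigmaFinEquiv ⟨i', b'⟩)) * P (finSigmaFinEquiv ⟨i, b⟩) else 0 := by
    intro b i'
    simp only [finSigma_lt]
    rcases lt_trichotomy i' i with h | rfl | h
    · simp [h.not_gt, h.ne, h.ne']
    · simp
    · simp [h, h.ne', Finset.sum_mul]
  rw [Finset.sum_congr rfl fun b _ => Finset.sum_congr rfl fun i' _ => h b i']
  simp only [Finset.sum_add_distrib, Finset.sum_ite_eq', Finset.mem_univ, if_true]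
  rw [compExp]
  congr 1
  rw [Finset.sum_comm]
  refine Finset.sum_congr rfl fun i' _ => ?_
  split_ifs
  · rw [Finset.mul_sum]
  · simp

/-- For an interchanged pair the product of `P + n` expands into four products: that of the `P`,
that of the `n`, and two mixed ones, which exchange the role of the operations and arguments passed.
-/
theorem compExp_map (e : Fin k ≃ Fin k') (n P : Fin k → ZMod 2) :
    compExp n P + koszulExp e (fun i => P i + n i) = koszulExp e n + koszulExp e P +
      compExp (fun i' => n (e.symm i')) fun i' => P (e.symm i') := by
  have h : compExp (fun i' => n (e.symm i')) (fun i' => P (e.symm i')) =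
      ∑ i, ∑ i', if e i < e i' then n i' * P i else 0 := by
    rw [compExp, ← e.sum_comp]
    refine Finset.sum_congr rfl fun i _ => ?_
    rw [← e.sum_comp]
    simp
  rw [← CharTwo.add_eq_zero, h, koszulExp, koszulExp, koszulExp, compExp]
  simp only [← Finset.sum_add_distrib]
  refine sum_lt_eq_zero_iff_pair _ (fun i i' hi => ?_) (fun i => by simp)
  have h2 : e i ≠ e i' := fun h => hi.ne (e.injective h)
  rcases h2.lt_or_gt with h4 | h4
  · simp [hi, hi.not_gt, h4, h4.not_gt, zmod_two_add_self]
  · simp only [hi, hi.not_gt, h4, h4.not_gt, true_and, false_and, if_true, if_false]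
    linear_combination zmod_two_add_self (n i' * P i) + zmod_two_add_self (n i * P i') +
      zmod_two_add_self (P i * P i') + zmod_two_add_self (n i * n i')

theorem koszulExp_eq_sum_symm (e : Fin k ≃ Fin k') (p : Fin k → ZMod 2) :
    koszulExp e p = ∑ u, ∑ u', if e.symm u < e.symm u' ∧ u' < u then
      p (e.symm u) * p (e.symm u') else 0 := by
  rw [koszulExp, ← e.symm.sum_comp]
  refine Finset.sum_congr rfl fun i _ => ?_
  rw [← e.symm.sum_comp]
  simp

/-- Whole blocks are interchanged while the order inside a block is kept, so a block acts like one
object of its total degree. -/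
theorem koszulExp_blockEquiv_left {j : Fin k → ℕ} (e : Fin k ≃ Fin k')
    (p : Fin (∑ i, j i) → ZMod 2) :
    koszulExp (blockEquiv (Equiv.sigmaCongrLeft' e)) p =
      koszulExp e fun i => ∑ b, p (finSigmaFinEquiv ⟨i, b⟩) := by
  have hs : ∀ i' (b : Fin (j (e.symm i'))), (blockEquiv (Equiv.sigmaCongrLeft' e)).symm
      (finSigmaFinEquiv ⟨i', b⟩) = finSigmaFinEquiv ⟨e.symm i', b⟩ := by
    intro i' b
    simp only [blockEquiv, Equiv.symm_trans_apply, Equiv.symm_symm, Equiv.symm_apply_apply]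
    rfl
  rw [koszulExp_eq_sum_symm, koszulExp_eq_sum_symm, sum_finSigma]
  refine Finset.sum_congr rfl fun i _ => ?_
  rw [Finset.sum_congr rfl fun b _ => sum_finSigma _, Finset.sum_comm]
  refine Finset.sum_congr rfl fun i' _ => ?_
  simp only [hs, finSigma_lt]
  rcases lt_trichotomy i' i with h | rfl | h
  · have hne : e.symm i ≠ e.symm i' := fun h' => h.ne' (e.symm.injective h')
    simp only [h, h.ne, hne, false_and, or_false, and_true, Finset.sum_mul_sum]
    split_ifs
    · rfl
    · simp
  · simp only [lt_irrefl, false_or, true_and, false_and, if_false]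
    refine Finset.sum_eq_zero fun b _ => Finset.sum_eq_zero fun b' _ => if_neg ?_
    rintro ⟨h1, h2⟩
    exact lt_asymm h1 h2
  · simp [h.not_gt, h.ne']

theorem koszulExp_blockEquiv_right {j j' : Fin k → ℕ} (e : ∀ i, Fin (j i) ≃ Fin (j' i))
    (p : Fin (∑ i, j i) → ZMod 2) :
    koszulExp (blockEquiv (Equiv.sigmaCongrRight e)) p =
      ∑ i, koszulExp (e i) fun b => p (finSigmaFinEquiv ⟨i, b⟩) := by
  have hs : ∀ i (b : Fin (j i)), blockEquiv (Equiv.sigmaCongrRight e)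
      (finSigmaFinEquiv ⟨i, b⟩) = finSigmaFinEquiv ⟨i, e i b⟩ := by
    intro i b
    simp [blockEquiv]
  rw [koszulExp, sum_finSigma]
  refine Finset.sum_congr rfl fun i _ => ?_
  rw [Finset.sum_congr rfl fun b _ => sum_finSigma _, Finset.sum_comm, Finset.sum_eq_single i]
  · simp only [hs, finSigma_lt, lt_irrefl, false_or, true_and]
    rfl
  · intro i' _ hi
    refine Finset.sum_eq_zero fun b _ => Finset.sum_eq_zero fun b' _ => if_neg ?_
    simp only [hs, finSigma_lt, hi, hi.symm, false_and, or_false]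
    rintro ⟨h1, h2⟩
    exact lt_asymm h1 h2
  · simp

theorem comp_assoc {j : Fin k → ℕ} {n : Fin k → ℤ} {l : Fin (∑ i, j i) → ℕ}
    {r : Fin (∑ i, j i) → ℤ} {f : Family.{u} k} {g : ∀ i, Family.{u} (j i)}
    {h : ∀ c, Family.{u} (l c)} (hl : ∑ c, l c = ∑ i, ∑ b : Fin (j i), l (finSigmaFinEquiv ⟨i, b⟩))
    (hh : ∀ c, h c ∈ N (l c) (r c)) :
    comp l r (comp j n f g) h =
      sgn (∑ i, ∑ i', if i < i' then n i' * ∑ b, r (finSigmaFinEquiv ⟨i, b⟩) else 0) •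
        act (finCongr hl)
          (comp (fun i => ∑ b, l (finSigmaFinEquiv ⟨i, b⟩))
            (fun i => n i + ∑ b, r (finSigmaFinEquiv ⟨i, b⟩)) f
            (fun i => comp (fun b => l (finSigmaFinEquiv ⟨i, b⟩))
              (fun b => r (finSigmaFinEquiv ⟨i, b⟩)) (g i)
              (fun b => h (finSigmaFinEquiv ⟨i, b⟩)))) := by
  refine family_ext_isHom fun X x p hx => ?_
  let P : Fin (∑ i, j i) → ZMod 2 := fun c => ∑ e, (p (finSigmaFinEquiv ⟨c, e⟩) : ZMod 2)
  -- The two ways of numbering triples, outer pair first or inner pair first, give the same number.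
  have hidx : ∀ i b e, finSigmaFinEquiv (⟨finSigmaFinEquiv ⟨i, b⟩, e⟩ : Σ c, Fin (l c)) =
      Fin.cast hl.symm (finSigmaFinEquiv ⟨i, finSigmaFinEquiv ⟨b, e⟩⟩) := by
    intro i b e
    ext
    rw [finSigma_val, sum_lt_finSigma l, Fin.val_cast, finSigma_val, finSigma_val, add_assoc]
  have hz : ∀ c, IsHom (∑ e, p (finSigmaFinEquiv ⟨c, e⟩) - r c)
      (h c X fun e => x (finSigmaFinEquiv ⟨c, e⟩)) := fun c =>
    isHom_of_mem_N (hh c) fun e => hx _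
  have hzP : ∀ c, ((∑ e, p (finSigmaFinEquiv ⟨c, e⟩) - r c : ℤ) : ZMod 2) = P c + r c := by
    intro c
    push_cast
    rw [CharTwo.sub_eq_add]
  have hxc : ∀ d, IsHom (p (Fin.cast hl.symm d)) (x (Fin.cast hl.symm d)) := fun d => hx _
  rw [comp_apply_of_isHom _ _ _ hx, comp_apply_of_isHom n f g hz]
  change _ = sgn _ • act (finCongr hl) _ X x
  rw [act_finCongr_apply hl _ hx, comp_apply_of_isHom _ _ _ hxc]
  have h1 : ∀ i, comp (fun b => l (finSigmaFinEquiv ⟨i, b⟩)) (fun b => r (finSigmaFinEquiv ⟨i, b⟩))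
      (g i) (fun b => h (finSigmaFinEquiv ⟨i, b⟩)) X
        (fun b' => x (Fin.cast hl.symm (finSigmaFinEquiv ⟨i, b'⟩))) =
      zs (compExp (fun b => (r (finSigmaFinEquiv ⟨i, b⟩) : ZMod 2)) fun b => P (finSigmaFinEquiv ⟨i, b⟩)) •
        g i X fun b => h (finSigmaFinEquiv ⟨i, b⟩) X fun e =>
          x (finSigmaFinEquiv ⟨finSigmaFinEquiv ⟨i, b⟩, e⟩) := by
    intro i
    rw [comp_apply_of_isHom _ _ _ fun b' => hxc (finSigmaFinEquiv ⟨i, b'⟩)]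
    simp only [P, hidx]
  simp only [h1]
  rw [MultilinearMap.map_smul_univ, ← zs_sum, smul_smul, smul_smul, smul_smul, sgn_eq_zs, ← zs_add,
    ← zs_add, ← zs_add]
  congr 2
  have h2 : ((∑ i, ∑ i', if i < i' then n i' * ∑ b, r (finSigmaFinEquiv ⟨i, b⟩) else 0 : ℤ) : ZMod 2) =
      compExp (fun i => n i) fun i => ∑ b, (r (finSigmaFinEquiv ⟨i, b⟩) : ZMod 2) := by
    push_cast
    rfl
  have h3 : ∀ i, (∑ b', (p (Fin.cast hl.symm (finSigmaFinEquiv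
      (⟨i, b'⟩ : Σ i, Fin (∑ b : Fin (j i), l (finSigmaFinEquiv ⟨i, b⟩))))) : ZMod 2)) =
      ∑ b, P (finSigmaFinEquiv ⟨i, b⟩) := by
    intro i
    rw [sum_finSigma]
    simp only [P, hidx]
  have h4 : (fun i => ((n i + ∑ b, r (finSigmaFinEquiv ⟨i, b⟩) : ℤ) : ZMod 2)) =
      fun i => (n i : ZMod 2) + ∑ b, (r (finSigmaFinEquiv ⟨i, b⟩) : ZMod 2) := by
    funext i
    push_cast
    rfl
  simp only [h2, h3, hzP, Finset.sum_add_distrib]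
  rw [h4, compExp_add_left, compExp_add_right, compExp_flatten (fun c => (r c : ZMod 2))]
  ring

theorem act_comp {j : Fin k → ℕ} {n : Fin k → ℤ} {f : Family.{u} k'}
    {g : ∀ i, Family.{u} (j i)} (e : Fin k ≃ Fin k') (hg : ∀ i, g i ∈ N (j i) (n i)) :
    comp j n (act e f) g =
      koszul e n • act (blockEquiv (Equiv.sigmaCongrLeft' e))
        (comp (fun i' => j (e.symm i')) (fun i' => n (e.symm i')) f (fun i' => g (e.symm i'))) := by
  refine family_ext_isHom fun X x p hx => ?_
  let P : Fin k → ZMod 2 := fun i => ∑ b, (p (finSigmaFinEquiv ⟨i, b⟩) : ZMod 2)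
  have hy : ∀ i, IsHom (∑ b, p (finSigmaFinEquiv ⟨i, b⟩) - n i)
      (g i X fun b => x (finSigmaFinEquiv ⟨i, b⟩)) := fun i => isHom_of_mem_N (hg i) fun b => hx _
  have hyP : ∀ i, ((∑ b, p (finSigmaFinEquiv ⟨i, b⟩) - n i : ℤ) : ZMod 2) = P i + n i := by
    intro i
    push_cast
    rw [CharTwo.sub_eq_add]
  have hs : ∀ i' (b : Fin (j (e.symm i'))), (blockEquiv (Equiv.sigmaCongrLeft' e)).symm
      (finSigmaFinEquiv ⟨i', b⟩) = finSigmaFinEquiv ⟨e.symm i', b⟩ := by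
    intro i' b
    simp only [blockEquiv, Equiv.symm_trans_apply, Equiv.symm_symm, Equiv.symm_apply_apply]
    rfl
  rw [comp_apply_of_isHom _ _ _ hx, act_apply_of_isHom _ _ hy]
  change _ = koszul e n • act (blockEquiv (Equiv.sigmaCongrLeft' e)) _ X x
  rw [act_apply_of_isHom _ _ hx, comp_apply_of_isHom _ _ _
    fun c => hx ((blockEquiv (Equiv.sigmaCongrLeft' e)).symm c), koszul_eq_zs]
  simp only [hs, hyP, koszulExp_blockEquiv_left]
  rw [smul_smul, smul_smul, smul_smul, ← zs_add, ← zs_add, ← zs_add]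
  congr 2
  exact compExp_map e (fun i => n i) P

theorem comp_act {j j' : Fin k → ℕ} {n : Fin k → ℤ} {f : Family.{u} k}
    {g : ∀ i, Family.{u} (j' i)} (e : ∀ i, Fin (j i) ≃ Fin (j' i)) :
    comp j n f (fun i => act (e i) (g i)) =
      act (blockEquiv (Equiv.sigmaCongrRight e)) (comp j' n f g) := by
  refine family_ext_isHom fun X x p hx => ?_
  have hs : ∀ i (b : Fin (j' i)), (blockEquiv (Equiv.sigmaCongrRight e)).symm
      (finSigmaFinEquiv ⟨i, b⟩) = finSigmaFinEquiv ⟨i, (e i).symm b⟩ := by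
    intro i b
    simp only [blockEquiv, Equiv.symm_trans_apply, Equiv.symm_symm, Equiv.symm_apply_apply]
    rfl
  rw [comp_apply_of_isHom _ _ _ hx, act_apply_of_isHom _ _ hx, comp_apply_of_isHom _ _ _
    fun c => hx ((blockEquiv (Equiv.sigmaCongrRight e)).symm c)]
  simp only [fun i => act_apply_of_isHom (e i) (g i) fun b => hx (finSigmaFinEquiv ⟨i, b⟩)]
  rw [MultilinearMap.map_smul_univ, ← zs_sum, smul_smul, smul_smul, ← zs_add, ← zs_add]
  simp only [hs, koszulExp_blockEquiv_right]
  congr 2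
  rw [add_comm]
  congr 2
  funext i
  exact ((e i).symm.sum_comp fun b => (p (finSigmaFinEquiv ⟨i, b⟩) : ZMod 2)).symm

theorem comp_update_add {j : Fin k → ℕ} {n : Fin k → ℤ} {f : Family.{u} k} (i : Fin k)
    (g : ∀ i, Family.{u} (j i)) (g' : Family.{u} (j i)) :
    comp j n f (Function.update g i (g i + g')) =
      comp j n f g + comp j n f (Function.update g i g') := by
  have h := (compMultilinear j n f).map_update_add g i (g i) g'
  rwa [Function.update_eq_self] at h

theorem diff_one : diff.{u} 1 0 one = 0 := by
  funext X
  ext1 x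
  rw [diff_apply, Fin.sum_univ_one]
  change coboundary X (x 0) - sgn 0 • coboundary X (x 0) = 0
  simp [sgn]

theorem isChainOperad_N : IsChainOperad endData.{u} N where
  d_mem := diff_mem_N
  act_mem e := act_mem_N e
  one_mem := S_le_N 1 0 one_mem_S
  comp_mem := comp_mem_N
  d_d _ := diff_diff _
  act_refl _ := act_refl _
  act_trans e e' _ := act_trans e e' _
  d_act e _ := diff_act e _
  comp_add_left _ _ _ := (compLeft _ _ _).map_add _ _
  comp_add_right i g' _ _ _ := comp_update_add i _ g'
  d_comp _ hg := diff_comp _ hg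
  d_one := diff_one
  one_comp _ := one_comp _
  comp_one _ := comp_one _
  assoc hl _ _ hh := comp_assoc hl hh
  act_comp e _ hg := act_comp e hg
  comp_act e _ _ := comp_act e

theorem isSubChainOperad_S : IsSubChainOperad endData.{u} S N where
  le := S_le_N
  d_mem := diff_mem_S
  act_mem ρ := act_mem_S ρ
  one_mem := one_mem_S
  comp_mem := comp_mem_S

theorem isChainOperad_S : IsChainOperad endData.{u} S where
  d_mem := diff_mem_S
  act_mem e := act_mem_S e
  one_mem := one_mem_S
  comp_mem := comp_mem_S
  d_d _ := diff_diff _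
  act_refl _ := act_refl _
  act_trans e e' _ := act_trans e e' _
  d_act e _ := diff_act e _
  comp_add_left _ _ _ := (compLeft _ _ _).map_add _ _
  comp_add_right i g' _ _ _ := comp_update_add i _ g'
  d_comp _ hg := diff_comp _ fun i => S_le_N _ _ (hg i)
  d_one := diff_one
  one_comp _ := one_comp _
  comp_one _ := comp_one _
  assoc hl _ _ hh := comp_assoc hl fun c => S_le_N _ _ (hh c)
  act_comp e _ hg := act_comp e fun i => S_le_N _ _ (hg i)
  comp_act e _ _ := comp_act e

end Operad

/-! ### Detecting sequence operations on the standard simplex: linear independence -/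

/-- The vertices of a singular simplex. -/
def vert {X : TopCat.{u}} {n : ℕ} (τ : Sing X n) (c : Fin (n + 1)) : Sing X 0 :=
  (TopCat.toSSet.obj X).map (SimplexCategory.const ⦋0⦌ ⦋n⦌ c).op τ

theorem vert_map {X : TopCat.{u}} {n m : ℕ} (θ : ⦋n⦌ ⟶ ⦋m⦌) (τ : Sing X m) (c : Fin (n + 1)) :
    vert ((TopCat.toSSet.obj X).map θ.op τ : Sing X n) c = vert τ (θ.toOrderHom c) := by
  have h : SimplexCategory.const ⦋0⦌ ⦋n⦌ c ≫ θ = SimplexCategory.const ⦋0⦌ ⦋m⦌ (θ.toOrderHom c) :=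
    SimplexCategory.const_comp _ _ _
  unfold vert
  rw [← h, op_comp, Functor.map_comp]
  rfl

open Classical in
/-- The cochain which detects the simplices with the given set of vertices. -/
def vertexIndicator {X : TopCat.{u}} (v : Multiset (Sing X 0)) (hv : v.Nodup) : cochains X :=
  ⟨fun _ τ => if Finset.univ.val.map (vert τ) = v then 1 else 0, fun n τ hτ => by
    obtain _ | n := n
    · simp [SSet.degenerate_zero] at hτ
    rw [SSet.degenerate_eq_iUnion_range_σ] at hτ
    simp only [Set.mem_iUnion, Set.mem_range] at hτ
    obtain ⟨s, y, rfl⟩ := hτ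
    refine if_neg ?_
    rintro rfl
    have hinj := Multiset.inj_on_of_nodup_map hv
    refine (Fin.castSucc_lt_succ (i := s)).ne
      (hinj _ (Finset.mem_univ s.castSucc) _ (Finset.mem_univ s.succ) ?_)
    have h : ∀ c, vert ((TopCat.toSSet.obj X).σ s y : Sing X (n + 1)) c =
        vert y (s.predAbove c) := fun c => vert_map (SimplexCategory.σ s) y c
    rw [h, h]
    simp, v.card, fun n hn => by
      ext τ
      refine if_neg ?_
      rintro rfl
      simp at hn⟩

theorem isHom_vertexIndicator {X : TopCat.{u}} {v : Multiset (Sing X 0)} (hv : v.Nodup) :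
    IsHom ((v.card : ℤ) - 1) (vertexIndicator v hv) := by
  intro q hq
  ext τ
  refine if_neg ?_
  rintro rfl
  simp at hq

open Classical in
theorem ev_face_vertexIndicator {X : TopCat.{u}} {q : ℕ} (σ : Sing X q)
    {B : Multiset (Fin (q + 1))} (hB : B ≠ 0) {v : Multiset (Sing X 0)} (hv : v.Nodup) :
    ev (face σ B) (vertexIndicator v hv) = if B.map (vert σ) = v then 1 else 0 := by
  have h : Finset.univ.val.map (vert (face σ B)) = B.map (vert σ) := by
    conv_rhs => rw [← univ_map_vertexMap B hB]
    rw [Multiset.map_map]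
    exact Multiset.map_congr rfl fun c _ => vert_map _ _ _
  change (if _ then (1 : ℤ) else 0) = _
  rw [h]

/-- The standard topological simplex. -/
def topSimplex (m : ℕ) : TopCat.{u} := SimplexCategory.toTop.{u}.obj ⦋m⦌

/-- The identity of the standard simplex. -/
def idSimplex (m : ℕ) : Sing (topSimplex.{u} m) m := ULift.up (𝟙 _)

theorem vert_idSimplex_injective (m : ℕ) : Function.Injective (vert (idSimplex.{u} m)) := by
  intro a b h
  have h1 : SimplexCategory.toTop.{u}.map (SimplexCategory.const ⦋0⦌ ⦋m⦌ a) ≫ 𝟙 _ =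
      SimplexCategory.toTop.{u}.map (SimplexCategory.const ⦋0⦌ ⦋m⦌ b) ≫ 𝟙 _ :=
    congrArg ULift.down h
  rw [Category.comp_id, Category.comp_id] at h1
  have h2 := congrArg (fun φ => (φ.hom (ULift.up (stdSimplex.vertex (S := ℝ) (0 : Fin 1)))).down) h1
  have h3 : stdSimplex.map (S := ℝ) (fun _ : Fin 1 => a) (stdSimplex.vertex 0) =
      stdSimplex.map (S := ℝ) (fun _ : Fin 1 => b) (stdSimplex.vertex 0) := h2
  rw [stdSimplex.map_vertex, stdSimplex.map_vertex] at h3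
  exact stdSimplex.vertex_injective h3

theorem mem_gpiece_id {m : ℕ} {j : Fin m} {b : Fin (m + 1)} :
    b ∈ gpiece (id : Fin m → Fin m) j ↔ (b : ℕ) = j ∨ (b : ℕ) = j + 1 := by
  rw [mem_gpiece]
  constructor
  · intro h
    by_contra hb
    push Not at hb
    have hj := j.2
    have hb2 := b.2
    rcases lt_or_ge (b : ℕ) j with hlt | hge
    · have := (h ⟨b, by omega⟩).1 hlt
      simp at this
    · have := (h ⟨j + 1, by omega⟩).2 (by simp; omega)
      simp [Fin.le_def] at this
  · rintro h s
    simp only [id, Fin.lt_def, Fin.le_def]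
    omega

theorem mem_labelled {L : Type*} [Fintype L] {k q : ℕ} {f : L → Fin k}
    {P : L → Finset (Fin (q + 1))} {i : Fin k} {b : Fin (q + 1)} :
    b ∈ labelled f P i ↔ ∃ j, f j = i ∧ b ∈ P j := by
  simp [labelled, Multiset.mem_sum]

/-- Under the identity map the pieces are the edges of the simplex. Two distinct edges meet only if
they are adjacent, and then nondegeneracy gives them different labels. -/
theorem labelled_id_nodup {m k : ℕ} {f : Fin m → Fin k} (hf : Nondegenerate f) (i : Fin k) :
    (labelled f (gpiece (id : Fin m → Fin m)) i).Nodup := by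
  have h : labelled f (gpiece (id : Fin m → Fin m)) i =
      ((Finset.univ.filter fun j => f j = i).disjiUnion (gpiece (id : Fin m → Fin m)) ?_).val := rfl
  · rw [h]
    exact Finset.nodup _
  · intro j hj j' hj' hne
    have hj := (Finset.mem_filter.1 hj).2
    have hj' := (Finset.mem_filter.1 hj').2
    refine Finset.disjoint_left.2 fun b hb hb' => ?_
    rw [mem_gpiece_id] at hb hb'
    have : (j : ℕ) ≠ j' := fun h => hne (Fin.ext h)
    rcases lt_or_gt_of_ne this with h | h
    · exact hf.2 j j' (by omega) (hj.trans hj'.symm)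
    · exact hf.2 j' j (by omega) (hj'.trans hj.symm)

/-- The blocks of the partition into edges determine the sequence: they determine its length, force
the other partition to consist of edges as well, and finally reveal the labels. -/
theorem eq_of_labelled_eq {m m' k : ℕ} {f : Fin m → Fin k} (hf : Nondegenerate f)
    {f' : Fin m' → Fin k} (J : Fin m →o Fin m')
    (h : ∀ i, labelled f' (gpiece J) i = labelled f (gpiece (id : Fin m → Fin m)) i) :
    ∃ e : m' = m, (∀ s, J s = Fin.cast e.symm s) ∧ ∀ j, f' j = f (Fin.cast e j) := by
  -- Blocks have as many vertices as gaps and pieces together, and both partitions have `m` gaps.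
  have hm : m' = m := by
    have h1 : ∑ i, (labelled f' (gpiece J) i).card =
        ∑ i, (labelled f (gpiece (OrderHom.id : Fin m →o Fin m)) i).card :=
      Finset.sum_congr rfl fun i _ => congrArg Multiset.card (h i)
    simp only [card_labelled, Finset.sum_add_distrib] at h1
    have h2 : ∀ {a : ℕ} (g : Fin a → Fin k), ∑ i, (Finset.univ.filter fun j => g j = i).card = a :=
      fun g => by
        rw [← Finset.card_eq_sum_card_fiberwise (fun _ _ => Finset.mem_coe.2 (Finset.mem_univ _))]
        simp
    rw [h2 f', h2 f, h2 (fun s => f' (J s)), h2 (fun s => f (OrderHom.id s))] at h1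
    omega
  subst hm
  have hmem : ∀ (b : Fin (m' + 1)) (j : Fin m'), ((b : ℕ) = j ∨ (b : ℕ) = j + 1) →
      ∃ j', f' j' = f j ∧ b ∈ gpiece J j' := fun b j hb => by
    rw [← mem_labelled, h, mem_labelled]
    exact ⟨j, rfl, mem_gpiece_id.2 hb⟩
  -- The vertex `s + 1` belongs to blocks of two different labels, hence to two different pieces of
  -- `J`. Both lie between `J s` and `J (s + 1)`, so these are distinct.
  have hJ : StrictMono J := by
    intro s s' hs
    rw [Fin.lt_def] at hs
    have hs2 := s'.2
    let s1 : Fin m' := ⟨s + 1, by omega⟩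
    let b : Fin (m' + 1) := ⟨s + 1, by omega⟩
    obtain ⟨j, hj, hbj⟩ := hmem b s (Or.inr rfl)
    obtain ⟨j', hj', hbj'⟩ := hmem b s1 (Or.inl rfl)
    have hne : j ≠ j' := by
      rintro rfl
      exact hf.2 s s1 rfl (hj.symm.trans hj')
    have key : ∀ j, b ∈ gpiece J j → J s ≤ j ∧ j ≤ J s1 := fun j hb => by
      rw [mem_gpiece] at hb
      refine ⟨(hb s).2 (by simp [b]), not_lt.1 fun hlt => ?_⟩
      have := (hb s1).1 hlt
      simp [b, s1] at this
    have h1 := key j hbj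
    have h2 := key j' hbj'
    have h3 : J s < J s1 := by
      rcases lt_or_gt_of_ne hne with h | h
      · exact h1.1.trans_lt (h.trans_le h2.2)
      · exact h2.1.trans_lt (h.trans_le h1.2)
    exact h3.trans_le (J.monotone (Fin.le_def.2 (by simp [s1]; omega)))
  have hJ' : ∀ s, J s = s := strictMono_fin_eq _ hJ
  refine ⟨rfl, hJ', ?_⟩
  have hJ2 : (J : Fin m' → Fin m') = id := funext hJ'
  rw [hJ2] at hmem
  simp only [mem_gpiece_id] at hmem
  rintro ⟨j, hj⟩
  -- The vertex `j` lies in a piece labelled `f j`, which is the edge `j - 1` or `j`. By induction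
  -- the former has the label `f (j - 1)`, which is different.
  induction j with
  | zero =>
    obtain ⟨j', h1, h2⟩ := hmem 0 ⟨0, hj⟩ (Or.inl rfl)
    have : j' = ⟨0, hj⟩ := Fin.ext (by simp at h2; simp [h2])
    rw [← this, h1, this]
    rfl
  | succ j ih =>
    obtain ⟨j', h1, h2⟩ := hmem ⟨j + 1, by omega⟩ ⟨j + 1, hj⟩ (Or.inl rfl)
    have ih' := ih (by omega)
    have hne : j' ≠ ⟨j, by omega⟩ := by
      intro h
      rw [h] at h1
      exact hf.2 ⟨j, by omega⟩ ⟨j + 1, hj⟩ rfl (ih'.symm.trans h1)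
    have : j' = ⟨j + 1, hj⟩ := Fin.ext (by
      have : (j' : ℕ) ≠ j := fun h => hne (Fin.ext h)
      simp at h2 ⊢
      omega)
    rw [← this, h1, this]
    rfl

/-- The functional which detects the sequence operation of the nondegenerate map `f`. -/
def detect {m k : ℕ} {f : Fin m → Fin k} (hf : Nondegenerate f) : Family.{u} k →ₗ[ℤ] ℤ :=
  evalAt (topSimplex m) (fun i => vertexIndicator
    ((labelled f (gpiece (id : Fin m → Fin m)) i).map (vert (idSimplex m)))
    ((labelled_id_nodup hf i).map (vert_idSimplex_injective m))) (idSimplex m)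

-- The chosen cochains take the values `0` and `1`, and on faces of the identity simplex they
-- recognize the multiset of vertices, because the vertices of the standard simplex are distinct. So
-- a term survives exactly when all blocks agree with those of `f`.
open Classical in
theorem detect_seqOp {m m' k : ℕ} {f : Fin m → Fin k} (hf : Nondegenerate f) {f' : Fin m' → Fin k}
    (hf' : Function.Surjective f') : ∃ c : ZMod 2, detect.{u} hf (seqOp f') =
      zs c * ∑ J : Fin m →o Fin m', zs (geps f' J) *
        if ∀ i, labelled f' (gpiece J) i = labelled f (gpiece (id : Fin m → Fin m)) i
          then 1 else 0 := by
  have h0 := seqOp_eq_core hf' (fun i => isHom_vertexIndicator ((labelled_id_nodup hf i).map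
    (vert_idSimplex_injective.{u} m))) (idSimplex m)
  rw [sgn_eq_zs, ← mul_assoc, ← zs_add] at h0
  refine ⟨_, h0.trans (congrArg _ (Finset.sum_congr rfl fun J _ => congrArg _ ?_))⟩
  have h : ∀ i, ev (face (idSimplex.{u} m) (labelled f' (gpiece J) i)) (vertexIndicator
      ((labelled f (gpiece (id : Fin m → Fin m)) i).map (vert (idSimplex m)))
      ((labelled_id_nodup hf i).map (vert_idSimplex_injective m))) =
      if labelled f' (gpiece J) i = labelled f (gpiece (id : Fin m → Fin m)) i
        then 1 else 0 := fun i => by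
    rw [ev_face_vertexIndicator _ (labelled_ne_zero hf' J i)]
    exact if_congr (Multiset.map_injective (vert_idSimplex_injective m)).eq_iff rfl rfl
  rw [monom, Finset.prod_congr rfl fun i _ => h i, Finset.prod_boole]
  simp

theorem detect_seqOp_self {m k : ℕ} {f : Fin m → Fin k} (hf : Nondegenerate f) :
    detect.{u} hf (seqOp f) * detect.{u} hf (seqOp f) = 1 := by
  classical
  obtain ⟨c, hc⟩ := detect_seqOp.{u} hf hf.1
  rw [hc, Finset.sum_eq_single OrderHom.id]
  · rw [if_pos (by exact fun i => rfl), mul_one, ← zs_add, zs_mul_self]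
  · intro J _ hJ
    rw [if_neg, mul_zero]
    intro h
    obtain ⟨e, h1, -⟩ := eq_of_labelled_eq hf J h
    exact hJ (OrderHom.ext _ _ (funext h1))
  · simp

theorem detect_seqOp_of_ne {m m' k : ℕ} {f : Fin m → Fin k} (hf : Nondegenerate f)
    {f' : Fin m' → Fin k} (hf' : Function.Surjective f')
    (h : (⟨m', f'⟩ : Σ m, Fin m → Fin k) ≠ ⟨m, f⟩) : detect.{u} hf (seqOp f') = 0 := by
  classical
  obtain ⟨c, hc⟩ := detect_seqOp.{u} hf hf'
  rw [hc, Finset.sum_eq_zero, mul_zero]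
  intro J _
  rw [if_neg, mul_zero]
  intro hJ
  obtain ⟨e, -, h2⟩ := eq_of_labelled_eq hf J hJ
  subst e
  exact h (congrArg _ (funext h2))

/-- The functionals form a dual system up to signs: the equation with the square says that the
diagonal values are `±1`. -/
theorem linearIndependent_of_functionals {ι M : Type*} [AddCommMonoid M] [Module ℤ M] {v : ι → M}
    (c : ι → M →ₗ[ℤ] ℤ) (h1 : ∀ i, c i (v i) * c i (v i) = 1)
    (h0 : ∀ i j, j ≠ i → c i (v j) = 0) : LinearIndependent ℤ v := by
  intro l l' h
  have key : ∀ (i : ι) (l : ι →₀ ℤ), c i (Finsupp.linearCombination ℤ v l) = l i * c i (v i) := by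
    intro i l
    rw [Finsupp.linearCombination_apply, Finsupp.sum, map_sum, Finset.sum_eq_single i]
    · rw [map_smul, smul_eq_mul]
    · intro j _ hj
      rw [map_smul, h0 i j hj, smul_zero]
    · intro hi
      rw [Finsupp.notMem_support_iff.1 hi, zero_smul, map_zero]
  ext i
  have h2 := congrArg (c i) h
  rw [key, key] at h2
  rw [← mul_one (l i), ← mul_one (l' i), ← h1 i, ← mul_assoc, ← mul_assoc, h2]

theorem linearIndependent_seqOp (k : ℕ) : LinearIndependent ℤ
    fun f : {f : Σ m : ℕ, (Fin m → Fin k) // Nondegenerate f.2} => seqOp.{u} f.1.2 :=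
  linearIndependent_of_functionals (fun f => detect f.2) (fun f => detect_seqOp_self f.2)
    fun f f' h => detect_seqOp_of_ne f.2 f'.2.1 fun e => h (Subtype.ext e)

/-! ### Finite type, and freeness over the symmetric groups -/

theorem S_eq_span (m k : ℕ) : S.{u} k ((m : ℤ) - k) =
    Submodule.span ℤ (Set.range fun f : {f : Fin m → Fin k // Nondegenerate f} =>
      seqOp.{u} f.1) := by
  unfold S
  congr 1
  ext ν
  constructor
  · rintro ⟨m', f, hf, hm, rfl⟩
    obtain rfl : m' = m := by omega
    exact ⟨⟨f, hf⟩, rfl⟩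
  · rintro ⟨f, rfl⟩
    exact ⟨m, f.1, f.2, rfl, rfl⟩

theorem le_of_surjective {m k : ℕ} {f : Fin m → Fin k} (hf : Function.Surjective f) : k ≤ m := by
  simpa using Fintype.card_le_of_surjective f hf

theorem S_eq_bot {k : ℕ} {n : ℤ} (hn : n < 0) : S.{u} k n = ⊥ := by
  rw [S, Submodule.span_eq_bot]
  rintro ν ⟨m, f, hf, hm, -⟩
  have := le_of_surjective hf.1
  omega

theorem exists_degree_eq {k : ℕ} {n : ℤ} (hn : 0 ≤ n) : ∃ m : ℕ, n = (m : ℤ) - k :=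
  ⟨(n + k).toNat, by omega⟩

theorem isOfFiniteType_S : IsOfFiniteType endData.{u} S := by
  intro k n
  change (S k n).FG
  rcases lt_or_ge n 0 with hn | hn
  · rw [S_eq_bot hn]
    exact Submodule.fg_bot
  · obtain ⟨m, rfl⟩ := exists_degree_eq (k := k) hn
    rw [S_eq_span]
    exact Submodule.fg_span (Set.finite_range _)

/-- Maps which differ by a permutation of their values. -/
def valueSetoid (m k : ℕ) : Setoid {f : Fin m → Fin k // Nondegenerate f} where
  r f f' := ∃ ρ : Equiv.Perm (Fin k), f'.1 = ρ ∘ f.1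
  iseqv := {
    refl := fun f => ⟨Equiv.refl _, rfl⟩
    symm := by
      rintro f f' ⟨ρ, h⟩
      exact ⟨ρ.symm, by rw [h]; funext j; simp⟩
    trans := by
      rintro f f' f'' ⟨ρ, h⟩ ⟨ρ', h'⟩
      exact ⟨ρ.trans ρ', by rw [h', h]; rfl⟩ }

theorem Nondegenerate.comp_perm {m k : ℕ} {f : Fin m → Fin k} (hf : Nondegenerate f)
    (ρ : Equiv.Perm (Fin k)) : Nondegenerate (ρ ∘ f) :=
  ⟨ρ.surjective.comp hf.1, fun j j' h e => hf.2 j j' h (ρ.injective e)⟩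

theorem exists_act_seqOp {m k : ℕ} {f : Fin m → Fin k} (hf : Nondegenerate f)
    (ρ : Equiv.Perm (Fin k)) : ∃ c, act.{u} ρ (seqOp f) = zs c • seqOp (ρ.symm ∘ f) := by
  have h := act_seqOp.{u} ρ (hf.comp_perm ρ.symm).1
  have e : ρ ∘ ρ.symm ∘ f = f := by funext j; simp
  rw [e] at h
  exact ⟨_, h⟩

/-- One representative is taken from each orbit of nondegenerate maps under relabelling. Its
translates are, up to sign, the operations of the maps in the orbit, each obtained once. -/
theorem exists_symmetric_basis (k : ℕ) (n : ℤ) : ∃ B : Set (Family.{u} k), B ⊆ S k n ∧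
    LinearIndependent ℤ (fun x : B × Equiv.Perm (Fin k) => act x.2 (x.1 : Family.{u} k)) ∧
    Submodule.span ℤ (Set.range fun x : B × Equiv.Perm (Fin k) =>
      act x.2 (x.1 : Family.{u} k)) = S k n := by
  rcases lt_or_ge n 0 with hn | hn
  · refine ⟨∅, Set.empty_subset _, ?_, ?_⟩
    · exact linearIndependent_empty_type
    · rw [S_eq_bot hn, Set.range_eq_empty]
      exact Submodule.span_empty
  obtain ⟨m, rfl⟩ := exists_degree_eq (k := k) hn
  let r : Quotient (valueSetoid m k) → Family.{u} k := fun q => seqOp q.out.1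
  refine ⟨Set.range r, ?_, ?_, ?_⟩
  · rintro _ ⟨q, rfl⟩
    exact seqOp_mem_S q.out.2.1
  · have hq : ∀ x : Set.range r × Equiv.Perm (Fin k), ∃ q : Quotient (valueSetoid m k),
        r q = (x.1 : Family.{u} k) := fun x => x.1.2
    choose q hq using hq
    have hc : ∀ x : Set.range r × Equiv.Perm (Fin k), ∃ c, act.{u} x.2 (x.1 : Family.{u} k) =
        zs c • seqOp (x.2.symm ∘ (q x).out.1) := fun x => by
      rw [← hq x]
      exact exists_act_seqOp (q x).out.2 x.2
    choose c hc using hc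
    have hnd := fun x : Set.range r × Equiv.Perm (Fin k) => (q x).out.2.comp_perm x.2.symm
    refine linearIndependent_of_functionals (fun x => detect (hnd x)) (fun x => ?_)
      fun x y hxy => ?_
    · rw [hc x, map_smul, smul_eq_mul, mul_mul_mul_comm, zs_mul_self, one_mul]
      exact detect_seqOp_self (hnd x)
    · rw [hc y, map_smul, detect_seqOp_of_ne (hnd x) (hnd y).1, smul_zero]
      intro h
      have h : y.2.symm ∘ (q y).out.1 = x.2.symm ∘ (q x).out.1 := by simpa using h
      have hqq : q y = q x := by
        rw [← Quotient.out_eq (q y), ← Quotient.out_eq (q x)]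
        refine Quotient.sound ⟨y.2.symm.trans x.2, ?_⟩
        funext j
        have := congrFun h j
        simp only [Function.comp_apply] at this
        simp [this]
      have h1 : y.1 = x.1 := Subtype.ext (by rw [← hq y, ← hq x, hqq])
      refine hxy (Prod.ext h1 (Equiv.symm_bijective.1 (Equiv.ext fun i => ?_)))
      -- Surjectivity of the representative makes the permutation unique: it is known on all values.
      obtain ⟨j, rfl⟩ := (q x).out.2.1 i
      rw [hqq] at h
      exact congrFun h j
  · apply le_antisymm
    · rw [Submodule.span_le]
      rintro _ ⟨⟨⟨_, q, rfl⟩, ρ⟩, rfl⟩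
      exact act_mem_S ρ (seqOp_mem_S q.out.2.1)
    · rw [S_eq_span, Submodule.span_le]
      rintro _ ⟨f, rfl⟩
      let q : Quotient (valueSetoid m k) := Quotient.mk _ f
      obtain ⟨ρ, hρ⟩ : (valueSetoid m k).r q.out f := Quotient.exact (Quotient.out_eq q)
      obtain ⟨c, hc⟩ := exists_act_seqOp.{u} q.out.2 ρ.symm
      have h : seqOp.{u} f.1 = zs c • act ρ.symm (seqOp q.out.1) := by
        rw [hc, smul_smul, zs_mul_self, one_smul, Equiv.symm_symm, ← hρ]
      change seqOp f.1 ∈ _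
      rw [h]
      exact Submodule.smul_mem _ _ (Submodule.subset_span ⟨(⟨r q, q, rfl⟩, ρ.symm), rfl⟩)

theorem seqOp_eq_zero_of_not_nondegenerate {m k : ℕ} {f : Fin m → Fin k}
    (hf : Function.Surjective f) (h : ¬ Nondegenerate f) : seqOp.{u} f = 0 := by
  have : ∃ j j' : Fin m, (j : ℕ) + 1 = j' ∧ f j = f j' := by
    by_contra hc
    push Not at hc
    exact h ⟨hf, hc⟩
  obtain ⟨j, j', hj, e⟩ := this
  exact seqOp_eq_zero hj e

theorem isSymmetricFree_S (k : ℕ) : IsSymmetricFree endData.{u} S k := exists_symmetric_basis k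

/-! ### Linear maps with prescribed values on sequence operations -/

/-- The linear map on operations of degree `n` with given values on the sequence operations. -/
def extend {k : ℕ} {W : Type*} [AddCommGroup W] (n : ℤ) (φ : ∀ m, (Fin m → Fin k) → W) :
    Family.{u} k →ₗ[ℤ] W :=
  open Classical in
  -- In degree `n` all sequences have length `n + k`. The value of `detect` on its own operation is
  -- `±1`; multiplying by it normalizes the coordinate functional.
  ∑ f : {f : Fin (n + k).toNat → Fin k // Nondegenerate f},
    (detect.{u} f.2 (seqOp f.1) • detect.{u} f.2).smulRight (φ _ f.1)

/-- The vanishing condition makes the formula valid for degenerate sequences too, so that it can be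
applied to all terms of a differential. -/
theorem extend_seqOp {k m : ℕ} {W : Type*} [AddCommGroup W] {n : ℤ}
    (φ : ∀ m, (Fin m → Fin k) → W) {f : Fin m → Fin k} (hf : Function.Surjective f)
    (hφ : ¬ Nondegenerate f → φ m f = 0) (hn : (m : ℤ) - k = n) :
    extend n φ (seqOp.{u} f) = φ m f := by
  obtain rfl : m = (n + k).toNat := by omega
  by_cases h : Nondegenerate f
  · rw [extend, LinearMap.sum_apply, Finset.sum_eq_single ⟨f, h⟩]
    · rw [LinearMap.smulRight_apply, LinearMap.smul_apply, smul_eq_mul, detect_seqOp_self, one_smul]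
    · intro f' _ hne
      rw [LinearMap.smulRight_apply, LinearMap.smul_apply, detect_seqOp_of_ne f'.2 hf, smul_zero, zero_smul]
      intro e
      exact hne (Subtype.ext (by simpa using e.symm))
    · simp
  · rw [hφ h, seqOp_eq_zero_of_not_nondegenerate hf h, map_zero]

/-! ### The contraction given by prepending a value -/

section Prepend

variable {m k : ℕ}

/-- Put the value `0` in front. -/
def cons0 (f : Fin m → Fin (k + 1)) : Fin (m + 1) → Fin (k + 1) := Fin.cons 0 f

@[simp] theorem cons0_zero (f : Fin m → Fin (k + 1)) : cons0 f 0 = 0 := rfl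

@[simp] theorem cons0_succ (f : Fin m → Fin (k + 1)) (j : Fin m) : cons0 f j.succ = f j := rfl

theorem cons0_comp_succAbove (f : Fin (m + 1) → Fin (k + 1)) (j : Fin (m + 1)) :
    cons0 f ∘ j.succ.succAbove = cons0 (f ∘ j.succAbove) := by
  funext a
  induction a using Fin.cases with
  | zero => simp
  | succ a => simp

theorem cons0_surjective {f : Fin m → Fin (k + 1)} (hf : ∀ i : Fin k, ∃ j, f j = i.succ) :
    Function.Surjective (cons0 f) := by
  intro i
  induction i using Fin.cases with
  | zero => exact ⟨0, rfl⟩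
  | succ i =>
    obtain ⟨j, hj⟩ := hf i
    exact ⟨j.succ, hj⟩

theorem cons0_succ_surjective {h : Fin m → Fin k} (hh : Function.Surjective h) :
    Function.Surjective (cons0 (Fin.succ ∘ h)) :=
  cons0_surjective fun i => (hh i).imp fun _ e => congrArg Fin.succ e

theorem seqOp_cons0_eq_zero {W : Type*} {f : Fin m → W} (g : W → Fin (k + 1))
    {hs : Prop} (hf : hs) (h : ¬ (hs ∧ ∀ j j' : Fin m, (j : ℕ) + 1 = j' → f j ≠ f j')) :
    seqOp.{u} (cons0 (g ∘ f)) = 0 := by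
  have : ∃ j j' : Fin m, (j : ℕ) + 1 = j' ∧ f j = f j' := by
    by_contra hc
    push Not at hc
    exact h ⟨hf, hc⟩
  obtain ⟨j, j', hj, e⟩ := this
  exact seqOp_eq_zero (j := j.succ) (j' := j'.succ) (by simp [← hj]) (congrArg g e)

theorem neg_smul_family (a : ℤ) (ν : Family.{u} k) : (-a) • ν = -(a • ν) := neg_smul a ν

theorem neg_neg_family (ν : Family.{u} k) : -(-ν) = ν := neg_neg ν

theorem neg_zero_family : -(0 : Family.{u} k) = 0 := by
  funext X
  ext1 x
  exact neg_zero

theorem sub_zero_family (ν : Family.{u} k) : ν - 0 = ν := sub_zero ν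

theorem smul_sub_family (a : ℤ) (ν μ : Family.{u} k) : a • (ν - μ) = a • ν - a • μ :=
  smul_sub a ν μ

theorem sub_sum_family {ι : Type*} [Fintype ι] (ν : Family.{u} k) (F : ι → Family.{u} k) :
    ν - ∑ j, F j = ν + ∑ j, -F j :=
  (sub_eq_add_neg ν _).trans (congrArg (ν + ·) (Finset.sum_neg_distrib F).symm)

theorem nb_cons0_zero (f : Fin m → Fin (k + 1)) : nb (cons0 f) 0 = 0 := by
  rw [nb]
  refine Finset.sum_eq_zero fun j _ => if_neg ?_
  simp

theorem nb_cons0_succ (f : Fin m → Fin (k + 1)) (j : Fin m) :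
    nb (cons0 f) j.succ = nb f j + 1 := by
  rw [nb, Fin.sum_univ_succ, add_comm, nb, if_pos]
  · simp
  · rw [cons0_zero, cons0_succ]
    rcases eq_or_ne (f j) 0 with h | h
    · exact Or.inr ⟨h.symm, Fin.succ_pos j⟩
    · exact Or.inl (Fin.pos_iff_ne_zero.2 h)

theorem nb_succ_comp (h : Fin m → Fin k) (j : Fin m) : nb (Fin.succ ∘ h) j = nb h j := by
  simp [nb]

-- Deleting the new first element gives back `f`, provided that `0` still occurs. Deleting a later
-- element acquires a minus sign, since one more element precedes it; and an element of value `0`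
-- may now always be deleted.
open Classical in
theorem diff_seqOp_cons0 {f : Fin (m + 1) → Fin (k + 1)} (hf : Function.Surjective (cons0 f))
    {n : ℤ} (hn : (m + 2 : ℤ) - (k + 1) = n) :
    diff.{u} (k + 1) n (seqOp (cons0 f)) = (if ∃ a, f a = 0 then seqOp f else 0) +
      ∑ j, if f j = 0 ∨ ∃ a, f (j.succAbove a) = f j then
        -(zs (nb f j + ((f j : ℕ) : ZMod 2)) • seqOp (cons0 (f ∘ j.succAbove))) else 0 := by
  obtain rfl : (((m + 1 + 1 : ℕ) : ℤ)) - (k + 1 : ℕ) = n := by push_cast; omega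
  rw [diff_seqOp hf, Fin.sum_univ_succ]
  congr 1
  · rw [nb_cons0_zero]
    refine if_congr (by simp) ?_ rfl
    have : cons0 f ∘ Fin.succAbove 0 = f := by funext a; simp
    rw [this]
    simp [zs_zero]
  · refine Finset.sum_congr rfl fun j _ => if_congr ?_ ?_ rfl
    · rw [Fin.exists_fin_succ]
      simp [eq_comm]
    · rw [cons0_comp_succAbove, nb_cons0_succ, cons0_succ, add_right_comm, zs_add, zs_one,
        mul_neg_one]
      exact neg_smul_family _ _

/-- The extension of `f ↦ ⟨0 f⟩`. -/
def prependOp (k : ℕ) (n : ℤ) : Family.{u} (k + 1) →ₗ[ℤ] Family.{u} (k + 1) :=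
  extend n fun _ f => seqOp (cons0 f)

/-- The extension of `h ↦ ⟨0 h'⟩`, where `h'` arises from `h` by raising all values. -/
def raiseOp (k : ℕ) (n : ℤ) : Family.{u} k →ₗ[ℤ] Family.{u} (k + 1) :=
  extend n fun _ h => seqOp (cons0 (Fin.succ ∘ h))

open Classical in
/-- The sequence operation which arises by removing the value `0`, if it occurs just once. -/
def removeZero (m : ℕ) (f : Fin m → Fin (k + 1)) : Family.{u} k :=
  match m, f with
  | 0, _ => 0
  | _ + 1, f => ∑ j : Fin _, if h : ∀ a, f (j.succAbove a) ≠ 0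
    then seqOp fun a => (f (j.succAbove a)).pred (h a) else 0

/-- The extension of `removeZero`. -/
def lowerOp (k : ℕ) (n : ℤ) : Family.{u} (k + 1) →ₗ[ℤ] Family.{u} k := extend n removeZero

theorem prependOp_seqOp {f : Fin m → Fin (k + 1)} (hf : Function.Surjective f) {n : ℤ}
    (hn : (m : ℤ) - (k + 1) = n) : prependOp k n (seqOp.{u} f) = seqOp (cons0 f) :=
  extend_seqOp _ hf (fun h => seqOp_cons0_eq_zero id hf h) (by push_cast; exact hn)

theorem raiseOp_seqOp {h : Fin m → Fin k} (hh : Function.Surjective h) {n : ℤ}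
    (hn : (m : ℤ) - k = n) : raiseOp k n (seqOp.{u} h) = seqOp (cons0 (Fin.succ ∘ h)) :=
  extend_seqOp _ hh (fun e => seqOp_cons0_eq_zero Fin.succ hh e) hn

theorem lowerOp_seqOp {f : Fin m → Fin (k + 1)} (hf : Nondegenerate f) {n : ℤ}
    (hn : (m : ℤ) - (k + 1) = n) : lowerOp k n (seqOp.{u} f) = removeZero m f :=
  extend_seqOp _ hf.1 (fun h => absurd hf h) (by push_cast; exact hn)

theorem eq_zero_of_succAbove_ne {f : Fin (m + 1) → Fin (k + 1)} (hf : Function.Surjective f)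
    {j : Fin (m + 1)} (h : ∀ a, f (j.succAbove a) ≠ 0) : f j = 0 := by
  obtain ⟨b, hb⟩ := hf 0
  by_cases e : b = j
  · rwa [← e]
  · obtain ⟨a, rfl⟩ := Fin.exists_succAbove_eq e
    exact absurd hb (h a)

theorem pred_surjective {f : Fin (m + 1) → Fin (k + 1)} (hf : Function.Surjective f)
    {j : Fin (m + 1)} (h : ∀ a, f (j.succAbove a) ≠ 0) :
    Function.Surjective fun a => (f (j.succAbove a)).pred (h a) := by
  intro i
  obtain ⟨b, hb⟩ := hf i.succ
  have e : b ≠ j := by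
    rintro rfl
    rw [eq_zero_of_succAbove_ne hf h] at hb
    exact (Fin.succ_ne_zero i).symm hb
  obtain ⟨a, rfl⟩ := Fin.exists_succAbove_eq e
  exact ⟨a, by simp [hb]⟩

theorem prependOp_mem {n : ℤ} {ν : Family.{u} (k + 1)} (hν : ν ∈ S (k + 1) n) :
    prependOp k n ν ∈ S (k + 1) (n + 1) := by
  induction hν using Submodule.span_induction with
  | mem ν h =>
    obtain ⟨m, f, hf, rfl, rfl⟩ := h
    rw [prependOp_seqOp hf.1 (by push_cast; omega)]
    have := seqOp_mem_S.{u} (f := cons0 f) (cons0_surjective fun i => hf.1 i.succ)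
    convert this using 2
    push_cast
    omega
  | zero => rw [map_zero]; exact zero_mem _
  | add ν μ _ _ h1 h2 => rw [map_add]; exact add_mem h1 h2
  | smul a ν _ h => rw [map_smul]; exact Submodule.smul_mem _ _ h

theorem raiseOp_mem {n : ℤ} {ν : Family.{u} k} (hν : ν ∈ S k n) :
    raiseOp k n ν ∈ S (k + 1) n := by
  induction hν using Submodule.span_induction with
  | mem ν h =>
    obtain ⟨m, f, hf, rfl, rfl⟩ := h
    rw [raiseOp_seqOp hf.1 rfl]
    have := seqOp_mem_S.{u} (cons0_succ_surjective hf.1)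
    convert this using 2
    push_cast
    omega
  | zero => rw [map_zero]; exact zero_mem _
  | add ν μ _ _ h1 h2 => rw [map_add]; exact add_mem h1 h2
  | smul a ν _ h => rw [map_smul]; exact Submodule.smul_mem _ _ h

theorem lowerOp_mem {n : ℤ} {ν : Family.{u} (k + 1)} (hν : ν ∈ S (k + 1) n) :
    lowerOp k n ν ∈ S k n := by
  induction hν using Submodule.span_induction with
  | mem ν h =>
    obtain ⟨m, f, hf, rfl, rfl⟩ := h
    rw [lowerOp_seqOp (n := (m : ℤ) - (k + 1 : ℕ)) hf (by push_cast; omega)]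
    obtain _ | m := m
    · exact zero_mem _
    · refine Submodule.sum_mem _ fun j _ => ?_
      split_ifs with h
      · have := seqOp_mem_S.{u} (pred_surjective hf.1 h)
        convert this using 2
        push_cast
        omega
      · exact zero_mem _
  | zero => rw [map_zero]; exact zero_mem _
  | add ν μ _ _ h1 h2 => rw [map_add]; exact add_mem h1 h2
  | smul a ν _ h => rw [map_smul]; exact Submodule.smul_mem _ _ h

/-- In a raised sequence the prepended `0` is the only one. -/
theorem lowerOp_raiseOp {n : ℤ} {ν : Family.{u} k} (hν : ν ∈ S k n) :
    lowerOp k n (raiseOp k n ν) = ν := by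
  induction hν using Submodule.span_induction with
  | mem ν h =>
    obtain ⟨m, h, hh, rfl, rfl⟩ := h
    have hnd : Nondegenerate (cons0 (Fin.succ ∘ h)) := by
      refine ⟨cons0_succ_surjective hh.1, fun j j' hj => ?_⟩
      obtain ⟨j', rfl⟩ := Fin.exists_succ_eq.2 (show j' ≠ 0 by rintro rfl; simp at hj)
      induction j using Fin.cases with
      | zero => exact (Fin.succ_ne_zero _).symm
      | succ j => exact fun e => hh.2 j j' (by simpa using hj) (Fin.succ_injective _ e)
    rw [raiseOp_seqOp hh.1 rfl, lowerOp_seqOp (n := (m : ℤ) - k) hnd (by push_cast; omega), removeZero,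
      Finset.sum_eq_single 0]
    · have e : ∀ a, cons0 (Fin.succ ∘ h) (Fin.succAbove 0 a) ≠ 0 := fun a => Fin.succ_ne_zero _
      rw [dif_pos e]
      congr 1
    · intro j _ hj
      rw [dif_neg]
      intro e
      obtain ⟨a, ha⟩ := Fin.exists_succAbove_eq hj.symm
      exact e a (by rw [ha]; rfl)
    · simp
  | zero => simp
  | add ν μ _ _ h1 h2 => rw [map_add, map_add, h1, h2]
  | smul a ν _ h => rw [map_smul, map_smul, h]

/-- The prepended `0` occurs only once and so is never deleted. -/
theorem diff_raiseOp {n : ℤ} {ν : Family.{u} k} (hν : ν ∈ S k n) :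
    diff (k + 1) n (raiseOp k n ν) = raiseOp k (n - 1) (diff k n ν) := by
  classical
  induction hν using Submodule.span_induction with
  | mem ν h =>
    obtain ⟨m, h, hh, rfl, rfl⟩ := h
    rw [raiseOp_seqOp hh.1 rfl]
    obtain _ | m := m
    · obtain rfl : k = 0 := by have := le_of_surjective hh.1; omega
      rw [diff_seqOp_empty, map_zero]
      have h1 := diff_seqOp.{u} (cons0_succ_surjective hh.1)
      have h2 : (((0 + 1 : ℕ) : ℤ)) - ((0 + 1 : ℕ) : ℤ) = ((0 : ℕ) : ℤ) - ((0 : ℕ) : ℤ) := by simp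
      rw [h2] at h1
      rw [h1]
      refine Finset.sum_eq_zero fun j _ => if_neg ?_
      rintro ⟨a, -⟩
      exact a.elim0
    · rw [diff_seqOp_cons0 (cons0_succ_surjective hh.1) (by push_cast; omega), diff_seqOp hh.1,
        map_sum, if_neg (by rintro ⟨a, ha⟩; exact Fin.succ_ne_zero _ ha), zero_add]
      refine Finset.sum_congr rfl fun j _ => ?_
      rw [apply_ite (raiseOp k _), map_zero]
      have hc : ((Fin.succ ∘ h) j = 0 ∨ ∃ a, (Fin.succ ∘ h) (j.succAbove a) = (Fin.succ ∘ h) j) ↔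
          ∃ a, h (j.succAbove a) = h j := by simp
      refine (if_congr hc rfl rfl).trans ?_
      split_ifs with hj
      -- The minus sign due to the additional element in front cancels against the one due to
      -- raising the value of `h j`.
      · rw [map_smul, raiseOp_seqOp (surjective_comp_succAbove hh.1 hj) (by push_cast; omega),
          nb_succ_comp, Function.comp_apply, Fin.val_succ, Nat.cast_add, Nat.cast_one, ← add_assoc,
          zs_add, zs_one, mul_neg_one]
        rw [neg_smul_family, neg_neg_family, Function.comp_assoc]
      · rfl
  | zero => simp
  | add ν μ _ _ h1 h2 => rw [map_add, map_add, map_add, map_add, h1, h2]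
  | smul a ν _ h => rw [map_smul, map_smul, map_smul, map_smul, h]

/-- Deleting the prepended `0` contributes `ν`. The deletion of an element whose value occurs again
appears in both terms with opposite signs. The deletion of an element `0` that is the only one in
`f` is possible only after prepending, and it produces the term with `raiseOp` and `lowerOp`. -/
theorem homotopy_identity {n : ℤ} {ν : Family.{u} (k + 1)} (hν : ν ∈ S (k + 1) n) :
    diff (k + 1) (n + 1) (prependOp k n ν) + prependOp k (n - 1) (diff (k + 1) n ν) =
      ν - raiseOp k n (lowerOp k n ν) := by
  classical
  induction hν using Submodule.span_induction with
  | mem ν h =>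
    obtain ⟨m, f, hf, rfl, rfl⟩ := h
    obtain _ | m := m
    · have := le_of_surjective hf.1; omega
    rw [prependOp_seqOp hf.1 (by push_cast; omega), lowerOp_seqOp (n := ((m + 1 : ℕ) : ℤ) - (k + 1 : ℕ)) hf (by push_cast; omega),
      diff_seqOp_cons0 (cons0_surjective fun i => hf.1 i.succ) (by push_cast; omega),
      diff_seqOp hf.1, removeZero, map_sum, map_sum, if_pos (hf.1 0), add_assoc,
      sub_sum_family, ← Finset.sum_add_distrib]
    congr 1
    refine Finset.sum_congr rfl fun j _ => ?_
    by_cases hj : ∃ a, f (j.succAbove a) = f j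
    · rw [if_pos (Or.inr hj), if_pos hj, map_smul,
        prependOp_seqOp (surjective_comp_succAbove hf.1 hj) (by push_cast; omega), dif_neg,
        map_zero, neg_zero_family]
      · exact neg_add_cancel (zs _ • seqOp.{u} _)
      intro h
      obtain ⟨a, ha⟩ := hj
      exact h a (ha.trans (eq_zero_of_succAbove_ne hf.1 h))
    -- If `j` carries the only `0`, it comes first in the order by labels, so the sign of its
    -- deletion is trivial. A nonzero value that occurs once is never deleted.
    · by_cases h0 : f j = 0
      · have h : ∀ a, f (j.succAbove a) ≠ 0 := fun a ha => hj ⟨a, ha.trans h0.symm⟩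
        have hnb : nb f j = 0 := by
          rw [nb]
          refine Finset.sum_eq_zero fun j' _ => if_neg ?_
          rintro (h' | ⟨h', hlt⟩)
          · rw [h0] at h'
            exact Fin.not_lt_zero _ h'
          · obtain ⟨a, rfl⟩ := Fin.exists_succAbove_eq hlt.ne
            exact hj ⟨a, h'⟩
        rw [if_pos (Or.inl h0), if_neg hj, dif_pos h,
          raiseOp_seqOp (pred_surjective hf.1 h) (by push_cast; omega), map_zero, add_zero, hnb, h0]
        have e : (Fin.succ ∘ fun a => (f (j.succAbove a)).pred (h a)) = f ∘ j.succAbove := by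
          funext a; simp
        rw [e]
        simp [zs_zero]
      · rw [if_neg (not_or.2 ⟨h0, hj⟩), if_neg hj,
          dif_neg fun h => h0 (eq_zero_of_succAbove_ne hf.1 h), map_zero, map_zero,
          neg_zero_family, add_zero]
  | zero => simp only [map_zero]; rw [add_zero, sub_zero_family]
  | add ν μ _ _ h1 h2 => simp only [map_add]; rw [add_add_add_comm, h1, h2]; abel
  | smul a ν _ h => simp only [map_smul]; rw [← smul_add, h]; exact smul_sub_family _ _ _

end Prepend

/-! ### The homology of a point, by induction on the arity -/

/-- In arity `k`, every cycle is a boundary up to a multiple of `e`, no nonzero multiple of which is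
a boundary, and every cycle of nonzero degree is a boundary. -/
structure IsPointClass {k : ℕ} (e : Family.{u} k) : Prop where
  mem : e ∈ S k 0
  diff_eq_zero : diff k 0 e = 0
  exists_eq : ∀ z ∈ S k 0, diff k 0 z = 0 → ∃ a : ℤ, ∃ w ∈ S k (0 + 1), a • e + diff k (0 + 1) w = z
  eq_zero : ∀ a : ℤ, ∀ w ∈ S k (0 + 1), diff k (0 + 1) w = a • e → a = 0
  exists_diff_eq : ∀ n : ℤ, n ≠ 0 → ∀ z ∈ S.{u} k n, diff k n z = 0 →
    ∃ w ∈ S.{u} k (n + 1), diff k (n + 1) w = z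

theorem S_zero_eq_bot {n : ℤ} (hn : n ≠ 0) : S.{u} 0 n = ⊥ := by
  rw [S, Submodule.span_eq_bot]
  rintro ν ⟨m, f, hf, hm, -⟩
  obtain _ | m := m
  · exact absurd hm.symm (by simpa using hn)
  · exact (f 0).elim0

/-- In arity `0` there is only the empty sequence, which spans degree `0` and is detected by its
functional. -/
theorem isPointClass_zero : IsPointClass (seqOp.{u} (id : Fin 0 → Fin 0)) where
  mem := seqOp_mem_S (f := (id : Fin 0 → Fin 0)) Function.surjective_id
  diff_eq_zero := diff_seqOp_empty _ _
  exists_eq := fun z hz _ => by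
    have h : S.{u} 0 0 ≤ Submodule.span ℤ {seqOp.{u} (id : Fin 0 → Fin 0)} := by
      refine Submodule.span_mono ?_
      rintro ν ⟨m, f, hf, hm, rfl⟩
      obtain rfl : m = 0 := by simpa using hm
      exact congrArg seqOp (Subsingleton.elim _ _)
    obtain ⟨a, rfl⟩ := Submodule.mem_span_singleton.1 (h hz)
    exact ⟨a, 0, zero_mem _, by rw [map_zero, add_zero]⟩
  eq_zero := fun a w hw h => by
    rw [S_zero_eq_bot (by simp), Submodule.mem_bot] at hw
    have hnd : Nondegenerate (id : Fin 0 → Fin 0) := ⟨Function.surjective_id, fun j => j.elim0⟩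
    rw [hw, map_zero] at h
    have h1 := congrArg (detect hnd) h
    rw [map_zero, map_smul, smul_eq_mul] at h1
    rw [← mul_one a, ← detect_seqOp_self.{u} hnd, ← mul_assoc, ← h1, zero_mul]
  exists_diff_eq := fun n hn z hz _ => by
    rw [S_zero_eq_bot hn, Submodule.mem_bot] at hz
    exact ⟨0, zero_mem _, by rw [hz, map_zero]⟩

section Step

variable {k : ℕ} {n : ℤ}

theorem raiseOp_lowerOp_add {ν : Family.{u} (k + 1)} (hν : ν ∈ S (k + 1) n) :
    raiseOp k n (lowerOp k n ν) + (diff (k + 1) (n + 1) (prependOp k n ν) +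
      prependOp k (n - 1) (diff (k + 1) n ν)) = ν := by
  rw [homotopy_identity hν]
  exact add_sub_cancel (raiseOp k n (lowerOp k n ν)) ν

theorem diff_prependOp {ν : Family.{u} (k + 1)} (hν : ν ∈ S (k + 1) n)
    (h : diff (k + 1) n ν = 0) :
    raiseOp k n (lowerOp k n ν) + diff (k + 1) (n + 1) (prependOp k n ν) = ν := by
  have := raiseOp_lowerOp_add hν
  rwa [h, map_zero, add_zero] at this

/-- This is formal. The homotopy identity for the differential of `ν`, and the differential of the
identity for `ν`, both express that differential; comparison shows that the two sides agree after
`raiseOp`, which has a left inverse on `S`. -/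
theorem lowerOp_diff {ν : Family.{u} (k + 1)} (hν : ν ∈ S (k + 1) n) :
    lowerOp k (n - 1) (diff (k + 1) n ν) = diff k n (lowerOp k n ν) := by
  have h1 := diff_prependOp (diff_mem_S hν) (diff_diff ν)
  have h2 := congrArg (diff (k + 1) n) (raiseOp_lowerOp_add hν)
  have h3 := diff_diff (n := n + 1) (prependOp k n ν)
  rw [sub_add_cancel] at h1
  rw [add_sub_cancel_right] at h3
  rw [map_add, map_add, h3, zero_add, diff_raiseOp (lowerOp_mem hν)] at h2
  have h4 := (eq_sub_of_add_eq h1).trans (eq_sub_of_add_eq h2).symm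
  rw [← lowerOp_raiseOp (lowerOp_mem (diff_mem_S hν)), h4,
    lowerOp_raiseOp (diff_mem_S (lowerOp_mem hν))]

/-- A cycle `z` differs from `raiseOp` of its lowering by the boundary of `prependOp` of `z`, so the
statements about cycles follow from arity `k`. A relation between `raiseOp` of `e` and a boundary is
carried to arity `k` by the chain map `lowerOp`. -/
theorem IsPointClass.raise {e : Family.{u} k} (he : IsPointClass e) :
    IsPointClass (raiseOp k 0 e) where
  mem := raiseOp_mem he.mem
  diff_eq_zero := by rw [diff_raiseOp he.mem, he.diff_eq_zero, map_zero]
  exists_eq := fun z hz hd => by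
    obtain ⟨a, w, hw, h⟩ := he.exists_eq (lowerOp k 0 z) (lowerOp_mem hz) (by
      rw [← lowerOp_diff hz, hd, map_zero])
    refine ⟨a, raiseOp k (0 + 1) w + prependOp k 0 z,
      add_mem (raiseOp_mem hw) (prependOp_mem hz), ?_⟩
    have h1 := diff_raiseOp hw
    rw [add_sub_cancel_right] at h1
    rw [map_add, h1, ← add_assoc, ← map_smul, ← map_add, h]
    exact diff_prependOp hz hd
  eq_zero := fun a w hw h => by
    refine he.eq_zero a _ (lowerOp_mem hw) ?_
    rw [← lowerOp_diff hw, add_sub_cancel_right, h, map_smul, lowerOp_raiseOp he.mem]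
  exists_diff_eq := fun n hn z hz hd => by
    obtain ⟨w, hw, h⟩ := he.exists_diff_eq n hn (lowerOp k n z) (lowerOp_mem hz) (by
      rw [← lowerOp_diff hz, hd, map_zero])
    refine ⟨raiseOp k (n + 1) w + prependOp k n z,
      add_mem (raiseOp_mem hw) (prependOp_mem hz), ?_⟩
    have h1 := diff_raiseOp hw
    rw [add_sub_cancel_right] at h1
    rw [map_add, h1, h]
    exact diff_prependOp hz hd

end Step

theorem exists_isPointClass (k : ℕ) : ∃ e : Family.{u} k, IsPointClass e := by
  induction k with
  | zero => exact ⟨_, isPointClass_zero⟩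
  | succ k ih =>
    obtain ⟨e, he⟩ := ih
    exact ⟨_, he.raise⟩

/-- The isomorphism in degree `0` is inverse to the one sending an integer to that multiple of the
class of `e`: `h2` gives injectivity and `h1` surjectivity. -/
theorem hasHomologyOfPoint_of_exists {D : OperadData.{v}}
    {G : ∀ k : ℕ, ℤ → Submodule ℤ (D.M k)} {k : ℕ} {e : D.M k} (he : e ∈ G k 0)
    (hd : D.d k 0 e = 0)
    (h1 : ∀ z ∈ G k 0, D.d k 0 z = 0 →
      ∃ a : ℤ, ∃ w ∈ G k (0 + 1), a • e + D.d k (0 + 1) w = z)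
    (h2 : ∀ a : ℤ, ∀ w ∈ G k (0 + 1), D.d k (0 + 1) w = a • e → a = 0)
    (h3 : ∀ n : ℤ, n ≠ 0 → ∀ z ∈ G k n, D.d k n z = 0 →
      ∃ w ∈ G k (n + 1), D.d k (n + 1) w = z) : HasHomologyOfPoint D G k := by
  let c : cycles D G k 0 := ⟨e, he, hd⟩
  let φ : ℤ →ₗ[ℤ] Homology D G k 0 := (Submodule.mkQ _).comp (LinearMap.toSpanSingleton ℤ _ c)
  refine ⟨⟨(LinearEquiv.ofBijective φ ⟨?_, ?_⟩).symm⟩, fun n hn => ⟨?_⟩⟩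
  · rw [← LinearMap.ker_eq_bot, LinearMap.ker_eq_bot']
    intro a ha
    have ha : a • c ∈ (boundaries D G k 0).submoduleOf (cycles D G k 0) :=
      (Submodule.Quotient.mk_eq_zero _).1 ha
    obtain ⟨w, hw, h⟩ := ha
    exact h2 a w hw h
  · intro y
    obtain ⟨⟨z, hz, hz'⟩, rfl⟩ := Submodule.mkQ_surjective _ y
    obtain ⟨a, w, hw, h⟩ := h1 z hz hz'
    refine ⟨a, (Submodule.Quotient.eq _).2 ?_⟩
    refine ⟨-w, neg_mem hw, ?_⟩
    change D.d k (0 + 1) (-w) = a • e - z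
    rw [← h, map_neg]
    abel
  · have h0 : ∀ y : Homology D G k n, y = 0 := by
      intro y
      obtain ⟨⟨z, hz, hz'⟩, rfl⟩ := Submodule.mkQ_surjective _ y
      obtain ⟨w, hw, h⟩ := h3 n hn z hz hz'
      exact (Submodule.Quotient.mk_eq_zero _).2 ⟨w, hw, h⟩
    intro y y'
    rw [h0 y, h0 y']

theorem hasHomologyOfPoint_S (k : ℕ) : HasHomologyOfPoint endData.{u} S k := by
  obtain ⟨e, he⟩ := exists_isPointClass.{u} k
  exact hasHomologyOfPoint_of_exists he.mem he.diff_eq_zero he.exists_eq he.eq_zero he.exists_diff_eq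

end

end SeqOp

open SeqOp in
theorem mainTheorem1 :
    -- the endomorphism operad `N` of normalized singular cochains is a chain operad
    IsChainOperad endData.{u} N ∧
    -- `S(k)` is freely generated by the nondegenerate maps
    (∀ k : ℕ, LinearIndependent ℤ
      fun f : {f : Σ m : ℕ, (Fin m → Fin k) // Nondegenerate f.2} => seqOp.{u} f.1.2) ∧
    -- (a) `S(k)` is a subcomplex of `N(k)`
    (∀ (k : ℕ) (n : ℤ), S.{u} k n ≤ N k n ∧ ∀ ν ∈ S.{u} k n, diff k n ν ∈ S.{u} k (n - 1)) ∧
    -- (b) `S` is a sub-chain-operad of `N`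
    IsSubChainOperad endData.{u} S N ∧
    -- (c) each `S(k)` has the homology of a point
    (∀ k : ℕ, HasHomologyOfPoint endData.{u} S k) ∧
    -- hence `S` is an `E_∞` chain operad, and it is of finite type
    IsEInfinityOperad endData.{u} S ∧ IsOfFiniteType endData.{u} S :=
  ⟨isChainOperad_N, linearIndependent_seqOp, fun k n => ⟨S_le_N k n, fun _ h => diff_mem_S h⟩,
    isSubChainOperad_S, hasHomologyOfPoint_S,
    ⟨isChainOperad_S, hasHomologyOfPoint_S, isSymmetricFree_S⟩, isOfFiniteType_S⟩
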